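/- Let $S$ be a projective complex K3 surface (a smooth projective complex surface with trivial canonical bundle and $h^{1,0}(S)=0$) and let $\iota$ be an Enriques involution of $S$, i.e. a non symplectic involution (one that does not preserve the nowhere vanishing $2$-form of $S$) without fixed points. Blow-ups along closed subsets are taken with the reduced structure. Consider the following varieties, all of which exist. * $W=S/\iota$, and $W^{(2)}$ is the quotient of $W\times W$ by the switch of the two factors. * $\sigma(p,q)=(q,p)$ on $S\times S$, $S^{(2)}=(S\times S)/\sigma$, $\iota^{(2)}$ is the involution of $S^{(2)}$ induced by $\iota\times\iota$, and $V=S^{(2)}/\iota^{(2)}$. * $S^{[2]}$ is the blow-up of $S^{(2)}$ in its singular locus, $\iota^{[2]}$ is the involution of $S^{[2]}$ induced by $\iota^{(2)}$, and $Y_S$ is the blow-up of $S^{[2]}/\iota^{[2]}$ in its singular locus. * $Z_S$ is the blow-up of $(S\times S)/(\iota\times\iota)$ in its singular locus, $\sigma_Z$ is the involution of $Z_S$ induced by $\sigma$, and $\widetilde{Z_S/\sigma_Z}$ is the blow-up of $Z_S/\sigma_Z$ in its singular locus. Then: 1. $W$ is a smooth irreducible surface, $V$ is integral, and the natural map $V\to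 W^{(2)}$ is a finite étale morphism of degree $2$, i.e. $V$ is an unramified double cover of $W^{(2)}$. 2. The singular locus of $V$ is the union of two disjoint closed surfaces, the images of the diagonal $\{(p,p)\}$ and of the graph $\{(p,\iota(p))\}$ of $\iota$; the natural maps $W\to V$ induced by $p\mapsto(p,p)$ and $p\mapsto (p,\iota(p))$ are closed immersions onto them. 3. The natural maps $Y_S\to S^{[2]}/\iota^{[2]}\to V$ and $\widetilde{Z_S/\sigma_Z}\to Z_S/\sigma_Z\to V$ both are the blow-up of $V$ in its singular locus. In particular there is an isomorphism $Y_S\cong\widetilde{Z_S/\sigma_Z}$ over $V$. -/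

import Mathlib

open CategoryTheory CategoryTheory.Limits AlgebraicGeometry TopologicalSpace
open scoped KaehlerDifferential

noncomputable section

namespace EnriquesQuotient

/-- Schemes over `ℂ`. -/
abbrev CScheme : Type 1 := Over (Spec (CommRingCat.of ℂ))

/-- The structure morphism `X ⟶ Spec ℂ`. -/
abbrev CScheme.str (X : CScheme) : X.left ⟶ Spec (CommRingCat.of ℂ) := X.hom

theorem CScheme.comp_str {X Y : CScheme} (f : X ⟶ Y) : f.left ≫ Y.str = X.str := Over.w f

/-! ## Algebraic differential forms -/

/-- The ring of sections of a `ℂ`-scheme over an open set is a `ℂ`-algebra. -/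
@[reducible] def sectionsAlgebra (X : CScheme) (U : X.left.Opens) : Algebra ℂ Γ(X.left, U) :=
  ((Scheme.ΓSpecIso (CommRingCat.of ℂ)).inv ≫ X.str.appLE ⊤ U le_top).hom.toAlgebra

attribute [local instance] sectionsAlgebra

/-- For a morphism `f : X ⟶ Y` over `ℂ` and open sets `U ⊆ Y`, `V ⊆ f⁻¹(U)`,
the pullback of functions `Γ(Y, U) → Γ(X, V)`. -/
def pullbackFun {X Y : CScheme} (f : X ⟶ Y) (U : Y.left.Opens) (V : X.left.Opens)
    (e : V ≤ f.left ⁻¹ᵁ U) : Γ(Y.left, U) →ₐ[ℂ] Γ(X.left, V) where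
  toRingHom := (f.left.appLE U V e).hom
  commutes' r := by
    have h : Y.str.appLE ⊤ U le_top ≫ f.left.appLE U V e = X.str.appLE ⊤ V le_top := by
      refine (Scheme.Hom.appLE_comp_appLE f.left Y.str ⊤ U V le_top e).trans ?_
      simp only [CScheme.comp_str]
    exact congrArg (fun φ => φ.hom ((Scheme.ΓSpecIso (CommRingCat.of ℂ)).inv.hom r)) h

/-- The map `⋀_A Ω_{A/ℂ} → ⋀_B Ω_{B/ℂ}`, `a da₁ ∧ ⋯ ∧ daₚ ↦ f a d(f a₁) ∧ ⋯ ∧ d(f aₚ)`,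
induced by a homomorphism `f : A → B` of `ℂ`-algebras. -/
def pullbackExterior {A B : Type} [CommRing A] [CommRing B] [Algebra ℂ A] [Algebra ℂ B]
    (f : A →ₐ[ℂ] B) : ExteriorAlgebra A Ω[A⁄ℂ] →+* ExteriorAlgebra B Ω[B⁄ℂ] :=
  letI : Algebra A B := f.toRingHom.toAlgebra
  haveI : IsScalarTower ℂ A B := IsScalarTower.of_algebraMap_eq fun r => (f.commutes r).symm
  (ExteriorAlgebra.lift A
    ⟨((ExteriorAlgebra.ι B (M := Ω[B⁄ℂ])).restrictScalars A).comp
        (KaehlerDifferential.map ℂ ℂ A B),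
      fun m => ExteriorAlgebra.ι_sq_zero (KaehlerDifferential.map ℂ ℂ A B m)⟩).toRingHom

/-- A family of `p`-forms on the affine open subsets of `X`. -/
abbrev LocalForms (X : CScheme) (p : ℕ) : Type :=
  ∀ U : X.left.affineOpens, ⋀[Γ(X.left, U.1)]^p Ω[Γ(X.left, U.1)⁄ℂ]

/-- `f^* ω = ω`, for `f : X ⟶ X`. -/
def LocalForms.IsPreservedBy {X : CScheme} {p : ℕ} (ω : LocalForms X p) (f : X ⟶ X) : Prop :=
  ∀ (U V : X.left.affineOpens) (e : V.1 ≤ f.left ⁻¹ᵁ U.1),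
    pullbackExterior (pullbackFun f U.1 V.1 e) (ω U : ExteriorAlgebra _ _) = ω V

/-- A global section of the sheaf `Ω^p` of `p`-forms on `X`: a family of `p`-forms on the affine
open subsets which is compatible with restriction. -/
structure GlobalForm (X : CScheme) (p : ℕ) where
  val : LocalForms X p
  compatible : val.IsPreservedBy (𝟙 X)

/-- The form generates the sheaf `Ω^p`.  For `p = dim X` with `X` smooth this says that it has no
zeros, i.e. that it trivializes the canonical bundle. -/
def GlobalForm.Generates {X : CScheme} {p : ℕ} (ω : GlobalForm X p) : Prop :=
  ∀ U : X.left.affineOpens, Submodule.span Γ(X.left, U.1) {ω.val U} = ⊤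

/-! ## K3 surfaces and Enriques involutions -/

attribute [local instance] MvPolynomial.gradedAlgebra

/-- The projective space `ℙⁿ` over `ℂ`. -/
def projectiveSpace (n : ℕ) : CScheme :=
  Over.mk (Proj.toSpecZero (MvPolynomial.homogeneousSubmodule (Fin (n + 1)) ℂ) ≫
    Spec.map (CommRingCat.ofHom
      (algebraMap ℂ (MvPolynomial.homogeneousSubmodule (Fin (n + 1)) ℂ 0))))

/-- A (projective, complex) K3 surface: a smooth projective surface with trivial canonical bundle
and `h^{1,0} = 0`. -/
structure IsK3Surface (S : CScheme) : Prop where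
  integral : IsIntegral S.left
  projective : ∃ (n : ℕ) (i : S ⟶ projectiveSpace n), IsClosedImmersion i.left
  smooth : SmoothOfRelativeDimension 2 S.str
  canonical_trivial : ∃ ω : GlobalForm S 2, ω.Generates
  no_one_forms : ∀ (η : GlobalForm S 1) (U : S.left.affineOpens), η.val U = 0

/-- An Enriques involution: a non symplectic involution without fixed (complex) points. -/
structure IsEnriquesInvolution {S : CScheme} (ι : S ⟶ S) : Prop where
  involutive : ι ≫ ι = 𝟙 S
  non_symplectic : ∀ ω : GlobalForm S 2, ω.Generates → ¬ ω.val.IsPreservedBy ι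
  fixedPointFree : ∀ x : Over.mk (𝟙 (Spec (CommRingCat.of ℂ))) ⟶ S, x ≫ ι ≠ x

/-! ## Products -/

/-- The self-product `X × X` over `ℂ`. -/
def square (X : CScheme) : CScheme :=
  Over.mk (pullback.fst X.str X.str ≫ X.str)

/-- The morphism `(f, g) : T ⟶ X × X`. -/
def squareLift {T X : CScheme} (f g : T ⟶ X) : T ⟶ square X :=
  Over.homMk (pullback.lift f.left g.left ((Over.w f).trans (Over.w g).symm))
    ((pullback.lift_fst_assoc _ _ _ _).trans (Over.w f))

/-- The first projection `X × X ⟶ X`. -/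
def squareFst (X : CScheme) : square X ⟶ X :=
  Over.homMk (pullback.fst X.str X.str) rfl

/-- The second projection `X × X ⟶ X`. -/
def squareSnd (X : CScheme) : square X ⟶ X :=
  Over.homMk (pullback.snd X.str X.str) pullback.condition.symm

/-- The morphism `f × f : X × X ⟶ Y × Y`. -/
def squareMap {X Y : CScheme} (f : X ⟶ Y) : square X ⟶ square Y :=
  squareLift (squareFst X ≫ f) (squareSnd X ≫ f)

/-- The switch `(p, q) ↦ (q, p)` of `X × X`. -/
def switch (X : CScheme) : square X ⟶ square X :=
  squareLift (squareSnd X) (squareFst X)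

/-! ## Quotients by involutions -/

theorem le_preimage_of_comp_eq {X Q : CScheme} {g : X ⟶ X} {π : X ⟶ Q} (h : g ≫ π = π)
    (U : Q.left.Opens) : π.left ⁻¹ᵁ U ≤ g.left ⁻¹ᵁ π.left ⁻¹ᵁ U := by
  rw [← Scheme.Hom.comp_preimage, ← Over.comp_left, h]

/-- `π : X ⟶ Q` is the (geometric) quotient of `X` by the involution `g`: topologically `Q` is the
space of orbits of `g`, and the functions on `Q` are the `g`-invariant functions on `X`. -/
structure IsQuotient {X Q : CScheme} (g : X ⟶ X) (π : X ⟶ Q) : Prop where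
  invariant : g ≫ π = π
  isQuotientMap : Topology.IsQuotientMap π.left
  orbits : ∀ x y : X.left, π.left x = π.left y ↔ y = x ∨ y = g.left x
  injective : ∀ U : Q.left.Opens, Function.Injective (π.left.app U)
  sections : ∀ (U : Q.left.Opens) (s : Γ(X.left, π.left ⁻¹ᵁ U)),
    s ∈ Set.range (π.left.app U) ↔
      g.left.appLE (π.left ⁻¹ᵁ U) (π.left ⁻¹ᵁ U) (le_preimage_of_comp_eq invariant U) s = s

/-! ## Singular loci and blow-ups -/

/-- The set of points at which `X` is smooth over `ℂ`. -/
def nonsingularLocus (X : CScheme) : X.left.Opens :=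
  sSup {U : X.left.Opens | Smooth (U.ι ≫ X.str)}

/-- The singular locus of `X`. -/
def singularLocus (X : CScheme) : Closeds X.left :=
  (nonsingularLocus X).compl

/-- The ideal sheaf `I` is that of an effective Cartier divisor: locally it is generated by one
element which is not a zero divisor. -/
def IsEffectiveCartier {X : Scheme.{0}} (I : X.IdealSheafData) : Prop :=
  ∀ x : X, ∃ U : X.affineOpens, x ∈ U.1 ∧
    ∃ f ∈ nonZeroDivisors Γ(X, U.1), I.ideal U = Ideal.span {f}

/-- `b : X' ⟶ X` is the blow-up of `X` along the closed subscheme defined by `I`: it is universal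
among the morphisms for which the inverse image of that subscheme is an effective Cartier
divisor. -/
structure IsBlowUp {X X' : Scheme.{0}} (I : X.IdealSheafData) (b : X' ⟶ X) : Prop where
  isEffectiveCartier : IsEffectiveCartier (I.comap b)
  universal : ∀ (T : Scheme.{0}) (f : T ⟶ X), IsEffectiveCartier (I.comap f) →
    ∃! g : T ⟶ X', g ≫ b = f

/-- `b : X' ⟶ X` is the blow-up of `X` in its singular locus (with the reduced structure). -/
def IsSingularBlowUp {X X' : CScheme} (b : X' ⟶ X) : Prop :=
  IsBlowUp (Scheme.IdealSheafData.vanishingIdeal (singularLocus X)) b.left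

/-! ## The varieties attached to `(S, ι)` -/

/-- The quotients and blow-ups constructed from a surface `S` with an involution `ι`.  All of them
are determined by `(S, ι)` up to a unique isomorphism. -/
structure Varieties (S : CScheme) (ι : S ⟶ S) where
  /-- The quotient surface `W = S/ι`. -/
  W : CScheme
  toW : S ⟶ W
  isQuotient_W : IsQuotient ι toW
  /-- The symmetric square `W^{(2)}`. -/
  W2 : CScheme
  toW2 : square W ⟶ W2
  isQuotient_W2 : IsQuotient (switch W) toW2
  /-- The symmetric square `S^{(2)} = (S × S)/σ`. -/
  S2 : CScheme
  toS2 : square S ⟶ S2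
  isQuotient_S2 : IsQuotient (switch S) toS2
  /-- The involution `ι^{(2)}` of `S^{(2)}` induced by `ι × ι`. -/
  ι2 : S2 ⟶ S2
  toS2_ι2 : toS2 ≫ ι2 = squareMap ι ≫ toS2
  /-- The quotient `S^{(2)}/ι^{(2)}`. -/
  V : CScheme
  toV : S2 ⟶ V
  isQuotient_V : IsQuotient ι2 toV
  /-- The Hilbert square `S^{[2]}`, the blow-up of `S^{(2)}` in its singular locus. -/
  Hilb : CScheme
  hilbertChow : Hilb ⟶ S2
  isBlowUp_Hilb : IsSingularBlowUp hilbertChow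
  /-- The natural involution `ι^{[2]}` of `S^{[2]}`. -/
  ιHilb : Hilb ⟶ Hilb
  ιHilb_hilbertChow : ιHilb ≫ hilbertChow = hilbertChow ≫ ι2
  /-- The quotient `S^{[2]}/ι^{[2]}`. -/
  HilbQuot : CScheme
  toHilbQuot : Hilb ⟶ HilbQuot
  isQuotient_HilbQuot : IsQuotient ιHilb toHilbQuot
  /-- `Y_S`, the blow-up of `S^{[2]}/ι^{[2]}` in its singular locus. -/
  Y : CScheme
  blowY : Y ⟶ HilbQuot
  isBlowUp_Y : IsSingularBlowUp blowY
  /-- The quotient `(S × S)/(ι × ι)`. -/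
  A : CScheme
  toA : square S ⟶ A
  isQuotient_A : IsQuotient (squareMap ι) toA
  /-- The involution of `(S × S)/(ι × ι)` induced by the switch `σ`. -/
  σA : A ⟶ A
  toA_σA : toA ≫ σA = switch S ≫ toA
  /-- The Borcea-Voisin variety `Z_S`, the blow-up of `(S × S)/(ι × ι)` in its singular locus. -/
  Z : CScheme
  blowZ : Z ⟶ A
  isBlowUp_Z : IsSingularBlowUp blowZ
  /-- The involution `σ_Z` of `Z_S` induced by the switch. -/
  σZ : Z ⟶ Z
  σZ_blowZ : σZ ≫ blowZ = blowZ ≫ σA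
  /-- The quotient `Z_S/σ_Z`. -/
  ZQuot : CScheme
  toZQuot : Z ⟶ ZQuot
  isQuotient_ZQuot : IsQuotient σZ toZQuot
  /-- The blow-up of `Z_S/σ_Z` in its singular locus. -/
  T : CScheme
  blowT : T ⟶ ZQuot
  isBlowUp_T : IsSingularBlowUp blowT

end EnriquesQuotient

end

/-!
All quotients in question are quotients by involutions `g` over `ℂ`. Affine locally such a quotient
is the spectrum of the ring of invariants, and since `2` is invertible, `a ↦ (a + g(a)) / 2`
projects onto the invariants. Hence quotients commute with base change
(`IsGeomQuotient.of_isPullback`). Their local structure over the points where `g` has no fixed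
points is equally elementary: there an invertible anti-invariant function exists
(`mem_freeLocus_of_apply_ne`), and the quotient map adjoins a square root of a unit, so it is étale
of degree `2` and smoothness descends along it. The quotients exist because finite sets of points
of the projective surface `S` lie in affine open sets.

Since `ι` acts freely, `S ⟶ W` is étale and `W` is a smooth surface. The variety `V` is the
quotient of `S × S` by the group generated by the switch and `ι × ι`, while `W^{(2)}` is the
quotient by the group generated in addition by `1 × ι` (`isGeomQuotient_of_tower`). So `V ⟶
W^{(2)}` is the quotient by the involution induced by `1 × ι`, which is free: an unordered pair
`{p, ι q}` is never `{p, q}` or `{ι p, ι q}` (`SymmetricQuotients.exists_double_cover`).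

The only points of `S × S` with a nontrivial stabilizer lie on the diagonal or on the graph of `ι`,
so `V` is smooth away from the images of these two, which are disjoint. Near the image of the
diagonal, `S^{(2)} ⟶ V` is étale, and `S^{(2)}` is singular along the diagonal: if `x`, `y` are
anti-invariant coordinates transverse to the diagonal, then the invariants `u = x²`, `v = y²`, `w =
x y` satisfy `u v = w²`, and the tangent vector of this cone with `w = ε` does not lift to second
order (`not_isSmoothAt_diag`). The involution of `V` induced by `1 × ι` exchanges the images of the
diagonal and of the graph, so `V` is singular along both (`SymmetricQuotients.singularLocus_V`).

Blow-ups are constructed by gluing the spectra of algebras generated by fractions `a / s`, where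
`a` and `s` belong to the ideal of the centre (`exists_isBlowUp`), and are determined by their
universal property. The blow-up `S^{[2]}` of the cone singularities is smooth
(`IsBlowUp.smooth_of_symmetricSquare`). Blowing up commutes with the quotient by an involution
acting freely near the centre (`IsBlowUp.exists_isPullback`). As `ι^{(2)}` acts freely near the
diagonal, `S^{[2]}/ι^{[2]}` is the blow-up of `V` in the image of the diagonal, and it is singular
exactly over the image of the graph. Blowing up two disjoint closed sets one after the other
amounts to blowing up their union (`IsBlowUp.comp_vanishingIdeal`), so `Y_S` is the blow-up of `V`
in its singular locus.

On the other side `ι × ι` acts freely on `S × S`. Therefore `(S × S)/(ι × ι)` is smooth, the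
blow-up `Z_S` of its empty singular locus is the same variety, and `Z_S/σ_Z` is `V` itself
(`SymmetricQuotients.exists_zQuot_hom`). The isomorphism over `V` comes from the uniqueness of
blow-ups.
-/

noncomputable section

namespace EnriquesQuotient

/-! ### Geometric quotients by involutions -/

theorem le_preimage_preimage {X Q : Scheme.{0}} {g : X ⟶ X} {π : X ⟶ Q} (h : g ≫ π = π)
    (U : Q.Opens) : π ⁻¹ᵁ U ≤ g ⁻¹ᵁ π ⁻¹ᵁ U := by
  rw [← Scheme.Hom.comp_preimage, h]

/-- The scheme-level version of `IsQuotient`: `π` is the geometric quotient of `X` by `g`. -/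
structure IsGeomQuotient {X Q : Scheme.{0}} (g : X ⟶ X) (π : X ⟶ Q) : Prop where
  invariant : g ≫ π = π
  isQuotientMap : Topology.IsQuotientMap π
  orbits : ∀ x y : X, π x = π y ↔ y = x ∨ y = g x
  injective : ∀ U : Q.Opens, Function.Injective (π.app U)
  exists_app_eq : ∀ (U : Q.Opens) (s : Γ(X, π ⁻¹ᵁ U)),
    g.appLE (π ⁻¹ᵁ U) (π ⁻¹ᵁ U) (le_preimage_preimage invariant U) s = s → ∃ t, π.app U t = s

theorem appLE_app_of_comp_eq {X Q : Scheme.{0}} {g : X ⟶ X} {π : X ⟶ Q} (h : g ≫ π = π)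
    (U : Q.Opens) (t : Γ(Q, U)) :
    g.appLE (π ⁻¹ᵁ U) (π ⁻¹ᵁ U) (le_preimage_preimage h U) (π.app U t) = π.app U t := by
  have := Scheme.Hom.appLE_comp_appLE g π U (π ⁻¹ᵁ U) (π ⁻¹ᵁ U) le_rfl (le_preimage_preimage h U)
  rw [Scheme.Hom.app_eq_appLE, ← CommRingCat.comp_apply, this]
  simp only [h]

theorem isQuotient_iff {X Q : CScheme} {g : X ⟶ X} {π : X ⟶ Q} :
    IsQuotient g π ↔ IsGeomQuotient g.left π.left := by
  constructor
  · intro H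
    have h : g.left ≫ π.left = π.left := by rw [← Over.comp_left, H.invariant]
    exact ⟨h, H.isQuotientMap, H.orbits, H.injective, fun U s hs => (H.sections U s).2 hs⟩
  · intro H
    exact ⟨Over.OverMorphism.ext H.invariant, H.isQuotientMap, H.orbits, H.injective,
      fun U s => ⟨by rintro ⟨t, rfl⟩; exact appLE_app_of_comp_eq H.invariant U t,
        H.exists_app_eq U s⟩⟩

/-- A surjective morphism that is injective on sections is an epimorphism. -/
theorem epi_of_surjective_of_injective {X Q : Scheme.{0}} {π : X ⟶ Q} (hs : Function.Surjective π)
    (hi : ∀ U : Q.Opens, Function.Injective (π.app U)) : Epi π := by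
  refine ⟨fun {T} f₁ f₂ h => ?_⟩
  have hb : f₁.base = f₂.base := by
    ext q
    obtain ⟨x, rfl⟩ := hs q
    have := congrArg (fun k : X ⟶ T => k x) h
    simpa using this
  refine Scheme.Hom.ext hb fun U => ?_
  ext t
  apply hi
  have h1 : ∀ (k₁ k₂ : X ⟶ T), k₁ = k₂ → ∀ (W : X.Opens) (e₁ : W ≤ k₁ ⁻¹ᵁ U) (e₂ : W ≤ k₂ ⁻¹ᵁ U),
      k₁.appLE U W e₁ = k₂.appLE U W e₂ := by rintro k₁ _ rfl W e₁ e₂; rfl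
  have hle : f₂ ⁻¹ᵁ U ≤ f₁ ⁻¹ᵁ U := by
    intro q hq
    change f₁.base q ∈ U
    rw [hb]; exact hq
  have e : f₁.app U ≫ Q.presheaf.map (eqToHom congr((Opens.map $hb.symm).obj U)).op =
      f₁.appLE U (f₂ ⁻¹ᵁ U) hle := rfl
  rw [e, ← CommRingCat.comp_apply, ← CommRingCat.comp_apply]
  rw [Scheme.Hom.app_eq_appLE π, Scheme.Hom.app_eq_appLE f₂, Scheme.Hom.appLE_comp_appLE,
    Scheme.Hom.appLE_comp_appLE]
  exact congr($(h1 _ _ h _ _ _).hom t)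

namespace IsGeomQuotient

variable {X Q : Scheme.{0}} {g : X ⟶ X} {π : X ⟶ Q}

theorem epi (H : IsGeomQuotient g π) : Epi π :=
  epi_of_surjective_of_injective H.isQuotientMap.surjective H.injective

section desc

variable (H : IsGeomQuotient g π) {T : Scheme.{0}} (f : X ⟶ T) (hf : g ≫ f = f)

theorem apply_eq_of_apply_eq (H : IsGeomQuotient g π) (f : X ⟶ T) (hf : g ≫ f = f)
    {x y : X} (h : π x = π y) : f x = f y := by
  rcases (H.orbits x y).1 h with rfl | rfl
  · rfl
  · rw [← Scheme.Hom.comp_apply, hf]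

/-- The continuous map underlying the descent of an invariant morphism. -/
def descBase : Q.carrier ⟶ T.carrier :=
  TopCat.ofHom (Topology.IsQuotientMap.lift (f := π.base.hom) H.isQuotientMap f.base.hom
    (fun _ _ h => H.apply_eq_of_apply_eq f hf h))

theorem descBase_apply (x : X) : H.descBase f hf (π x) = f x :=
  congr($(Topology.IsQuotientMap.lift_comp (f := π.base.hom) H.isQuotientMap f.base.hom
    (fun _ _ h => H.apply_eq_of_apply_eq f hf h)) x)

theorem le_preimage_descBase (V : T.Opens) :
    π ⁻¹ᵁ ((Opens.map (H.descBase f hf)).obj V) ≤ f ⁻¹ᵁ V := by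
  intro x hx
  change f x ∈ V
  rw [← H.descBase_apply f hf x]
  exact hx

theorem exists_app_eq_appLE (V : T.Opens) (t : Γ(T, V)) :
    ∃ s : Γ(Q, (Opens.map (H.descBase f hf)).obj V), π.app _ s =
      f.appLE V _ (H.le_preimage_descBase f hf V) t := by
  apply H.exists_app_eq
  rw [← CommRingCat.comp_apply, Scheme.Hom.appLE_comp_appLE]
  simp only [hf]

/-- The map on sections underlying the descent of an invariant morphism. -/
def descApp (V : T.Opens) : Γ(T, V) →+* Γ(Q, (Opens.map (H.descBase f hf)).obj V) where
  toFun t := (H.exists_app_eq_appLE f hf V t).choose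
  map_one' := H.injective _ (by
    rw [(H.exists_app_eq_appLE f hf V 1).choose_spec, map_one, map_one])
  map_zero' := H.injective _ (by
    rw [(H.exists_app_eq_appLE f hf V 0).choose_spec, map_zero, map_zero])
  map_mul' s t := H.injective _ (by
    rw [(H.exists_app_eq_appLE f hf V _).choose_spec, map_mul, map_mul,
      (H.exists_app_eq_appLE f hf V s).choose_spec, (H.exists_app_eq_appLE f hf V t).choose_spec])
  map_add' s t := H.injective _ (by
    rw [(H.exists_app_eq_appLE f hf V _).choose_spec, map_add, map_add,
      (H.exists_app_eq_appLE f hf V s).choose_spec, (H.exists_app_eq_appLE f hf V t).choose_spec])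

theorem app_descApp (V : T.Opens) (t : Γ(T, V)) :
    π.app _ (H.descApp f hf V t) = f.appLE V _ (H.le_preimage_descBase f hf V) t :=
  (H.exists_app_eq_appLE f hf V t).choose_spec

/-- The descent of an invariant morphism, as a morphism of presheafed spaces. -/
def descPsh : Q.toPresheafedSpace.Hom T.toPresheafedSpace where
  base := H.descBase f hf
  c :=
    { app := fun V => CommRingCat.ofHom (H.descApp f hf V.unop)
      naturality := by
        intro U V i
        ext t
        apply H.injective
        have h1 := H.app_descApp f hf V.unop (T.presheaf.map i t)
        have h2 := H.app_descApp f hf U.unop t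
        refine h1.trans ?_
        have h3 := congrArg (X.presheaf.map ((Opens.map π.base).map
          ((Opens.map (H.descBase f hf)).map i.unop)).op) h2
        refine Eq.trans ?_ (h3.symm.trans ?_)
        · rw [← CommRingCat.comp_apply, ← CommRingCat.comp_apply, Scheme.Hom.map_appLE,
            Scheme.Hom.appLE_map]
        · exact congr($((Scheme.Hom.naturality π ((Opens.map (H.descBase f hf)).map
            i.unop).op).symm).hom (H.descApp f hf U.unop t)) }

theorem toPsh_comp_descPsh :
    (π.toLRSHom.toHom ≫ H.descPsh f hf : X.toPresheafedSpace ⟶ T.toPresheafedSpace) =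
      f.toLRSHom.toHom := by
  refine PresheafedSpace.Hom.ext _ _ ?_ ?_
  · ext x
    exact H.descBase_apply f hf x
  · apply TopCat.Presheaf.ext
    intro V
    ext t
    have := H.app_descApp f hf V t
    rw [Scheme.Hom.appLE] at this
    simp only [CommRingCat.comp_apply] at this
    change X.presheaf.map _ (π.app _ (H.descApp f hf V t)) = f.app V t
    rw [this]
    have key : ∀ {U₁ U₂ : X.Opensᵒᵖ} (a : U₁ ⟶ U₂) (b : U₂ ⟶ U₁) (s : X.presheaf.obj U₁),
        X.presheaf.map b (X.presheaf.map a s) = s := by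
      intro U₁ U₂ a b s
      rw [← CommRingCat.comp_apply, ← X.presheaf.map_comp, Subsingleton.elim (a ≫ b) (𝟙 _),
        X.presheaf.map_id]
      rfl
    exact key _ _ _

/-- A morphism that is constant on orbits factors through the geometric quotient. -/
def desc : Q ⟶ T where
  toLRSHom' :=
    { toHom := H.descPsh f hf
      prop := fun q => by
        obtain ⟨x, rfl⟩ := H.isQuotientMap.surjective q
        have key : ∀ F : X.toPresheafedSpace ⟶ T.toPresheafedSpace,
            F = f.toLRSHom.toHom → IsLocalHom (F.stalkMap x).hom := by
          rintro _ rfl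
          exact f.toLRSHom.prop x
        have h1 := key _ (H.toPsh_comp_descPsh f hf)
        rw [PresheafedSpace.stalkMap.comp] at h1
        exact @isLocalHom_of_comp _ _ _ _ _ _ _ _ h1 }


theorem comp_desc : π ≫ H.desc f hf = f := by
  apply Scheme.Hom.ext'
  apply LocallyRingedSpace.Hom.ext'
  exact H.toPsh_comp_descPsh f hf

end desc

end IsGeomQuotient

/-! ### Sections and restriction maps -/

/-- The restriction of a section to a smaller open set. -/
def res {X : Scheme.{0}} {U V : X.Opens} (h : V ≤ U) : Γ(X, U) →+* Γ(X, V) :=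
  (X.presheaf.map (homOfLE h).op).hom

/-- The pullback of sections along `f`, as a ring homomorphism. -/
def pb {X Y : Scheme.{0}} (f : X ⟶ Y) {U : Y.Opens} {V : X.Opens} (e : V ≤ f ⁻¹ᵁ U) :
    Γ(Y, U) →+* Γ(X, V) :=
  (f.appLE U V e).hom

section

variable {X Y Z : Scheme.{0}}

theorem res_res {U V W : X.Opens} (h : V ≤ U) (h' : W ≤ V) (s : Γ(X, U)) :
    res h' (res h s) = res (h'.trans h) s := by
  simp only [res, ← CommRingCat.comp_apply, ← Functor.map_comp]
  rfl

theorem res_self {U : X.Opens} (h : U ≤ U) (s : Γ(X, U)) : res h s = s := by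
  simp [res]

theorem pb_res (f : X ⟶ Y) {U U' : Y.Opens} {V : X.Opens} (h : U' ≤ U) (e : V ≤ f ⁻¹ᵁ U')
    (s : Γ(Y, U)) : pb f e (res h s) = pb f (e.trans (f.preimage_mono h)) s := by
  simp only [res, pb, ← CommRingCat.comp_apply, Scheme.Hom.map_appLE]

theorem res_pb (f : X ⟶ Y) {U : Y.Opens} {V V' : X.Opens} (h : V' ≤ V) (e : V ≤ f ⁻¹ᵁ U)
    (s : Γ(Y, U)) : res h (pb f e s) = pb f (h.trans e) s := by
  simp only [res, pb, ← CommRingCat.comp_apply, Scheme.Hom.appLE_map]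

theorem le_comp_preimage {f : X ⟶ Y} {k : Y ⟶ Z} {U : Z.Opens} {V : Y.Opens} {W : X.Opens}
    (e : V ≤ k ⁻¹ᵁ U) (e' : W ≤ f ⁻¹ᵁ V) : W ≤ (f ≫ k) ⁻¹ᵁ U :=
  e'.trans (f.preimage_mono e)

theorem le_of_le_id_preimage {U V : X.Opens} (e : V ≤ (𝟙 X : X ⟶ X) ⁻¹ᵁ U) : V ≤ U := e

theorem pb_pb (f : X ⟶ Y) (k : Y ⟶ Z) {U : Z.Opens} {V : Y.Opens} {W : X.Opens}
    (e : V ≤ k ⁻¹ᵁ U) (e' : W ≤ f ⁻¹ᵁ V) (s : Γ(Z, U)) :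
    pb f e' (pb k e s) = pb (f ≫ k) (le_comp_preimage e e') s := by
  simp only [pb, ← CommRingCat.comp_apply, Scheme.Hom.appLE_comp_appLE]

theorem pb_congr {f f' : X ⟶ Y} (h : f = f') {U : Y.Opens} {V : X.Opens} (e : V ≤ f ⁻¹ᵁ U)
    (s : Γ(Y, U)) : pb f e s = pb f' (h ▸ e) s := by
  subst h; rfl

theorem pb_id {U V : X.Opens} (e : V ≤ (𝟙 X : X ⟶ X) ⁻¹ᵁ U) (s : Γ(X, U)) :
    pb (𝟙 X) e s = res (le_of_le_id_preimage e) s := by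
  simp only [pb, res, Scheme.Hom.appLE, Scheme.Hom.id_app]
  exact congr($(Category.id_comp (X.presheaf.map (homOfLE e).op)) s)

theorem app_eq_pb (f : X ⟶ Y) (U : Y.Opens) (s : Γ(Y, U)) :
    f.app U s = pb f (U := U) (V := f ⁻¹ᵁ U) le_rfl s := by
  rw [Scheme.Hom.app_eq_appLE]; rfl

theorem appLE_eq_pb (f : X ⟶ Y) {U : Y.Opens} {V : X.Opens} (e : V ≤ f ⁻¹ᵁ U) (s : Γ(Y, U)) :
    f.appLE U V e s = pb f e s := rfl

/-- Sections that agree locally are equal. -/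
theorem section_ext {U : X.Opens} {s t : Γ(X, U)}
    (h : ∀ x ∈ U, ∃ (V : X.Opens) (hV : V ≤ U), x ∈ V ∧ res hV s = res hV t) : s = t := by
  choose V hV hx he using h
  refine X.sheaf.eq_of_locally_eq' (fun x : U => V x.1 x.2) U
    (fun x => homOfLE (hV x.1 x.2)) ?_ s t (fun x => he x.1 x.2)
  intro x hx'
  exact Opens.mem_iSup.2 ⟨⟨x, hx'⟩, hx x hx'⟩

theorem mem_basicOpen_pb (f : X ⟶ Y) {U : Y.Opens} {V : X.Opens} (e : V ≤ f ⁻¹ᵁ U)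
    (s : Γ(Y, U)) {x : X} (hx : x ∈ V) : x ∈ X.basicOpen (pb f e s) ↔ f x ∈ Y.basicOpen s := by
  rw [pb, Scheme.basicOpen_appLE]
  exact ⟨fun h => h.2, fun h => ⟨hx, h⟩⟩

theorem mem_basicOpen_mul {U : X.Opens} (s t : Γ(X, U)) {x : X} :
    x ∈ X.basicOpen (s * t) ↔ x ∈ X.basicOpen s ∧ x ∈ X.basicOpen t := by
  rw [Scheme.basicOpen_mul]; rfl

/-- Over an affine open set, a section on `D(b)` is a fraction with denominator a power of `b`. -/
theorem exists_eq_pow_mul {U : X.Opens} (hU : IsAffineOpen U) (b : Γ(X, U))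
    (s : Γ(X, X.basicOpen b)) : ∃ (n : ℕ) (y : Γ(X, U)),
      res (X.basicOpen_le b) y = (res (X.basicOpen_le b) b) ^ n * s :=
  exists_eq_pow_mul_of_isAffineOpen X U hU b s

theorem exists_pow_mul_eq_zero {U : X.Opens} (hU : IsAffineOpen U) (b s : Γ(X, U))
    (h : res (X.basicOpen_le b) s = 0) : ∃ n : ℕ, b ^ n * s = 0 :=
  exists_pow_mul_eq_zero_of_res_basicOpen_eq_zero_of_isAffineOpen X hU s b h

theorem isUnit_res_basicOpen {U : X.Opens} (b : Γ(X, U)) : IsUnit (res (X.basicOpen_le b) b) :=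
  RingedSpace.isUnit_res_basicOpen X.toRingedSpace b

theorem isUnit_res_of_le_basicOpen {U V : X.Opens} (b : Γ(X, U)) (h : V ≤ X.basicOpen b) :
    IsUnit (res (h.trans (X.basicOpen_le b)) b) := by
  rw [← res_res (X.basicOpen_le b) h]
  exact (isUnit_res_basicOpen b).map _

/-- Compatible sections can be glued. -/
theorem exists_glue {ι : Type} {U : X.Opens} (V : ι → X.Opens) (hV : ∀ i, V i ≤ U)
    (hc : ∀ x ∈ U, ∃ i, x ∈ V i) (s : ∀ i, Γ(X, V i))
    (hs : ∀ i j, res (inf_le_left : V i ⊓ V j ≤ V i) (s i) = res inf_le_right (s j)) :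
    ∃ t : Γ(X, U), ∀ i, res (hV i) t = s i := by
  obtain ⟨t, ht, -⟩ := X.sheaf.existsUnique_gluing' V U (fun i => homOfLE (hV i))
    (fun x hx => Opens.mem_iSup.2 (hc x hx)) s hs
  exact ⟨t, ht⟩

end

/-! ### Geometric quotients by involutions, affine locally -/

section

variable {X Q : Scheme.{0}} {g : X ⟶ X} {π : X ⟶ Q}

/-- The functions on the open set `O` of `Q` are the invariant functions on its preimage. -/
structure HasInvariantSections (h : g ≫ π = π) (O : Q.Opens) : Prop where
  injective : Function.Injective (pb π (U := O) (V := π ⁻¹ᵁ O) le_rfl)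
  exists_pb_eq : ∀ s : Γ(X, π ⁻¹ᵁ O), pb g (le_preimage_preimage h O) s = s →
    ∃ t, pb π (U := O) (V := π ⁻¹ᵁ O) le_rfl t = s

/-- Taking invariants commutes with localization at an invariant section `b`: if `s / b ^ n` is
invariant, then so is `b ^ m * s` for large `m`. -/
theorem HasInvariantSections.basicOpen {h : g ≫ π = π} {O : Q.Opens}
    (H : HasInvariantSections h O) (hO : IsAffineOpen O) (hO' : IsAffineOpen (π ⁻¹ᵁ O))
    (b : Γ(Q, O)) : HasInvariantSections h (Q.basicOpen b) := by
  have hb : π ⁻¹ᵁ (Q.basicOpen b) = X.basicOpen (pb π (U := O) (V := π ⁻¹ᵁ O) le_rfl b) := by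
    rw [Scheme.preimage_basicOpen]
    congr 1
    exact app_eq_pb π O b
  set b' := pb π (U := O) (V := π ⁻¹ᵁ O) le_rfl b with hb'
  have hle : π ⁻¹ᵁ (Q.basicOpen b) ≤ π ⁻¹ᵁ O := π.preimage_mono (Q.basicOpen_le b)
  have hbr : res hle b' = pb π le_rfl (res (Q.basicOpen_le b) b) := by
    rw [hb', pb_res, res_pb]
  -- vanishing on the preimage of `D(b)`
  have hzero : ∀ s : Γ(X, π ⁻¹ᵁ O), res hle s = 0 → ∃ n : ℕ, b' ^ n * s = 0 := by
    intro s hs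
    apply exists_pow_mul_eq_zero hO'
    have := congrArg (res hb.ge) hs
    rwa [res_res, map_zero] at this
  have hub : IsUnit (res (Q.basicOpen_le b) b) := isUnit_res_basicOpen b
  have hgb : ∀ n : ℕ, pb g (le_preimage_preimage h O) (b' ^ n) = b' ^ n := by
    intro n
    rw [map_pow, hb', pb_pb]
    rw [pb_congr h]
  constructor
  · rw [injective_iff_map_eq_zero]
    intro t ht
    obtain ⟨n, u, hu⟩ := exists_eq_pow_mul hO b t
    have h1 : res hle (pb π (U := O) (V := π ⁻¹ᵁ O) le_rfl u) = 0 := by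
      rw [res_pb, ← pb_res π (Q.basicOpen_le b) le_rfl, hu, map_mul, ht, mul_zero]
    obtain ⟨m, hm⟩ := hzero _ h1
    rw [hb', ← map_pow, ← map_mul] at hm
    have h2 := (injective_iff_map_eq_zero _).1 H.injective _ hm
    have h3 := congrArg (res (Q.basicOpen_le b)) h2
    rw [map_mul, map_zero, hu, map_pow, ← mul_assoc, ← pow_add] at h3
    exact (hub.pow _).mul_right_eq_zero.1 h3
  · intro s hs
    obtain ⟨n, y, hy⟩ := exists_eq_pow_mul hO' b' (res hb.ge s)
    have hy' : res hle y = pb π le_rfl (res (Q.basicOpen_le b) b) ^ n * s := by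
      have := congrArg (res hb.le) hy
      rw [res_res, map_mul, map_pow, res_res, res_res, res_self] at this
      rw [this, hbr]
    have h1 : res hle (pb g (le_preimage_preimage h O) y - y) = 0 := by
      rw [map_sub, res_pb, ← pb_res g hle (le_preimage_preimage h _), hy', map_mul, map_pow, hs,
        pb_pb, pb_congr h, sub_self]
    obtain ⟨m, hm⟩ := hzero _ h1
    obtain ⟨c, hc⟩ := H.exists_pb_eq (b' ^ m * y) (by
      rw [map_mul, hgb]
      rw [mul_sub, sub_eq_zero] at hm
      exact hm)
    obtain ⟨v, hv⟩ := hub.exists_right_inv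
    refine ⟨v ^ (m + n) * res (Q.basicOpen_le b) c, ?_⟩
    have h2 : pb π (U := Q.basicOpen b) (V := π ⁻¹ᵁ Q.basicOpen b) le_rfl
        (res (Q.basicOpen_le b) c) =
        pb π le_rfl (res (Q.basicOpen_le b) b) ^ (m + n) * s := by
      rw [pb_res, ← res_pb π hle le_rfl, hc, map_mul, hy', map_pow, hbr, pow_add]
      ring
    rw [map_mul, h2, ← mul_assoc, ← map_pow, ← map_mul, ← mul_pow, mul_comm v, hv, one_pow,
      map_one, one_mul]

/-- Having invariant sections can be checked on a basis of the topology. -/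
theorem HasInvariantSections.of_basis {h : g ≫ π = π} {U : Q.Opens}
    (H : ∀ q ∈ U, ∃ O : Q.Opens, q ∈ O ∧ ∀ V : Q.Opens, V ≤ O → q ∈ V →
      ∃ V', q ∈ V' ∧ V' ≤ V ∧ HasInvariantSections h V') : HasInvariantSections h U := by
  have H' : ∀ W : Q.Opens, W ≤ U → ∀ q ∈ W, ∃ V, q ∈ V ∧ V ≤ W ∧ HasInvariantSections h V := by
    intro W hW q hq
    obtain ⟨O, hqO, hO⟩ := H q (hW hq)
    obtain ⟨V, h1, h2, h3⟩ := hO (O ⊓ W) inf_le_left ⟨hqO, hq⟩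
    exact ⟨V, h1, h2.trans inf_le_right, h3⟩
  have hinj : ∀ W : Q.Opens, W ≤ U →
      Function.Injective (pb π (U := W) (V := π ⁻¹ᵁ W) le_rfl) := by
    intro W hW s t hst
    apply section_ext
    intro q hq
    obtain ⟨V, h1, h2, h3⟩ := H' W hW q hq
    refine ⟨V, h2, h1, h3.injective ?_⟩
    rw [pb_res, pb_res, ← res_pb π (π.preimage_mono h2) le_rfl, hst, res_pb]
  refine ⟨hinj U le_rfl, fun s hs => ?_⟩
  choose V h1 h2 h3 using fun q : U => H' U le_rfl q.1 q.2
  have : ∀ q : U, ∃ t : Γ(Q, V q), pb π le_rfl t = res (π.preimage_mono (h2 q)) s := by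
    intro q
    apply (h3 q).exists_pb_eq
    rw [pb_res, ← res_pb g (π.preimage_mono (h2 q)) (le_preimage_preimage h U), hs]
  choose t ht using this
  obtain ⟨r, hr⟩ := exists_glue V h2 (fun x hx => ⟨⟨x, hx⟩, h1 _⟩) t (by
    intro i j
    apply hinj _ (inf_le_left.trans (h2 i))
    rw [pb_res, pb_res, ← res_pb π (π.preimage_mono inf_le_left) le_rfl, ht,
      ← res_pb π (V := π ⁻¹ᵁ V j) (π.preimage_mono inf_le_right) le_rfl, ht, res_res, res_res])
  refine ⟨r, ?_⟩
  apply section_ext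
  intro x hx
  refine ⟨π ⁻¹ᵁ V ⟨π x, hx⟩, π.preimage_mono (h2 _), h1 _, ?_⟩
  rw [res_pb, ← pb_res π (h2 ⟨π x, hx⟩) le_rfl, hr, ht]

theorem HasInvariantSections.of_affine {h : g ≫ π = π}
    (H : ∀ q, ∃ O : Q.Opens, q ∈ O ∧ IsAffineOpen O ∧ IsAffineOpen (π ⁻¹ᵁ O) ∧
      HasInvariantSections h O) (U : Q.Opens) : HasInvariantSections h U := by
  refine .of_basis fun q _ => ?_
  obtain ⟨O, h1, h2, h3, h4⟩ := H q
  refine ⟨O, h1, fun V hV hq => ?_⟩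
  obtain ⟨b, hb1, hb2⟩ := h2.exists_basicOpen_le ⟨q, hq⟩ h1
  exact ⟨Q.basicOpen b, hb2, hb1, h4.basicOpen h2 h3 b⟩

theorem IsGeomQuotient.hasInvariantSections (H : IsGeomQuotient g π) (U : Q.Opens) :
    HasInvariantSections H.invariant U := by
  refine ⟨fun s t hst => H.injective U ?_, fun s hs => ?_⟩
  · rwa [app_eq_pb, app_eq_pb]
  · obtain ⟨t, ht⟩ := H.exists_app_eq U s hs
    exact ⟨t, by rwa [← app_eq_pb]⟩

end

section

variable {X Q : Scheme.{0}} {g : X ⟶ X} {π : X ⟶ Q}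

theorem mem_primeIdealOf {U : X.Opens} (hU : IsAffineOpen U) {x : X} (hx : x ∈ U) (a : Γ(X, U)) :
    a ∈ (hU.primeIdealOf ⟨x, hx⟩).asIdeal ↔ x ∉ X.basicOpen a := by
  have h := hU.fromSpec_preimage_basicOpen a
  have h2 : hU.primeIdealOf ⟨x, hx⟩ ∈ hU.fromSpec ⁻¹ᵁ X.basicOpen a ↔ x ∈ X.basicOpen a := by
    change hU.fromSpec (hU.primeIdealOf ⟨x, hx⟩) ∈ X.basicOpen a ↔ _
    rw [hU.fromSpec_primeIdealOf]
  rw [h] at h2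
  rw [← h2]
  exact (not_not (a := a ∈ (hU.primeIdealOf ⟨x, hx⟩).asIdeal)).symm

theorem eq_of_primeIdealOf_eq {U : X.Opens} (hU : IsAffineOpen U) {x y : X} (hx : x ∈ U)
    (hy : y ∈ U) (h : (hU.primeIdealOf ⟨x, hx⟩).asIdeal = (hU.primeIdealOf ⟨y, hy⟩).asIdeal) :
    x = y := by
  have h1 := hU.fromSpec_primeIdealOf ⟨x, hx⟩
  rw [show hU.primeIdealOf ⟨x, hx⟩ = hU.primeIdealOf ⟨y, hy⟩ from PrimeSpectrum.ext h,
    hU.fromSpec_primeIdealOf] at h1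
  exact h1.symm

theorem apply_apply_of_involutive (hg : g ≫ g = 𝟙 X) (x : X) : g (g x) = x := by
  rw [← Scheme.Hom.comp_apply, hg]; rfl

theorem pb_pb_of_involutive (hg : g ≫ g = 𝟙 X) {U : X.Opens} (hU : U ≤ g ⁻¹ᵁ U) (a : Γ(X, U)) :
    pb g hU (pb g hU a) = a := by
  rw [pb_pb, pb_congr hg, pb_id, res_self]

theorem HasInvariantSections.exists_mul (hg : g ≫ g = 𝟙 X) {h : g ≫ π = π} {O : Q.Opens}
    (H : HasInvariantSections h O) (a : Γ(X, π ⁻¹ᵁ O)) :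
    ∃ n, pb π (U := O) (V := π ⁻¹ᵁ O) le_rfl n = a * pb g (le_preimage_preimage h O) a :=
  H.exists_pb_eq _ (by rw [map_mul, pb_pb_of_involutive hg, mul_comm])

theorem HasInvariantSections.exists_add (hg : g ≫ g = 𝟙 X) {h : g ≫ π = π} {O : Q.Opens}
    (H : HasInvariantSections h O) (a : Γ(X, π ⁻¹ᵁ O)) :
    ∃ n, pb π (U := O) (V := π ⁻¹ᵁ O) le_rfl n = a + pb g (le_preimage_preimage h O) a :=
  H.exists_pb_eq _ (by rw [map_add, pb_pb_of_involutive hg, add_comm])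

/-- Every `a` is a root of `(T - a)(T - g(a))`. -/
theorem HasInvariantSections.isIntegral (hg : g ≫ g = 𝟙 X) {h : g ≫ π = π} {O : Q.Opens}
    (H : HasInvariantSections h O) : (π.app O).hom.IsIntegral := by
  intro a
  obtain ⟨n, hn⟩ := H.exists_mul hg a
  obtain ⟨t, ht⟩ := H.exists_add hg a
  refine ⟨Polynomial.X ^ 2 - Polynomial.C t * Polynomial.X + Polynomial.C n, ?_, ?_⟩
  · monicity!
  · have h1 : (π.app O).hom n = _ := (app_eq_pb π O n).trans hn
    have h2 : (π.app O).hom t = _ := (app_eq_pb π O t).trans ht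
    simp only [Polynomial.eval₂_add, Polynomial.eval₂_sub, Polynomial.eval₂_mul,
      Polynomial.eval₂_pow, Polynomial.eval₂_X, Polynomial.eval₂_C, h1, h2]
    ring

theorem presheaf_map_surjective {U V : X.Opens} (k : Opposite.op U ⟶ Opposite.op V) (h : U ≤ V) :
    Function.Surjective (X.presheaf.map k).hom := by
  intro s
  refine ⟨X.presheaf.map (homOfLE h).op s, ?_⟩
  have : X.presheaf.map ((homOfLE h).op ≫ k) s = s := by
    rw [Subsingleton.elim ((homOfLE h).op ≫ k) (𝟙 _), X.presheaf.map_id]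
    rfl
  rwa [Functor.map_comp, CommRingCat.comp_apply] at this

theorem isIntegralHom_of_affine (h : g ≫ π = π) (hg : g ≫ g = 𝟙 X)
    (H : ∀ q, ∃ O : Q.Opens, q ∈ O ∧ IsAffineOpen O ∧ IsAffineOpen (π ⁻¹ᵁ O) ∧
      HasInvariantSections h O) : IsIntegralHom π := by
  choose O h1 h2 h3 h4 using H
  have htop : iSup O = ⊤ := by
    ext q
    simp only [Opens.coe_iSup, Set.mem_iUnion, SetLike.mem_coe, Opens.coe_top, Set.mem_univ,
      iff_true]
    exact ⟨q, h1 q⟩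
  refine (@HasAffineProperty.iff_of_iSup_eq_top _ _ IsIntegralHom.hasAffineProperty _ _ π _
    (fun q => (⟨O q, h2 q⟩ : Q.affineOpens)) htop).2 fun q => ⟨h3 q, ?_⟩
  have := HasInvariantSections.isIntegral hg
    (HasInvariantSections.of_affine (h := h) (fun q => ⟨O q, h1 q, h2 q, h3 q, h4 q⟩)
      ((O q).ι ''ᵁ ⊤))
  change ((π ∣_ O q).appTop).hom.IsIntegral
  rw [morphismRestrict_appTop]
  refine RingHom.IsIntegral.trans _ _ this (RingHom.isIntegral_of_surjective _ ?_)
  exact presheaf_map_surjective _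
    (by rw [show (π ∣_ O q) ⁻¹ᵁ ⊤ = ⊤ from rfl, Scheme.Opens.ι_image_top, Scheme.Opens.ι_image_top])

theorem HasInvariantSections.exists_apply_eq (hg : g ≫ g = 𝟙 X) {h : g ≫ π = π} {O : Q.Opens}
    (H : HasInvariantSections h O) (hO : IsAffineOpen O) (hO' : IsAffineOpen (π ⁻¹ᵁ O))
    {q : Q} (hq : q ∈ O) : ∃ x, π x = q := by
  have hs := (H.isIntegral hg).comap_surjective (by
    intro s t hst
    apply H.injective
    change π.app O s = π.app O t at hst
    rwa [app_eq_pb, app_eq_pb] at hst)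
  obtain ⟨z, hz⟩ := hs (hO.primeIdealOf ⟨q, hq⟩)
  let z' : Spec Γ(X, π ⁻¹ᵁ O) := z
  have h2 : (Spec.map (π.app O)) z' = hO.primeIdealOf ⟨q, hq⟩ := hz
  refine ⟨hO'.fromSpec z', ?_⟩
  have h1 := hO.SpecMap_appLE_fromSpec π hO' le_rfl
  rw [← Scheme.Hom.comp_apply, ← h1, Scheme.Hom.comp_apply, ← Scheme.Hom.app_eq_appLE, h2,
    hO.fromSpec_primeIdealOf]

/-- The fibres of the quotient map are orbits. If `π w = π z`, then each `a` in the prime of `w` has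
its norm `a * g a` in the prime of `z`, so the prime of `w` lies in the union of the primes of `z`
and `g z`, and prime avoidance applies. -/
theorem HasInvariantSections.eq_or_eq (hg : g ≫ g = 𝟙 X) {h : g ≫ π = π} {O : Q.Opens}
    (H : HasInvariantSections h O) (hO' : IsAffineOpen (π ⁻¹ᵁ O)) {x y : X} (hx : π x ∈ O)
    (hxy : π x = π y) : y = x ∨ y = g x := by
  have hmem : ∀ {z : X}, π z ∈ O → π (g z) ∈ O := by
    intro z hz
    rwa [← Scheme.Hom.comp_apply, h]
  let p : ∀ z : X, π z ∈ O → Ideal Γ(X, π ⁻¹ᵁ O) :=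
    fun z hz => (hO'.primeIdealOf ⟨z, hz⟩).asIdeal
  have hp : ∀ (z : X) (hz : π z ∈ O) (a : Γ(X, π ⁻¹ᵁ O)), a ∈ p z hz ↔ z ∉ X.basicOpen a :=
    fun z hz a => mem_primeIdealOf hO' hz a
  have hpg : ∀ (z : X) (hz : π z ∈ O) (a : Γ(X, π ⁻¹ᵁ O)),
      a ∈ p (g z) (hmem hz) ↔ pb g (le_preimage_preimage h O) a ∈ p z hz := by
    intro z hz a
    rw [hp, hp, mem_basicOpen_pb g _ _ hz]
  have hinv : ∀ (a : Γ(X, π ⁻¹ᵁ O)), pb g (le_preimage_preimage h O)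
      (pb g (le_preimage_preimage h O) a) = a := pb_pb_of_involutive hg _
  have key : ∀ (z w : X) (hz : π z ∈ O) (hw : π w ∈ O), π z = π w →
      p w hw ≤ p z hz ∨ p w hw ≤ p (g z) (hmem hz) := by
    intro z w hz hw hzw
    rw [← Ideal.subset_union]
    intro a ha
    obtain ⟨n, hn⟩ := H.exists_mul hg a
    have h1 : w ∉ X.basicOpen (pb π (U := O) (V := π ⁻¹ᵁ O) le_rfl n) := by
      rw [← hp w hw, hn]
      exact Ideal.mul_mem_right _ _ ha
    rw [mem_basicOpen_pb π _ _ hw, ← hzw, ← mem_basicOpen_pb π (le_refl (π ⁻¹ᵁ O)) _ hz,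
      ← hp z hz, hn] at h1
    rcases (hO'.primeIdealOf ⟨z, hz⟩).isPrime.mem_or_mem h1 with h2 | h2
    · exact Or.inl h2
    · exact Or.inr ((hpg z hz a).2 h2)
  have key2 : ∀ (z w : X) (hz : π z ∈ O) (hw : π w ∈ O), π z = π w →
      p w hw ≤ p z hz → w = z := by
    intro z w hz hw hzw hle
    refine eq_of_primeIdealOf_eq hO' hw hz (le_antisymm hle ?_)
    rcases key w z hw hz hzw.symm with h1 | h1
    · exact h1
    · have h2 : p (g w) (hmem hw) ≤ p w hw := by
        intro a ha
        rw [hpg w hw] at ha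
        rw [← hinv a, ← hpg w hw]
        exact h1 (hle ha)
      exact h1.trans h2
  have hy : π y ∈ O := hxy ▸ hx
  rcases key x y hx hy hxy with h1 | h1
  · exact Or.inl (key2 x y hx hy hxy h1)
  · refine Or.inr (key2 (g x) y (hmem hx) hy ?_ h1)
    rw [← hxy, ← Scheme.Hom.comp_apply, h]

/-- A morphism which affine locally is the inclusion of the ring of invariants of an involution
is a geometric quotient. -/
theorem isGeomQuotient_of_affine (h : g ≫ π = π) (hg : g ≫ g = 𝟙 X)
    (H : ∀ q, ∃ O : Q.Opens, q ∈ O ∧ IsAffineOpen O ∧ IsAffineOpen (π ⁻¹ᵁ O) ∧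
      HasInvariantSections h O) : IsGeomQuotient g π := by
  have := isIntegralHom_of_affine h hg H
  have hall := HasInvariantSections.of_affine H
  refine ⟨h, ?_, ?_, ?_, ?_⟩
  · refine π.isClosedMap.isQuotientMap π.continuous ?_
    intro q
    obtain ⟨O, h1, h2, h3, h4⟩ := H q
    exact h4.exists_apply_eq hg h2 h3 h1
  · intro x y
    constructor
    · intro hxy
      obtain ⟨O, h1, h2, h3, h4⟩ := H (π x)
      exact h4.eq_or_eq hg h3 h1 hxy
    · rintro (rfl | rfl)
      · rfl
      · rw [← Scheme.Hom.comp_apply, h]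
  · intro U s t hst
    rw [app_eq_pb, app_eq_pb] at hst
    exact (hall U).injective hst
  · intro U s hs
    obtain ⟨t, ht⟩ := (hall U).exists_pb_eq s hs
    exact ⟨t, by rwa [app_eq_pb]⟩

/-- An equivariant open immersion of schemes induces an open immersion of geometric quotients. -/
theorem isOpenImmersion_of_isGeomQuotient {Y Q' : Scheme.{0}} {γ : Y ⟶ Y} {p : Y ⟶ Q'}
    (Hp : IsGeomQuotient γ p) (Hπ : IsGeomQuotient g π) (i : Y ⟶ X) [IsOpenImmersion i]
    (hi : γ ≫ i = i ≫ g) (θ : Q' ⟶ Q) (hθ : p ≫ θ = i ≫ π) : IsOpenImmersion θ := by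
  have hθ' : ∀ y, θ (p y) = π (i y) := fun y => by
    rw [← Scheme.Hom.comp_apply, hθ, Scheme.Hom.comp_apply]
  have hi' : ∀ y, i (γ y) = g (i y) := fun y => by
    rw [← Scheme.Hom.comp_apply, hi, Scheme.Hom.comp_apply]
  -- the image of `i` is a union of fibres of `π`
  have hsat : ∀ x y, π x = π (i y) → ∃ y', i y' = x ∧ p y' = p y := by
    intro x y hxy
    rcases (Hπ.orbits (i y) x).1 hxy.symm with rfl | rfl
    · exact ⟨y, rfl, rfl⟩
    · exact ⟨γ y, hi' y, ((Hp.orbits _ _).2 (Or.inr rfl)).symm⟩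
  have hinj : Function.Injective θ := by
    intro q q' hqq
    obtain ⟨y, rfl⟩ := Hp.isQuotientMap.surjective q
    obtain ⟨y', rfl⟩ := Hp.isQuotientMap.surjective q'
    rw [hθ', hθ'] at hqq
    obtain ⟨y'', h1, h2⟩ := hsat _ _ hqq
    rw [← h2, i.isOpenEmbedding.injective h1]
  have hpre : ∀ W : Set Q', π ⁻¹' (θ '' W) = i '' (p ⁻¹' W) := by
    intro W
    ext x
    constructor
    · rintro ⟨q, hq, hqx⟩
      obtain ⟨y, rfl⟩ := Hp.isQuotientMap.surjective q
      rw [hθ'] at hqx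
      obtain ⟨y', h1, h2⟩ := hsat _ _ hqx.symm
      exact ⟨y', by simpa only [Set.mem_preimage, h2] using hq, h1⟩
    · rintro ⟨y, hy, rfl⟩
      exact ⟨p y, hy, hθ' y⟩
  have hopen : IsOpenMap θ := by
    intro W hW
    rw [← Hπ.isQuotientMap.isOpen_preimage, hpre]
    exact i.isOpenEmbedding.isOpenMap _ (hW.preimage p.continuous)
  have hemb : Topology.IsOpenEmbedding θ :=
    .of_continuous_injective_isOpenMap θ.continuous hinj hopen
  have hbij : ∀ U : Q'.Opens, IsIso (θ.app ⟨θ '' (U : Set Q'), hopen _ U.2⟩) := by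
    intro U
    set V : Q.Opens := ⟨θ '' (U : Set Q'), hopen _ U.2⟩ with hV
    have hVr : π ⁻¹ᵁ V ≤ i.opensRange := by
      intro x hx
      have : x ∈ π ⁻¹' (θ '' (U : Set Q')) := hx
      rw [hpre] at this
      obtain ⟨y, -, rfl⟩ := this
      exact ⟨y, rfl⟩
    have hiso := i.isIso_app (π ⁻¹ᵁ V) hVr
    have hib := ConcreteCategory.bijective_of_isIso (i.app (π ⁻¹ᵁ V))
    have hYV : p ⁻¹ᵁ θ ⁻¹ᵁ V = i ⁻¹ᵁ π ⁻¹ᵁ V := by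
      rw [← Scheme.Hom.comp_preimage, hθ, Scheme.Hom.comp_preimage]
    have hcomm : ∀ s : Γ(Q, V), pb p (U := θ ⁻¹ᵁ V) (V := p ⁻¹ᵁ θ ⁻¹ᵁ V) le_rfl
        (pb θ (U := V) le_rfl s) = pb i hYV.le (pb π (U := V) (V := π ⁻¹ᵁ V) le_rfl s) := by
      intro s
      rw [pb_pb, pb_pb, pb_congr hθ]
    have hpi : Function.Bijective (pb i (U := π ⁻¹ᵁ V) hYV.le) := by
      have : ∀ s, pb i (U := π ⁻¹ᵁ V) hYV.le s = res hYV.le (i.app (π ⁻¹ᵁ V) s) := by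
        intro s
        rw [app_eq_pb, res_pb]
      have h2 : Function.Bijective (res hYV.le : Γ(Y, _) →+* Γ(Y, _)) := by
        refine Function.bijective_iff_has_inverse.2 ⟨res hYV.ge, ?_, ?_⟩ <;>
        intro s <;> rw [res_res, res_self]
      convert h2.comp hib using 1
      ext s
      exact this s
    have hib' : Function.Bijective (θ.app V) := by
      constructor
      · intro s t hst
        rw [app_eq_pb, app_eq_pb] at hst
        apply (Hπ.hasInvariantSections V).injective
        apply hpi.1
        rw [← hcomm, ← hcomm, hst]
      · intro t
        obtain ⟨s, hs⟩ := hpi.2 (pb p (U := θ ⁻¹ᵁ V) (V := p ⁻¹ᵁ θ ⁻¹ᵁ V) le_rfl t)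
        obtain ⟨r, hr⟩ := (Hπ.hasInvariantSections V).exists_pb_eq s (by
          apply hpi.1
          have hle : p ⁻¹ᵁ θ ⁻¹ᵁ V ≤ γ ⁻¹ᵁ p ⁻¹ᵁ θ ⁻¹ᵁ V := le_preimage_preimage Hp.invariant _
          rw [pb_pb, pb_congr hi.symm, ← pb_pb γ i hYV.le hle, hs, pb_pb,
            pb_congr Hp.invariant])
        refine ⟨r, ?_⟩
        rw [app_eq_pb]
        apply (Hp.hasInvariantSections (θ ⁻¹ᵁ V)).injective
        rw [hcomm, hr, hs]
    exact (ConcreteCategory.isIso_iff_bijective _).2 hib'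
  exact { base_open := hemb, c_iso := hbij }

end

/-! ### Gluing morphisms -/

theorem hom_ext_of_isOpenImmersion {X T : Scheme.{0}} (f g : X ⟶ T)
    (h : ∀ x : X, ∃ (Z : Scheme.{0}) (a : Z ⟶ X) (_ : IsOpenImmersion a) (z : Z),
      a z = x ∧ a ≫ f = a ≫ g) : f = g := by
  refine Scheme.hom_ext_of_forall f g fun x => ?_
  obtain ⟨Z, a, ha, z, rfl, hz⟩ := h x
  refine ⟨a.opensRange, ⟨z, rfl⟩, ?_⟩
  rw [← cancel_epi a.isoOpensRange.hom]
  simpa using hz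

/-- Morphisms on the members of an open cover that agree locally can be glued. -/
theorem exists_glue_hom {X T : Scheme.{0}} {ι : Type} (Y : ι → Scheme.{0}) (u : ∀ i, Y i ⟶ X)
    [∀ i, IsOpenImmersion (u i)] (hu : ∀ x, ∃ i y, u i y = x) (f : ∀ i, Y i ⟶ T)
    (hf : ∀ i j (y : Y i) (y' : Y j), u i y = u j y' →
      ∃ (Z : Scheme.{0}) (a : Z ⟶ Y i) (b : Z ⟶ Y j) (_ : IsOpenImmersion a) (z : Z),
        a z = y ∧ a ≫ u i = b ≫ u j ∧ a ≫ f i = b ≫ f j) :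
    ∃ k : X ⟶ T, ∀ i, u i ≫ k = f i := by
  choose idx pt hpt using hu
  let 𝒰 : X.OpenCover :=
    { I₀ := ι, X := Y, f := u,
      mem₀ := by
        rw [Scheme.presieve₀_mem_precoverage_iff]
        exact ⟨fun x => ⟨idx x, pt x, hpt x⟩, inferInstance⟩ }
  have hc : ∀ i j, pullback.fst (u i) (u j) ≫ f i = pullback.snd (u i) (u j) ≫ f j := by
    intro i j
    refine hom_ext_of_isOpenImmersion _ _ fun p => ?_
    have hp : u i (pullback.fst (u i) (u j) p) = u j (pullback.snd (u i) (u j) p) := by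
      rw [← Scheme.Hom.comp_apply, pullback.condition, Scheme.Hom.comp_apply]
    obtain ⟨Z, a, b, ha, z, hz, h1, h2⟩ := hf i j _ _ hp
    have hl : IsOpenImmersion (pullback.lift a b h1 ≫ pullback.fst (u i) (u j)) := by
      rwa [pullback.lift_fst]
    refine ⟨Z, pullback.lift a b h1, .of_comp _ (pullback.fst (u i) (u j)), z, ?_, ?_⟩
    · apply (pullback.fst (u i) (u j)).isOpenEmbedding.injective
      rw [← Scheme.Hom.comp_apply, pullback.lift_fst, hz]
    · rw [pullback.lift_fst_assoc, pullback.lift_snd_assoc, h2]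
  exact ⟨𝒰.glueMorphisms f hc, fun i => 𝒰.ι_glueMorphisms f hc i⟩

/-! ### Quotients of affine schemes -/

theorem bijective_pb_of_isOpenImmersion {X Y : Scheme.{0}} (i : Y ⟶ X) [IsOpenImmersion i]
    {V : X.Opens} (hV : V ≤ i.opensRange) {W : Y.Opens} (hW : W = i ⁻¹ᵁ V) :
    Function.Bijective (pb i (U := V) (V := W) hW.le) := by
  subst hW
  have hiso := i.isIso_app V hV
  have hib := ConcreteCategory.bijective_of_isIso (i.app V)
  convert hib using 1
  ext s
  exact (app_eq_pb i V s).symm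

/-- The sections over the image of an open immersion `j` of quotients can be computed on the source
of `j`. -/
theorem HasInvariantSections.of_isOpenImmersion {X Q Y Q' : Scheme.{0}} {g : X ⟶ X} {π : X ⟶ Q}
    {γ : Y ⟶ Y} {p : Y ⟶ Q'} (h : g ≫ π = π) (h' : γ ≫ p = p)
    (Hp : HasInvariantSections h' ⊤) (i : Y ⟶ X) (j : Q' ⟶ Q)
    [IsOpenImmersion i] [IsOpenImmersion j] (hi : γ ≫ i = i ≫ g) (hj : p ≫ j = i ≫ π)
    (hr : π ⁻¹ᵁ j.opensRange = i.opensRange) : HasInvariantSections h j.opensRange := by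
  have hjr : (⊤ : Q'.Opens) = j ⁻¹ᵁ j.opensRange := by simp
  have hir : (⊤ : Y.Opens) = i ⁻¹ᵁ π ⁻¹ᵁ j.opensRange := by rw [hr]; simp
  have hjb := bijective_pb_of_isOpenImmersion j le_rfl hjr
  have hib := bijective_pb_of_isOpenImmersion i hr.le hir
  have hcomm : ∀ s : Γ(Q, j.opensRange), pb p (U := ⊤) (V := p ⁻¹ᵁ ⊤) le_rfl
      (pb j hjr.le s) = pb i hir.le (pb π (U := j.opensRange) le_rfl s) := by
    intro s
    rw [pb_pb, pb_pb, pb_congr hj]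
    rfl
  constructor
  · intro s t hst
    apply hjb.1
    apply Hp.injective
    rw [hcomm, hcomm, hst]
  · intro s hs
    obtain ⟨t, ht⟩ := Hp.exists_pb_eq (pb i hir.le s) (by
      have hle : (⊤ : Y.Opens) ≤ γ ⁻¹ᵁ ⊤ := le_top
      change pb γ hle (pb i hir.le s) = _
      rw [pb_pb, pb_congr hi, ← pb_pb i g (le_preimage_preimage h _) hir.le, hs])
    obtain ⟨r, rfl⟩ := hjb.2 t
    rw [hcomm] at ht
    exact ⟨r, hib.1 ht⟩

theorem pb_SpecMap {A B : CommRingCat.{0}} (φ : B ⟶ A) (s : Γ(Spec B, ⊤)) :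
    (Scheme.ΓSpecIso A).hom (pb (Spec.map φ) (U := ⊤) (V := ⊤) le_top s) =
      φ ((Scheme.ΓSpecIso B).hom s) := by
  have := congr($(Scheme.ΓSpecIso_naturality φ) s)
  simp only [CommRingCat.comp_apply] at this
  rw [← this]
  exact congrArg _ (app_eq_pb (Spec.map φ) ⊤ s).symm

theorem ΓSpecIso_hom_bijective (A : CommRingCat.{0}) :
    Function.Bijective (Scheme.ΓSpecIso A).hom :=
  ConcreteCategory.bijective_of_isIso _

theorem hasInvariantSections_SpecMap {A B : CommRingCat.{0}} {γ : A ⟶ A} {φ : B ⟶ A}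
    (h : φ ≫ γ = φ) (hφ : Function.Injective φ) (hr : ∀ a, γ a = a → ∃ b, φ b = a) :
    HasInvariantSections (g := Spec.map γ) (π := Spec.map φ) (by rw [← Spec.map_comp, h]) ⊤ := by
  constructor
  · intro s t hst
    apply (ΓSpecIso_hom_bijective B).1
    apply hφ
    rw [← pb_SpecMap, ← pb_SpecMap]
    exact congrArg _ hst
  · intro s hs
    let s' : Γ(Spec A, ⊤) := s
    obtain ⟨b, hb⟩ := hr ((Scheme.ΓSpecIso A).hom s')
      ((pb_SpecMap γ s').symm.trans (congrArg _ hs))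
    obtain ⟨t, rfl⟩ := (ΓSpecIso_hom_bijective B).2 b
    exact ⟨t, (ΓSpecIso_hom_bijective A).1 ((pb_SpecMap φ t).trans hb)⟩

theorem isGeomQuotient_SpecMap {A B : CommRingCat.{0}} {γ : A ⟶ A} {φ : B ⟶ A} (hγ : γ ≫ γ = 𝟙 A)
    (h : φ ≫ γ = φ) (hφ : Function.Injective φ) (hr : ∀ a, γ a = a → ∃ b, φ b = a) :
    IsGeomQuotient (Spec.map γ) (Spec.map φ) :=
  isGeomQuotient_of_affine (by rw [← Spec.map_comp, h]) (by rw [← Spec.map_comp, hγ, Spec.map_id])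
    fun q => ⟨⊤, trivial, isAffineOpen_top _, isAffineOpen_top _,
      hasInvariantSections_SpecMap h hφ hr⟩

/-! ### Quotients by involutions with an invariant affine open cover -/

section

variable {X : Scheme.{0}} (g : X ⟶ X)

/-- The affine open subsets of `X` that are stable under `g`. -/
abbrev InvariantAffine : Type := {U : X.Opens // IsAffineOpen U ∧ U ≤ g ⁻¹ᵁ U}

variable {g}

/-- The action of `g` on the functions on an invariant open set. -/
abbrev actionOn {U : X.Opens} (hU : U ≤ g ⁻¹ᵁ U) : Γ(X, U) ⟶ Γ(X, U) := g.appLE U U hU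

/-- The ring of invariant functions on an invariant open set. -/
abbrev invariantRing {U : X.Opens} (hU : U ≤ g ⁻¹ᵁ U) : CommRingCat.{0} :=
  CommRingCat.of ((pb g hU).eqLocus (RingHom.id _))

/-- The inclusion of the ring of invariants. -/
abbrev invariantIncl {U : X.Opens} (hU : U ≤ g ⁻¹ᵁ U) : invariantRing hU ⟶ Γ(X, U) :=
  CommRingCat.ofHom ((pb g hU).eqLocus (RingHom.id _)).subtype

theorem isGeomQuotient_invariantIncl (hg : g ≫ g = 𝟙 X) {U : X.Opens} (hU : U ≤ g ⁻¹ᵁ U) :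
    IsGeomQuotient (Spec.map (actionOn hU)) (Spec.map (invariantIncl hU)) := by
  refine isGeomQuotient_SpecMap ?_ ?_ Subtype.val_injective fun a ha => ⟨⟨a, ha⟩, rfl⟩
  · ext a
    exact pb_pb_of_involutive hg hU a
  · ext a
    exact a.2

theorem actionOn_fromSpec {U : X.Opens} (hU : U ≤ g ⁻¹ᵁ U) (hU' : IsAffineOpen U) :
    Spec.map (actionOn hU) ≫ hU'.fromSpec = hU'.fromSpec ≫ g :=
  hU'.SpecMap_appLE_fromSpec g hU' hU

theorem preimage_opensRange_of_isGeomQuotient {Q Y Q' : Scheme.{0}} {π : X ⟶ Q} {γ : Y ⟶ Y}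
    {p : Y ⟶ Q'} (Hp : IsGeomQuotient γ p) (Hπ : IsGeomQuotient g π) (i : Y ⟶ X)
    [IsOpenImmersion i] (hi : γ ≫ i = i ≫ g) (θ : Q' ⟶ Q) [IsOpenImmersion θ]
    (hθ : p ≫ θ = i ≫ π) : π ⁻¹ᵁ θ.opensRange = i.opensRange := by
  ext x
  constructor
  · rintro ⟨q, hq⟩
    obtain ⟨y, rfl⟩ := Hp.isQuotientMap.surjective q
    rw [← Scheme.Hom.comp_apply, hθ, Scheme.Hom.comp_apply] at hq
    rcases (Hπ.orbits _ _).1 hq with rfl | rfl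
    · exact ⟨y, rfl⟩
    · exact ⟨γ y, by rw [← Scheme.Hom.comp_apply, hi, Scheme.Hom.comp_apply]⟩
  · rintro ⟨y, rfl⟩
    exact ⟨p y, by rw [← Scheme.Hom.comp_apply, hθ, Scheme.Hom.comp_apply]⟩

/-- The image of an invariant affine open set in the quotient is an affine open set. -/
theorem IsGeomQuotient.exists_isAffineOpen {Q : Scheme.{0}} {π : X ⟶ Q} (H : IsGeomQuotient g π)
    (hg : g ≫ g = 𝟙 X) {U : X.Opens} (hU : IsAffineOpen U) (hUg : U ≤ g ⁻¹ᵁ U) :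
    ∃ O : Q.Opens, IsAffineOpen O ∧ π ⁻¹ᵁ O = U := by
  have Hp := isGeomQuotient_invariantIncl hg hUg
  have hi := actionOn_fromSpec hUg hU
  let θ := Hp.desc (hU.fromSpec ≫ π) (by rw [← Category.assoc, hi, Category.assoc, H.invariant])
  have hθ : Spec.map (invariantIncl hUg) ≫ θ = hU.fromSpec ≫ π := Hp.comp_desc _ _
  have := isOpenImmersion_of_isGeomQuotient Hp H hU.fromSpec hi θ hθ
  refine ⟨θ.opensRange, isAffineOpen_opensRange θ, ?_⟩
  rw [preimage_opensRange_of_isGeomQuotient Hp H hU.fromSpec hi θ hθ, hU.opensRange_fromSpec]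

/-- Invariant open subsets of an invariant affine open set are unions of invariant principal open
sets: the norms `a * g(a)` do the job. -/
theorem exists_invariant_basicOpen (hg : g ≫ g = 𝟙 X) {U : X.Opens} (hU : IsAffineOpen U)
    (hUg : U ≤ g ⁻¹ᵁ U) {W : X.Opens} (hWg : W ≤ g ⁻¹ᵁ W) {x : X} (hxU : x ∈ U)
    (hxW : x ∈ W) :
    ∃ b : Γ(X, U), pb g hUg b = b ∧ x ∈ X.basicOpen b ∧ X.basicOpen b ≤ W := by
  obtain ⟨a, ha1, ha2, ha3⟩ : ∃ a : Γ(X, U), x ∈ X.basicOpen a ∧ g x ∈ X.basicOpen a ∧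
      X.basicOpen a ≤ W := by
    obtain ⟨a₁, h1, h2⟩ := hU.exists_basicOpen_le ⟨x, hxW⟩ hxU
    obtain ⟨a₂, h3, h4⟩ := hU.exists_basicOpen_le (V := W) ⟨g x, hWg hxW⟩ (hUg hxU)
    dsimp only at h2 h4
    by_cases h5 : g x ∈ X.basicOpen a₁
    · exact ⟨a₁, h2, h5, h1⟩
    by_cases h6 : x ∈ X.basicOpen a₂
    · exact ⟨a₂, h6, h4, h3⟩
    have hadd : ∀ (z : X) (hz : z ∈ U) (c d : Γ(X, U)), z ∈ X.basicOpen c → z ∉ X.basicOpen d →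
        z ∈ X.basicOpen (c + d) := by
      intro z hz c d hc hd
      by_contra hcd
      rw [← mem_primeIdealOf hU hz] at hd hcd
      have := (hU.primeIdealOf ⟨z, hz⟩).asIdeal.sub_mem hcd hd
      rw [add_sub_cancel_right, mem_primeIdealOf hU hz] at this
      exact this hc
    refine ⟨a₁ + a₂, hadd x hxU _ _ h2 h6, ?_, ?_⟩
    · rw [add_comm]
      exact hadd _ (hUg hxU) _ _ h4 h5
    · exact (X.basicOpen_add_le a₁ a₂).trans (sup_le h1 h3)
  refine ⟨a * pb g hUg a, ?_, ?_, ?_⟩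
  · rw [map_mul, pb_pb_of_involutive hg, mul_comm]
  · rw [mem_basicOpen_mul, mem_basicOpen_pb g hUg _ hxU]
    exact ⟨ha1, ha2⟩
  · intro z hz
    exact ha3 ((mem_basicOpen_mul _ _).1 hz).1

theorem exists_invariantAffine_le (hg : g ≫ g = 𝟙 X) (U : InvariantAffine g) {W : X.Opens}
    (hWg : W ≤ g ⁻¹ᵁ W) {x : X} (hxU : x ∈ U.1) (hxW : x ∈ W) :
    ∃ U' : InvariantAffine g, x ∈ U'.1 ∧ U'.1 ≤ W ∧ U' ≤ U := by
  obtain ⟨b, h1, h2, h3⟩ := exists_invariant_basicOpen hg U.2.1 U.2.2 hWg hxU hxW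
  refine ⟨⟨X.basicOpen b, U.2.1.basicOpen b, ?_⟩, h2, h3, X.basicOpen_le b⟩
  intro z hz
  have hzU := X.basicOpen_le b hz
  rw [← h1] at hz
  exact (mem_basicOpen_pb g U.2.2 b hzU).1 hz

theorem pb_res_mem {U V : X.Opens} (hU : U ≤ g ⁻¹ᵁ U) (hV : V ≤ g ⁻¹ᵁ V) (h : V ≤ U)
    {a : Γ(X, U)} (ha : pb g hU a = a) : pb g hV (res h a) = res h a := by
  rw [pb_res, ← res_pb g h hU, ha]

/-- Restriction of invariant functions. -/
def invariantRes {U V : X.Opens} (hU : U ≤ g ⁻¹ᵁ U) (hV : V ≤ g ⁻¹ᵁ V) (h : V ≤ U) :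
    invariantRing hU ⟶ invariantRing hV :=
  CommRingCat.ofHom (((res h).comp ((pb g hU).eqLocus (RingHom.id _)).subtype).codRestrict
    _ (fun a => pb_res_mem hU hV h a.2))

theorem invariantRes_incl {U V : X.Opens} (hU : U ≤ g ⁻¹ᵁ U) (hV : V ≤ g ⁻¹ᵁ V) (h : V ≤ U) :
    invariantRes hU hV h ≫ invariantIncl hV =
      invariantIncl hU ≫ X.presheaf.map (homOfLE h).op := rfl

/-- The morphism between the quotients of two invariant affine open sets. -/
abbrev quotientMap {V U : InvariantAffine g} (h : V.1 ≤ U.1) :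
    Spec (invariantRing V.2.2) ⟶ Spec (invariantRing U.2.2) :=
  Spec.map (invariantRes U.2.2 V.2.2 h)

theorem incl_quotientMap {V U : InvariantAffine g} (h : V.1 ≤ U.1) :
    Spec.map (invariantIncl V.2.2) ≫ quotientMap h =
      Spec.map (X.presheaf.map (homOfLE h).op) ≫ Spec.map (invariantIncl U.2.2) :=
  (Spec.map_comp _ _).symm.trans ((congrArg Spec.map
      (invariantRes_incl U.2.2 V.2.2 h)).trans (Spec.map_comp _ _))

variable (g) in
/-- The quotients of the invariant affine open sets. -/
def quotientDiagram : InvariantAffine g ⥤ Scheme.{0} where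
  obj U := Spec (invariantRing U.2.2)
  map {V U} h := Spec.map (invariantRes U.2.2 V.2.2 (leOfHom h))
  map_id U := by
    rw [← Spec.map_id]
    congr 1
    ext a
    exact res_self _ _
  map_comp {U V W} h k := by
    rw [← Spec.map_comp]
    congr 1
    ext a
    exact (res_res _ _ _).symm

theorem isOpenImmersion_quotientMap (hg : g ≫ g = 𝟙 X) {V U : InvariantAffine g}
    (h : V.1 ≤ U.1) : IsOpenImmersion (quotientMap h) := by
  have e := U.2.1.map_fromSpec V.2.1 (homOfLE h).op
  have : IsOpenImmersion (Spec.map (X.presheaf.map (homOfLE h).op) ≫ U.2.1.fromSpec) := by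
    rw [e]; infer_instance
  have : IsOpenImmersion (Spec.map (X.presheaf.map (homOfLE h).op)) := .of_comp _ U.2.1.fromSpec
  refine isOpenImmersion_of_isGeomQuotient (isGeomQuotient_invariantIncl hg V.2.2)
    (isGeomQuotient_invariantIncl hg U.2.2) (Spec.map (X.presheaf.map (homOfLE h).op))
    ?_ _ (incl_quotientMap h)
  rw [← Spec.map_comp, ← Spec.map_comp]
  congr 1
  simp only [actionOn, Scheme.Hom.appLE_map, Scheme.Hom.map_appLE]

end

section

variable {X : Scheme.{0}} {g : X ⟶ X}

/-- The point of `Spec Γ(X, U)` that corresponds to a point of an affine open set `U`. -/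
def specPt {U : X.Opens} (hU : IsAffineOpen U) {x : X} (hx : x ∈ U) : Spec Γ(X, U) :=
  hU.primeIdealOf ⟨x, hx⟩

theorem fromSpec_specPt {U : X.Opens} (hU : IsAffineOpen U) {x : X} (hx : x ∈ U) :
    hU.fromSpec (specPt hU hx) = x :=
  hU.fromSpec_primeIdealOf ⟨x, hx⟩

theorem fromSpec_mem {U : X.Opens} (hU : IsAffineOpen U) (y : Spec Γ(X, U)) :
    hU.fromSpec y ∈ U := by
  have : hU.fromSpec y ∈ hU.fromSpec.opensRange := ⟨y, rfl⟩
  rwa [hU.opensRange_fromSpec] at this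

theorem map_specPt {U V : X.Opens} (hU : IsAffineOpen U) (hV : IsAffineOpen V) (h : V ≤ U) {x : X}
    (hx : x ∈ V) : Spec.map (X.presheaf.map (homOfLE h).op) (specPt hV hx) = specPt hU (h hx) := by
  apply hU.fromSpec.isOpenEmbedding.injective
  rw [← Scheme.Hom.comp_apply, hU.map_fromSpec hV (homOfLE h).op, fromSpec_specPt, fromSpec_specPt]

theorem quotientMap_apply {U V : InvariantAffine g} (h : V.1 ≤ U.1) {x : X} (hx : x ∈ V.1) :
    quotientMap h (Spec.map (invariantIncl V.2.2) (specPt V.2.1 hx)) =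
      Spec.map (invariantIncl U.2.2) (specPt U.2.1 (h hx)) := by
  rw [← Scheme.Hom.comp_apply, incl_quotientMap h, Scheme.Hom.comp_apply,
    map_specPt U.2.1 V.2.1 h hx]

/-- A point of the quotient of the smaller open set which has the same image as a point `x` of the
larger one is itself the image of `x`. So the quotients of invariant affine open sets are glued
along the right open sets. -/
theorem exists_quotientMap_apply_eq (hg : g ≫ g = 𝟙 X) {U V : InvariantAffine g} (h : V.1 ≤ U.1)
    (z : Spec (invariantRing V.2.2)) (x : X) (hx : x ∈ U.1)
    (hz : quotientMap h z = Spec.map (invariantIncl U.2.2) (specPt U.2.1 hx)) :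
    ∃ hxV : x ∈ V.1, Spec.map (invariantIncl V.2.2) (specPt V.2.1 hxV) = z := by
  have HV := isGeomQuotient_invariantIncl hg V.2.2
  have HU := isGeomQuotient_invariantIncl hg U.2.2
  have := isOpenImmersion_quotientMap hg h
  obtain ⟨w, rfl⟩ := HV.isQuotientMap.surjective z
  have hz' := hz
  rw [← Scheme.Hom.comp_apply, incl_quotientMap h, Scheme.Hom.comp_apply] at hz'
  have hfs : U.2.1.fromSpec (Spec.map (X.presheaf.map (homOfLE h).op) w) =
      V.2.1.fromSpec w := by
    rw [← Scheme.Hom.comp_apply, U.2.1.map_fromSpec V.2.1 (homOfLE h).op]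
  have hxV : x ∈ V.1 := by
    rcases (HU.orbits _ _).1 hz' with h1 | h1
    · have := congrArg U.2.1.fromSpec h1
      rw [hfs, fromSpec_specPt] at this
      rw [this]
      exact fromSpec_mem _ _
    · have := congrArg U.2.1.fromSpec h1
      rw [← Scheme.Hom.comp_apply, actionOn_fromSpec, Scheme.Hom.comp_apply, hfs,
        fromSpec_specPt] at this
      rw [this]
      exact V.2.2 (fromSpec_mem _ _)
  refine ⟨hxV, (quotientMap h).isOpenEmbedding.injective ?_⟩
  rw [quotientMap_apply h hxV, hz]

theorem isLocallyDirected_quotientDiagram (hg : g ≫ g = 𝟙 X) :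
    (quotientDiagram g ⋙ Scheme.forget).IsLocallyDirected := by
  constructor
  intro U V K h k z w hzw
  have hUK : U.1 ≤ K.1 := leOfHom h
  have hVK : V.1 ≤ K.1 := leOfHom k
  replace hzw : quotientMap hUK z = quotientMap hVK w := hzw
  obtain ⟨y, rfl⟩ := (isGeomQuotient_invariantIncl hg U.2.2).isQuotientMap.surjective z
  have hyU : U.2.1.fromSpec y ∈ U.1 := fromSpec_mem _ _
  have hyp : specPt U.2.1 hyU = y := by
    apply U.2.1.fromSpec.isOpenEmbedding.injective
    rw [fromSpec_specPt]
  rw [← hyp, quotientMap_apply hUK hyU] at hzw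
  obtain ⟨hxV, hw⟩ := exists_quotientMap_apply_eq hg hVK w _ (hUK hyU) hzw.symm
  obtain ⟨L, h1, h2, h3⟩ := exists_invariantAffine_le hg U V.2.2 hyU hxV
  refine ⟨L, homOfLE h3, homOfLE h2,
    Spec.map (invariantIncl L.2.2) (specPt L.2.1 h1), ?_, ?_⟩
  · exact (quotientMap_apply h3 h1).trans (congrArg _ hyp)
  · exact (quotientMap_apply h2 h1).trans hw

/-- A scheme with an involution admits a geometric quotient as soon as it is covered by invariant
affine open sets. -/
theorem exists_isGeomQuotient (hg : g ≫ g = 𝟙 X)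
    (hc : ∀ x : X, ∃ U : InvariantAffine g, x ∈ U.1) :
    ∃ (Q : Scheme.{0}) (π : X ⟶ Q), IsGeomQuotient g π := by
  have hop : ∀ {V U : InvariantAffine g} (h : V ⟶ U), IsOpenImmersion ((quotientDiagram g).map h) :=
    fun h => isOpenImmersion_quotientMap hg (leOfHom h)
  -- The quotient is glued from the spectra of the rings of invariants. Two of them meet in the
  -- union of the spectra belonging to smaller invariant affine open sets.
  have hld := isLocallyDirected_quotientDiagram hg
  let j : ∀ U : InvariantAffine g,
      Spec (invariantRing U.2.2) ⟶ colimit (quotientDiagram g) :=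
    fun U => colimit.ι (quotientDiagram g) U
  have hj : ∀ U, IsOpenImmersion (j U) := fun U =>
    Scheme.Cover.map_prop (Scheme.IsLocallyDirected.openCover (quotientDiagram g)) U
  have hjc : ∀ {V U : InvariantAffine g} (h : V.1 ≤ U.1),
      Spec.map (invariantRes U.2.2 V.2.2 h) ≫ j U = j V :=
    fun h => colimit.w (quotientDiagram g) (homOfLE h)
  obtain ⟨π, hπ⟩ := exists_glue_hom (X := X) (T := colimit (quotientDiagram g))
    (fun U : InvariantAffine g => Spec Γ(X, U.1)) (fun U => U.2.1.fromSpec)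
    (fun x => by
      obtain ⟨U, hU⟩ := hc x
      exact ⟨U, specPt U.2.1 hU, fromSpec_specPt U.2.1 hU⟩)
    (fun U => Spec.map (invariantIncl U.2.2) ≫ j U) (by
      intro U V y y' hyy
      obtain ⟨L, h1, h2, h3⟩ := exists_invariantAffine_le hg U V.2.2 (fromSpec_mem U.2.1 y)
        (by rw [hyy]; exact fromSpec_mem V.2.1 y')
      have h3' : L.1 ≤ U.1 := h3
      have e1 := U.2.1.map_fromSpec L.2.1 (homOfLE h3').op
      have e2 := V.2.1.map_fromSpec L.2.1 (homOfLE h2).op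
      have : IsOpenImmersion (Spec.map (X.presheaf.map (homOfLE h3').op) ≫ U.2.1.fromSpec) := by
        rw [e1]; infer_instance
      refine ⟨_, Spec.map (X.presheaf.map (homOfLE h3').op),
        Spec.map (X.presheaf.map (homOfLE h2).op), .of_comp _ U.2.1.fromSpec,
        specPt L.2.1 h1, ?_, e1.trans e2.symm, ?_⟩
      · apply U.2.1.fromSpec.isOpenEmbedding.injective
        rw [← Scheme.Hom.comp_apply, e1, fromSpec_specPt]
      · rw [← Spec.map_comp_assoc, ← Spec.map_comp_assoc,
          ← invariantRes_incl U.2.2 L.2.2 h3', ← invariantRes_incl V.2.2 L.2.2 h2,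
          Spec.map_comp_assoc, Spec.map_comp_assoc, hjc, hjc])
  have hinv : g ≫ π = π := by
    refine hom_ext_of_isOpenImmersion _ _ fun x => ?_
    obtain ⟨U, hU⟩ := hc x
    refine ⟨_, U.2.1.fromSpec, inferInstance, specPt U.2.1 hU,
      fromSpec_specPt U.2.1 hU, ?_⟩
    rw [← Category.assoc, ← actionOn_fromSpec U.2.2 U.2.1, Category.assoc, hπ, ← Category.assoc,
      (isGeomQuotient_invariantIncl hg U.2.2).invariant]
  have hpt : ∀ (U : InvariantAffine g) (x : X) (hx : x ∈ U.1),
      π x = j U (Spec.map (invariantIncl U.2.2) (specPt U.2.1 hx)) := by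
    intro U x hx
    rw [← Scheme.Hom.comp_apply, ← hπ, Scheme.Hom.comp_apply, fromSpec_specPt]
  have hpre : ∀ U : InvariantAffine g, π ⁻¹ᵁ (j U).opensRange = U.1 := by
    intro U
    ext x
    constructor
    · rintro ⟨z, hz⟩
      obtain ⟨V, hV⟩ := hc x
      rw [hpt V x hV] at hz
      obtain ⟨L, h, k, w, hw1, hw2⟩ :=
        (Scheme.IsLocallyDirected.ι_eq_ι_iff (quotientDiagram g)).1 hz
      obtain ⟨hxL, -⟩ := exists_quotientMap_apply_eq hg (leOfHom k) w x hV hw2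
      have hLU : L.1 ≤ U.1 := leOfHom h
      exact hLU hxL
    · intro hx
      exact ⟨_, (hpt U x hx).symm⟩
  refine ⟨colimit (quotientDiagram g), π, isGeomQuotient_of_affine hinv hg fun q => ?_⟩
  obtain ⟨U, z, rfl⟩ := Scheme.IsLocallyDirected.ι_jointly_surjective (quotientDiagram g) q
  have HU := isGeomQuotient_invariantIncl hg U.2.2
  refine ⟨(j U).opensRange, ⟨z, rfl⟩, isAffineOpen_opensRange (j U), by rw [hpre]; exact U.2.1, ?_⟩
  exact HasInvariantSections.of_isOpenImmersion hinv HU.invariant (HU.hasInvariantSections ⊤)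
    U.2.1.fromSpec (j U) (actionOn_fromSpec U.2.2 U.2.1) (hπ U).symm
    (by rw [hpre, U.2.1.opensRange_fromSpec])

end

/-! ### Base change of quotients -/

section

open TensorProduct

/-- Taking invariants under an involution commutes with base change if `2` is invertible, because
`a ↦ (a + g(a)) / 2` is a projection onto the invariants. -/
theorem invariants_of_isPushout {A B C D : CommRingCat.{0}} {φ : B ⟶ A} {ψ : B ⟶ C} {u : A ⟶ D}
    {v : C ⟶ D} (h : IsPushout φ ψ u v) (γ : A ⟶ A) (hγ : γ ≫ γ = 𝟙 A) (hφγ : φ ≫ γ = φ)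
    (hφ : Function.Injective φ) (hr : ∀ a, γ a = a → ∃ b, φ b = a) (γ' : D ⟶ D)
    (hu : u ≫ γ' = γ ≫ u) (hv : v ≫ γ' = v) (h2 : IsUnit (2 : B)) :
    Function.Injective v ∧ ∀ d, γ' d = d → ∃ c, v c = d := by
  obtain ⟨w, hw⟩ := h2.exists_left_inv
  have hγ' : ∀ a, γ (γ a) = a := fun a => congr($hγ a)
  have hφγ' : ∀ b, γ (φ b) = φ b := fun b => congr($hφγ b)
  have hu' : ∀ a, γ' (u a) = u (γ a) := fun a => congr($hu a)
  have hv' : ∀ c, γ' (v c) = v c := fun c => congr($hv c)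
  have hcomm : ∀ b, u (φ b) = v (ψ b) := fun b => congr($(h.w) b)
  -- the projection `ρ a = (a + γ a) / 2` onto the invariants, and below its base change `R`
  have hρ : ∀ a : A, ∃ b, φ b = φ w * (a + γ a) := fun a => hr _ (by
    rw [map_mul, map_add, hγ', hφγ', add_comm])
  choose ρ hρ' using hρ
  let _ : Algebra B A := φ.hom.toAlgebra
  let _ : Algebra B C := ψ.hom.toAlgebra
  have hsA : ∀ (b : B) (a : A), b • a = φ b * a := fun b a => rfl
  have hsC : ∀ (b : B) (c : C), b • c = ψ b * c := fun b a => rfl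
  let P : A →ₗ[B] B :=
    { toFun := ρ
      map_add' := fun a a' => hφ (by rw [map_add, hρ', hρ', hρ', map_add]; ring)
      map_smul' := fun b a => hφ (by
        rw [RingHom.id_apply, smul_eq_mul, map_mul, hρ', hρ', hsA, map_mul, hφγ']; ring) }
  have hPφ : ∀ b, P (φ b) = b := fun b => hφ (by
    change φ (ρ (φ b)) = _
    rw [hρ', hφγ', ← map_add, ← map_mul, ← two_mul, ← mul_assoc, hw, one_mul])
  have hiso : IsPushout φ ψ
      (CommRingCat.ofHom (Algebra.TensorProduct.includeLeftRingHom : A →+* A ⊗[B] C))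
      (CommRingCat.ofHom (Algebra.TensorProduct.includeRight : C →ₐ[B] A ⊗[B] C).toRingHom) :=
    CommRingCat.isPushout_tensorProduct B A C
  let e : CommRingCat.of (A ⊗[B] C) ≅ D := hiso.isoIsPushout _ _ h
  have he1 : ∀ a c, e.hom (a ⊗ₜ c) = u a * v c := by
    intro a c
    have h1 : e.hom (a ⊗ₜ 1) = u a := congr($(IsPushout.inl_isoIsPushout_hom _ _ hiso h) a)
    have h2 : e.hom (1 ⊗ₜ c) = v c := congr($(IsPushout.inr_isoIsPushout_hom _ _ hiso h) c)
    rw [← h1, ← h2, ← map_mul, Algebra.TensorProduct.tmul_mul_tmul, mul_one, one_mul]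
  have heb : Function.Bijective e.hom := ConcreteCategory.bijective_of_isIso e.hom
  let R : A ⊗[B] C →ₗ[B] C := TensorProduct.lift ((LinearMap.lsmul B C).comp P)
  have hR : ∀ a c, R (a ⊗ₜ c) = ψ (P a) * c := fun a c => rfl
  have hvR : ∀ t, v (R t) = v (ψ w) * (e.hom t + γ' (e.hom t)) := by
    intro t
    induction t using TensorProduct.induction_on with
    | zero => simp
    | tmul a c =>
      rw [hR, map_mul, ← hcomm, he1, map_mul, hu', hv']
      change u (φ (ρ a)) * _ = _
      rw [hρ', map_mul, map_add, hcomm]; ring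
    | add x y hx hy => rw [map_add, map_add, hx, hy, map_add, map_add]; ring
  constructor
  · intro c c' hcc
    have h1 : ∀ c, e.hom ((1 : A) ⊗ₜ c) = v c := fun c => by rw [he1, map_one, one_mul]
    rw [← h1, ← h1] at hcc
    have := congrArg R (heb.1 hcc)
    rw [hR, hR] at this
    have hP1 : P (1 : A) = 1 := by simpa using hPφ 1
    simpa only [hP1, map_one, one_mul] using this
  · intro d hd
    obtain ⟨t, rfl⟩ := heb.2 d
    refine ⟨R t, ?_⟩
    rw [hvR, hd, ← two_mul, ← mul_assoc, ← map_ofNat v.hom 2, ← map_mul, ← map_ofNat ψ.hom 2,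
      ← map_mul, hw, map_one, map_one, one_mul]

/-- Geometric quotients by involutions commute with arbitrary base change where `2` is invertible.
-/
theorem IsGeomQuotient.of_isPullback {X Q T P : Scheme.{0}} {g : X ⟶ X} {π : X ⟶ Q}
    (H : IsGeomQuotient g π) (hg : g ≫ g = 𝟙 X) [IsAffineHom π] (h2 : IsUnit (2 : Γ(Q, ⊤)))
    {k : T ⟶ Q} {fst : P ⟶ X} {snd : P ⟶ T} (hP : IsPullback fst snd π k) (γ : P ⟶ P)
    (hγ1 : γ ≫ fst = fst ≫ g) (hγ2 : γ ≫ snd = snd) :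
    IsGeomQuotient γ snd ∧ IsAffineHom snd ∧ γ ≫ γ = 𝟙 P := by
  have hγ : γ ≫ γ = 𝟙 P := by
    apply hP.hom_ext
    · rw [Category.assoc, hγ1, ← Category.assoc, hγ1, Category.assoc, hg, Category.id_comp,
        Category.comp_id]
    · rw [Category.assoc, hγ2, hγ2, Category.id_comp]
  have haff : IsAffineHom snd := MorphismProperty.of_isPullback hP inferInstance
  refine ⟨isGeomQuotient_of_affine hγ2 hγ fun t => ?_, haff, hγ⟩
  obtain ⟨_, ⟨O, hO, rfl⟩, hkO, -⟩ := Q.isBasis_affineOpens.exists_subset_of_mem_open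
    (Set.mem_univ (k t)) isOpen_univ
  obtain ⟨_, ⟨T', hT', rfl⟩, htT, hTO : T' ≤ k ⁻¹ᵁ O⟩ :=
    T.isBasis_affineOpens.exists_subset_of_mem_open hkO (k ⁻¹ᵁ O).isOpen
  have hU : IsAffineOpen (π ⁻¹ᵁ O) := IsAffineHom.isAffine_preimage O hO
  refine ⟨T', htT, hT', IsAffineHom.isAffine_preimage T' hT', ?_⟩
  have hle : snd ⁻¹ᵁ T' ≤ fst ⁻¹ᵁ π ⁻¹ᵁ O := by
    rw [← Scheme.Hom.comp_preimage, hP.w, Scheme.Hom.comp_preimage]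
    exact snd.preimage_mono hTO
  have hpush := (isIso_pushoutSection_iff hP hTO (le_refl (π ⁻¹ᵁ O))
    (UY := snd ⁻¹ᵁ T') (inf_eq_right.2 hle).symm).1
    (isIso_pushoutSection_of_isAffineOpen hP hTO le_rfl _ hO hT' hU)
  have HO := H.hasInvariantSections O
  have hi := invariants_of_isPushout hpush (g.appLE _ _ (le_preimage_preimage H.invariant O))
    (by ext a; exact pb_pb_of_involutive hg _ a)
    (by rw [Scheme.Hom.appLE_comp_appLE]; simp only [H.invariant])
    HO.injective HO.exists_pb_eq
    (γ.appLE _ _ (le_preimage_preimage hγ2 T'))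
    (by rw [Scheme.Hom.appLE_comp_appLE, Scheme.Hom.appLE_comp_appLE]; simp only [hγ1])
    (by rw [Scheme.Hom.appLE_comp_appLE]; simp only [hγ2])
    (by
      have := h2.map (res (le_top : O ≤ ⊤))
      rwa [map_ofNat] at this)
  exact ⟨hi.1, hi.2⟩

end

/-! ### Morphisms to affine schemes -/

section

variable {X T : Scheme.{0}}

theorem pb_fromSpec {U : X.Opens} (hU : IsAffineOpen U) (e : ⊤ ≤ hU.fromSpec ⁻¹ᵁ U)
    (s : Γ(X, U)) : pb hU.fromSpec e s = (Scheme.ΓSpecIso Γ(X, U)).inv s := by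
  have h1 : pb hU.fromSpec e s = res e (hU.fromSpec.app U s) := by
    rw [app_eq_pb, res_pb]
  rw [h1, hU.fromSpec_app_self, CommRingCat.comp_apply]
  exact (res_res (X := Spec Γ(X, U)) (V := hU.fromSpec ⁻¹ᵁ U) le_top e _).trans (res_self _ _)

theorem top_le_preimage_fromSpec {U : X.Opens} (hU : IsAffineOpen U) :
    ⊤ ≤ hU.fromSpec ⁻¹ᵁ U := by
  rw [hU.fromSpec_preimage_self]

theorem top_le_preimage_top (f : T ⟶ X) : (⊤ : T.Opens) ≤ f ⁻¹ᵁ ⊤ := fun _ _ => trivial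

/-- A morphism into an affine open set is given by its effect on global sections. -/
theorem toSpecΓ_appLE_fromSpec {U : X.Opens} (hU : IsAffineOpen U) (f : T ⟶ X)
    (e : ⊤ ≤ f ⁻¹ᵁ U) : T.toSpecΓ ≫ Spec.map (f.appLE U ⊤ e) ≫ hU.fromSpec = f := by
  have hr : Set.range f ⊆ Set.range hU.fromSpec := by
    rw [hU.range_fromSpec]
    rintro _ ⟨t, rfl⟩
    exact e (trivial : t ∈ (⊤ : T.Opens))
  set l := IsOpenImmersion.lift hU.fromSpec f hr with hl
  have hlf : l ≫ hU.fromSpec = f := IsOpenImmersion.lift_fac _ _ _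
  have h1 : f.appLE U ⊤ e = hU.fromSpec.appLE U ⊤ (top_le_preimage_fromSpec hU) ≫
      l.appLE ⊤ ⊤ (top_le_preimage_top l) := by
    rw [Scheme.Hom.appLE_comp_appLE]
    simp only [hlf]
  have h2 : Spec.map (hU.fromSpec.appLE U ⊤ (top_le_preimage_fromSpec hU)) =
      (Spec Γ(X, U)).isoSpec.inv := by
    rw [← cancel_mono hU.fromSpec, hU.SpecMap_appLE_fromSpec hU.fromSpec
      (isAffineOpen_top (Spec Γ(X, U))) (top_le_preimage_fromSpec hU),
      IsAffineOpen.fromSpec_top]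
  have h3 : l.appLE ⊤ ⊤ (top_le_preimage_top l) = l.appTop := l.app_eq_appLE.symm
  rw [h1, Spec.map_comp, h2, h3, Category.assoc, ← Scheme.toSpecΓ_naturality_assoc,
    Scheme.toSpecΓ_isoSpec_inv_assoc, hlf]

end

/-! ### Inverse images of ideal sheaves -/

section

variable {X T : Scheme.{0}}

theorem comap_ideal_of_isOpenImmersion (I : X.IdealSheafData) (j : T ⟶ X) [IsOpenImmersion j]
    (U : X.affineOpens) (V : T.affineOpens) (e : V.1 ≤ j ⁻¹ᵁ U.1) :
    (I.comap j).ideal V = (I.ideal U).map (pb j e) := by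
  rw [Scheme.IdealSheafData.ideal_comap_of_isOpenImmersion]
  have hle : j ''ᵁ V.1 ≤ U.1 := by
    rintro _ ⟨t, ht, rfl⟩
    exact e ht
  rw [← I.map_ideal (U := ⟨j ''ᵁ V.1, V.2.image_of_isOpenImmersion j⟩) (V := U) hle]
  have h1 := Ideal.map_comap_of_equiv (I := Ideal.map (X.presheaf.map (homOfLE hle).op).hom
    (I.ideal U)) (j.appIso V.1).commRingCatIsoToRingEquiv
  refine h1.symm.trans ?_
  rw [Ideal.map_map]
  congr 1
  ext s
  change (j.appIso V.1).hom (res hle s) = _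
  rw [Scheme.Hom.appIso_hom']
  exact pb_res j hle _ s

theorem comap_ideal_top (I : X.IdealSheafData) (f : T ⟶ X) [IsAffine X] [IsAffine T] :
    (I.comap f).ideal ⟨⊤, isAffineOpen_top T⟩ =
      (I.ideal ⟨⊤, isAffineOpen_top X⟩).map f.appTop.hom := by
  apply le_antisymm
  · set K := Scheme.IdealSheafData.ofIdealTop
      ((I.ideal ⟨⊤, isAffineOpen_top X⟩).map f.appTop.hom) with hK
    have hKt : K.ideal ⟨⊤, isAffineOpen_top T⟩ =
        (I.ideal ⟨⊤, isAffineOpen_top X⟩).map f.appTop.hom := by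
      simp [hK]
    have hle : I.comap f ≤ K := by
      rw [← Scheme.IdealSheafData.le_map_iff_comap_le]
      apply Scheme.IdealSheafData.le_of_isAffine
      rw [Scheme.IdealSheafData.ideal_map_of_isAffineHom]
      change _ ≤ (K.ideal ⟨⊤, isAffineOpen_top T⟩).comap f.appTop.hom
      rw [hKt, ← Ideal.map_le_iff_le_comap]
    exact (hle _).trans hKt.le
  · rw [Ideal.map_le_iff_le_comap]
    refine (Scheme.IdealSheafData.le_map_comap I f ⟨⊤, isAffineOpen_top X⟩).trans ?_
    rw [Scheme.IdealSheafData.ideal_map_of_isAffineHom]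
    exact le_rfl

/-- The inverse image ideal sheaf is affine locally the extension of ideals. -/
theorem comap_ideal (I : X.IdealSheafData) (f : T ⟶ X)
    (U : X.affineOpens) (V : T.affineOpens) (e : V.1 ≤ f ⁻¹ᵁ U.1) :
    (I.comap f).ideal V = (I.ideal U).map (pb f e) := by
  obtain ⟨U, hU'⟩ := U
  obtain ⟨V, hV'⟩ := V
  replace hU' : IsAffineOpen U := hU'
  replace hV' : IsAffineOpen V := hV'
  replace e : V ≤ f ⁻¹ᵁ U := e
  have hV := top_le_preimage_fromSpec hV'
  have hU := top_le_preimage_fromSpec hU'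
  have hcomp := hU'.SpecMap_appLE_fromSpec f hV' e
  have hbij : Function.Bijective (pb hV'.fromSpec hV) := by
    have : Function.Bijective (Scheme.ΓSpecIso Γ(T, V)).inv :=
      ConcreteCategory.bijective_of_isIso _
    convert this using 1
    ext s
    exact pb_fromSpec hV' hV s
  have h1 := comap_ideal_of_isOpenImmersion (I.comap f) hV'.fromSpec ⟨V, hV'⟩
    ⟨⊤, isAffineOpen_top _⟩ hV
  have h2 : ((I.comap f).comap hV'.fromSpec).ideal ⟨⊤, isAffineOpen_top _⟩ =
      ((I.ideal ⟨U, hU'⟩).map (pb f e)).map (pb hV'.fromSpec hV) := by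
    rw [← Scheme.IdealSheafData.comap_comp, ← hcomp, Scheme.IdealSheafData.comap_comp,
      comap_ideal_top,
      comap_ideal_of_isOpenImmersion I hU'.fromSpec ⟨U, hU'⟩ ⟨⊤, isAffineOpen_top _⟩ hU,
      Ideal.map_map,
      Ideal.map_map]
    congr 1
    ext s
    rw [RingHom.comp_apply, RingHom.comp_apply, pb_pb, pb_congr hcomp.symm]
    exact (app_eq_pb _ _ _).trans (pb_pb _ _ _ _ _)
  have hmap : ∀ K : Ideal Γ(T, V), (K.map (pb hV'.fromSpec hV)).comap (pb hV'.fromSpec hV) = K :=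
    fun K => Ideal.comap_map_of_bijective _ hbij
  rw [← hmap ((I.comap f).ideal ⟨V, hV'⟩), ← h1, h2, hmap]

/-! ### Regular sections -/

/-- A section is regular if none of its restrictions is a zero divisor. -/
def IsRegularSection {V : T.Opens} (s : Γ(T, V)) : Prop :=
  ∀ (W : T.Opens) (h : W ≤ V) (a : Γ(T, W)), res h s * a = 0 → a = 0

theorem isRegularSection_of_mem_nonZeroDivisors {V : T.Opens} (hV : IsAffineOpen V)
    {s : Γ(T, V)} (hs : s ∈ nonZeroDivisors Γ(T, V)) : IsRegularSection s := by
  intro W h a ha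
  apply section_ext
  intro x hx
  obtain ⟨b, hb1, hb2⟩ := hV.exists_basicOpen_le ⟨x, hx⟩ (h hx)
  refine ⟨T.basicOpen b, hb1, hb2, ?_⟩
  obtain ⟨n, y, hy⟩ := exists_eq_pow_mul hV b (res hb1 a)
  have h1 : res (T.basicOpen_le b) (s * y) = 0 := by
    have := congrArg (res hb1) ha
    rw [map_mul, res_res, map_zero] at this
    rw [map_mul, hy, mul_left_comm, this, mul_zero]
  obtain ⟨m, hm⟩ := exists_pow_mul_eq_zero hV b _ h1
  rw [mul_left_comm] at hm
  have h2 : b ^ m * y = 0 := (mul_right_mem_nonZeroDivisors_eq_zero_iff hs).1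
    (by rwa [mul_comm] at hm)
  have h3 := congrArg (res (T.basicOpen_le b)) h2
  rw [map_mul, hy, map_zero, map_pow, ← mul_assoc, ← pow_add] at h3
  rw [map_zero]
  exact ((isUnit_res_basicOpen b).pow _).mul_right_eq_zero.1 h3

theorem IsRegularSection.mem_nonZeroDivisors {V : T.Opens} {s : Γ(T, V)}
    (hs : IsRegularSection s) : s ∈ nonZeroDivisors Γ(T, V) := by
  rw [mem_nonZeroDivisors_iff_right]
  intro a ha
  refine hs V le_rfl a ?_
  rw [res_self, mul_comm, ha]

theorem IsRegularSection.res {V W : T.Opens} {s : Γ(T, V)} (hs : IsRegularSection s)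
    (h : W ≤ V) : IsRegularSection (res h s) := by
  intro W' h' a ha
  rw [res_res] at ha
  exact hs W' _ a ha

theorem IsRegularSection.of_mul {V : T.Opens} {s t : Γ(T, V)} (h : IsRegularSection (s * t)) :
    IsRegularSection s := by
  intro W hW a ha
  refine h W hW a ?_
  rw [map_mul, mul_right_comm, ha, zero_mul]

theorem IsRegularSection.mul {V : T.Opens} {s t : Γ(T, V)} (hs : IsRegularSection s)
    (ht : IsRegularSection t) : IsRegularSection (s * t) := by
  intro W hW a ha
  refine ht W hW a (hs W hW _ ?_)
  rwa [map_mul, mul_assoc] at ha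

theorem IsUnit.isRegularSection {V : T.Opens} {s : Γ(T, V)} (hs : IsUnit s) :
    IsRegularSection s := by
  intro W hW a ha
  exact ((hs.map (EnriquesQuotient.res hW)).mul_right_eq_zero).1 ha

theorem IsRegularSection.of_local {V : T.Opens} {s : Γ(T, V)}
    (h : ∀ x ∈ V, ∃ (W : T.Opens) (hW : W ≤ V), x ∈ W ∧
      IsRegularSection (EnriquesQuotient.res hW s)) :
    IsRegularSection s := by
  intro W hW a ha
  apply section_ext
  intro x hx
  obtain ⟨W', hW', hx', hr⟩ := h x (hW hx)
  refine ⟨W ⊓ W', inf_le_left, ⟨hx, hx'⟩, ?_⟩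
  rw [map_zero]
  apply hr (W ⊓ W') inf_le_right
  have := congrArg (EnriquesQuotient.res (inf_le_left : W ⊓ W' ≤ W)) ha
  rw [map_mul, map_zero, res_res] at this
  rwa [res_res]

theorem IsRegularSection.pb {V : X.Opens} {s : Γ(X, V)} (hs : IsRegularSection s) (j : T ⟶ X)
    [IsOpenImmersion j] {V' : T.Opens} (e : V' ≤ j ⁻¹ᵁ V) : IsRegularSection (pb j e s) := by
  intro W hW a ha
  have hr : j ''ᵁ W ≤ j.opensRange := j.image_le_opensRange W
  have hW' : W = j ⁻¹ᵁ j ''ᵁ W := (j.preimage_image_eq W).symm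
  have hb := bijective_pb_of_isOpenImmersion j hr hW'
  have hle : j ''ᵁ W ≤ V := by
    rintro _ ⟨t, ht, rfl⟩
    exact e (hW ht)
  obtain ⟨a', rfl⟩ := hb.2 a
  rw [res_pb, ← pb_res j hle hW'.le, ← map_mul] at ha
  rw [hs _ hle a' (hb.1 (ha.trans (map_zero _).symm)), map_zero]

/-- Regularity can be tested after an open immersion onto the open set in question. -/
theorem isRegularSection_of_pb {V : X.Opens} {s : Γ(X, V)} (j : T ⟶ X) [IsOpenImmersion j]
    {V' : T.Opens} (hV' : V' = j ⁻¹ᵁ V) (hV : V ≤ j.opensRange)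
    (hs : IsRegularSection (EnriquesQuotient.pb j hV'.le s)) : IsRegularSection s := by
  intro W hW a ha
  have hb := bijective_pb_of_isOpenImmersion j (hW.trans hV) (rfl : j ⁻¹ᵁ W = j ⁻¹ᵁ W)
  apply hb.1
  rw [map_zero]
  have hle : j ⁻¹ᵁ W ≤ V' := by
    rw [hV']
    exact j.preimage_mono hW
  apply hs _ hle
  have := congrArg (EnriquesQuotient.pb j (U := W) (V := j ⁻¹ᵁ W) le_rfl) ha
  rw [map_mul, map_zero, pb_res] at this
  rwa [res_pb]

end

/-! ### Blow-up algebras -/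

section

variable {R : Type} [CommRing R] (I : Ideal R) (F : Set R)

/-- `C` is the algebra generated over (the image of) `R` by the fractions `a / s` with `a ∈ I` and
`s ∈ F`, the elements of `F` being regular in `C`. -/
structure IsBlowUpAlgebra {C : Type} [CommRing C] (φ : R →+* C) : Prop where
  mem_nonZeroDivisors : ∀ s ∈ F, φ s ∈ nonZeroDivisors C
  dvd : ∀ s ∈ F, ∀ a ∈ I, φ s ∣ φ a
  ker : ∀ r, φ r = 0 → ∃ p ∈ Submonoid.closure F, p * r = 0
  closure : Subring.closure (Set.range φ ∪ {c | ∃ s ∈ F, ∃ a ∈ I, φ s * c = φ a}) = ⊤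

variable {I F}

theorem map_mem_nonZeroDivisors_of_closure {D : Type} [CommRing D] (ρ : R →+* D)
    (h : ∀ s ∈ F, ρ s ∈ nonZeroDivisors D) {p : R} (hp : p ∈ Submonoid.closure F) :
    ρ p ∈ nonZeroDivisors D := by
  induction hp using Submonoid.closure_induction with
  | mem x hx => exact h x hx
  | one => rw [map_one]; exact one_mem _
  | mul x y _ _ hx hy => rw [map_mul]; exact mul_mem hx hy

/-- The universal property of the blow-up algebra. -/
theorem IsBlowUpAlgebra.existsUnique {C : Type} [CommRing C] {φ : R →+* C}
    (H : IsBlowUpAlgebra I F φ) {D : Type} [CommRing D] (ρ : R →+* D)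
    (h1 : ∀ s ∈ F, ρ s ∈ nonZeroDivisors D) (h2 : ∀ s ∈ F, ∀ a ∈ I, ρ s ∣ ρ a) :
    ∃! θ : C →+* D, θ.comp φ = ρ := by
  -- `c` and `d` are the same fraction `r / p`
  let rel : C → D → Prop := fun c d => ∃ p ∈ Submonoid.closure F, ∃ r,
    φ p * c = φ r ∧ ρ p * d = ρ r
  have hρ := fun {p} hp => map_mem_nonZeroDivisors_of_closure ρ h1 (p := p) hp
  have hφ := fun {p} hp => map_mem_nonZeroDivisors_of_closure φ H.mem_nonZeroDivisors (p := p) hp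
  have hadd : ∀ {c d c' d'}, rel c d → rel c' d' → rel (c + c') (d + d') := by
    rintro c d c' d' ⟨p, hp, r, e1, e2⟩ ⟨p', hp', r', e1', e2'⟩
    refine ⟨p * p', mul_mem hp hp', p' * r + p * r', ?_, ?_⟩
    · rw [map_mul, map_add, map_mul, map_mul, ← e1, ← e1']; ring
    · rw [map_mul, map_add, map_mul, map_mul, ← e2, ← e2']; ring
  have hmul : ∀ {c d c' d'}, rel c d → rel c' d' → rel (c * c') (d * d') := by
    rintro c d c' d' ⟨p, hp, r, e1, e2⟩ ⟨p', hp', r', e1', e2'⟩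
    refine ⟨p * p', mul_mem hp hp', r * r', ?_, ?_⟩
    · rw [map_mul, map_mul, ← e1, ← e1']; ring
    · rw [map_mul, map_mul, ← e2, ← e2']; ring
  have hrange : ∀ r, rel (φ r) (ρ r) := fun r =>
    ⟨1, one_mem _, r, by rw [map_one, one_mul], by rw [map_one, one_mul]⟩
  have hneg : ∀ {c d}, rel c d → rel (-c) (-d) := by
    rintro c d ⟨p, hp, r, e1, e2⟩
    exact ⟨p, hp, -r, by rw [map_neg, ← e1]; ring, by rw [map_neg, ← e2]; ring⟩
  have huniq : ∀ {c d d'}, rel c d → rel c d' → d = d' := by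
    intro c d d' h h'
    obtain ⟨p, hp, r, e1, e2⟩ := hadd h (hneg h')
    rw [add_neg_cancel, mul_zero] at e1
    obtain ⟨q, hq, hqr⟩ := H.ker r e1.symm
    have : ρ (q * p) * (d + -d') = 0 := by
      rw [map_mul, mul_assoc, e2, ← map_mul, hqr, map_zero]
    have := (mul_left_mem_nonZeroDivisors_eq_zero_iff (hρ (mul_mem hq hp))).1 this
    exact sub_eq_zero.1 (by rw [sub_eq_add_neg, this])
  have hex : ∀ c, ∃ d, rel c d := by
    intro c
    have hc : c ∈ Subring.closure (Set.range φ ∪ {c | ∃ s ∈ F, ∃ a ∈ I, φ s * c = φ a}) := by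
      rw [H.closure]; trivial
    induction hc using Subring.closure_induction with
    | mem x hx =>
      rcases hx with ⟨r, rfl⟩ | ⟨s, hs, a, ha, e⟩
      · exact ⟨_, hrange r⟩
      · obtain ⟨d, hd⟩ := h2 s hs a ha
        exact ⟨d, s, Submonoid.subset_closure hs, a, e, hd.symm⟩
    | zero => exact ⟨0, by simpa using hrange 0⟩
    | one => exact ⟨1, by simpa using hrange 1⟩
    | add x y _ _ hx hy =>
      obtain ⟨d, hd⟩ := hx
      obtain ⟨d', hd'⟩ := hy
      exact ⟨_, hadd hd hd'⟩
    | neg x _ hx =>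
      obtain ⟨d, hd⟩ := hx
      exact ⟨_, hneg hd⟩
    | mul x y _ _ hx hy =>
      obtain ⟨d, hd⟩ := hx
      obtain ⟨d', hd'⟩ := hy
      exact ⟨_, hmul hd hd'⟩
  choose θ hθ using hex
  refine ⟨{ toFun := θ, map_one' := ?_, map_mul' := ?_, map_zero' := ?_, map_add' := ?_ }, ?_, ?_⟩
  · exact huniq (hθ 1) (by simpa using hrange 1)
  · exact fun x y => huniq (hθ _) (hmul (hθ x) (hθ y))
  · exact huniq (hθ 0) (by simpa using hrange 0)
  · exact fun x y => huniq (hθ _) (hadd (hθ x) (hθ y))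
  · ext r
    exact huniq (hθ _) (hrange r)
  · intro θ' hθ'
    ext c
    obtain ⟨p, hp, r, e1, e2⟩ := hθ c
    have h' : ∀ r, θ' (φ r) = ρ r := fun r => congr($hθ' r)
    exact huniq ⟨p, hp, r, e1, by rw [← h', ← h', ← map_mul, e1]⟩ ⟨p, hp, r, e1, e2⟩

variable (I F) in
/-- The blow-up algebra, as a subring of the localization of `R` at the products of elements of
`F`. -/
theorem exists_isBlowUpAlgebra : ∃ (C : CommRingCat.{0}) (φ : R →+* C), IsBlowUpAlgebra I F φ := by
  let L := Localization (Submonoid.closure F)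
  let ψ : R →+* L := algebraMap R L
  have hunit : ∀ s ∈ F, IsUnit (ψ s) := fun s hs =>
    IsLocalization.map_units L (⟨s, Submonoid.subset_closure hs⟩ : Submonoid.closure F)
  let G : Set L := Set.range ψ ∪ {c | ∃ s ∈ F, ∃ a ∈ I, ψ s * c = ψ a}
  let C := Subring.closure G
  let φ : R →+* C := ψ.codRestrict C fun r => Subring.subset_closure (Or.inl ⟨r, rfl⟩)
  refine ⟨CommRingCat.of C, φ, ?_, ?_, ?_, ?_⟩
  · intro s hs
    rw [mem_nonZeroDivisors_iff_right]
    intro c hc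
    have : c.1 * ψ s = 0 := congrArg Subtype.val hc
    exact Subtype.ext ((hunit s hs).mul_left_eq_zero.1 this)
  · intro s hs a ha
    obtain ⟨u, hu⟩ := (hunit s hs).exists_right_inv
    have e : ψ s * (u * ψ a) = ψ a := by rw [← mul_assoc, hu, one_mul]
    exact ⟨⟨u * ψ a, Subring.subset_closure (Or.inr ⟨s, hs, a, ha, e⟩)⟩, Subtype.ext e.symm⟩
  · intro r hr
    have hr' : ψ r = 0 := congrArg Subtype.val hr
    obtain ⟨p, hp⟩ := (IsLocalization.map_eq_zero_iff (Submonoid.closure F) L r).1 hr'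
    exact ⟨p, p.2, hp⟩
  · rw [eq_top_iff]
    rintro ⟨c, hc⟩ -
    induction hc using Subring.closure_induction with
    | mem x hx =>
      apply Subring.subset_closure
      rcases hx with ⟨r, rfl⟩ | ⟨s, hs, a, ha, e⟩
      · exact Or.inl ⟨r, rfl⟩
      · exact Or.inr ⟨s, hs, a, ha, Subtype.ext e⟩
    | zero => exact zero_mem _
    | one => exact one_mem _
    | add x y hx hy h1 h2 => exact add_mem h1 h2
    | neg x hx h => exact neg_mem h
    | mul x y hx hy h1 h2 => exact mul_mem h1 h2

end

/-! ### Charts of blow-ups -/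

section

variable {X T : Scheme.{0}} (I : X.IdealSheafData)

/-- The morphism `f : T ⟶ X` maps the open set `W` to the affine open set `U`, and each of the
sections in `F` generates the inverse image of `I` on `W` and is regular there. -/
structure IsChartOn {U : X.Opens} (hU : IsAffineOpen U) (F : Set Γ(X, U)) (f : T ⟶ X)
    (W : T.Opens) : Prop where
  le : W ≤ f ⁻¹ᵁ U
  regular : ∀ s ∈ F, IsRegularSection (pb f le s)
  dvd : ∀ s ∈ F, ∀ a ∈ I.ideal ⟨U, hU⟩, pb f le s ∣ pb f le a

/-- `IsChartOn` for the whole scheme `T`. -/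
abbrev IsChartMap {U : X.Opens} (hU : IsAffineOpen U) (F : Set Γ(X, U)) (f : T ⟶ X) : Prop :=
  IsChartOn I hU F f ⊤

variable {I} {U : X.Opens} {hU : IsAffineOpen U} {F : Set Γ(X, U)} {f : T ⟶ X} {W : T.Opens}

theorem pb_dvd_pb (e : W ≤ f ⁻¹ᵁ U) {T' : Scheme.{0}} (j : T' ⟶ T) {W' : T'.Opens}
    (h : W' ≤ j ⁻¹ᵁ W) {s a : Γ(X, U)} (H : pb f e s ∣ pb f e a) :
    pb (j ≫ f) (le_comp_preimage e h) s ∣ pb (j ≫ f) (le_comp_preimage e h) a := by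
  have := map_dvd (pb j h) H
  rwa [pb_pb, pb_pb] at this

theorem pb_dvd_pb_of_le (e : W ≤ f ⁻¹ᵁ U) {W' : T.Opens} (h : W' ≤ W) {s a : Γ(X, U)}
    (H : pb f e s ∣ pb f e a) : pb f (h.trans e) s ∣ pb f (h.trans e) a := by
  have := map_dvd (res h) H
  rwa [res_pb, res_pb] at this

theorem IsChartOn.of_le (H : IsChartOn I hU F f W) {W' : T.Opens} (h : W' ≤ W) :
    IsChartOn I hU F f W' where
  le := h.trans H.le
  regular s hs := by
    have := (H.regular s hs).res h
    rwa [res_pb] at this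
  dvd s hs a ha := pb_dvd_pb_of_le H.le h (H.dvd s hs a ha)

theorem IsChartOn.mono {F' : Set Γ(X, U)} (H : IsChartOn I hU F f W) (h : F' ⊆ F) :
    IsChartOn I hU F' f W :=
  ⟨H.le, fun s hs => H.regular s (h hs), fun s hs => H.dvd s (h hs)⟩

theorem IsChartOn.union {F' : Set Γ(X, U)} (H : IsChartOn I hU F f W)
    (H' : IsChartOn I hU F' f W) : IsChartOn I hU (F ∪ F') f W :=
  ⟨H.le, fun s hs => hs.elim (H.regular s) (H'.regular s),
    fun s hs => hs.elim (H.dvd s) (H'.dvd s)⟩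

/-- If `s` divides the sections of the ideal over `U`, then it divides those over `V ⊆ U`. -/
theorem pb_dvd_of_restrict {s : Γ(X, U)} {e : W ≤ f ⁻¹ᵁ U}
    (h : ∀ a ∈ I.ideal ⟨U, hU⟩, pb f e s ∣ pb f e a) {V : X.Opens} (hV : IsAffineOpen V)
    (hVU : V ≤ U) {W' : T.Opens} (hW : W' ≤ W) (e' : W' ≤ f ⁻¹ᵁ V) {a : Γ(X, V)}
    (ha : a ∈ I.ideal ⟨V, hV⟩) :
    pb f (hW.trans e) s ∣ pb f e' a := by
  rw [← I.map_ideal (U := ⟨V, hV⟩) (V := ⟨U, hU⟩) hVU] at ha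
  have hle : ((I.ideal ⟨U, hU⟩).map (res hVU)) ≤
      (Ideal.span {pb f (hW.trans e) s}).comap (pb f e') := by
    rw [Ideal.map_le_iff_le_comap]
    intro b hb
    rw [Ideal.mem_comap, Ideal.mem_comap, pb_res, Ideal.mem_span_singleton]
    exact pb_dvd_pb_of_le e hW (h b hb)
  exact Ideal.mem_span_singleton.1 (hle ha)

theorem IsChartOn.restrict (H : IsChartOn I hU F f W) {V : X.Opens} (hV : IsAffineOpen V)
    (h : V ≤ U) (e : W ≤ f ⁻¹ᵁ V) : IsChartOn I hV (res h '' F) f W where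
  le := e
  regular := by
    rintro _ ⟨s, hs, rfl⟩
    rw [pb_res]
    exact H.regular s hs
  dvd := by
    rintro _ ⟨s, hs, rfl⟩ a ha
    rw [pb_res]
    exact pb_dvd_of_restrict (H.dvd s hs) hV h le_rfl e ha

theorem IsChartOn.of_restrict {V : X.Opens} {hV : IsAffineOpen V} (h : V ≤ U)
    {F' : Set Γ(X, V)} (H : IsChartOn I hV F' f W) (hF : res h '' F ⊆ F') :
    IsChartOn I hU F f W where
  le := H.le.trans (f.preimage_mono h)
  regular s hs := by
    have := H.regular _ (hF ⟨s, hs, rfl⟩)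
    rwa [pb_res] at this
  dvd s hs a ha := by
    have := H.dvd _ (hF ⟨s, hs, rfl⟩) (res h a) (I.ideal_le_comap_ideal
      (U := ⟨V, hV⟩) (V := ⟨U, hU⟩) h ha)
    rwa [pb_res, pb_res] at this

/-- Being mapped to a chart is a local property of the source. -/
theorem IsChartOn.of_local (H : ∀ t ∈ W, ∃ W' : T.Opens, t ∈ W' ∧ IsChartOn I hU F f W') :
    IsChartOn I hU F f W := by
  have hle : W ≤ f ⁻¹ᵁ U := fun t ht => by
    obtain ⟨W', ht', h⟩ := H t ht
    exact h.le ht'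
  choose! N hN hch using H
  have hreg : ∀ s ∈ F, IsRegularSection (pb f hle s) := by
    intro s hs
    refine IsRegularSection.of_local fun t ht => ⟨W ⊓ N t, inf_le_left, ⟨ht, hN t ht⟩, ?_⟩
    have := ((hch t ht).regular s hs).res (inf_le_right : W ⊓ N t ≤ N t)
    rw [res_pb] at this
    rwa [res_pb]
  refine ⟨hle, hreg, ?_⟩
  intro s hs a ha
  -- the quotients are unique, so they can be glued
  have hloc : ∀ t : W, ∃ q : Γ(T, W ⊓ N t.1), pb f (inf_le_left.trans hle) a =
      pb f (inf_le_left.trans hle) s * q := fun t =>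
    ((hch t.1 t.2).of_le inf_le_right).dvd s hs a ha
  choose q hq using hloc
  obtain ⟨r, hr⟩ := exists_glue (fun t : W => W ⊓ N t.1) (fun _ => inf_le_left)
    (fun t ht => ⟨⟨t, ht⟩, ht, hN t ht⟩) q (by
      intro t t'
      rw [← sub_eq_zero]
      refine hreg s hs _ (inf_le_left.trans inf_le_left) _ ?_
      have h1 := congrArg (res (inf_le_left : (W ⊓ N t.1) ⊓ (W ⊓ N t'.1) ≤ _)) (hq t)
      have h2 := congrArg (res (inf_le_right : (W ⊓ N t.1) ⊓ (W ⊓ N t'.1) ≤ _)) (hq t')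
      rw [map_mul, res_pb, res_pb] at h1 h2
      rw [res_pb, mul_sub, ← h1, ← h2, sub_self])
  refine ⟨r, section_ext fun t ht => ⟨W ⊓ N t, inf_le_left, ⟨ht, hN t ht⟩, ?_⟩⟩
  rw [map_mul, res_pb, res_pb, hr ⟨t, ht⟩]
  exact hq ⟨t, ht⟩

theorem isChartMap_comp_iff {T' : Scheme.{0}} (j : T' ⟶ T) [IsOpenImmersion j] :
    IsChartMap I hU F (j ≫ f) ↔ IsChartOn I hU F f j.opensRange := by
  have htop : (⊤ : T'.Opens) = j ⁻¹ᵁ j.opensRange := by simp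
  constructor
  · intro H
    have hle : j.opensRange ≤ f ⁻¹ᵁ U := by
      rintro _ ⟨t, rfl⟩
      exact H.le (trivial : t ∈ (⊤ : T'.Opens))
    refine ⟨hle, fun s hs => ?_, fun s hs a ha => ?_⟩
    · apply isRegularSection_of_pb j htop le_rfl
      rw [pb_pb]
      exact H.regular s hs
    · obtain ⟨q, hq⟩ := H.dvd s hs a ha
      have hb := bijective_pb_of_isOpenImmersion j le_rfl htop
      obtain ⟨q, rfl⟩ := hb.2 q
      refine ⟨q, hb.1 ?_⟩
      rw [map_mul, pb_pb, pb_pb]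
      exact hq
  · intro H
    refine ⟨le_comp_preimage H.le htop.le, fun s hs => ?_, fun s hs a ha => ?_⟩
    · have := (H.regular s hs).pb j htop.le
      rwa [pb_pb] at this
    · exact pb_dvd_pb H.le j htop.le (H.dvd s hs a ha)

theorem isChartMap_ι_comp_iff : IsChartMap I hU F (W.ι ≫ f) ↔ IsChartOn I hU F f W := by
  rw [isChartMap_comp_iff, Scheme.Opens.opensRange_ι]

theorem eq_toSpecΓ_SpecMap {A : CommRingCat.{0}} (g : T ⟶ Spec A) :
    g = T.toSpecΓ ≫ Spec.map ((Scheme.ΓSpecIso A).inv ≫ g.appTop) := by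
  rw [Spec.map_comp, ← Scheme.toSpecΓ_naturality_assoc, ← SpecMap_ΓSpecIso_hom, ← Spec.map_comp,
    Iso.inv_hom_id, Spec.map_id, Category.comp_id]

theorem pb_SpecMap_fromSpec {U : X.Opens} (hU : IsAffineOpen U) {C : CommRingCat.{0}}
    (φ : Γ(X, U) ⟶ C) (e : ⊤ ≤ (Spec.map φ ≫ hU.fromSpec) ⁻¹ᵁ U) (s : Γ(X, U)) :
    pb (Spec.map φ ≫ hU.fromSpec) e s = (Scheme.ΓSpecIso C).inv (φ s) := by
  rw [← pb_pb (Spec.map φ) hU.fromSpec (top_le_preimage_fromSpec hU) (top_le_preimage_top _),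
    pb_fromSpec]
  apply (ΓSpecIso_hom_bijective C).1
  have := pb_SpecMap φ ((Scheme.ΓSpecIso Γ(X, U)).inv s)
  rw [← CommRingCat.comp_apply (Scheme.ΓSpecIso Γ(X, U)).inv, Iso.inv_hom_id] at this
  exact this.trans congr($((Scheme.ΓSpecIso C).inv_hom_id.symm) (φ s))

/-- The universal property of a chart of the blow-up. -/
structure IsChart (hU : IsAffineOpen U) (F : Set Γ(X, U)) {C : Scheme.{0}} (c : C ⟶ X) :
    Prop where
  isChartMap : IsChartMap I hU F c
  existsUnique : ∀ (T : Scheme.{0}) (f : T ⟶ X), IsChartMap I hU F f → ∃! g : T ⟶ C, g ≫ c = f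

/-- The spectrum of the blow-up algebra is a chart of the blow-up. -/
theorem isChart_SpecMap {U : X.Opens} (hU : IsAffineOpen U) (F : Set Γ(X, U)) {C : CommRingCat.{0}}
    (φ : Γ(X, U) ⟶ C) (H : IsBlowUpAlgebra (I.ideal ⟨U, hU⟩) F φ.hom) :
    IsChart (I := I) hU F (Spec.map φ ≫ hU.fromSpec) := by
  have e : ⊤ ≤ (Spec.map φ ≫ hU.fromSpec) ⁻¹ᵁ U :=
    le_comp_preimage (top_le_preimage_fromSpec hU) (top_le_preimage_top _)
  refine ⟨⟨e, ?_, ?_⟩, ?_⟩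
  · intro s hs
    apply isRegularSection_of_mem_nonZeroDivisors (isAffineOpen_top (Spec C))
    rw [pb_SpecMap_fromSpec, mem_nonZeroDivisors_iff_right]
    intro a ha
    apply (ΓSpecIso_hom_bijective C).1
    rw [map_zero]
    have := congrArg (Scheme.ΓSpecIso C).hom ha
    rw [map_mul, map_zero, ← CommRingCat.comp_apply, Iso.inv_hom_id] at this
    exact (mem_nonZeroDivisors_iff_right.1 (H.mem_nonZeroDivisors s hs)) _ this
  · intro s hs a ha
    rw [pb_SpecMap_fromSpec, pb_SpecMap_fromSpec]
    exact map_dvd (Scheme.ΓSpecIso C).inv.hom (H.dvd s hs a ha)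
  · intro T f hf
    obtain ⟨θ, hθ, huniq⟩ := H.existsUnique (pb f hf.le)
      (fun s hs => (hf.regular s hs).mem_nonZeroDivisors) hf.dvd
    refine ⟨T.toSpecΓ ≫ Spec.map (CommRingCat.ofHom θ), ?_, ?_⟩
    · have h1 : φ ≫ CommRingCat.ofHom θ = f.appLE U ⊤ hf.le := CommRingCat.hom_ext hθ
      dsimp only
      rw [Category.assoc, ← Spec.map_comp_assoc, h1, toSpecΓ_appLE_fromSpec]
    · intro g hg
      rw [eq_toSpecΓ_SpecMap g]
      congr 2
      apply CommRingCat.hom_ext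
      apply huniq
      ext s
      have h1 : pb f hf.le s =
          pb g (top_le_preimage_top g) (pb (Spec.map φ ≫ hU.fromSpec) e s) := by
        rw [pb_pb, pb_congr hg]
      rw [h1, pb_SpecMap_fromSpec]
      exact (app_eq_pb g ⊤ _)

variable (I) in
theorem exists_isChart {U : X.Opens} (hU : IsAffineOpen U) (F : Set Γ(X, U)) :
    ∃ (C : Scheme.{0}) (c : C ⟶ X), IsAffine C ∧ IsChart (I := I) hU F c := by
  obtain ⟨C, φ, H⟩ := exists_isBlowUpAlgebra (I.ideal ⟨U, hU⟩) F
  exact ⟨Spec C, _, inferInstance, isChart_SpecMap hU F (CommRingCat.ofHom φ) H⟩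

theorem IsChart.hom_ext {C : Scheme.{0}} {c : C ⟶ X} (H : IsChart (I := I) hU F c) {g h : T ⟶ C}
    (hg : IsChartMap I hU F (g ≫ c)) (e : g ≫ c = h ≫ c) : g = h :=
  (H.existsUnique T _ hg).unique rfl e.symm

end

/-! ### Existence of blow-ups -/

section

variable {X T : Scheme.{0}} {I : X.IdealSheafData}

theorem exists_isAffineOpen_le {x : X} {U : X.Opens} (hx : x ∈ U) :
    ∃ V : X.Opens, IsAffineOpen V ∧ x ∈ V ∧ V ≤ U := by
  obtain ⟨_, ⟨V, hV, rfl⟩, hxV, hVU⟩ :=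
    X.isBasis_affineOpens.exists_subset_of_mem_open hx U.isOpen
  exact ⟨V, hV, hxV, hVU⟩

variable (I) in
/-- Near `t` the inverse image of `I` under `f` is generated by a regular section, and this section
comes from `X`. -/
def IsCartierAt (f : T ⟶ X) (t : T) : Prop :=
  ∃ (U : X.Opens) (hU : IsAffineOpen U), ∃ a ∈ I.ideal ⟨U, hU⟩, ∃ W : T.Opens,
    t ∈ W ∧ IsChartOn I hU {a} f W

/-- If the inverse image of `I` is an effective Cartier divisor, then locally it is generated by the
inverse image of a single section of `I`, by Nakayama. -/
theorem exists_isChartOn_of_isEffectiveCartier {f : T ⟶ X} (H : IsEffectiveCartier (I.comap f))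
    {t : T} {U : X.Opens} (hU : IsAffineOpen U) (htU : f t ∈ U) :
    ∃ a ∈ I.ideal ⟨U, hU⟩, ∃ W : T.Opens, t ∈ W ∧ IsChartOn I hU {a} f W := by
  obtain ⟨⟨V, hV⟩, htV, d, hd, hI⟩ := H t
  replace hV : IsAffineOpen V := hV
  replace htV : t ∈ V := htV
  obtain ⟨W, hW, htW, hWV⟩ := exists_isAffineOpen_le (x := t) (U := V ⊓ f ⁻¹ᵁ U) ⟨htV, htU⟩
  have hWU : W ≤ f ⁻¹ᵁ U := hWV.trans inf_le_right
  replace hWV : W ≤ V := hWV.trans inf_le_left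
  have hdr := (isRegularSection_of_mem_nonZeroDivisors hV hd).res hWV
  have hI' : (I.ideal ⟨U, hU⟩).map (pb f hWU) = Ideal.span {res hWV d} := by
    rw [← comap_ideal I f ⟨U, hU⟩ ⟨W, hW⟩ hWU, ← (I.comap f).map_ideal (U := ⟨W, hW⟩)
      (V := ⟨V, hV⟩) hWV, hI, Ideal.map_span, Set.image_singleton]
    rfl
  -- some element of the ideal generates it at `t`, as otherwise `d` would lie in `d * p_t`
  have hex : ∃ a ∈ I.ideal ⟨U, hU⟩, ∃ b, pb f hWU a = res hWV d * b ∧ t ∈ T.basicOpen b := by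
    by_contra! hcon
    have hle : (I.ideal ⟨U, hU⟩).map (pb f hWU) ≤
        Ideal.span {res hWV d} * (hW.primeIdealOf ⟨t, htW⟩).asIdeal := by
      rw [Ideal.map_le_iff_le_comap]
      intro a ha
      have h1 : pb f hWU a ∈ Ideal.span {res hWV d} := hI' ▸ Ideal.mem_map_of_mem _ ha
      obtain ⟨b, hb⟩ := Ideal.mem_span_singleton.1 h1
      refine Ideal.mem_span_singleton_mul.2 ⟨b, ?_, hb.symm⟩
      exact (mem_primeIdealOf hW htW b).2 (hcon a ha b hb)
    rw [hI', Ideal.span_singleton_le_iff_mem, Ideal.mem_span_singleton_mul] at hle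
    obtain ⟨z, hz, hz'⟩ := hle
    have : z = 1 := by
      have := hdr W le_rfl (z - 1) (by rw [res_self, mul_sub, hz', mul_one, sub_self])
      exact sub_eq_zero.1 this
    exact (Ideal.ne_top_iff_one _).1 (hW.primeIdealOf ⟨t, htW⟩).2.ne_top (this ▸ hz)
  obtain ⟨a, ha, b, hab, htb⟩ := hex
  refine ⟨a, ha, T.basicOpen b, htb, (T.basicOpen_le b).trans hWU, ?_, ?_⟩
  · rintro _ rfl
    rw [← res_pb f (T.basicOpen_le b) hWU, hab, map_mul]
    exact (hdr.res _).mul (IsUnit.isRegularSection (isUnit_res_basicOpen b))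
  · rintro _ rfl c hc
    rw [← res_pb f (T.basicOpen_le b) hWU, ← res_pb f (T.basicOpen_le b) hWU, hab, map_mul,
      (isUnit_res_basicOpen b).mul_right_dvd, ← Ideal.mem_span_singleton,
      ← Set.image_singleton, ← Ideal.map_span, ← hI']
    exact Ideal.mem_map_of_mem _ (Ideal.mem_map_of_mem _ hc)

theorem isCartierAt_of_isEffectiveCartier {f : T ⟶ X} (H : IsEffectiveCartier (I.comap f))
    (t : T) : IsCartierAt I f t := by
  obtain ⟨U, hU, htU, -⟩ := exists_isAffineOpen_le (U := ⊤) (Set.mem_univ (f t))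
  exact ⟨U, hU, exists_isChartOn_of_isEffectiveCartier H hU htU⟩

theorem isEffectiveCartier_of_isCartierAt {f : T ⟶ X} (H : ∀ t : T, IsCartierAt I f t) :
    IsEffectiveCartier (I.comap f) := by
  intro t
  obtain ⟨U, hU, a, ha, W, htW, h⟩ := H t
  obtain ⟨V, hV, htV, hVW⟩ := exists_isAffineOpen_le htW
  replace h := h.of_le hVW
  refine ⟨⟨V, hV⟩, htV, pb f h.le a, (h.regular a rfl).mem_nonZeroDivisors, ?_⟩
  rw [comap_ideal I f ⟨U, hU⟩ ⟨V, hV⟩ h.le]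
  apply le_antisymm
  · rw [Ideal.map_le_iff_le_comap]
    exact fun b hb => Ideal.mem_span_singleton.2 (h.dvd a rfl b hb)
  · rw [Ideal.span_singleton_le_iff_mem]
    exact Ideal.mem_map_of_mem _ ha

theorem isEffectiveCartier_comap_comp {T' : Scheme.{0}} (j : T' ⟶ T) [IsOpenImmersion j]
    {f : T ⟶ X} (H : IsEffectiveCartier (I.comap f)) : IsEffectiveCartier (I.comap (j ≫ f)) := by
  apply isEffectiveCartier_of_isCartierAt
  intro t
  obtain ⟨U, hU, a, ha, W, htW, h⟩ := isCartierAt_of_isEffectiveCartier H (j t)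
  refine ⟨U, hU, a, ha, j ⁻¹ᵁ W, htW, le_comp_preimage h.le le_rfl, ?_, ?_⟩
  · intro s hs
    have := (h.regular s hs).pb j (le_refl (j ⁻¹ᵁ W))
    rwa [pb_pb] at this
  · exact fun s hs a ha => pb_dvd_pb h.le j le_rfl (h.dvd s hs a ha)

/-- A morphism for which the inverse image of `I` is Cartier is a chart map wherever it factors
through one: the generators are automatically regular. -/
theorem IsChartOn.comp_of_isEffectiveCartier {U : X.Opens} {hU : IsAffineOpen U} {F : Set Γ(X, U)}
    {f : T ⟶ X} {W : T.Opens} (h : IsChartOn I hU F f W) {T' : Scheme.{0}} (g : T' ⟶ T)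
    (H : IsEffectiveCartier (I.comap (g ≫ f))) : IsChartOn I hU F (g ≫ f) (g ⁻¹ᵁ W) := by
  refine ⟨le_comp_preimage h.le le_rfl, ?_,
    fun s hs a ha => pb_dvd_pb h.le g le_rfl (h.dvd s hs a ha)⟩
  intro s hs
  apply IsRegularSection.of_local
  intro t ht
  obtain ⟨U', hU', a, ha, W', htW', h'⟩ := isCartierAt_of_isEffectiveCartier H t
  have h1 := h.le ht
  obtain ⟨V, hV, htV, hVU⟩ := exists_isAffineOpen_le (x := (g ≫ f) t) (U := U ⊓ U')
    ⟨h1, h'.le htW'⟩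
  have hVU1 := hVU.trans inf_le_left
  have hVU2 := hVU.trans inf_le_right
  set N : T'.Opens := (g ⁻¹ᵁ W ⊓ W') ⊓ (g ≫ f) ⁻¹ᵁ V with hN
  have hN1 : N ≤ g ⁻¹ᵁ W := inf_le_left.trans inf_le_left
  have hN2 : N ≤ W' := inf_le_left.trans inf_le_right
  have hN3 : N ≤ (g ≫ f) ⁻¹ᵁ V := inf_le_right
  refine ⟨N, hN1, ⟨⟨ht, htW'⟩, htV⟩, ?_⟩
  rw [res_pb]
  have hd : pb (g ≫ f) (hN1.trans (le_comp_preimage h.le le_rfl)) s ∣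
      pb (g ≫ f) hN3 (res hVU2 a) :=
    pb_dvd_of_restrict (e := le_comp_preimage h.le le_rfl)
      (fun a ha => pb_dvd_pb h.le g le_rfl (h.dvd s hs a ha)) hV hVU1 hN1 hN3
      (I.ideal_le_comap_ideal (U := ⟨V, hV⟩) (V := ⟨U', hU'⟩) hVU2 ha)
  obtain ⟨q, hq⟩ := hd
  have hr := (h'.regular a rfl).res hN2
  rw [res_pb, ← pb_res _ hVU2 hN3, hq] at hr
  exact hr.of_mul

/-- A morphism from a chart to a scheme over `X` on which the inverse image of `I` is Cartier and
to which chart maps lift uniquely is an open immersion. -/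
theorem IsChart.isOpenImmersion {U : X.Opens} {hU : IsAffineOpen U} {F : Set Γ(X, U)}
    (hF : F.Finite) (hFI : F ⊆ I.ideal ⟨U, hU⟩) {C : Scheme.{0}} {c : C ⟶ X}
    (hc : IsChart (I := I) hU F c) {b : T ⟶ X} (hb : IsEffectiveCartier (I.comap b))
    (huniq : ∀ (T' : Scheme.{0}) (g h : T' ⟶ T), IsChartMap I hU F (g ≫ b) →
      g ≫ b = h ≫ b → g = h) (κ : C ⟶ T) (hκ : κ ≫ b = c) :
    IsOpenImmersion κ ∧
      ∀ t : T, t ∈ Set.range κ ↔ ∃ O : T.Opens, t ∈ O ∧ IsChartOn I hU F b O := by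
  have hcm := hc.isChartMap
  have key : ∀ y : C, ∃ O : T.Opens, κ y ∈ O ∧ IsChartOn I hU F b O := by
    intro y
    obtain ⟨U', hU', a, ha, W', htW', h'⟩ := isCartierAt_of_isEffectiveCartier hb (κ y)
    have h1 : κ y ∈ b ⁻¹ᵁ U := by
      change b (κ y) ∈ U
      rw [← Scheme.Hom.comp_apply, hκ]
      exact hcm.le (trivial : y ∈ (⊤ : C.Opens))
    obtain ⟨V, hV, htV, hVU⟩ := exists_isAffineOpen_le (x := b (κ y)) (U := U ⊓ U') ⟨h1, h'.le htW'⟩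
    have hVU1 := hVU.trans inf_le_left
    have hVU2 := hVU.trans inf_le_right
    set N : T.Opens := W' ⊓ b ⁻¹ᵁ V with hN
    have hN2 : N ≤ W' := inf_le_left
    have hN3 : N ≤ b ⁻¹ᵁ V := inf_le_right
    have hyN : κ y ∈ N := ⟨htW', htV⟩
    have hd : ∀ s ∈ F, ∃ u : Γ(T, N), pb b (hN2.trans h'.le) a * u =
        pb b (hN3.trans (b.preimage_mono hVU1)) s := by
      intro s hs
      obtain ⟨u, hu⟩ := pb_dvd_of_restrict (h'.dvd a rfl) hV hVU2 hN2 hN3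
        (I.ideal_le_comap_ideal (U := ⟨V, hV⟩) (V := ⟨U, hU⟩) hVU1 (hFI hs))
      refine ⟨u, hu.symm.trans ?_⟩
      exact pb_res b hVU1 hN3 s
    choose! u hu using hd
    have hyu : ∀ s ∈ F, κ y ∈ T.basicOpen (u s) := by
      intro s hs
      -- on the chart `s` divides `a`, so that the quotient of `s` by `a` becomes invertible
      have hκN : κ ⁻¹ᵁ N ≤ c ⁻¹ᵁ V := by
        rw [← hκ, Scheme.Hom.comp_preimage]
        exact κ.preimage_mono hN3
      obtain ⟨v, hv⟩ := pb_dvd_of_restrict (hcm.dvd s hs) hV hVU1 (W' := κ ⁻¹ᵁ N) le_top hκN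
        (I.ideal_le_comap_ideal (U := ⟨V, hV⟩) (V := ⟨U', hU'⟩) hVU2 ha)
      have hv' : pb c (hκN.trans (c.preimage_mono hVU2)) a =
          pb c (hκN.trans (c.preimage_mono hVU1)) s * v := by
        rw [← pb_res c hVU2 hκN]
        exact hv
      have hu' := congrArg (pb κ (le_refl (κ ⁻¹ᵁ N))) (hu s hs)
      rw [map_mul, pb_pb, pb_pb, pb_congr hκ, pb_congr hκ, hv', mul_assoc] at hu'
      have hr := (hcm.regular s hs) (κ ⁻¹ᵁ N) le_top (v * pb κ le_rfl (u s) - 1) (by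
        rw [res_pb, mul_sub, mul_one, sub_eq_zero]
        exact hu')
      have hun : IsUnit (pb κ (le_refl (κ ⁻¹ᵁ N)) (u s)) :=
        IsUnit.of_mul_eq_one_right v (sub_eq_zero.1 hr)
      rw [← mem_basicOpen_pb κ (le_refl (κ ⁻¹ᵁ N)) (u s) hyN, Scheme.basicOpen_of_isUnit _ hun]
      exact hyN
    set p : Γ(T, N) := ∏ s ∈ hF.toFinset, u s with hp
    have hyp : κ y ∈ T.basicOpen p := by
      rw [hp]
      have : ∀ G : Finset Γ(X, U), (∀ s ∈ G, κ y ∈ T.basicOpen (u s)) →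
          κ y ∈ T.basicOpen (∏ s ∈ G, u s) := by
        intro G
        induction G using Finset.cons_induction with
        | empty =>
          intro _
          rw [Finset.prod_empty, Scheme.basicOpen_of_isUnit _ isUnit_one]
          exact hyN
        | cons s G hs ih =>
          intro h
          rw [Finset.prod_cons, mem_basicOpen_mul]
          exact ⟨h s (Finset.mem_cons_self _ _),
            ih fun s hs => h s (Finset.mem_cons_of_mem hs)⟩
      exact this _ fun s hs => hyu s (hF.mem_toFinset.1 hs)
    have hle : T.basicOpen p ≤ b ⁻¹ᵁ V := (T.basicOpen_le p).trans hN3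
    have hun : ∀ s ∈ F, IsUnit (res (T.basicOpen_le p) (u s)) := by
      intro s hs
      refine isUnit_of_dvd_unit (map_dvd _ ?_) (isUnit_res_basicOpen p)
      exact Finset.dvd_prod_of_mem u (hF.mem_toFinset.2 hs)
    have hres : ∀ s ∈ F, pb b (hle.trans (b.preimage_mono hVU1)) s =
        pb b (hle.trans (b.preimage_mono hVU2)) a * res (T.basicOpen_le p) (u s) := by
      intro s hs
      have := congrArg (res (T.basicOpen_le p)) (hu s hs)
      rw [map_mul, res_pb, res_pb] at this
      exact this.symm
    refine ⟨T.basicOpen p, hyp, hle.trans (b.preimage_mono hVU1), ?_, ?_⟩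
    · intro s hs
      rw [hres s hs]
      have := ((h'.regular a rfl).res ((T.basicOpen_le p).trans hN2))
      rw [res_pb] at this
      exact this.mul (IsUnit.isRegularSection (hun s hs))
    · intro s hs z hz
      rw [hres s hs, (hun s hs).mul_right_dvd, ← pb_res b hVU1 hle]
      exact pb_dvd_of_restrict (h'.dvd a rfl) hV hVU2 ((T.basicOpen_le p).trans hN2) hle
        (I.ideal_le_comap_ideal (U := ⟨V, hV⟩) (V := ⟨U, hU⟩) hVU1 hz)
  set O : T.Opens := sSup {O | IsChartOn I hU F b O} with hO
  have hchO : IsChartOn I hU F b O := by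
    refine IsChartOn.of_local fun t ht => ?_
    obtain ⟨O', hO', ht'⟩ := Opens.mem_sSup.1 ht
    exact ⟨O', ht', hO'⟩
  have hrange : Set.range κ ⊆ Set.range O.ι := by
    rintro _ ⟨y, rfl⟩
    rw [Scheme.Opens.range_ι]
    obtain ⟨O', hy, hO'⟩ := key y
    exact Opens.mem_sSup.2 ⟨O', hO', hy⟩
  have hOch := isChartMap_ι_comp_iff.2 hchO
  obtain ⟨g, hg, -⟩ := hc.existsUnique _ _ hOch
  have hgκ : g ≫ κ = O.ι := by
    refine huniq _ _ _ ?_ ?_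
    · rwa [Category.assoc, hκ, hg]
    · rw [Category.assoc, hκ, hg]
  set κ' := IsOpenImmersion.lift O.ι κ hrange with hκ'
  have hfac : κ' ≫ O.ι = κ := IsOpenImmersion.lift_fac _ _ _
  have h1 : κ' ≫ g = 𝟙 C := by
    have e : (κ' ≫ g) ≫ c = 𝟙 C ≫ c := by
      rw [Category.assoc, hg, ← Category.assoc, hfac, hκ, Category.id_comp]
    refine hc.hom_ext ?_ e
    rw [e, Category.id_comp]
    exact hcm
  have h2 : g ≫ κ' = 𝟙 _ := by
    rw [← cancel_mono O.ι, Category.assoc, hfac, hgκ, Category.id_comp]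
  have hiso : IsIso κ' := ⟨g, h1, h2⟩
  refine ⟨?_, fun t => ⟨?_, ?_⟩⟩
  · rw [← hfac]
    infer_instance
  · rintro ⟨y, rfl⟩
    exact key y
  · rintro ⟨O', ht, hO'⟩
    have htO : t ∈ O := Opens.mem_sSup.2 ⟨O', hO', ht⟩
    obtain ⟨y, rfl⟩ : t ∈ Set.range O.ι := by rwa [Scheme.Opens.range_ι]
    exact ⟨g y, by rw [← Scheme.Hom.comp_apply, hgκ]⟩

end

section

variable {X T : Scheme.{0}}

/-- The index of a chart of the blow-up of `I`: an affine open set `U` and finitely many sections of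
the ideal over `U`.  The corresponding chart is the open part of the blow-up over `U` where each of
these sections generates the inverse image of `I`. -/
structure ChartIndex (I : X.IdealSheafData) where
  U : X.Opens
  isAffineOpen : IsAffineOpen U
  F : Set Γ(X, U)
  finite : F.Finite
  nonempty : F.Nonempty
  subset : F ⊆ I.ideal ⟨U, isAffineOpen⟩

variable {I : X.IdealSheafData}

instance : Preorder (ChartIndex I) where
  le i j := ∃ h : i.U ≤ j.U, res h '' j.F ⊆ i.F
  le_refl i := ⟨le_rfl, by
    rintro _ ⟨s, hs, rfl⟩
    rwa [res_self]⟩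
  le_trans i j k := by
    rintro ⟨h, hF⟩ ⟨h', hF'⟩
    refine ⟨h.trans h', ?_⟩
    rintro _ ⟨s, hs, rfl⟩
    rw [← res_res h' h]
    exact hF ⟨_, hF' ⟨s, hs, rfl⟩, rfl⟩

/-- `IsChartOn` for a chart index. -/
abbrev ChartIndex.IsChartOn (i : ChartIndex I) (f : T ⟶ X) (W : T.Opens) : Prop :=
  EnriquesQuotient.IsChartOn I i.isAffineOpen i.F f W

theorem ChartIndex.IsChartOn.of_index_le {i j : ChartIndex I} (h : i ≤ j) {f : T ⟶ X} {W : T.Opens}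
    (H : i.IsChartOn f W) : j.IsChartOn f W := by
  obtain ⟨h1, h2⟩ := h
  exact EnriquesQuotient.IsChartOn.of_restrict h1 H h2

/-- Two charts intersect in charts. -/
theorem ChartIndex.exists_le (i j : ChartIndex I) {x : X} (hi : x ∈ i.U) (hj : x ∈ j.U) :
    ∃ l : ChartIndex I, l ≤ i ∧ l ≤ j ∧ x ∈ l.U ∧ ∀ (T : Scheme.{0}) (f : T ⟶ X) (W : T.Opens),
      W ≤ f ⁻¹ᵁ l.U → i.IsChartOn f W → j.IsChartOn f W → l.IsChartOn f W := by
  obtain ⟨V, hV, hxV, hVU⟩ := exists_isAffineOpen_le (x := x) (U := i.U ⊓ j.U) ⟨hi, hj⟩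
  have h1 : V ≤ i.U := hVU.trans inf_le_left
  have h2 : V ≤ j.U := hVU.trans inf_le_right
  refine ⟨⟨V, hV, res h1 '' i.F ∪ res h2 '' j.F, (i.finite.image _).union (j.finite.image _),
    (i.nonempty.image _).inl, ?_⟩, ⟨h1, Set.subset_union_left⟩, ⟨h2, Set.subset_union_right⟩, hxV,
    ?_⟩
  · rintro _ (⟨s, hs, rfl⟩ | ⟨s, hs, rfl⟩)
    · exact I.ideal_le_comap_ideal (U := ⟨V, hV⟩) (V := ⟨i.U, i.isAffineOpen⟩) h1 (i.subset hs)
    · exact I.ideal_le_comap_ideal (U := ⟨V, hV⟩) (V := ⟨j.U, j.isAffineOpen⟩) h2 (j.subset hs)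
  · intro T f W e Hi Hj
    exact (Hi.restrict hV h1 e).union (Hj.restrict hV h2 e)

variable (I) in
/-- A chart of the blow-up. -/
def blowUpChart (i : ChartIndex I) : Scheme.{0} := (exists_isChart I i.isAffineOpen i.F).choose

/-- The structure morphism of a chart of the blow-up. -/
def blowUpChartHom (i : ChartIndex I) : blowUpChart I i ⟶ X :=
  (exists_isChart I i.isAffineOpen i.F).choose_spec.choose

theorem isChart_blowUpChartHom (i : ChartIndex I) :
    IsChart (I := I) i.isAffineOpen i.F (blowUpChartHom i) :=
  (exists_isChart I i.isAffineOpen i.F).choose_spec.choose_spec.2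

theorem isEffectiveCartier_of_isChartMap (i : ChartIndex I) {f : T ⟶ X} (H : i.IsChartOn f ⊤) :
    IsEffectiveCartier (I.comap f) := by
  obtain ⟨s, hs⟩ := i.nonempty
  exact isEffectiveCartier_of_isCartierAt fun t => ⟨i.U, i.isAffineOpen, s, i.subset hs, ⊤,
    trivial, H.mono (Set.singleton_subset_iff.2 hs)⟩

theorem isEffectiveCartier_blowUpChartHom (i : ChartIndex I) :
    IsEffectiveCartier (I.comap (blowUpChartHom i)) :=
  isEffectiveCartier_of_isChartMap i (isChart_blowUpChartHom i).isChartMap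

/-- The inclusion of a chart into a bigger one. -/
def chartTransition {i j : ChartIndex I} (h : i ≤ j) : blowUpChart I i ⟶ blowUpChart I j :=
  ((isChart_blowUpChartHom j).existsUnique _ (blowUpChartHom i)
    (ChartIndex.IsChartOn.of_index_le h (isChart_blowUpChartHom i).isChartMap)).exists.choose

theorem chartTransition_comp {i j : ChartIndex I} (h : i ≤ j) :
    chartTransition h ≫ blowUpChartHom j = blowUpChartHom i :=
  ((isChart_blowUpChartHom j).existsUnique _ (blowUpChartHom i)
    (ChartIndex.IsChartOn.of_index_le h (isChart_blowUpChartHom i).isChartMap)).exists.choose_spec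

theorem blowUpChart_hom_ext {i j : ChartIndex I} (h : i ≤ j) {g k : T ⟶ blowUpChart I j}
    (hg : i.IsChartOn (g ≫ blowUpChartHom j) ⊤)
    (e : g ≫ blowUpChartHom j = k ≫ blowUpChartHom j) : g = k :=
  (isChart_blowUpChartHom j).hom_ext (ChartIndex.IsChartOn.of_index_le h hg) e

theorem chartTransition_isOpenImmersion {i j : ChartIndex I} (h : i ≤ j) :
    IsOpenImmersion (chartTransition h) ∧ ∀ t, t ∈ Set.range (chartTransition h) ↔
      ∃ O : (blowUpChart I j).Opens, t ∈ O ∧ i.IsChartOn (blowUpChartHom j) O :=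
  (isChart_blowUpChartHom i).isOpenImmersion i.finite i.subset
    (isEffectiveCartier_blowUpChartHom j) (fun _ _ _ hg e => blowUpChart_hom_ext h hg e)
    (chartTransition h) (chartTransition_comp h)

variable (I) in
/-- The charts of the blow-up and their inclusions. -/
def chartDiagram : ChartIndex I ⥤ Scheme.{0} where
  obj i := blowUpChart I i
  map h := chartTransition (leOfHom h)
  map_id i := by
    apply blowUpChart_hom_ext (le_refl i)
    · rw [chartTransition_comp]
      exact (isChart_blowUpChartHom i).isChartMap
    · rw [chartTransition_comp, Category.id_comp]
  map_comp {i j k} f g := by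
    apply blowUpChart_hom_ext ((leOfHom f).trans (leOfHom g))
    · rw [chartTransition_comp]
      exact (isChart_blowUpChartHom i).isChartMap
    · rw [Category.assoc, chartTransition_comp, chartTransition_comp, chartTransition_comp]

/-- The charts can be glued: two charts inside a third meet in the union of the charts contained in
both. -/
theorem isLocallyDirected_chartDiagram :
    (chartDiagram I ⋙ Scheme.forget).IsLocallyDirected := by
  constructor
  intro i j k fi fj xi xj hx
  replace hx : chartTransition (leOfHom fi) xi = chartTransition (leOfHom fj) xj := hx
  set v := chartTransition (leOfHom fi) xi with hv
  obtain ⟨hoi, hri⟩ := chartTransition_isOpenImmersion (leOfHom fi)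
  obtain ⟨hoj, hrj⟩ := chartTransition_isOpenImmersion (leOfHom fj)
  obtain ⟨Oi, hOi, hci⟩ := (hri v).1 ⟨xi, rfl⟩
  obtain ⟨Oj, hOj, hcj⟩ := (hrj v).1 ⟨xj, hx.symm⟩
  obtain ⟨l, hli, hlj, hxl, hl⟩ := i.exists_le j (hci.le hOi) (hcj.le hOj)
  obtain ⟨hol, hrl⟩ := chartTransition_isOpenImmersion (hli.trans (leOfHom fi))
  have hle1 : Oi ⊓ Oj ⊓ blowUpChartHom k ⁻¹ᵁ l.U ≤ Oi := inf_le_left.trans inf_le_left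
  have hle2 : Oi ⊓ Oj ⊓ blowUpChartHom k ⁻¹ᵁ l.U ≤ Oj := inf_le_left.trans inf_le_right
  obtain ⟨x, hx'⟩ := (hrl v).2 ⟨Oi ⊓ Oj ⊓ blowUpChartHom k ⁻¹ᵁ l.U, ⟨⟨hOi, hOj⟩, hxl⟩,
    hl _ _ _ inf_le_right (hci.of_le hle1) (hcj.of_le hle2)⟩
  have hcomp : ∀ {m : ChartIndex I} (hlm : l ≤ m) (hmk : m ≤ k),
      chartTransition hmk (chartTransition hlm x) = chartTransition (hli.trans (leOfHom fi)) x := by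
    intro m hlm hmk
    have : chartTransition hlm ≫ chartTransition hmk = chartTransition (hlm.trans hmk) :=
      ((chartDiagram I).map_comp (homOfLE hlm) (homOfLE hmk)).symm
    rw [← Scheme.Hom.comp_apply, this]
  refine ⟨l, homOfLE hli, homOfLE hlj, x, ?_, ?_⟩
  · apply (chartTransition (leOfHom fi)).isOpenEmbedding.injective
    exact (hcomp hli (leOfHom fi)).trans (hx'.trans hv)
  · apply (chartTransition (leOfHom fj)).isOpenEmbedding.injective
    exact (hcomp hlj (leOfHom fj)).trans (hx'.trans hx)

variable (I) in
/-- The charts can be glued. -/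
theorem exists_glue_charts : ∃ (B : Scheme.{0}) (b : B ⟶ X) (j : ∀ i, blowUpChart I i ⟶ B),
    (∀ i, IsOpenImmersion (j i)) ∧ (∀ {l i} (h : l ≤ i), chartTransition h ≫ j i = j l) ∧
    (∀ y, ∃ i x, j i x = y) ∧ ∀ i, j i ≫ b = blowUpChartHom i := by
  have hop : ∀ {V U : ChartIndex I} (h : V ⟶ U), IsOpenImmersion ((chartDiagram I).map h) :=
    fun h => (chartTransition_isOpenImmersion (leOfHom h)).1
  have hld := isLocallyDirected_chartDiagram (I := I)
  exact ⟨colimit (chartDiagram I), colimit.desc (chartDiagram I)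
    { pt := X
      ι :=
        { app := fun i => blowUpChartHom i
          naturality := fun i k h =>
            (chartTransition_comp (leOfHom h)).trans (Category.comp_id _).symm } },
    fun i => colimit.ι (chartDiagram I) i,
    fun i => Scheme.Cover.map_prop (Scheme.IsLocallyDirected.openCover (chartDiagram I)) i,
    fun h => colimit.w (chartDiagram I) (homOfLE h),
    (Scheme.IsLocallyDirected.openCover (chartDiagram I)).exists_eq,
    fun i => colimit.ι_desc _ _⟩

variable (I) in
/-- Blow-ups exist. -/
theorem exists_isBlowUp : ∃ (B : Scheme.{0}) (b : B ⟶ X), IsBlowUp I b := by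
  obtain ⟨B, b, j, hj, hjc, hjs, hjb⟩ := exists_glue_charts I
  have hch : ∀ i : ChartIndex I, i.IsChartOn b (j i).opensRange := fun i => by
    refine (isChartMap_comp_iff (j i)).1 ?_
    rw [hjb]
    exact (isChart_blowUpChartHom i).isChartMap
  -- two lifts of a morphism to `X` agree, as locally both factor through one chart `l`
  have huniq : ∀ (T : Scheme.{0}) (g h : T ⟶ B), g ≫ b = h ≫ b →
      IsEffectiveCartier (I.comap (g ≫ b)) → g = h := by
    intro T g h e H
    refine hom_ext_of_isOpenImmersion _ _ fun t => ?_
    obtain ⟨i, y, hy⟩ := hjs (g t)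
    obtain ⟨k, z, hz⟩ := hjs (h t)
    have hi : i.IsChartOn (g ≫ b) (g ⁻¹ᵁ (j i).opensRange) :=
      (hch i).comp_of_isEffectiveCartier g H
    have hk : k.IsChartOn (g ≫ b) (h ⁻¹ᵁ (j k).opensRange) := by
      rw [e] at H ⊢
      exact (hch k).comp_of_isEffectiveCartier h H
    have hti : t ∈ g ⁻¹ᵁ (j i).opensRange := ⟨y, hy⟩
    have htk : t ∈ h ⁻¹ᵁ (j k).opensRange := ⟨z, hz⟩
    obtain ⟨l, hli, hlk, hxl, hl⟩ := i.exists_le k (hi.le hti) (hk.le htk)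
    set N : T.Opens := g ⁻¹ᵁ (j i).opensRange ⊓ h ⁻¹ᵁ (j k).opensRange ⊓ (g ≫ b) ⁻¹ᵁ l.U with hN
    have hN1 : N ≤ g ⁻¹ᵁ (j i).opensRange := inf_le_left.trans inf_le_left
    have hN2 : N ≤ h ⁻¹ᵁ (j k).opensRange := inf_le_left.trans inf_le_right
    have hlN := isChartMap_ι_comp_iff.2 (hl _ _ N inf_le_right (hi.of_le hN1) (hk.of_le hN2))
    obtain ⟨m, hm, -⟩ := (isChart_blowUpChartHom l).existsUnique _ _ hlN
    have hsub : ∀ {n : ChartIndex I} (hln : l ≤ n) (f : T ⟶ B),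
        f ≫ b = g ≫ b → N ≤ f ⁻¹ᵁ (j n).opensRange → N.ι ≫ f = m ≫ j l := by
      intro n hln f hf hNf
      have hr : Set.range (N.ι ≫ f) ⊆ Set.range (j n) := by
        rintro _ ⟨t, rfl⟩
        exact hNf t.2
      have hfac := IsOpenImmersion.lift_fac (j n) (N.ι ≫ f) hr
      have e1 : IsOpenImmersion.lift (j n) (N.ι ≫ f) hr ≫ blowUpChartHom n = N.ι ≫ g ≫ b := by
        rw [← hjb, ← Category.assoc, hfac, Category.assoc, hf]
      rw [← hfac, ← hjc hln, ← Category.assoc]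
      congr 1
      apply blowUpChart_hom_ext hln
      · rw [e1]
        exact hlN
      · rw [e1, Category.assoc, chartTransition_comp, hm]
    refine ⟨N, N.ι, inferInstance, (⟨t, ⟨hti, htk⟩, hxl⟩ : N), rfl, ?_⟩
    rw [hsub hli g rfl hN1, hsub hlk h e.symm hN2]
  refine ⟨B, b, ?_, ?_⟩
  · apply isEffectiveCartier_of_isCartierAt
    intro y
    obtain ⟨i, x, rfl⟩ := hjs y
    obtain ⟨s, hs⟩ := i.nonempty
    exact ⟨i.U, i.isAffineOpen, s, i.subset hs, (j i).opensRange, ⟨x, rfl⟩,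
      (hch i).mono (Set.singleton_subset_iff.2 hs)⟩
  · intro T f H
    -- `f` lifts to a chart near each point, and the lifts agree on overlaps
    have hloc : ∀ t : T, ∃ (i : ChartIndex I) (W : T.Opens), t ∈ W ∧ i.IsChartOn f W := by
      intro t
      obtain ⟨U, hU, a, ha, W, htW, h⟩ := isCartierAt_of_isEffectiveCartier H t
      exact ⟨⟨U, hU, {a}, Set.finite_singleton a, Set.singleton_nonempty a,
        Set.singleton_subset_iff.2 ha⟩, W, htW, h⟩
    choose i W htW hW using hloc
    have hlift : ∀ t, ∃ g : (W t : Scheme.{0}) ⟶ B, g ≫ b = (W t).ι ≫ f := by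
      intro t
      obtain ⟨m, hm, -⟩ := (isChart_blowUpChartHom (i t)).existsUnique _ _
        (isChartMap_ι_comp_iff.2 (hW t))
      exact ⟨m ≫ j (i t), by rw [Category.assoc, hjb, hm]⟩
    choose g hg using hlift
    obtain ⟨k, hk⟩ := exists_glue_hom (X := T) (fun t => (W t : Scheme.{0})) (fun t => (W t).ι)
      (fun t => ⟨t, (⟨t, htW t⟩ : W t), rfl⟩) g (by
        intro s t y y' hyy
        obtain ⟨z, hz1, hz2⟩ := Scheme.Pullback.exists_preimage_pullback y y' hyy
        refine ⟨_, pullback.fst (W s).ι (W t).ι, pullback.snd (W s).ι (W t).ι, inferInstance,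
          z, hz1, pullback.condition, ?_⟩
        apply huniq
        · rw [Category.assoc, Category.assoc, hg, hg, pullback.condition_assoc]
        · rw [Category.assoc, hg, ← Category.assoc]
          exact isEffectiveCartier_comap_comp _ H)
    have hkb : k ≫ b = f := by
      refine hom_ext_of_isOpenImmersion _ _ fun t => ?_
      refine ⟨W t, (W t).ι, inferInstance, (⟨t, htW t⟩ : W t), rfl, ?_⟩
      rw [← Category.assoc, hk, hg]
    refine ⟨k, hkb, fun k' hk' => ?_⟩
    apply huniq
    · rw [hk', hkb]
    · rwa [hk']

end

/-! ### Properties of blow-ups -/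

section

variable {X T : Scheme.{0}} {I J : X.IdealSheafData}

theorem IsRegularSection.pb_of_flat {T' : Scheme.{0}} (j : T' ⟶ T) [Flat j] {V : T.Opens}
    {s : Γ(T, V)} (hs : IsRegularSection s) {V' : T'.Opens} (e : V' ≤ j ⁻¹ᵁ V) :
    IsRegularSection (EnriquesQuotient.pb j e s) := by
  apply IsRegularSection.of_local
  intro t ht
  obtain ⟨N, hN, htN, hNV⟩ := exists_isAffineOpen_le (x := j t) (U := V) (e ht)
  obtain ⟨N', hN', htN', hNV'⟩ := exists_isAffineOpen_le (x := t) (U := V' ⊓ j ⁻¹ᵁ N) ⟨ht, htN⟩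
  have e' : N' ≤ j ⁻¹ᵁ N := hNV'.trans inf_le_right
  refine ⟨N', hNV'.trans inf_le_left, htN', ?_⟩
  rw [res_pb, ← pb_res j hNV e']
  apply isRegularSection_of_mem_nonZeroDivisors hN'
  have hflat := j.flat_appLE hN hN' e'
  algebraize [(j.appLE N N' e').hom]
  rw [mem_nonZeroDivisors_iff_right]
  intro z hz
  have := Module.Flat.isSMulRegular_of_nonZeroDivisors (M := Γ(T', N'))
    (hs.res hNV).mem_nonZeroDivisors
  refine this.right_eq_zero_of_smul ?_
  rw [Algebra.smul_def, mul_comm]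
  exact hz

theorem IsCartierAt.of_comp {Z : Scheme.{0}} {f : T ⟶ X} (a : Z ⟶ T) [IsOpenImmersion a] {z : Z}
    (H : IsCartierAt I (a ≫ f) z) : IsCartierAt I f (a z) := by
  obtain ⟨U, hU, s, hs, W, hz, h⟩ := H
  rw [← isChartMap_ι_comp_iff, ← Category.assoc, isChartMap_comp_iff] at h
  refine ⟨U, hU, s, hs, (W.ι ≫ a).opensRange, ?_, h⟩
  exact ⟨(⟨z, hz⟩ : W), rfl⟩

theorem IsCartierAt.comp {Z : Scheme.{0}} {f : T ⟶ X} (a : Z ⟶ T) [Flat a] {z : Z}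
    (H : IsCartierAt I f (a z)) : IsCartierAt I (a ≫ f) z := by
  obtain ⟨U, hU, s, hs, W, hz, h⟩ := H
  refine ⟨U, hU, s, hs, a ⁻¹ᵁ W, hz, le_comp_preimage h.le le_rfl, ?_, ?_⟩
  · intro s hs
    have := (h.regular s hs).pb_of_flat a (le_refl (a ⁻¹ᵁ W))
    rwa [pb_pb] at this
  · exact fun s hs c hc => pb_dvd_pb h.le a le_rfl (h.dvd s hs c hc)

theorem isCartierAt_iff_comp {Z : Scheme.{0}} {f : T ⟶ X} (a : Z ⟶ T) [IsOpenImmersion a] {z : Z} :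
    IsCartierAt I (a ≫ f) z ↔ IsCartierAt I f (a z) :=
  ⟨fun h => h.of_comp, fun h => h.comp⟩

theorem isCartierAt_iff_of_ideal_eq {f : T ⟶ X} {t : T} {U : X.Opens} (hU : IsAffineOpen U)
    (htU : f t ∈ U) (h : I.ideal ⟨U, hU⟩ = J.ideal ⟨U, hU⟩) :
    IsCartierAt I f t ↔ IsCartierAt J f t := by
  have key : ∀ {I J : X.IdealSheafData}, I.ideal ⟨U, hU⟩ = J.ideal ⟨U, hU⟩ → IsCartierAt I f t →
      IsCartierAt J f t := by
    rintro I J h ⟨U', hU', a, ha, W, htW, hW⟩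
    obtain ⟨V, hV, htV, hVU⟩ := exists_isAffineOpen_le (x := f t) (U := U ⊓ U') ⟨htU, hW.le htW⟩
    have h1 : V ≤ U := hVU.trans inf_le_left
    have h2 : V ≤ U' := hVU.trans inf_le_right
    have hIJ : I.ideal ⟨V, hV⟩ = J.ideal ⟨V, hV⟩ := by
      rw [← I.map_ideal (U := ⟨V, hV⟩) (V := ⟨U, hU⟩) h1,
        ← J.map_ideal (U := ⟨V, hV⟩) (V := ⟨U, hU⟩) h1, h]
    have hr := (hW.of_le (inf_le_left : W ⊓ f ⁻¹ᵁ V ≤ W)).restrict hV h2 inf_le_right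
    rw [Set.image_singleton] at hr
    refine ⟨V, hV, res h2 a, ?_, W ⊓ f ⁻¹ᵁ V, ⟨htW, htV⟩, hr.le, hr.regular, ?_⟩
    · rw [← hIJ]
      exact I.ideal_le_comap_ideal (U := ⟨V, hV⟩) (V := ⟨U', hU'⟩) h2 ha
    · rw [← hIJ]
      exact hr.dvd
  exact ⟨key h, key h.symm⟩

theorem isChartOn_one {U : X.Opens} (hU : IsAffineOpen U) {f : T ⟶ X} {W : T.Opens}
    (h : W ≤ f ⁻¹ᵁ U) : IsChartOn I hU {1} f W where
  le := h
  regular := by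
    rintro _ rfl
    rw [map_one]
    exact IsUnit.isRegularSection isUnit_one
  dvd := by
    rintro _ rfl a _
    rw [map_one]
    exact one_dvd _

theorem isCartierAt_of_one_mem {f : T ⟶ X} {t : T} {U : X.Opens} (hU : IsAffineOpen U)
    (htU : f t ∈ U) (h : 1 ∈ I.ideal ⟨U, hU⟩) : IsCartierAt I f t :=
  ⟨U, hU, 1, h, f ⁻¹ᵁ U, htU, isChartOn_one hU le_rfl⟩

variable (I) in
/-- An affine open set `U` is the chart of the blow-up that belongs to the section `1`; it matters
where `I` is the unit ideal on `U`. -/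
theorem isChart_ι {U : X.Opens} (hU : IsAffineOpen U) : IsChart (I := I) hU {1} U.ι where
  isChartMap := isChartOn_one hU (by simp)
  existsUnique T f H := by
    have hr : Set.range f ⊆ Set.range U.ι := by
      rw [Scheme.Opens.range_ι]
      rintro _ ⟨t, rfl⟩
      exact H.le (trivial : t ∈ (⊤ : T.Opens))
    refine ⟨IsOpenImmersion.lift U.ι f hr, IsOpenImmersion.lift_fac _ _ _, fun g hg => ?_⟩
    rw [← cancel_mono U.ι, hg, IsOpenImmersion.lift_fac]

theorem isEffectiveCartier_comap_of_isChartMap {U : X.Opens} {hU : IsAffineOpen U}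
    {F : Set Γ(X, U)} (hF : F.Nonempty) (hFI : F ⊆ I.ideal ⟨U, hU⟩) {f : T ⟶ X}
    (H : IsChartMap I hU F f) : IsEffectiveCartier (I.comap f) := by
  obtain ⟨s, hs⟩ := hF
  exact isEffectiveCartier_of_isCartierAt fun t => ⟨U, hU, s, hFI hs, ⊤,
    trivial, H.mono (Set.singleton_subset_iff.2 hs)⟩

variable {B : Scheme.{0}} {b : B ⟶ X}

theorem IsBlowUp.hom_ext (H : IsBlowUp I b) {g h : T ⟶ B} (e : g ≫ b = h ≫ b)
    (hC : IsEffectiveCartier (I.comap (g ≫ b))) : g = h :=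
  (H.universal T _ hC).unique rfl e.symm

/-- The charts are open subschemes of every blow-up. -/
theorem IsBlowUp.exists_chart (H : IsBlowUp I b) {U : X.Opens} {hU : IsAffineOpen U}
    {F : Set Γ(X, U)} (hF : F.Finite) (hFn : F.Nonempty) (hFI : F ⊆ I.ideal ⟨U, hU⟩)
    {C : Scheme.{0}} {c : C ⟶ X} (hc : IsChart (I := I) hU F c) :
    ∃ κ : C ⟶ B, κ ≫ b = c ∧ IsOpenImmersion κ ∧
      ∀ y : B, y ∈ Set.range κ ↔ ∃ O : B.Opens, y ∈ O ∧ IsChartOn I hU F b O := by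
  obtain ⟨κ, hκ, -⟩ :=
    H.universal C c (isEffectiveCartier_comap_of_isChartMap hFn hFI hc.isChartMap)
  exact ⟨κ, hκ, hc.isOpenImmersion hF hFI H.isEffectiveCartier
    (fun T g h hg e => H.hom_ext e (isEffectiveCartier_comap_of_isChartMap hFn hFI hg)) κ hκ⟩

/-- Where the ideal is trivial, the blow-up is an isomorphism. -/
theorem IsBlowUp.exists_of_one_mem (H : IsBlowUp I b) {U : X.Opens} (hU : IsAffineOpen U)
    (h1 : 1 ∈ I.ideal ⟨U, hU⟩) : ∃ κ : (U : Scheme.{0}) ⟶ B, κ ≫ b = U.ι ∧ IsOpenImmersion κ ∧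
      Set.range κ = b ⁻¹ᵁ U := by
  obtain ⟨κ, hκ, ho, hr⟩ := H.exists_chart (Set.finite_singleton 1) (Set.singleton_nonempty _)
    (Set.singleton_subset_iff.2 h1) (isChart_ι I hU)
  refine ⟨κ, hκ, ho, ?_⟩
  ext y
  rw [hr]
  exact ⟨fun ⟨O, hy, hO⟩ => hO.le hy, fun hy => ⟨b ⁻¹ᵁ U, hy, isChartOn_one hU le_rfl⟩⟩

theorem IsBlowUp.exists_iso (H : IsBlowUp I b) {B' : Scheme.{0}} {b' : B' ⟶ X}
    (H' : IsBlowUp I b') : ∃ e : B ≅ B', e.hom ≫ b' = b := by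
  obtain ⟨g, hg, -⟩ := H'.universal B b H.isEffectiveCartier
  obtain ⟨h, hh, -⟩ := H.universal B' b' H'.isEffectiveCartier
  refine ⟨⟨g, h, ?_, ?_⟩, hg⟩
  · have e : (g ≫ h) ≫ b = b := by rw [Category.assoc, hh, hg]
    refine H.hom_ext (e.trans (Category.id_comp _).symm) ?_
    rw [e]
    exact H.isEffectiveCartier
  · have e : (h ≫ g) ≫ b' = b' := by rw [Category.assoc, hg, hh]
    refine H'.hom_ext (e.trans (Category.id_comp _).symm) ?_
    rw [e]
    exact H'.isEffectiveCartier

theorem isBlowUp_top_id : IsBlowUp (⊤ : X.IdealSheafData) (𝟙 X) where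
  isEffectiveCartier := isEffectiveCartier_of_isCartierAt fun t => by
    obtain ⟨U, hU, htU, -⟩ := exists_isAffineOpen_le (U := ⊤) (Set.mem_univ ((𝟙 X : X ⟶ X) t))
    exact isCartierAt_of_one_mem hU htU (by simp)
  universal T f _ := ⟨f, Category.comp_id f, fun g hg => (Category.comp_id g).symm.trans hg⟩

theorem IsBlowUp.isIso_of_eq_top (H : IsBlowUp I b) (hI : I = ⊤) : IsIso b := by
  subst hI
  obtain ⟨e, he⟩ := H.exists_iso isBlowUp_top_id
  rw [Category.comp_id] at he
  rw [← he]
  infer_instance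

theorem IsBlowUp.of_iso {X' B' : Scheme.{0}} (H : IsBlowUp I b) (e : X' ≅ X) (e' : B' ≅ B) :
    IsBlowUp (I.comap e.hom) (e'.hom ≫ b ≫ e.inv) where
  isEffectiveCartier := by
    rw [← Scheme.IdealSheafData.comap_comp]
    simp only [Category.assoc, e.inv_hom_id, Category.comp_id]
    exact isEffectiveCartier_comap_comp _ H.isEffectiveCartier
  universal T f hf := by
    rw [← Scheme.IdealSheafData.comap_comp] at hf
    obtain ⟨g, hg, hu⟩ := H.universal T _ hf
    refine ⟨g ≫ e'.inv, ?_, ?_⟩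
    · simp [reassoc_of% hg]
    · intro k hk
      rw [← hu (k ≫ e'.hom), Category.assoc, e'.hom_inv_id, Category.comp_id]
      simp [← hk]

/-- Blow-ups commute with those base changes that leave the exceptional divisor Cartier. -/
theorem IsBlowUp.of_isPullback {P : Scheme.{0}} (H : IsBlowUp I b) {k : T ⟶ X} {fst : P ⟶ B}
    {snd : P ⟶ T} (hP : IsPullback fst snd b k) (hC : IsEffectiveCartier (I.comap (fst ≫ b))) :
    IsBlowUp (I.comap k) snd where
  isEffectiveCartier := by
    rwa [← Scheme.IdealSheafData.comap_comp, ← hP.w]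
  universal T' f hf := by
    rw [← Scheme.IdealSheafData.comap_comp] at hf
    obtain ⟨g, hg, hu⟩ := H.universal T' _ hf
    refine ⟨hP.lift g f hg, hP.lift_snd _ _ _, fun l hl => ?_⟩
    apply hP.hom_ext
    · rw [hP.lift_fst]
      apply hu
      rw [Category.assoc, hP.w, ← Category.assoc, hl]
    · rw [hP.lift_snd, hl]

/-- If the closed subschemes of `I` and `J` are disjoint, then every point has an affine
neighbourhood that misses one of them. -/
theorem exists_one_mem_of_sup_eq_top (hIJ : I ⊔ J = ⊤) (x : X) :
    ∃ (U : X.Opens) (hU : IsAffineOpen U), x ∈ U ∧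
      (1 ∈ I.ideal ⟨U, hU⟩ ∨ 1 ∈ J.ideal ⟨U, hU⟩) := by
  obtain ⟨U, hU, hxU, -⟩ := exists_isAffineOpen_le (U := ⊤) (Set.mem_univ x)
  have h1 : (1 : Γ(X, U)) ∈ I.ideal ⟨U, hU⟩ ⊔ J.ideal ⟨U, hU⟩ := by
    have : (I ⊔ J).ideal ⟨U, hU⟩ = I.ideal ⟨U, hU⟩ ⊔ J.ideal ⟨U, hU⟩ := by simp
    rw [← this, hIJ]
    simp
  obtain ⟨a, ha, c, hc, hac⟩ := Submodule.mem_sup.1 h1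
  have hx : x ∈ X.basicOpen a ∨ x ∈ X.basicOpen c := by
    by_contra! hcon
    have h2 := (mem_primeIdealOf hU hxU a).2 hcon.1
    have h3 := (mem_primeIdealOf hU hxU c).2 hcon.2
    have := Ideal.add_mem _ h2 h3
    rw [hac] at this
    exact (Ideal.ne_top_iff_one _).1 (hU.primeIdealOf ⟨x, hxU⟩).2.ne_top this
  have key : ∀ (K : X.IdealSheafData) (z : Γ(X, U)), z ∈ K.ideal ⟨U, hU⟩ →
      1 ∈ K.ideal ⟨X.basicOpen z, hU.basicOpen z⟩ := by
    intro K z hz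
    have := K.ideal_le_comap_ideal (U := ⟨X.basicOpen z, hU.basicOpen z⟩) (V := ⟨U, hU⟩)
      (X.basicOpen_le z) hz
    exact (Ideal.eq_top_iff_one _).1 (Ideal.eq_top_of_isUnit_mem _ this (isUnit_res_basicOpen z))
  rcases hx with hx | hx
  · exact ⟨_, hU.basicOpen a, hx, Or.inl (key I a ha)⟩
  · exact ⟨_, hU.basicOpen c, hx, Or.inr (key J c hc)⟩

theorem ideal_inf_of_one_mem {U : X.Opens} {hU : IsAffineOpen U} (h : 1 ∈ I.ideal ⟨U, hU⟩) :
    (I ⊓ J).ideal ⟨U, hU⟩ = J.ideal ⟨U, hU⟩ := by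
  have : (I ⊓ J).ideal ⟨U, hU⟩ = I.ideal ⟨U, hU⟩ ⊓ J.ideal ⟨U, hU⟩ := by simp
  rw [this, (Ideal.eq_top_iff_one _).2 h, top_inf_eq]

theorem isCartierAt_inf_iff (hIJ : I ⊔ J = ⊤) {f : T ⟶ X} {t : T} :
    IsCartierAt (I ⊓ J) f t ↔ IsCartierAt I f t ∧ IsCartierAt J f t := by
  obtain ⟨U, hU, htU, h | h⟩ := exists_one_mem_of_sup_eq_top hIJ (f t)
  · rw [isCartierAt_iff_of_ideal_eq hU htU (ideal_inf_of_one_mem h)]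
    exact ⟨fun hJ => ⟨isCartierAt_of_one_mem hU htU h, hJ⟩, fun h => h.2⟩
  · rw [inf_comm, isCartierAt_iff_of_ideal_eq hU htU (ideal_inf_of_one_mem h)]
    exact ⟨fun hI => ⟨hI, isCartierAt_of_one_mem hU htU h⟩, fun h => h.1⟩

theorem comap_one_mem {f : T ⟶ X} {U : X.Opens} {hU : IsAffineOpen U} (h : 1 ∈ I.ideal ⟨U, hU⟩)
    {V : T.Opens} (hV : IsAffineOpen V) (e : V ≤ f ⁻¹ᵁ U) : 1 ∈ (I.comap f).ideal ⟨V, hV⟩ := by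
  rw [comap_ideal I f ⟨U, hU⟩ ⟨V, hV⟩ e]
  simpa using Ideal.mem_map_of_mem (pb f e) h

/-- Blowing up two disjoint closed subschemes one after the other is the same as blowing up their
union. -/
theorem IsBlowUp.comp {B' : Scheme.{0}} {b' : B' ⟶ B} (H : IsBlowUp I b)
    (H' : IsBlowUp (J.comap b) b') (hIJ : I ⊔ J = ⊤) : IsBlowUp (I ⊓ J) (b' ≫ b) where
  isEffectiveCartier := by
    apply isEffectiveCartier_of_isCartierAt
    intro y
    have hJ : IsCartierAt J (b' ≫ b) y := by
      have := H'.isEffectiveCartier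
      rw [← Scheme.IdealSheafData.comap_comp] at this
      exact isCartierAt_of_isEffectiveCartier this y
    refine (isCartierAt_inf_iff hIJ).2 ⟨?_, hJ⟩
    obtain ⟨U, hU, hyU, h | h⟩ := exists_one_mem_of_sup_eq_top hIJ ((b' ≫ b) y)
    · exact isCartierAt_of_one_mem hU hyU h
    · -- the second blow-up is an isomorphism near `y`
      obtain ⟨V, hV, hyV, hVU⟩ := exists_isAffineOpen_le (x := b' y) (U := b ⁻¹ᵁ U) hyU
      obtain ⟨κ, hκ, ho, hr⟩ := H'.exists_of_one_mem hV (comap_one_mem h hV hVU)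
      obtain ⟨z, rfl⟩ : y ∈ Set.range κ := by
        rw [hr]
        exact hyV
      rw [← isCartierAt_iff_comp κ, ← Category.assoc, hκ]
      exact (isCartierAt_of_isEffectiveCartier H.isEffectiveCartier _).comp V.ι
  universal T f hf := by
    have hfI : IsEffectiveCartier (I.comap f) := isEffectiveCartier_of_isCartierAt fun t =>
      ((isCartierAt_inf_iff hIJ).1 (isCartierAt_of_isEffectiveCartier hf t)).1
    have hfJ : IsEffectiveCartier (J.comap f) := isEffectiveCartier_of_isCartierAt fun t =>
      ((isCartierAt_inf_iff hIJ).1 (isCartierAt_of_isEffectiveCartier hf t)).2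
    obtain ⟨g, hg, hu⟩ := H.universal T f hfI
    obtain ⟨g', hg', hu'⟩ := H'.universal T g (by
      rwa [← Scheme.IdealSheafData.comap_comp, hg])
    dsimp only at hg hg' hu hu'
    refine ⟨g', ?_, fun k hk => hu' _ (hu _ ?_)⟩
    · dsimp only
      rw [← Category.assoc, hg', hg]
    · rw [Category.assoc, hk]

end

/-! ### Adjoining a square root -/

section

variable {C D : Type} [CommRing C] [CommRing D] [Algebra C D]

/-- `D` is the free `C`-algebra `C[x] / (x² - w)`. -/
structure IsSqrtExtension (w : C) (x : D) : Prop where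
  sq : x * x = algebraMap C D w
  span : ∀ d : D, ∃ c c' : C, d = algebraMap C D c + algebraMap C D c' * x
  indep : ∀ c c' : C, algebraMap C D c + algebraMap C D c' * x = 0 → c = 0 ∧ c' = 0

namespace IsSqrtExtension

variable {w : C} {x : D}

theorem injective (H : IsSqrtExtension w x) : Function.Injective (algebraMap C D) := by
  rw [injective_iff_map_eq_zero]
  intro c hc
  exact (H.indep c 0 (by rw [hc, map_zero, zero_mul, add_zero])).1

/-- The universal property of adjoining a square root: a homomorphism from `C` extends to `D` as
soon as the image of `w` has a square root `y`. -/
theorem exists_lift (H : IsSqrtExtension w x) {E : Type} [CommRing E] (f : C →+* E) (y : E)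
    (hy : y * y = f w) : ∃ F : D →+* E, (∀ c, F (algebraMap C D c) = f c) ∧ F x = y := by
  choose r i hri using H.span
  have huniq : ∀ c c' d, d = algebraMap C D c + algebraMap C D c' * x → r d = c ∧ i d = c' := by
    intro c c' d hd
    have := H.indep (r d - c) (i d - c') (by
      rw [map_sub, map_sub]
      have := (hri d).symm.trans hd
      linear_combination this)
    exact ⟨sub_eq_zero.1 this.1, sub_eq_zero.1 this.2⟩
  have hC : ∀ c, r (algebraMap C D c) = c ∧ i (algebraMap C D c) = 0 := fun c =>
    huniq _ _ _ (by rw [map_zero, zero_mul, add_zero])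
  have hadd : ∀ d e, r (d + e) = r d + r e ∧ i (d + e) = i d + i e := by
    intro d e
    apply huniq
    rw [map_add, map_add]
    linear_combination hri d + hri e
  have hmul : ∀ d e, r (d * e) = r d * r e + i d * i e * w ∧ i (d * e) = r d * i e + i d * r e := by
    intro d e
    apply huniq
    simp only [map_add, map_mul]
    rw [← H.sq]
    conv_lhs => rw [hri d, hri e]
    ring
  refine ⟨{ toFun := fun d => f (r d) + f (i d) * y, map_one' := ?_, map_mul' := ?_,
            map_zero' := ?_, map_add' := ?_ }, fun c => ?_, ?_⟩
  · have := hC 1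
    rw [map_one] at this
    rw [this.1, this.2, map_one, map_zero, zero_mul, add_zero]
  · intro d e
    rw [(hmul d e).1, (hmul d e).2]
    simp only [map_add, map_mul]
    rw [← hy]
    ring
  · have := hC 0
    rw [map_zero] at this
    rw [this.1, this.2, map_zero, zero_mul, add_zero]
  · intro d e
    rw [(hadd d e).1, (hadd d e).2, map_add, map_add]
    ring
  · change f (r _) + f (i _) * y = _
    rw [(hC c).1, (hC c).2, map_zero, zero_mul, add_zero]
  · change f (r _) + f (i _) * y = _
    obtain ⟨h1, h2⟩ := huniq 0 1 x (by rw [map_zero, map_one, zero_add, one_mul])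
    rw [h1, h2, map_zero, map_one, zero_add, one_mul]

theorem ringHom_ext (H : IsSqrtExtension w x) {E : Type} [CommRing E] {F G : D →+* E}
    (h : ∀ c, F (algebraMap C D c) = G (algebraMap C D c)) (hx : F x = G x) : F = G := by
  ext d
  obtain ⟨c, c', rfl⟩ := H.span d
  simp only [map_add, map_mul, h, hx]

theorem span_eq_top (H : IsSqrtExtension w x) : Submodule.span C {1, x} = ⊤ := by
  rw [eq_top_iff]
  rintro d -
  obtain ⟨c, c', rfl⟩ := H.span d
  refine add_mem ?_ ?_
  · rw [Algebra.algebraMap_eq_smul_one]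
    exact Submodule.smul_mem _ _ (Submodule.subset_span (by simp))
  · rw [← Algebra.smul_def]
    exact Submodule.smul_mem _ _ (Submodule.subset_span (by simp))

/-- The basis `1, x`. -/
def basis (H : IsSqrtExtension w x) : Module.Basis (Fin 2) C D :=
  Module.Basis.mk (v := ![1, x])
    (by
      rw [LinearIndependent.pair_iff]
      intro c c' h
      rw [Algebra.smul_def, Algebra.smul_def, mul_one] at h
      exact H.indep c c' h)
    (by
      rw [Matrix.range_cons, Matrix.range_cons, Matrix.range_empty, Set.union_empty,
        Set.singleton_union, H.span_eq_top])

theorem moduleFinite (H : IsSqrtExtension w x) : Module.Finite C D := .of_basis H.basis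

theorem moduleFree (H : IsSqrtExtension w x) : Module.Free C D := .of_basis H.basis

theorem finrank_eq [Nontrivial C] (H : IsSqrtExtension w x) : Module.finrank C D = 2 := by
  rw [Module.finrank_eq_card_basis H.basis, Fintype.card_fin]

/-- If `D = C[x] / (x² - w)` is formally smooth, so is `C`: to lift a map `C → T / J`, lift the
induced map from `D` to `T[√w]` and take the rational part of the result. -/
theorem formallySmooth {k : Type} [CommRing k] [Algebra k C] [Algebra k D] [IsScalarTower k C D]
    (H : IsSqrtExtension w x) [Algebra.FormallySmooth k D] : Algebra.FormallySmooth k C := by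
  rw [Algebra.FormallySmooth.iff_comp_surjective]
  intro T _ _ J hJ f
  obtain ⟨w', hw'⟩ := Ideal.Quotient.mk_surjective (f w)
  let q : QuadraticAlgebra T w' 0 →ₐ[k] QuadraticAlgebra (T ⧸ J) (f w) 0 :=
    { toFun := fun z => ⟨Ideal.Quotient.mk J z.re, Ideal.Quotient.mk J z.im⟩
      map_one' := by ext <;> simp [QuadraticAlgebra.re_one, QuadraticAlgebra.im_one]
      map_mul' := fun z z' => by
        ext
        · simp [← hw']
        · simp
      map_zero' := by ext <;> simp
      map_add' := fun z z' => by ext <;> simp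
      commutes' := fun r => by
        ext
        · rfl
        · exact map_zero _ }
  have hq : Function.Surjective q := by
    rintro ⟨a, b⟩
    obtain ⟨a, rfl⟩ := Ideal.Quotient.mk_surjective a
    obtain ⟨b, rfl⟩ := Ideal.Quotient.mk_surjective b
    exact ⟨⟨a, b⟩, rfl⟩
  have hJ' : ∀ a ∈ J, ∀ b ∈ J, a * b = 0 := fun a ha b hb => by
    have : a * b ∈ J ^ 2 := by rw [pow_two]; exact Ideal.mul_mem_mul ha hb
    rwa [hJ] at this
  have hker : ∀ z,
      z ∈ RingHom.ker (q : QuadraticAlgebra T w' 0 →+* QuadraticAlgebra (T ⧸ J) (f w) 0) →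
      z.re ∈ J ∧ z.im ∈ J := by
    intro z hz
    have h1 : Ideal.Quotient.mk J z.re = 0 := congrArg QuadraticAlgebra.re hz
    have h2 : Ideal.Quotient.mk J z.im = 0 := congrArg QuadraticAlgebra.im hz
    exact ⟨Ideal.Quotient.eq_zero_iff_mem.1 h1, Ideal.Quotient.eq_zero_iff_mem.1 h2⟩
  have hnil : IsNilpotent
      (RingHom.ker (q : QuadraticAlgebra T w' 0 →+* QuadraticAlgebra (T ⧸ J) (f w) 0)) := by
    refine ⟨2, ?_⟩
    rw [pow_two, Ideal.zero_eq_bot, eq_bot_iff, Ideal.mul_le]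
    intro a ha b hb
    obtain ⟨h1, h2⟩ := hker a ha
    obtain ⟨h3, h4⟩ := hker b hb
    rw [Ideal.mem_bot]
    ext
    · rw [QuadraticAlgebra.re_mul, hJ' _ h1 _ h3, mul_assoc, hJ' _ h2 _ h4]
      simp
    · rw [QuadraticAlgebra.im_mul, hJ' _ h1 _ h4, hJ' _ h2 _ h3]
      simp
  obtain ⟨F, hF1, hF2⟩ := H.exists_lift
    ((algebraMap (T ⧸ J) (QuadraticAlgebra (T ⧸ J) (f w) 0)).comp f.toRingHom) ⟨0, 1⟩ (by
      ext <;> simp)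
  let F' : D →ₐ[k] QuadraticAlgebra (T ⧸ J) (f w) 0 := { F with
    commutes' := fun r => by
      change F (algebraMap k D r) = _
      rw [IsScalarTower.algebraMap_apply k C D, hF1]
      change (algebraMap (T ⧸ J) (QuadraticAlgebra (T ⧸ J) (f w) 0)) (f (algebraMap k C r)) = _
      rw [f.commutes]
      rfl }
  let G := Algebra.FormallySmooth.liftOfSurjective F' q hq hnil
  have hG : ∀ d, q (G d) = F d := Algebra.FormallySmooth.liftOfSurjective_apply F' q hq hnil
  have hre : ∀ c, Ideal.Quotient.mk J (G (algebraMap C D c)).re = f c := by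
    intro c
    have := congrArg QuadraticAlgebra.re (hG (algebraMap C D c))
    rw [hF1] at this
    exact this
  have him : ∀ c, (G (algebraMap C D c)).im ∈ J := by
    intro c
    have := congrArg QuadraticAlgebra.im (hG (algebraMap C D c))
    rw [hF1] at this
    exact Ideal.Quotient.eq_zero_iff_mem.1 this
  refine ⟨{ toFun := fun c => (G (algebraMap C D c)).re, map_one' := ?_, map_mul' := ?_,
            map_zero' := ?_, map_add' := ?_, commutes' := ?_ }, ?_⟩
  · rw [map_one, map_one]; rfl
  · intro a b
    rw [map_mul, map_mul, QuadraticAlgebra.re_mul, mul_assoc, hJ' _ (him a) _ (him b), mul_zero,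
      add_zero]
  · rw [map_zero, map_zero]; rfl
  · intro a b
    rw [map_add, map_add]; rfl
  · intro r
    rw [← IsScalarTower.algebraMap_apply k C D, G.commutes]
    rfl
  · ext c
    exact hre c

theorem finiteType {k : Type} [CommRing k] [IsNoetherianRing k] [Algebra k C] [Algebra k D]
    [IsScalarTower k C D] (H : IsSqrtExtension w x) [hD : Algebra.FiniteType k D] :
    Algebra.FiniteType k C :=
  ⟨fg_of_fg_of_fg k C D hD.1 H.moduleFinite.1 H.injective⟩

theorem smooth {k : Type} [CommRing k] [IsNoetherianRing k] [Algebra k C] [Algebra k D]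
    [IsScalarTower k C D] (H : IsSqrtExtension w x) [Algebra.Smooth k D] : Algebra.Smooth k C where
  formallySmooth := H.formallySmooth
  finitePresentation := Algebra.FinitePresentation.of_finiteType.1 H.finiteType

/-- Adjoining a square root of a unit is étale if `2` is invertible. -/
theorem formallyEtale (H : IsSqrtExtension w x) (hx : IsUnit x) (h2 : IsUnit (2 : D)) :
    Algebra.FormallyEtale C D := by
  rw [Algebra.FormallyEtale.iff_comp_bijective]
  intro T _ _ J hJ
  have hJ' : ∀ a ∈ J, ∀ b ∈ J, a * b = 0 := fun a ha b hb => by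
    have : a * b ∈ J ^ 2 := by rw [pow_two]; exact Ideal.mul_mem_mul ha hb
    rwa [hJ] at this
  have hJn : ∀ a ∈ J, IsNilpotent a := fun a ha => ⟨2, by rw [pow_two, hJ' a ha a ha]⟩
  constructor
  · intro f g hfg
    have hsub : ∀ d, f d - g d ∈ J := fun d => Ideal.Quotient.eq.1 (congr($hfg d))
    have e1 : f x * f x = algebraMap C T w := by rw [← map_mul, H.sq, f.commutes]
    have e2 : g x * g x = algebraMap C T w := by rw [← map_mul, H.sq, g.commutes]
    -- two square roots that agree modulo `J` are equal
    have e3 : (2 * f x) * (f x - g x) = 0 := by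
      have := hJ' _ (hsub x) _ (hsub x)
      linear_combination this + e1 - e2
    have hu : IsUnit (2 * f x) := by
      have := (h2.mul hx).map f
      rwa [map_mul, map_ofNat] at this
    have e4 : f x = g x := sub_eq_zero.1 (hu.mul_right_eq_zero.1 e3)
    have := H.ringHom_ext (F := f.toRingHom) (G := g.toRingHom)
      (fun c => (f.commutes c).trans (g.commutes c).symm) e4
    ext d
    exact congr($this d)
  · intro f
    obtain ⟨y, hy⟩ := Ideal.Quotient.mk_surjective (f x)
    have hyu : IsUnit (2 * y) := by
      have h1 : IsUnit (Ideal.Quotient.mk J (2 * y)) := by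
        have := (h2.mul hx).map f
        rwa [map_mul, map_ofNat, ← hy, ← map_ofNat (Ideal.Quotient.mk J), ← map_mul] at this
      obtain ⟨u, hu⟩ := h1.exists_right_inv
      obtain ⟨u, rfl⟩ := Ideal.Quotient.mk_surjective u
      rw [← map_mul, ← map_one (Ideal.Quotient.mk J), Ideal.Quotient.eq] at hu
      have := (hJn _ hu).isUnit_add_one
      rw [sub_add_cancel] at this
      exact isUnit_of_mul_isUnit_left this
    obtain ⟨v, hv⟩ := hyu.exists_right_inv
    have he : y * y - algebraMap C T w ∈ J := by
      rw [← Ideal.Quotient.eq, map_mul, hy, ← map_mul, H.sq, f.commutes]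
      rfl
    set e := y * y - algebraMap C T w with hedef
    -- Newton's correction of the approximate square root `y`
    have hroot : (y - v * e) * (y - v * e) = algebraMap C T w := by
      have h1 := hJ' _ he _ he
      linear_combination (v * v) * h1 - e * hv + hedef
    obtain ⟨F, hF1, hF2⟩ := H.exists_lift (algebraMap C T) _ hroot
    refine ⟨{ F with commutes' := hF1 }, ?_⟩
    have hcomp := H.ringHom_ext (F := (Ideal.Quotient.mk J).comp F) (G := f.toRingHom)
      (fun c => by
        rw [RingHom.comp_apply, hF1]
        exact (f.commutes c).symm)
      (by
        rw [RingHom.comp_apply, hF2, map_sub, map_mul, Ideal.Quotient.eq_zero_iff_mem.2 he,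
          mul_zero, sub_zero, hy]
        rfl)
    ext d
    exact congr($hcomp d)

theorem etale (H : IsSqrtExtension w x) (hx : IsUnit x) (h2 : IsUnit (2 : D)) :
    Algebra.Etale C D where
  formallyEtale := H.formallyEtale hx h2
  finitePresentation := by
    have := H.moduleFinite
    have := H.moduleFree
    have := Module.finitePresentation_of_projective C D
    exact Algebra.FinitePresentation.of_finitePresentation C D

/-- The extension of a radical ideal is radical if `x` and `2` are invertible. -/
theorem isRadical_map (H : IsSqrtExtension w x) (hx : IsUnit x) (h2 : IsUnit (2 : C)) {K : Ideal C}
    (hK : K.IsRadical) : (K.map (algebraMap C D)).IsRadical := by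
  have hmem : ∀ c c', algebraMap C D c + algebraMap C D c' * x ∈ K.map (algebraMap C D) →
      c ∈ K ∧ c' ∈ K := by
    -- the elements with both coordinates in `K` form an ideal
    let K' : Ideal D :=
      { carrier := {d | ∃ c ∈ K, ∃ c' ∈ K, d = algebraMap C D c + algebraMap C D c' * x}
        zero_mem' := ⟨0, zero_mem _, 0, zero_mem _, by simp⟩
        add_mem' := by
          rintro _ _ ⟨c, hc, c', hc', rfl⟩ ⟨b, hb, b', hb', rfl⟩
          exact ⟨c + b, add_mem hc hb, c' + b', add_mem hc' hb', by rw [map_add, map_add]; ring⟩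
        smul_mem' := by
          rintro d _ ⟨c, hc, c', hc', rfl⟩
          obtain ⟨b, b', rfl⟩ := H.span d
          refine ⟨b * c + b' * c' * w, add_mem (K.mul_mem_left _ hc)
            (K.mul_mem_right _ (K.mul_mem_left _ hc')), b * c' + b' * c,
            add_mem (K.mul_mem_left _ hc') (K.mul_mem_left _ hc), ?_⟩
          simp only [map_add, map_mul, smul_eq_mul]
          rw [← H.sq]
          ring }
    have hle : K.map (algebraMap C D) ≤ K' := by
      rw [Ideal.map_le_iff_le_comap]
      exact fun c hc => ⟨c, hc, 0, zero_mem _, by simp⟩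
    intro c c' h
    obtain ⟨b, hb, b', hb', e⟩ := hle h
    obtain ⟨h1, h2⟩ := H.indep (c - b) (c' - b') (by
      rw [map_sub, map_sub]
      linear_combination e)
    rw [sub_eq_zero.1 h1, sub_eq_zero.1 h2]
    exact ⟨hb, hb'⟩
  obtain ⟨σ, hσ1, hσ2⟩ := H.exists_lift (algebraMap C D) (-x) (by rw [neg_mul_neg, H.sq])
  have hσK : ∀ d ∈ K.map (algebraMap C D), σ d ∈ K.map (algebraMap C D) := by
    intro d hd
    have hle : K.map (algebraMap C D) ≤ (K.map (algebraMap C D)).comap σ := by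
      rw [Ideal.map_le_iff_le_comap]
      intro c hc
      rw [Ideal.mem_comap, Ideal.mem_comap, hσ1]
      exact Ideal.mem_map_of_mem _ hc
    exact hle hd
  have h2' : IsUnit (algebraMap C D 2) := h2.map _
  have hC : ∀ c, algebraMap C D c ∈ (K.map (algebraMap C D)).radical → c ∈ K := by
    rintro c ⟨n, hn⟩
    rw [← map_pow] at hn
    have := (hmem (c ^ n) 0 (by rwa [map_zero, zero_mul, add_zero])).1
    exact hK ⟨n, this⟩
  intro d hd
  have hσd : σ d ∈ (K.map (algebraMap C D)).radical := by
    obtain ⟨n, hn⟩ := hd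
    exact ⟨n, by rw [← map_pow]; exact hσK _ hn⟩
  obtain ⟨c, c', rfl⟩ := H.span d
  rw [map_add, map_mul, hσ1, hσ1, hσ2] at hσd
  have e1 : algebraMap C D 2 * algebraMap C D c ∈ (K.map (algebraMap C D)).radical := by
    have := add_mem hd hσd
    convert this using 1
    rw [map_ofNat]
    ring
  have e2 : algebraMap C D 2 * (x * algebraMap C D c') ∈ (K.map (algebraMap C D)).radical := by
    have := sub_mem hd hσd
    convert this using 1
    rw [map_ofNat]
    ring
  have hc := hC c ((Ideal.unit_mul_mem_iff_mem _ h2').1 e1)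
  have hc' := hC c' ((Ideal.unit_mul_mem_iff_mem _ hx).1 ((Ideal.unit_mul_mem_iff_mem _ h2').1 e2))
  exact add_mem (Ideal.mem_map_of_mem _ hc) (Ideal.mul_mem_right _ _ (Ideal.mem_map_of_mem _ hc'))

end IsSqrtExtension

end

/-! ### The free locus of an involution -/

theorem of_forall_exists_isOpenImmersion (P : MorphismProperty Scheme.{0})
    [IsZariskiLocalAtSource P] {X Y : Scheme.{0}} {f : X ⟶ Y}
    (H : ∀ x : X, ∃ (Z : Scheme.{0}) (a : Z ⟶ X) (_ : IsOpenImmersion a),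
      x ∈ Set.range a ∧ P (a ≫ f)) : P f := by
  choose Z a ha hx hP using H
  refine IsZariskiLocalAtSource.of_iSup_eq_top (fun x => (a x).opensRange) ?_ fun x => ?_
  · ext x
    simp only [Opens.coe_iSup, Set.mem_iUnion, Opens.coe_top, Set.mem_univ, iff_true]
    exact ⟨x, hx x⟩
  · have := IsZariskiLocalAtSource.comp (hP x) (a x).isoOpensRange.inv
    rwa [Scheme.Hom.isoOpensRange_inv_comp_assoc] at this

theorem isZariskiLocalAtSource_etale : IsZariskiLocalAtSource @Etale.{0} :=
  HasRingHomProperty.instIsZariskiLocalAtSource (P := @Etale.{0}) (Q := RingHom.Etale)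

theorem isZariskiLocalAtSource_smooth : IsZariskiLocalAtSource @Smooth.{0} :=
  HasRingHomProperty.instIsZariskiLocalAtSource (P := @Smooth.{0}) (Q := RingHom.Smooth)

section

variable {X Q : Scheme.{0}} {g : X ⟶ X} {π : X ⟶ Q}

/-- An invertible function that is mapped to its negative by the involution.  Its existence shows
that the involution acts freely over `O`. -/
structure IsFreeSection (h : g ≫ π = π) {O : Q.Opens} (a : Γ(X, π ⁻¹ᵁ O)) : Prop where
  isUnit : IsUnit a
  pb_eq : pb g (le_preimage_preimage h O) a = -a

theorem IsFreeSection.res {h : g ≫ π = π} {O O' : Q.Opens} {a : Γ(X, π ⁻¹ᵁ O)}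
    (H : IsFreeSection h a) (hO : O' ≤ O) :
    IsFreeSection h (O := O') (EnriquesQuotient.res (π.preimage_mono hO) a) where
  isUnit := H.isUnit.map _
  pb_eq := by
    have := congrArg (EnriquesQuotient.res (π.preimage_mono hO)) H.pb_eq
    rw [res_pb, map_neg] at this
    rw [pb_res]
    exact this

/-- The open set over which the involution acts freely. -/
def freeLocus (h : g ≫ π = π) : Q.Opens :=
  sSup {O | IsAffineOpen O ∧ ∃ a : Γ(X, π ⁻¹ᵁ O), IsFreeSection h a}

theorem exists_isFreeSection {h : g ≫ π = π} {q : Q} (hq : q ∈ freeLocus h) {U : Q.Opens}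
    (hqU : q ∈ U) : ∃ O : Q.Opens, IsAffineOpen O ∧ q ∈ O ∧ O ≤ U ∧
      ∃ a : Γ(X, π ⁻¹ᵁ O), IsFreeSection h a := by
  obtain ⟨O, ⟨-, a, ha⟩, hqO⟩ := Opens.mem_sSup.1 hq
  obtain ⟨O', hO', hqO', hle⟩ := exists_isAffineOpen_le (x := q) (U := O ⊓ U) ⟨hqO, hqU⟩
  exact ⟨O', hO', hqO', hle.trans inf_le_right, _, ha.res (hle.trans inf_le_left)⟩

theorem isUnit_two_res (h2 : IsUnit (2 : Γ(Q, ⊤))) (O : Q.Opens) : IsUnit (2 : Γ(Q, O)) := by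
  have := h2.map (res (le_top : O ≤ ⊤))
  rwa [map_ofNat] at this

/-- Where the involution is free, the quotient map adjoins a square root. -/
theorem IsFreeSection.exists_isSqrtExtension {h : g ≫ π = π} (hg : g ≫ g = 𝟙 X) {O : Q.Opens}
    (HO : HasInvariantSections h O) (h2 : IsUnit (2 : Γ(Q, O))) {a : Γ(X, π ⁻¹ᵁ O)}
    (ha : IsFreeSection h a) : ∃ w, @IsSqrtExtension Γ(Q, O) Γ(X, π ⁻¹ᵁ O) _ _
      (pb π (U := O) (V := π ⁻¹ᵁ O) le_rfl).toAlgebra w a := by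
  let _ := (pb π (U := O) (V := π ⁻¹ᵁ O) le_rfl).toAlgebra
  have hinv : ∀ c, pb g (le_preimage_preimage h O) (pb π (U := O) (V := π ⁻¹ᵁ O) le_rfl c) =
      pb π (U := O) (V := π ⁻¹ᵁ O) le_rfl c := fun c => by
    rw [pb_pb, pb_congr h]
  obtain ⟨t, ht⟩ := h2.exists_right_inv
  have ht' := congrArg (pb π (U := O) (V := π ⁻¹ᵁ O) le_rfl) ht
  rw [map_mul, map_one, map_ofNat] at ht'
  obtain ⟨b, hb⟩ := ha.isUnit.exists_right_inv
  have hgb : pb g (le_preimage_preimage h O) b = -b := by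
    have := congrArg (pb g (le_preimage_preimage h O)) hb
    rw [map_mul, map_one, ha.pb_eq] at this
    linear_combination (-b) * this - pb g (le_preimage_preimage h O) b * hb
  obtain ⟨w, hw⟩ := HO.exists_pb_eq (a * a) (by rw [map_mul, ha.pb_eq, neg_mul_neg])
  refine ⟨w, hw.symm, fun d => ?_, fun c c' hcc => ?_⟩
  · obtain ⟨c, hc⟩ := HO.exists_add hg d
    obtain ⟨c', hc'⟩ := HO.exists_pb_eq (b * (d - pb g (le_preimage_preimage h O) d)) (by
      rw [map_mul, map_sub, pb_pb_of_involutive hg, hgb]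
      ring)
    refine ⟨t * c, t * c', ?_⟩
    change d = pb π _ _ + pb π _ _ * a
    rw [map_mul, map_mul, hc, hc']
    linear_combination (-d) * ht' - pb π (U := O) (V := π ⁻¹ᵁ O) le_rfl t *
      (d - pb g (le_preimage_preimage h O) d) * hb
  · change pb π _ c + pb π _ c' * a = 0 at hcc
    have h1 := congrArg (pb g (le_preimage_preimage h O)) hcc
    rw [map_add, map_mul, hinv, hinv, ha.pb_eq, map_zero] at h1
    have e1 : pb π (U := O) (V := π ⁻¹ᵁ O) le_rfl c = 0 := by
      linear_combination (-pb π (U := O) (V := π ⁻¹ᵁ O) le_rfl c) * ht' +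
        pb π (U := O) (V := π ⁻¹ᵁ O) le_rfl t * (hcc + h1)
    have e2 : pb π (U := O) (V := π ⁻¹ᵁ O) le_rfl c' = 0 := by
      rw [e1, zero_add] at hcc
      exact ha.isUnit.mul_left_eq_zero.1 hcc
    exact ⟨HO.injective (e1.trans (map_zero _).symm), HO.injective (e2.trans (map_zero _).symm)⟩

/-- The image of a point that is moved by the involution lies in the free locus: if the function `a`
vanishes at exactly one of `x` and `g x`, then `a - g a` is an anti-invariant function vanishing at
neither of them. -/
theorem mem_freeLocus_of_apply_ne (H : IsGeomQuotient g π) (hg : g ≫ g = 𝟙 X) [IsAffineHom π]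
    {x : X} (hx : g x ≠ x) : π x ∈ freeLocus H.invariant := by
  obtain ⟨O, hO, hxO, -⟩ := exists_isAffineOpen_le (U := ⊤) (Set.mem_univ (π x))
  have hU : IsAffineOpen (π ⁻¹ᵁ O) := IsAffineHom.isAffine_preimage O hO
  have hle := le_preimage_preimage H.invariant O
  have hxU : x ∈ π ⁻¹ᵁ O := hxO
  have hgxU : g x ∈ π ⁻¹ᵁ O := hle hxU
  -- a function vanishing at exactly one of `x` and `g x`
  have hex : ∃ a : Γ(X, π ⁻¹ᵁ O), x ∈ X.basicOpen a ∧ g x ∉ X.basicOpen a := by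
    by_contra! hcon
    apply hx
    apply eq_of_primeIdealOf_eq hU hgxU hxU
    ext a
    rw [mem_primeIdealOf, mem_primeIdealOf, not_iff_not]
    refine ⟨fun h => ?_, hcon a⟩
    have h1 : x ∈ X.basicOpen (pb g hle a) := (mem_basicOpen_pb g hle a hxU).2 h
    have h2 := (mem_basicOpen_pb g hle a hgxU).1 (hcon _ h1)
    rwa [apply_apply_of_involutive hg] at h2
  obtain ⟨a, hxa, hgxa⟩ := hex
  set d := a - pb g hle a with hd
  have hgd : pb g hle d = -d := by
    rw [hd, map_sub, pb_pb_of_involutive hg]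
    ring
  have hxd : x ∈ X.basicOpen d := by
    by_contra hcon
    have h1 := (mem_primeIdealOf hU hxU d).2 hcon
    have h2 : pb g hle a ∈ (hU.primeIdealOf ⟨x, hxU⟩).asIdeal := by
      rwa [mem_primeIdealOf, mem_basicOpen_pb g hle a hxU]
    have h3 := add_mem h1 h2
    rw [hd, sub_add_cancel, mem_primeIdealOf] at h3
    exact h3 hxa
  obtain ⟨b, hb⟩ := (H.hasInvariantSections O).exists_pb_eq (d * d) (by
    rw [map_mul, hgd, neg_mul_neg])
  have hpre : π ⁻¹ᵁ (Q.basicOpen b) ≤ X.basicOpen d := by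
    intro y hy
    have hyO : y ∈ π ⁻¹ᵁ O := Q.basicOpen_le b hy
    have := (mem_basicOpen_pb π (le_refl (π ⁻¹ᵁ O)) b hyO).2 hy
    rw [hb, mem_basicOpen_mul] at this
    exact this.1
  have hxb : π x ∈ Q.basicOpen b := by
    rw [← mem_basicOpen_pb π (le_refl (π ⁻¹ᵁ O)) b hxU, hb, mem_basicOpen_mul]
    exact ⟨hxd, hxd⟩
  refine Opens.mem_sSup.2 ⟨Q.basicOpen b, ⟨hO.basicOpen b,
    res (π.preimage_mono (Q.basicOpen_le b)) d, isUnit_res_of_le_basicOpen d hpre, ?_⟩, hxb⟩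
  have := congrArg (res (π.preimage_mono (Q.basicOpen_le b))) hgd
  rw [res_pb, map_neg] at this
  rw [pb_res]
  exact this

/-- Over the free locus, the quotient map is étale. -/
theorem etale_fromSpec_comp (H : IsGeomQuotient g π) (hg : g ≫ g = 𝟙 X)
    (h2 : IsUnit (2 : Γ(Q, ⊤))) {O : Q.Opens} (hO : IsAffineOpen O) (hU : IsAffineOpen (π ⁻¹ᵁ O))
    {a : Γ(X, π ⁻¹ᵁ O)} (ha : IsFreeSection H.invariant a) : Etale (hU.fromSpec ≫ π) := by
  obtain ⟨w, hw⟩ := ha.exists_isSqrtExtension hg (H.hasInvariantSections O) (isUnit_two_res h2 O)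
  have h2' : IsUnit (2 : Γ(X, π ⁻¹ᵁ O)) := by
    have := (isUnit_two_res h2 O).map (pb π (U := O) (V := π ⁻¹ᵁ O) le_rfl)
    rwa [map_ofNat] at this
  rw [← hO.SpecMap_appLE_fromSpec π hU le_rfl]
  have : Etale (Spec.map (π.appLE O (π ⁻¹ᵁ O) le_rfl)) := by
    rw [HasRingHomProperty.Spec_iff (P := @Etale)]
    exact @IsSqrtExtension.etale _ _ _ _ (_) _ _ hw ha.isUnit h2'
  infer_instance

theorem etale_of_freeLocus_eq_top (H : IsGeomQuotient g π) (hg : g ≫ g = 𝟙 X) [IsAffineHom π]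
    (h2 : IsUnit (2 : Γ(Q, ⊤))) (hfree : freeLocus H.invariant = ⊤) : Etale π := by
  have := isZariskiLocalAtSource_etale
  apply of_forall_exists_isOpenImmersion @Etale
  intro x
  obtain ⟨O, hO, hxO, -, a, ha⟩ := exists_isFreeSection (h := H.invariant) (q := π x) (U := ⊤)
    (hfree.ge trivial) trivial
  have hU : IsAffineOpen (π ⁻¹ᵁ O) := IsAffineHom.isAffine_preimage O hO
  refine ⟨_, hU.fromSpec, inferInstance, ?_, etale_fromSpec_comp H hg h2 hO hU ha⟩
  rw [hU.range_fromSpec]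
  exact hxO


end

section

variable {X Q : Scheme.{0}} {g : X ⟶ X} {π : X ⟶ Q}

theorem IsGeomQuotient.isIntegralHom (H : IsGeomQuotient g π) (hg : g ≫ g = 𝟙 X)
    [IsAffineHom π] : IsIntegralHom π := by
  refine isIntegralHom_of_affine H.invariant hg fun q => ?_
  obtain ⟨O, hO, hqO, -⟩ := exists_isAffineOpen_le (U := ⊤) (Set.mem_univ q)
  exact ⟨O, hqO, hO, IsAffineHom.isAffine_preimage O hO, H.hasInvariantSections O⟩

theorem isFinite_of_freeLocus_eq_top (H : IsGeomQuotient g π) (hg : g ≫ g = 𝟙 X) [IsAffineHom π]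
    (h2 : IsUnit (2 : Γ(Q, ⊤))) (hfree : freeLocus H.invariant = ⊤) : IsFinite π := by
  have := etale_of_freeLocus_eq_top H hg h2 hfree
  exact (IsFinite.iff_isIntegralHom_and_locallyOfFiniteType π).2
    ⟨H.isIntegralHom hg, inferInstance⟩

/-- The quotient by a free involution has degree `2`, as locally a square root is adjoined. -/
theorem finrank_eq_two_of_freeLocus_eq_top (H : IsGeomQuotient g π) (hg : g ≫ g = 𝟙 X)
    [IsAffineHom π] (h2 : IsUnit (2 : Γ(Q, ⊤))) (hfree : freeLocus H.invariant = ⊤) (q : Q) :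
    π.finrank q = 2 := by
  have := etale_of_freeLocus_eq_top H hg h2 hfree
  have := isFinite_of_freeLocus_eq_top H hg h2 hfree
  obtain ⟨O, hO, hqO, -, a, ha⟩ := exists_isFreeSection (h := H.invariant) (q := q) (U := ⊤)
    (hfree.ge trivial) trivial
  have hU : IsAffineOpen (π ⁻¹ᵁ O) := IsAffineHom.isAffine_preimage O hO
  obtain ⟨w, hw⟩ := ha.exists_isSqrtExtension hg (H.hasInvariantSections O) (isUnit_two_res h2 O)
  have hpb : IsPullback (Spec.map (π.appLE O (π ⁻¹ᵁ O) le_rfl)) hU.fromSpec hO.fromSpec π := by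
    apply IsOpenImmersion.isPullback
    · exact (hO.SpecMap_appLE_fromSpec π hU le_rfl).symm
    · rw [hO.opensRange_fromSpec, hU.opensRange_fromSpec]
  have h1 := Scheme.Hom.finrank_of_isPullback _ _ _ _ hpb.flip (specPt hO hqO)
  rw [fromSpec_specPt] at h1
  rw [← h1]
  let _ : Algebra Γ(Q, O) Γ(X, π ⁻¹ᵁ O) := (pb π (U := O) (V := π ⁻¹ᵁ O) le_rfl).toAlgebra
  have := hw.moduleFinite
  have := hw.moduleFree
  have : Nontrivial Γ(Q, O) := (specPt hO hqO).nontrivial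
  have h3 := Scheme.Hom.finrank_SpecMap_algebraMap Γ(Q, O) Γ(X, π ⁻¹ᵁ O) (specPt hO hqO)
  rw [Module.rankAtStalk_eq_finrank_of_free] at h3
  exact h3.trans hw.finrank_eq

/-! ### Smooth points -/

/-- `s` is smooth at `x`. -/
def IsSmoothAt {S : Scheme.{0}} (s : X ⟶ S) (x : X) : Prop :=
  ∃ U : X.Opens, x ∈ U ∧ Smooth (U.ι ≫ s)

theorem mem_nonsingularLocus_iff {X : CScheme} {x : X.left} :
    x ∈ nonsingularLocus X ↔ IsSmoothAt X.str x := by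
  rw [nonsingularLocus, Opens.mem_sSup]
  exact ⟨fun ⟨U, h, hx⟩ => ⟨U, hx, h⟩, fun ⟨U, hx, h⟩ => ⟨U, h, hx⟩⟩

variable {S T : Scheme.{0}} {s : X ⟶ S}

theorem isSmoothAt_of_isOpenImmersion (a : T ⟶ X) [IsOpenImmersion a] {t : T}
    (h : Smooth (a ≫ s)) : IsSmoothAt s (a t) := by
  refine ⟨a.opensRange, ⟨t, rfl⟩, ?_⟩
  rw [← Scheme.Hom.isoOpensRange_inv_comp_assoc]
  infer_instance

theorem IsSmoothAt.of_comp (a : T ⟶ X) [IsOpenImmersion a] {t : T} (h : IsSmoothAt (a ≫ s) t) :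
    IsSmoothAt s (a t) := by
  obtain ⟨U, ht, hU⟩ := h
  rw [← Category.assoc] at hU
  exact isSmoothAt_of_isOpenImmersion (U.ι ≫ a) (t := (⟨t, ht⟩ : U)) hU

theorem IsSmoothAt.comp (f : T ⟶ X) [Etale f] {t : T} (h : IsSmoothAt s (f t)) :
    IsSmoothAt (f ≫ s) t := by
  obtain ⟨U, ht, hU⟩ := h
  refine ⟨f ⁻¹ᵁ U, ht, ?_⟩
  have : Etale (f ∣_ U) := MorphismProperty.of_isPullback (isPullback_morphismRestrict f U).flip
    inferInstance
  rw [← morphismRestrict_ι_assoc]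
  infer_instance

theorem isSmoothAt_comp_iff (a : T ⟶ X) [IsOpenImmersion a] {t : T} :
    IsSmoothAt (a ≫ s) t ↔ IsSmoothAt s (a t) :=
  ⟨fun h => h.of_comp, fun h => h.comp a⟩

theorem smooth_of_isSmoothAt (h : ∀ x, IsSmoothAt s x) : Smooth s := by
  have := isZariskiLocalAtSource_smooth
  apply of_forall_exists_isOpenImmersion @Smooth
  intro x
  obtain ⟨U, hx, hU⟩ := h x
  exact ⟨U, U.ι, inferInstance, by rwa [Scheme.Opens.range_ι], hU⟩

theorem isSmoothAt_of_smooth [Smooth s] (x : X) : IsSmoothAt s x :=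
  ⟨⊤, trivial, inferInstance⟩

/-- A free quotient of a smooth scheme is smooth. -/
theorem isSmoothAt_of_mem_freeLocus (H : IsGeomQuotient g π) (hg : g ≫ g = 𝟙 X) [IsAffineHom π]
    (h2 : IsUnit (2 : Γ(Q, ⊤))) {s : Q ⟶ Spec (CommRingCat.of ℂ)} {q : Q}
    (hq : q ∈ freeLocus H.invariant) (hs : ∀ x, π x = q → IsSmoothAt (π ≫ s) x) :
    IsSmoothAt s q := by
  let N : X.Opens := sSup {U : X.Opens | Smooth (U.ι ≫ π ≫ s)}
  have hN : ∀ x, x ∈ N ↔ IsSmoothAt (π ≫ s) x := fun x => by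
    rw [Opens.mem_sSup]
    exact ⟨fun ⟨U, h, hx⟩ => ⟨U, hx, h⟩, fun ⟨U, hx, h⟩ => ⟨U, h, hx⟩⟩
  -- the image of the non-smooth locus is closed
  have hcl : IsClosed (π '' (N : Set X)ᶜ) := by
    rw [← H.isQuotientMap.isClosed_preimage]
    have : π ⁻¹' (π '' (N : Set X)ᶜ) = (N : Set X)ᶜ ∪ g ⁻¹' (N : Set X)ᶜ := by
      ext y
      constructor
      · rintro ⟨x, hx, hxy⟩
        rcases (H.orbits y x).1 hxy.symm with rfl | rfl
        · exact Or.inl hx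
        · exact Or.inr hx
      · rintro (hy | hy)
        · exact ⟨y, hy, rfl⟩
        · exact ⟨g y, hy, by rw [← Scheme.Hom.comp_apply, H.invariant]⟩
    rw [this]
    exact N.isOpen.isClosed_compl.union (N.isOpen.isClosed_compl.preimage g.continuous)
  obtain ⟨O, hO, hqO, hOV, a, ha⟩ := exists_isFreeSection hq (U := ⟨_, hcl.isOpen_compl⟩) (by
    rintro ⟨x, hx, rfl⟩
    exact hx ((hN x).2 (hs x rfl)))
  have hU : IsAffineOpen (π ⁻¹ᵁ O) := IsAffineHom.isAffine_preimage O hO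
  obtain ⟨w, hw⟩ := ha.exists_isSqrtExtension hg (H.hasInvariantSections O) (isUnit_two_res h2 O)
  have hsm : Smooth (hU.fromSpec ≫ π ≫ s) := by
    apply smooth_of_isSmoothAt
    intro z
    rw [isSmoothAt_comp_iff, ← hN]
    by_contra hz
    exact hOV (fromSpec_mem hU z) ⟨_, hz, rfl⟩
  obtain ⟨φ, hφ⟩ := Spec.map_surjective (hO.fromSpec ≫ s)
  rw [← Category.assoc, ← hO.SpecMap_appLE_fromSpec π hU le_rfl, Category.assoc, ← hφ,
    ← Spec.map_comp, HasRingHomProperty.Spec_iff (P := @Smooth)] at hsm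
  let _ : Algebra Γ(Q, O) Γ(X, π ⁻¹ᵁ O) := (pb π (U := O) (V := π ⁻¹ᵁ O) le_rfl).toAlgebra
  let _ : Algebra ℂ Γ(Q, O) := φ.hom.toAlgebra
  let _ : Algebra ℂ Γ(X, π ⁻¹ᵁ O) := ((pb π (U := O) (V := π ⁻¹ᵁ O) le_rfl).comp φ.hom).toAlgebra
  have : IsScalarTower ℂ Γ(Q, O) Γ(X, π ⁻¹ᵁ O) := IsScalarTower.of_algebraMap_eq fun r => rfl
  have : Algebra.Smooth ℂ Γ(X, π ⁻¹ᵁ O) := hsm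
  have hsm' : Algebra.Smooth ℂ Γ(Q, O) := hw.smooth
  have : Smooth (hO.fromSpec ≫ s) := by
    rw [← hφ, HasRingHomProperty.Spec_iff (P := @Smooth)]
    exact hsm'
  rw [← fromSpec_specPt hO hqO]
  exact isSmoothAt_of_isOpenImmersion _ this

/-- Near a point over the free locus the quotient map is étale. -/
theorem exists_etale_of_mem_freeLocus (H : IsGeomQuotient g π) (hg : g ≫ g = 𝟙 X) [IsAffineHom π]
    (h2 : IsUnit (2 : Γ(Q, ⊤))) {x : X} (hx : π x ∈ freeLocus H.invariant) :
    ∃ U : X.Opens, x ∈ U ∧ Etale (U.ι ≫ π) := by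
  obtain ⟨O, hO, hqO, -, a, ha⟩ := exists_isFreeSection hx (U := ⊤) trivial
  have hU : IsAffineOpen (π ⁻¹ᵁ O) := IsAffineHom.isAffine_preimage O hO
  have := etale_fromSpec_comp H hg h2 hO hU ha
  refine ⟨hU.fromSpec.opensRange, ?_, ?_⟩
  · rw [hU.opensRange_fromSpec]
    exact hqO
  · rw [← Scheme.Hom.isoOpensRange_inv_comp_assoc]
    infer_instance

/-! ### Reduced closed subschemes and quotients -/

theorem eq_vanishingIdeal_of_isRadical {K : X.IdealSheafData}
    (h : ∀ x : X, ∃ (U : X.Opens) (hU : IsAffineOpen U), x ∈ U ∧ (K.ideal ⟨U, hU⟩).IsRadical) :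
    K = Scheme.IdealSheafData.vanishingIdeal K.support := by
  rw [Scheme.IdealSheafData.vanishingIdeal_support]
  choose U hU hxU hr using h
  refine Scheme.IdealSheafData.ext_of_iSup_eq_top (fun x => ⟨U x, hU x⟩) ?_ fun x => ?_
  · ext x
    simp only [Opens.coe_iSup, Set.mem_iUnion, Opens.coe_top, Set.mem_univ, iff_true]
    exact ⟨x, hxU x⟩
  · exact (hr x).radical.symm

theorem support_vanishingIdeal (Z : Closeds X) :
    (Scheme.IdealSheafData.vanishingIdeal Z).support = Z := by
  ext x
  simp

theorem isRadical_vanishingIdeal (Z : Closeds X) (U : X.affineOpens) :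
    ((Scheme.IdealSheafData.vanishingIdeal Z).ideal U).IsRadical := by
  have h1 : Scheme.IdealSheafData.vanishingIdeal Z =
      (Scheme.IdealSheafData.vanishingIdeal Z).radical := by
    rw [← Scheme.IdealSheafData.vanishingIdeal_support,
      support_vanishingIdeal]
  rw [h1]
  exact Ideal.radical_isRadical _

theorem one_mem_vanishingIdeal {Z : Closeds X} {x : X} (hx : x ∉ Z) :
    ∃ (U : X.Opens) (hU : IsAffineOpen U), x ∈ U ∧
      1 ∈ (Scheme.IdealSheafData.vanishingIdeal Z).ideal ⟨U, hU⟩ := by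
  obtain ⟨U, hU, hxU, hUZ⟩ := exists_isAffineOpen_le (U := Z.compl) hx
  refine ⟨U, hU, hxU, ?_⟩
  rw [Scheme.IdealSheafData.vanishingIdeal_ideal, PrimeSpectrum.mem_vanishingIdeal]
  intro y hy
  exact (hUZ (fromSpec_mem hU y) hy).elim

/-- Inverse images of reduced closed subschemes of the free locus are reduced. -/
theorem comap_vanishingIdeal_of_le_freeLocus (H : IsGeomQuotient g π) (hg : g ≫ g = 𝟙 X)
    [IsAffineHom π] (h2 : IsUnit (2 : Γ(Q, ⊤))) {Z : Closeds Q}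
    (hZ : ∀ q ∈ Z, q ∈ freeLocus H.invariant) :
    (Scheme.IdealSheafData.vanishingIdeal Z).comap π =
      Scheme.IdealSheafData.vanishingIdeal (Z.preimage π.continuous) := by
  have h1 : ((Scheme.IdealSheafData.vanishingIdeal Z).comap π).support =
      Z.preimage π.continuous := by
    rw [Scheme.IdealSheafData.support_comap, support_vanishingIdeal]
  rw [← h1]
  apply eq_vanishingIdeal_of_isRadical
  intro x
  by_cases hx : π x ∈ Z
  · obtain ⟨O, hO, hqO, -, a, ha⟩ := exists_isFreeSection (hZ _ hx) (U := ⊤) trivial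
    have hU : IsAffineOpen (π ⁻¹ᵁ O) := IsAffineHom.isAffine_preimage O hO
    obtain ⟨w, hw⟩ := ha.exists_isSqrtExtension hg (H.hasInvariantSections O) (isUnit_two_res h2 O)
    refine ⟨π ⁻¹ᵁ O, hU, hqO, ?_⟩
    rw [comap_ideal _ π ⟨O, hO⟩ ⟨π ⁻¹ᵁ O, hU⟩ le_rfl]
    exact @IsSqrtExtension.isRadical_map _ _ _ _ (_) _ _ hw ha.isUnit (isUnit_two_res h2 O) _
      (isRadical_vanishingIdeal Z ⟨O, hO⟩)
  · obtain ⟨O, hO, hqO, h1⟩ := one_mem_vanishingIdeal hx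
    have hU : IsAffineOpen (π ⁻¹ᵁ O) := IsAffineHom.isAffine_preimage O hO
    refine ⟨π ⁻¹ᵁ O, hU, hqO, ?_⟩
    rw [(Ideal.eq_top_iff_one _).2 (comap_one_mem h1 hU le_rfl)]
    exact fun _ _ => trivial

end

/-! ### Points and affine open subsets of projective schemes -/

attribute [local instance] MvPolynomial.gradedAlgebra in
/-- A general linear form does not vanish at any of finitely many given points. -/
theorem exists_isAffineOpen_projectiveSpace (n : ℕ) {κ : Type} [Finite κ]
    (x : κ → (projectiveSpace n).left) :
    ∃ U : (projectiveSpace n).left.Opens, IsAffineOpen U ∧ ∀ k, x k ∈ U := by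
  let 𝒜 := MvPolynomial.homogeneousSubmodule (Fin (n + 1)) ℂ
  let y : κ → Proj 𝒜 := x
  let p (k : κ) : Subspace ℂ (𝒜 1) :=
    ((y k).asHomogeneousIdeal.toIdeal.restrictScalars ℂ).comap (𝒜 1).subtype
  have hp : ∀ k, p k ≠ ⊤ := fun k hk => by
    refine (y k).not_irrelevant_le ?_
    have hX : ∀ j, (MvPolynomial.X j : MvPolynomial (Fin (n + 1)) ℂ) ∈
        (y k).asHomogeneousIdeal.toIdeal := fun j =>
      (hk.ge trivial : (⟨_, MvPolynomial.isHomogeneous_X ℂ j⟩ : 𝒜 1) ∈ p k)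
    intro a ha
    rw [HomogeneousIdeal.mem_irrelevant_iff, GradedRing.proj_apply] at ha
    have ha' : a.coeff 0 = 0 := by
      have h1 : MvPolynomial.homogeneousComponent 0 a = 0 :=
        (MvPolynomial.decomposition.decompose'_apply a 0).symm.trans ha
      rw [MvPolynomial.homogeneousComponent_zero] at h1
      simpa using h1
    have hs : a ∈ Ideal.span (MvPolynomial.X '' (Set.univ : Set (Fin (n + 1)))) := by
      rw [MvPolynomial.mem_ideal_span_X_image]
      intro m hm
      by_contra! h
      have : m = 0 := Finsupp.ext fun j => h j trivial
      rw [MvPolynomial.mem_support_iff, this] at hm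
      exact hm ha'
    exact Ideal.span_le.2 (by rintro _ ⟨j, -, rfl⟩; exact hX j) hs
  obtain ⟨f, hf⟩ : ∃ f : 𝒜 1, ∀ k, f ∉ p k := by
    by_contra! h
    obtain ⟨k, hk⟩ := Subspace.exists_eq_top_of_iUnion_eq_univ (p := p)
      (Set.eq_univ_of_forall fun f => Set.mem_iUnion.2 (h f))
    exact hp k hk
  exact ⟨Proj.basicOpen 𝒜 f.1, Proj.isAffineOpen_basicOpen 𝒜 f.1 f.2 one_pos, hf⟩

attribute [local instance] MvPolynomial.gradedAlgebra in
theorem isSeparated_projectiveSpace (n : ℕ) : IsSeparated (projectiveSpace n).hom := by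
  unfold projectiveSpace
  dsimp only [Over.mk_hom]
  infer_instance

/-! ### Tensor products of domains -/

open TensorProduct in
/-- Over an algebraically closed field the tensor product of two domains, one of which is of
finite type, is a domain. -/
theorem isDomain_tensorProduct {k R R' : Type} [Field k] [IsAlgClosed k] [CommRing R] [CommRing R']
    [Algebra k R] [Algebra k R'] [IsDomain R] [IsDomain R'] [Algebra.FiniteType k R] :
    IsDomain (R ⊗[k] R') := by
  have : Nontrivial (R ⊗[k] R') := inferInstance
  refine @NoZeroDivisors.to_isDomain _ _ _ ⟨fun {f g} hfg => ?_⟩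
  let b := Module.Free.chooseBasis k R'
  let B := b.baseChange R
  -- Evaluation at a closed point of `Spec R` maps the product `f * g = 0` to a domain, so at each
  -- closed point all coefficients of `f` or all coefficients of `g` vanish.
  have key : ∀ (m : Ideal R) [m.IsMaximal], (∀ i, B.repr f i ∈ m) ∨ ∀ i, B.repr g i ∈ m := by
    intro m hm
    let _ : Field (R ⧸ m) := Ideal.Quotient.field m
    have hfin : Module.Finite k (R ⧸ m) := finite_of_finite_type_of_isJacobsonRing k (R ⧸ m)
    have hbij := IsAlgClosed.algebraMap_bijective_of_isIntegral (k := k) (K := R ⧸ m)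
    let e : k ≃ₐ[k] R ⧸ m := AlgEquiv.ofBijective (Algebra.ofId k (R ⧸ m)) hbij
    let ev : R →ₐ[k] k := e.symm.toAlgHom.comp (Ideal.Quotient.mkₐ k m)
    have hev : ∀ r, ev r = 0 ↔ r ∈ m := fun r => by
      simp [ev, Ideal.Quotient.eq_zero_iff_mem]
    let F : R ⊗[k] R' →ₐ[k] R' :=
      (Algebra.TensorProduct.lid k R').toAlgHom.comp (Algebra.TensorProduct.map ev (AlgHom.id k R'))
    have hF : ∀ (z : R ⊗[k] R') i, b.repr (F z) i = ev (B.repr z i) := by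
      intro z i
      induction z with
      | zero => simp
      | tmul r r' => simp [F, B, Module.Basis.baseChange_repr_tmul, mul_comm]
      | add u v hu hv => simp [hu, hv]
    have h0 : F f * F g = 0 := by rw [← map_mul, hfg, map_zero]
    rcases mul_eq_zero.1 h0 with h | h
    · exact Or.inl fun i => (hev _).1 (by rw [← hF, h]; simp)
    · exact Or.inr fun i => (hev _).1 (by rw [← hF, h]; simp)
  have : IsJacobsonRing R := isJacobsonRing_of_finiteType (A := k)
  by_contra! h
  obtain ⟨i, hi⟩ : ∃ i, B.repr f i ≠ 0 := by
    by_contra! h'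
    exact h.1 (B.repr.injective (Finsupp.ext (by simpa using h')))
  obtain ⟨j, hj⟩ : ∃ i, B.repr g i ≠ 0 := by
    by_contra! h'
    exact h.2 (B.repr.injective (Finsupp.ext (by simpa using h')))
  -- a product of two coefficients vanishes at all closed points, hence is `0`
  have h1 : B.repr f i * B.repr g j ∈ (⊥ : Ideal R).jacobson := by
    refine Ideal.mem_sInf.2 fun {m} hm => ?_
    have := hm.2
    rcases key m with h' | h'
    · exact m.mul_mem_right _ (h' i)
    · exact m.mul_mem_left _ (h' j)
  rw [IsJacobsonRing.out' (⊥ : Ideal R) Ideal.isPrime_bot.isRadical] at h1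
  exact mul_ne_zero hi hj h1

/-! ### Affine open subsets of K3 surfaces -/

section

variable {S : CScheme} {ι : S ⟶ S}

theorem IsK3Surface.exists_isAffineOpen (hS : IsK3Surface S) {κ : Type} [Finite κ]
    (x : κ → S.left) : ∃ U : S.left.Opens, IsAffineOpen U ∧ ∀ k, x k ∈ U := by
  obtain ⟨n, i, hi⟩ := hS.projective
  obtain ⟨U, hU, hx⟩ := exists_isAffineOpen_projectiveSpace n fun k => i.left (x k)
  exact ⟨i.left ⁻¹ᵁ U, hU.preimage i.left, hx⟩

theorem IsK3Surface.isSeparated (hS : IsK3Surface S) : IsSeparated S.str := by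
  obtain ⟨n, i, hi⟩ := hS.projective
  have := isSeparated_projectiveSpace n
  rw [← CScheme.comp_str i]
  infer_instance

theorem IsK3Surface.locallyOfFiniteType (hS : IsK3Surface S) : LocallyOfFiniteType S.str := by
  have := hS.smooth.smooth
  infer_instance

theorem isAffineOpen_inf [IsSeparated S.str] {U V : S.left.Opens} (hU : IsAffineOpen U)
    (hV : IsAffineOpen V) : IsAffineOpen (U ⊓ V) := by
  have : S.left.IsSeparated := by
    constructor
    rw [← terminal.comp_from S.str]
    infer_instance
  exact hU.inf hV

/-- Any two points of a K3 surface lie in an affine open subset which is invariant under a given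
involution. -/
theorem IsK3Surface.exists_invariantAffine (hS : IsK3Surface S) (hι : ι.left ≫ ι.left = 𝟙 S.left)
    (x y : S.left) : ∃ U : InvariantAffine ι.left, x ∈ U.1 ∧ y ∈ U.1 := by
  obtain ⟨U, hU, h⟩ := hS.exists_isAffineOpen ![x, y, ι.left x, ι.left y]
  have := hS.isSeparated
  have hg : IsIso ι.left := ⟨ι.left, hι, hι⟩
  refine ⟨⟨U ⊓ ι.left ⁻¹ᵁ U, isAffineOpen_inf hU (hU.preimage ι.left), ?_⟩,
    ⟨h 0, h 2⟩, ⟨h 1, h 3⟩⟩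
  intro z hz
  exact ⟨hz.2, by simpa [apply_apply_of_involutive hι] using hz.1⟩

end

attribute [local instance] sectionsAlgebra

/-! ### Self-products -/

section

variable {S : CScheme}

theorem isPullback_square (S : CScheme) :
    IsPullback (squareFst S).left (squareSnd S).left S.str S.str :=
  IsPullback.of_hasPullback _ _

theorem square_hom_ext {T : Scheme.{0}} {f g : T ⟶ (square S).left}
    (h1 : f ≫ (squareFst S).left = g ≫ (squareFst S).left)
    (h2 : f ≫ (squareSnd S).left = g ≫ (squareSnd S).left) : f = g :=
  (isPullback_square S).hom_ext h1 h2

theorem square_hom_ext_over {T : CScheme} {f g : T ⟶ square S}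
    (h1 : f ≫ squareFst S = g ≫ squareFst S) (h2 : f ≫ squareSnd S = g ≫ squareSnd S) : f = g := by
  apply Over.OverMorphism.ext
  exact square_hom_ext (by simpa using congrArg CommaMorphism.left h1)
    (by simpa using congrArg CommaMorphism.left h2)

theorem squareLift_fst {T : CScheme} (f g : T ⟶ S) : squareLift f g ≫ squareFst S = f :=
  Over.OverMorphism.ext (pullback.lift_fst _ _ _)

theorem squareLift_snd {T : CScheme} (f g : T ⟶ S) : squareLift f g ≫ squareSnd S = g :=
  Over.OverMorphism.ext (pullback.lift_snd _ _ _)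

theorem comp_squareLift {T T' : CScheme} (a : T' ⟶ T) (f g : T ⟶ S) :
    a ≫ squareLift f g = squareLift (a ≫ f) (a ≫ g) := by
  apply square_hom_ext_over <;> simp only [Category.assoc, squareLift_fst, squareLift_snd]

theorem squareLift_switch {T : CScheme} (f g : T ⟶ S) :
    squareLift f g ≫ switch S = squareLift g f := by
  rw [switch, comp_squareLift, squareLift_fst, squareLift_snd]

theorem squareLift_squareMap {T S' : CScheme} (f g : T ⟶ S) (h : S ⟶ S') :
    squareLift f g ≫ squareMap h = squareLift (f ≫ h) (g ≫ h) := by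
  rw [squareMap, comp_squareLift, ← Category.assoc, ← Category.assoc, squareLift_fst,
    squareLift_snd]

theorem squareLift_fst_snd {T : CScheme} (a : T ⟶ square S) :
    squareLift (a ≫ squareFst S) (a ≫ squareSnd S) = a := by
  apply square_hom_ext_over <;> simp only [squareLift_fst, squareLift_snd]

theorem squareLift_self_fst_snd : squareLift (squareFst S) (squareSnd S) = 𝟙 (square S) := by
  apply square_hom_ext_over <;> simp only [squareLift_fst, squareLift_snd, Category.id_comp]

theorem switch_switch (S : CScheme) : switch S ≫ switch S = 𝟙 _ := by
  nth_rw 1 [switch]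
  rw [squareLift_switch, squareLift_self_fst_snd]

theorem switch_fst : switch S ≫ squareFst S = squareSnd S := squareLift_fst _ _
theorem switch_snd : switch S ≫ squareSnd S = squareFst S := squareLift_snd _ _

theorem squareMap_fst {S' : CScheme} (h : S ⟶ S') :
    squareMap h ≫ squareFst S' = squareFst S ≫ h := squareLift_fst _ _
theorem squareMap_snd {S' : CScheme} (h : S ⟶ S') :
    squareMap h ≫ squareSnd S' = squareSnd S ≫ h := squareLift_snd _ _

/-- The open subset `U × U` of `S × S`. -/
def box (U : S.left.Opens) : (square S).left.Opens :=
  (squareFst S).left ⁻¹ᵁ U ⊓ (squareSnd S).left ⁻¹ᵁ U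

theorem box_le_fst (U : S.left.Opens) : box U ≤ (squareFst S).left ⁻¹ᵁ U := inf_le_left
theorem box_le_snd (U : S.left.Opens) : box U ≤ (squareSnd S).left ⁻¹ᵁ U := inf_le_right

theorem isAffineOpen_box {U : S.left.Opens} (hU : IsAffineOpen U) : IsAffineOpen (box U) := by
  have : IsAffine _ := hU
  have : IsAffine _ := isAffineOpen_top (Spec (CommRingCat.of ℂ))
  exact .of_isIso (Scheme.Hom.isPullback_resLE (isPullback_square S) (US := ⊤) (UT := U) (UX := U)
    le_top le_top (UY := box U) rfl).isoPullback.hom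

open TensorProduct

/-- The functions on `U × U` are the tensor square of the functions on `U`. -/
theorem exists_tensorEquiv {U : S.left.Opens} (hU : IsAffineOpen U) :
    ∃ e : Γ(S.left, U) ⊗[ℂ] Γ(S.left, U) ≃+* Γ((square S).left, box U),
      ∀ r r', e (r ⊗ₜ r') = pb (squareFst S).left (box_le_fst U) r *
        pb (squareSnd S).left (box_le_snd U) r' := by
  have h1 := (isIso_pushoutSection_iff (isPullback_square S) (US := ⊤) (UT := U) (UX := U) le_top
    le_top (UY := box U) rfl).1
    (isIso_pushoutSection_of_isAffineOpen _ _ _ _ (isAffineOpen_top _) hU hU)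
  have h2 : IsPushout (CommRingCat.ofHom (algebraMap ℂ Γ(S.left, U)))
      (CommRingCat.ofHom (algebraMap ℂ Γ(S.left, U)))
      ((squareFst S).left.appLE U (box U) (box_le_fst U))
      ((squareSnd S).left.appLE U (box U) (box_le_snd U)) :=
    h1.of_iso (Scheme.ΓSpecIso (CommRingCat.of ℂ)) (Iso.refl _) (Iso.refl _) (Iso.refl _)
      (by
        ext z
        simp [RingHom.algebraMap_toAlgebra])
      (by
        ext z
        simp [RingHom.algebraMap_toAlgebra]) (by simp) (by simp)
  have h3 := CommRingCat.isPushout_tensorProduct ℂ Γ(S.left, U) Γ(S.left, U)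
  let e := h3.isoIsPushout _ _ h2
  have e1 : ∀ r, e.hom (r ⊗ₜ 1) = (squareFst S).left.appLE U (box U) (box_le_fst U) r :=
    fun r => congr($(h3.inl_isoIsPushout_hom _ _ h2) r)
  have e2 : ∀ r, e.hom (1 ⊗ₜ r) = (squareSnd S).left.appLE U (box U) (box_le_snd U) r :=
    fun r => congr($(h3.inr_isoIsPushout_hom _ _ h2) r)
  refine ⟨e.commRingCatIsoToRingEquiv, fun r r' => ?_⟩
  have : (r ⊗ₜ[ℂ] r' : Γ(S.left, U) ⊗[ℂ] Γ(S.left, U)) = r ⊗ₜ 1 * 1 ⊗ₜ r' := by simp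
  rw [this, map_mul]
  exact congrArg₂ (· * ·) (e1 r) (e2 r')

theorem switch_invariant_box (U : S.left.Opens) : box U ≤ (switch S).left ⁻¹ᵁ box U := by
  intro x hx
  have h1 := congrArg (fun f => f.left x) (switch_fst (S := S))
  have h2 := congrArg (fun f => f.left x) (switch_snd (S := S))
  exact ⟨(congrArg (· ∈ U) h1).mpr hx.2, (congrArg (· ∈ U) h2).mpr hx.1⟩

theorem squareMap_invariant_box {ι : S ⟶ S} {U : S.left.Opens} (hU : U ≤ ι.left ⁻¹ᵁ U) :
    box U ≤ (squareMap ι).left ⁻¹ᵁ box U := by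
  intro x hx
  have h1 := congrArg (fun f => f.left x) (squareMap_fst ι)
  have h2 := congrArg (fun f => f.left x) (squareMap_snd ι)
  exact ⟨(congrArg (· ∈ U) h1).mpr (hU hx.1), (congrArg (· ∈ U) h2).mpr (hU hx.2)⟩

theorem squareMap_comp {S₁ S₂ S₃ : CScheme} (f : S₁ ⟶ S₂) (g : S₂ ⟶ S₃) :
    squareMap f ≫ squareMap g = squareMap (f ≫ g) := by
  nth_rw 1 [squareMap]
  rw [squareLift_squareMap, Category.assoc, Category.assoc, squareMap]

theorem squareMap_id (S : CScheme) : squareMap (𝟙 S) = 𝟙 (square S) := by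
  rw [squareMap, Category.comp_id, Category.comp_id, squareLift_self_fst_snd]

theorem switch_squareMap {S' : CScheme} (f : S ⟶ S') :
    switch S ≫ squareMap f = squareMap f ≫ switch S' := by
  rw [switch, squareLift_squareMap, squareMap, squareLift_switch]

/-! ### Integrality of self-products -/

theorem finiteType_sections [LocallyOfFiniteType S.str] {U : S.left.Opens} (hU : IsAffineOpen U) :
    Algebra.FiniteType ℂ Γ(S.left, U) := by
  have h1 := S.str.finiteType_appLE (isAffineOpen_top _) hU le_top
  exact h1.comp (RingHom.FiniteType.of_surjective _
    (Scheme.ΓSpecIso (CommRingCat.of ℂ)).symm.commRingCatIsoToRingEquiv.surjective)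

theorem isDomain_box [IsIntegral S.left] [LocallyOfFiniteType S.str] {U : S.left.Opens}
    (hU : IsAffineOpen U) [Nonempty U] : IsDomain Γ((square S).left, box U) := by
  obtain ⟨e, -⟩ := exists_tensorEquiv hU
  have := finiteType_sections hU
  have : IsDomain (Γ(S.left, U) ⊗[ℂ] Γ(S.left, U)) := isDomain_tensorProduct
  exact e.symm.toMulEquiv.isDomain _

/-- The product `S × S` is integral: any two of its points lie in a common affine open set `U × U`,
whose ring of functions is a domain. -/
theorem isIntegral_square [IsIntegral S.left] [LocallyOfFiniteType S.str]
    (h : ∀ x : Fin 4 → S.left, ∃ U : S.left.Opens, IsAffineOpen U ∧ ∀ k, x k ∈ U)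
    (hne : Nonempty (square S).left) : IsIntegral (square S).left := by
  have key : ∀ x y : (square S).left, ∃ B : (square S).left.Opens, IsAffineOpen B ∧ x ∈ B ∧ y ∈ B ∧
      IsDomain Γ((square S).left, B) := fun x y => by
    obtain ⟨U, hU, hx⟩ := h ![(squareFst S).left x, (squareSnd S).left x,
      (squareFst S).left y, (squareSnd S).left y]
    have : Nonempty U := ⟨⟨_, hx 0⟩⟩
    exact ⟨box U, isAffineOpen_box hU, ⟨hx 0, hx 1⟩, ⟨hx 2, hx 3⟩, isDomain_box hU⟩
  have h1 : IsReduced (square S).left := by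
    choose B hB hx hy hd using key
    have : ∀ x, _root_.IsReduced ((square S).left.presheaf.stalk x) := by
      intro x
      have := hd x x
      obtain ⟨y, hyx⟩ : x ∈ Set.range (hB x x).fromSpec := by
        rw [(hB x x).range_fromSpec]
        exact hx x x
      rw [← hyx]
      exact isReduced_of_injective (((hB x x).fromSpec.stalkMap y).hom)
        (ConcreteCategory.bijective_of_isIso ((hB x x).fromSpec.stalkMap y)).1
    exact isReduced_of_isReduced_stalk _
  have h2 : PreirreducibleSpace (square S).left := by
    constructor
    rintro O O' hO hO' ⟨x, -, hx⟩ ⟨y, -, hy⟩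
    obtain ⟨B, hB, hxB, hyB, hd⟩ := key x y
    have h1 : ∀ (P : (square S).left.Opens) (z), z ∈ P → z ∈ B →
        ((hB.fromSpec ⁻¹ᵁ P : (Spec _).Opens) :
        Set (Spec Γ((square S).left, B))).Nonempty := by
      intro P z hzP hzB
      obtain ⟨w, rfl⟩ : z ∈ Set.range hB.fromSpec := by rwa [hB.range_fromSpec]
      exact ⟨w, hzP⟩
    have : IrreducibleSpace (Spec Γ((square S).left, B)) := inferInstance
    obtain ⟨w, hw, hw'⟩ := nonempty_preirreducible_inter (hB.fromSpec ⁻¹ᵁ ⟨O, hO⟩).isOpen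
      (hB.fromSpec ⁻¹ᵁ ⟨O', hO'⟩).isOpen (h1 ⟨O, hO⟩ x hx hxB) (h1 ⟨O', hO'⟩ y hy hyB)
    exact ⟨hB.fromSpec w, trivial, hw, hw'⟩
  have h3 : IrreducibleSpace (square S).left := ⟨hne⟩
  exact isIntegral_of_irreducibleSpace_of_isReduced _

end

/-! ### Integrality of quotients -/

section

variable {X Q : Scheme.{0}} {g : X ⟶ X} {π : X ⟶ Q}

theorem IsGeomQuotient.isIntegral (H : IsGeomQuotient g π) [IsIntegral X] : IsIntegral Q := by
  refine ⟨⟨π (Classical.arbitrary X)⟩, fun {U} hU => ?_⟩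
  have : Nonempty (π ⁻¹ᵁ U) := by
    obtain ⟨q, hq⟩ := hU
    obtain ⟨x, rfl⟩ := H.isQuotientMap.surjective q
    exact ⟨⟨x, hq⟩⟩
  exact (H.injective U).isDomain (π.app U).hom

end

attribute [local instance] sectionsAlgebra

/-! ### Complex points -/

/-- The spectrum of `ℂ` as a `ℂ`-scheme. -/
abbrev pt : CScheme := Over.mk (𝟙 (Spec (CommRingCat.of ℂ)))

/-- The point of the underlying space given by a complex point. -/
def pointAt {X : CScheme} (p : pt ⟶ X) : X.left :=
  p.left (IsLocalRing.closedPoint ℂ)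

section

variable {X Y : CScheme}

theorem pointAt_comp (p : pt ⟶ X) (f : X ⟶ Y) : pointAt (p ≫ f) = f.left (pointAt p) := by
  exact Scheme.Hom.comp_apply p.left f.left _

theorem point_ext [LocallyOfFiniteType X.str] {p q : pt ⟶ X} (h : pointAt p = pointAt q) :
    p = q :=
  Over.OverMorphism.ext (ext_of_apply_closedPoint_eq X.str (Over.w p) (Over.w q) h)

theorem exists_pointAt_eq [LocallyOfFiniteType X.str] {x : X.left} (hx : IsClosed {x}) :
    ∃ p : pt ⟶ X, pointAt p = x :=
  ⟨Over.homMk (pointOfClosedPoint X.str x hx) (pointOfClosedPoint_comp X.str x hx),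
    pointOfClosedPoint_apply X.str x hx _⟩

theorem isClosed_pointAt [LocallyOfFiniteType X.str] (p : pt ⟶ X) : IsClosed {pointAt p} :=
  (pointEquivClosedPoint X.str ⟨p.left, Over.w p⟩).2

/-- Complex points are dense in every locally closed subset. -/
theorem exists_pointAt_mem [LocallyOfFiniteType X.str] {Z : Set X.left} (hZ : Z.Nonempty)
    (hZ' : IsLocallyClosed Z) : ∃ p : pt ⟶ X, pointAt p ∈ Z := by
  have := LocallyOfFiniteType.jacobsonSpace X.str
  obtain ⟨x, hx, hx'⟩ := nonempty_inter_closedPoints hZ hZ'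
  obtain ⟨p, rfl⟩ := exists_pointAt_eq hx'
  exact ⟨p, hx⟩

theorem isUnit_two (X : CScheme) (U : X.left.Opens) : IsUnit (2 : Γ(X.left, U)) := by
  have h : IsUnit (2 : ℂ) := isUnit_iff_ne_zero.2 two_ne_zero
  have h2 := h.map (algebraMap ℂ Γ(X.left, U))
  rwa [map_ofNat] at h2

/-- To determine the free locus of a quotient map it suffices to consider complex points. -/
theorem mem_freeLocus_of_forall_point {Q P : CScheme} [LocallyOfFiniteType P.str] {g : X ⟶ X}
    {π : X ⟶ Q} (H : IsGeomQuotient g.left π.left) (hg : g.left ≫ g.left = 𝟙 X.left)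
    [IsAffineHom π.left] (a : P ⟶ X) (ha : Function.Surjective a.left) {Q₀ : Q.left.Opens}
    (h : ∀ p : pt ⟶ P, pointAt (p ≫ a ≫ π) ∈ Q₀ →
      pointAt (p ≫ a ≫ g) ≠ pointAt (p ≫ a))
    {q : Q.left} (hq : q ∈ Q₀) : q ∈ freeLocus H.invariant := by
  by_contra hq'
  let Z : Set Q.left := (Q₀ : Set Q.left) ∩ (freeLocus H.invariant : Set Q.left)ᶜ
  have hZ : IsLocallyClosed Z :=
    Q₀.isOpen.isLocallyClosed.inter (freeLocus H.invariant).isOpen.isClosed_compl.isLocallyClosed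
  obtain ⟨x, rfl⟩ := H.isQuotientMap.surjective q
  obtain ⟨y, rfl⟩ := ha x
  obtain ⟨p, hp⟩ := exists_pointAt_mem (Z := (a ≫ π).left ⁻¹' Z) ⟨y, by
    rw [Set.mem_preimage, Over.comp_left, Scheme.Hom.comp_apply]
    exact ⟨hq, hq'⟩⟩ (hZ.preimage (a ≫ π).left.continuous)
  rw [Set.mem_preimage, ← pointAt_comp] at hp
  have h1 := h p hp.1
  rw [← Category.assoc, pointAt_comp _ g] at h1
  have h2 := mem_freeLocus_of_apply_ne H hg h1
  rw [← pointAt_comp, Category.assoc] at h2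
  exact hp.2 h2

end

/-! ### Quotients of schemes over `ℂ` -/

section

variable {X Q T : CScheme} {g : X ⟶ X} {π : X ⟶ Q}

theorem left_comp_eq_id (hg : g ≫ g = 𝟙 X) : g.left ≫ g.left = 𝟙 X.left :=
  congrArg CommaMorphism.left hg

theorem IsQuotient.epi (H : IsQuotient g π) : Epi π := by
  have := (isQuotient_iff.1 H).epi
  exact ⟨fun a b h => Over.OverMorphism.ext ((cancel_epi π.left).1 (congrArg CommaMorphism.left h))⟩

theorem IsQuotient.hom_ext (H : IsQuotient g π) {a b : Q ⟶ T} (h : π ≫ a = π ≫ b) : a = b := by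
  have := H.epi
  exact (cancel_epi π).1 h

theorem IsQuotient.exists_desc (H : IsQuotient g π) (f : X ⟶ T) (hf : g ≫ f = f) :
    ∃ f' : Q ⟶ T, π ≫ f' = f := by
  have H' := isQuotient_iff.1 H
  have h1 : g.left ≫ f.left = f.left := congrArg CommaMorphism.left hf
  have := H'.epi
  refine ⟨Over.homMk (H'.desc f.left h1) ?_, Over.OverMorphism.ext (H'.comp_desc f.left h1)⟩
  rw [← cancel_epi π.left, ← Category.assoc, H'.comp_desc, Over.w, Over.w]

theorem exists_isQuotient (hg : g ≫ g = 𝟙 X)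
    (hc : ∀ x : X.left, ∃ U : InvariantAffine g.left, x ∈ U.1) :
    ∃ (Q : CScheme) (π : X ⟶ Q), IsQuotient g π := by
  obtain ⟨Q, π, H⟩ := exists_isGeomQuotient (left_comp_eq_id hg) hc
  exact ⟨Over.mk (H.desc X.str (Over.w g)), Over.homMk π (H.comp_desc _ _), isQuotient_iff.2 H⟩

theorem IsGeomQuotient.isAffineHom {X Q : Scheme.{0}} {g : X ⟶ X} {π : X ⟶ Q}
    (H : IsGeomQuotient g π) (hg : g ≫ g = 𝟙 X)
    (hc : ∀ x : X, ∃ U : InvariantAffine g, x ∈ U.1) : IsAffineHom π := by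
  apply isAffineHom_of_forall_exists_isAffineOpen
  intro q
  obtain ⟨x, rfl⟩ := H.isQuotientMap.surjective q
  obtain ⟨U, hx⟩ := hc x
  obtain ⟨O, hO, hOU⟩ := H.exists_isAffineOpen hg U.2.1 U.2.2
  exact ⟨O, by rwa [← hOU] at hx, hO, by rw [hOU]; exact U.2.1⟩

theorem IsQuotient.isAffineHom (H : IsQuotient g π) (hg : g ≫ g = 𝟙 X)
    (hc : ∀ x : X.left, ∃ U : InvariantAffine g.left, x ∈ U.1) : IsAffineHom π.left :=
  (isQuotient_iff.1 H).isAffineHom (left_comp_eq_id hg) hc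

/-- The image in the quotient of an invariant affine open subset, with the action on the quotient
of a further automorphism which preserves this subset. -/
theorem IsQuotient.exists_invariantAffine (H : IsQuotient g π) (hg : g ≫ g = 𝟙 X) {g' : X ⟶ X}
    {γ : Q ⟶ Q} (hγ : π ≫ γ = g' ≫ π) {U : X.left.Opens} (hU : IsAffineOpen U)
    (hUg : U ≤ g.left ⁻¹ᵁ U) (hUg' : U ≤ g'.left ⁻¹ᵁ U) :
    ∃ O : InvariantAffine γ.left, π.left ⁻¹ᵁ O.1 = U := by
  obtain ⟨O, hO, hOU⟩ := (isQuotient_iff.1 H).exists_isAffineOpen (left_comp_eq_id hg) hU hUg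
  refine ⟨⟨O, hO, fun q hq => ?_⟩, hOU⟩
  obtain ⟨x, rfl⟩ := H.isQuotientMap.surjective q
  have hx : x ∈ U := by rw [← hOU]; exact hq
  have h1 : γ.left (π.left x) = π.left (g'.left x) := congrArg (fun f => f.left x) hγ
  have h2 : g'.left x ∈ π.left ⁻¹ᵁ O := by rw [hOU]; exact hUg' hx
  exact (congrArg (· ∈ O) h1).mpr h2

end

attribute [local instance] sectionsAlgebra

/-! ### The quotients of the product of the surface with itself -/

/-- The quotients `W = S/ι`, `S^{(2)}` and `V = S^{(2)}/ι^{(2)}`. -/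
structure SymmetricQuotients (S : CScheme) (ι : S ⟶ S) where
  /-- The quotient surface. -/
  W : CScheme
  toW : S ⟶ W
  isQuotient_W : IsQuotient ι toW
  /-- The symmetric square of `S`. -/
  S2 : CScheme
  toS2 : square S ⟶ S2
  isQuotient_S2 : IsQuotient (switch S) toS2
  /-- The involution induced by `ι × ι`. -/
  ι2 : S2 ⟶ S2
  toS2_ι2 : toS2 ≫ ι2 = squareMap ι ≫ toS2
  /-- The quotient of the symmetric square. -/
  V : CScheme
  toV : S2 ⟶ V
  isQuotient_V : IsQuotient ι2 toV

section

variable {S : CScheme} {ι : S ⟶ S}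

theorem squareMap_involutive (hι : ι ≫ ι = 𝟙 S) : squareMap ι ≫ squareMap ι = 𝟙 _ := by
  rw [squareMap_comp, hι, squareMap_id]

/-- The self-product of a K3 surface is covered by open sets `U × U` with `U` affine and
invariant. -/
theorem IsK3Surface.exists_mem_box (hS : IsK3Surface S) (hι : ι ≫ ι = 𝟙 S) (x : (square S).left) :
    ∃ U : InvariantAffine ι.left, x ∈ box U.1 := by
  obtain ⟨U, h1, h2⟩ := hS.exists_invariantAffine (left_comp_eq_id hι) ((squareFst S).left x)
    ((squareSnd S).left x)
  exact ⟨U, h1, h2⟩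

theorem IsK3Surface.switch_cover (hS : IsK3Surface S) (hι : ι ≫ ι = 𝟙 S) (x : (square S).left) :
    ∃ B : InvariantAffine (switch S).left, x ∈ B.1 := by
  obtain ⟨U, hx⟩ := hS.exists_mem_box hι x
  exact ⟨⟨box U.1, isAffineOpen_box U.2.1, switch_invariant_box _⟩, hx⟩

theorem IsK3Surface.squareMap_cover (hS : IsK3Surface S) (hι : ι ≫ ι = 𝟙 S)
    (x : (square S).left) : ∃ B : InvariantAffine (squareMap ι).left, x ∈ B.1 := by
  obtain ⟨U, hx⟩ := hS.exists_mem_box hι x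
  exact ⟨⟨box U.1, isAffineOpen_box U.2.1, squareMap_invariant_box U.2.2⟩, hx⟩

theorem IsK3Surface.cover (hS : IsK3Surface S) (hι : ι ≫ ι = 𝟙 S)
    (x : S.left) : ∃ B : InvariantAffine ι.left, x ∈ B.1 := by
  obtain ⟨U, h1, h2⟩ := hS.exists_invariantAffine (left_comp_eq_id hι) x x
  exact ⟨U, h1⟩

theorem IsQuotient.ι2_involutive {S2 : CScheme} {π : square S ⟶ S2} {ι2 : S2 ⟶ S2}
    (H : IsQuotient (switch S) π) (hι : ι ≫ ι = 𝟙 S) (h : π ≫ ι2 = squareMap ι ≫ π) :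
    ι2 ≫ ι2 = 𝟙 S2 := by
  apply H.hom_ext
  rw [← Category.assoc, h, Category.assoc, h, ← Category.assoc, squareMap_involutive hι,
    Category.id_comp, Category.comp_id]

/-- The images of the sets `U × U` in `S^{(2)}` cover it and are affine and invariant. -/
theorem IsK3Surface.exists_invariantAffine_S2 (hS : IsK3Surface S) (hι : ι ≫ ι = 𝟙 S)
    {S2 : CScheme} {π : square S ⟶ S2} {ι2 : S2 ⟶ S2}
    (H : IsQuotient (switch S) π) (h : π ≫ ι2 = squareMap ι ≫ π) (y : S2.left) :
    ∃ (U : InvariantAffine ι.left) (O : InvariantAffine ι2.left), y ∈ O.1 ∧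
      π.left ⁻¹ᵁ O.1 = box U.1 := by
  obtain ⟨x, rfl⟩ := H.isQuotientMap.surjective y
  obtain ⟨U, hx⟩ := hS.exists_mem_box hι x
  obtain ⟨O, hO⟩ := H.exists_invariantAffine (switch_switch S) h (isAffineOpen_box U.2.1)
    (switch_invariant_box _) (squareMap_invariant_box U.2.2)
  refine ⟨U, O, ?_, hO⟩
  rw [← hO] at hx
  exact hx

theorem exists_symmetricQuotients (hS : IsK3Surface S) (hι : ι ≫ ι = 𝟙 S) :
    Nonempty (SymmetricQuotients S ι) := by
  obtain ⟨W, toW, HW⟩ := exists_isQuotient hι (hS.cover hι)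
  obtain ⟨S2, π, Hπ⟩ := exists_isQuotient (switch_switch S) (hS.switch_cover hι)
  obtain ⟨ι2, h2⟩ := Hπ.exists_desc (squareMap ι ≫ π) (by
    rw [← Category.assoc, switch_squareMap, Category.assoc, Hπ.invariant])
  obtain ⟨V, ρ, Hρ⟩ := exists_isQuotient (Hπ.ι2_involutive hι h2) fun y => by
    obtain ⟨U, O, hy, -⟩ := hS.exists_invariantAffine_S2 hι Hπ h2 y
    exact ⟨O, hy⟩
  exact ⟨⟨W, toW, HW, S2, π, Hπ, ι2, h2, V, ρ, Hρ⟩⟩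

namespace SymmetricQuotients

variable (D : SymmetricQuotients S ι)

/-- The quotient map `S × S ⟶ V`. -/
abbrev toVq : square S ⟶ D.V := D.toS2 ≫ D.toV

theorem switch_toVq : switch S ≫ D.toVq = D.toVq := by
  rw [← Category.assoc, D.isQuotient_S2.invariant]

theorem squareMap_toVq : squareMap ι ≫ D.toVq = D.toVq := by
  rw [← Category.assoc, ← D.toS2_ι2, Category.assoc, D.isQuotient_V.invariant]

theorem toVq_surjective : Function.Surjective D.toVq.left :=
  D.isQuotient_V.isQuotientMap.surjective.comp D.isQuotient_S2.isQuotientMap.surjective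

theorem toVq_hom_ext {T : CScheme} {a b : D.V ⟶ T} (h : D.toVq ≫ a = D.toVq ≫ b) : a = b := by
  apply D.isQuotient_V.hom_ext
  apply D.isQuotient_S2.hom_ext
  simpa using h

theorem exists_toVq_desc {T : CScheme} (f : square S ⟶ T) (h1 : switch S ≫ f = f)
    (h2 : squareMap ι ≫ f = f) : ∃ f' : D.V ⟶ T, D.toVq ≫ f' = f := by
  obtain ⟨a, ha⟩ := D.isQuotient_S2.exists_desc f h1
  obtain ⟨b, hb⟩ := D.isQuotient_V.exists_desc a (by
    apply D.isQuotient_S2.hom_ext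
    rw [← Category.assoc, D.toS2_ι2, Category.assoc, ha, h2])
  exact ⟨b, by rw [Category.assoc, hb, ha]⟩

/-- The fibres of `S × S ⟶ V` are the orbits of the group generated by the switch and `ι × ι`. -/
theorem toVq_eq_iff {x y : (square S).left} : D.toVq.left x = D.toVq.left y ↔
    y = x ∨ y = (switch S).left x ∨ y = (squareMap ι).left x ∨
      y = (switch S).left ((squareMap ι).left x) := by
  have h1 : D.ι2.left (D.toS2.left x) = D.toS2.left ((squareMap ι).left x) :=
    congrArg (fun f => f.left x) D.toS2_ι2
  have h2 : D.toVq.left x = D.toVq.left y ↔ D.toV.left (D.toS2.left x) =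
      D.toV.left (D.toS2.left y) := Iff.rfl
  rw [h2, D.isQuotient_V.orbits, h1, eq_comm (a := D.toS2.left y),
    D.isQuotient_S2.orbits, eq_comm (a := D.toS2.left y), D.isQuotient_S2.orbits, or_assoc]

end SymmetricQuotients

end

attribute [local instance] sectionsAlgebra

/-! ### The diagonal and the graph of the involution -/

/-- The diagonal `p ↦ (p, p)`. -/
abbrev diag (S : CScheme) : S ⟶ square S := squareLift (𝟙 S) (𝟙 S)

/-- The graph `p ↦ (p, ι p)`. -/
abbrev graph {S : CScheme} (ι : S ⟶ S) : S ⟶ square S := squareLift (𝟙 S) ι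

section

variable {S : CScheme} {ι : S ⟶ S}

theorem diag_switch (S : CScheme) : diag S ≫ switch S = diag S := squareLift_switch _ _

theorem graph_switch (hι : ι ≫ ι = 𝟙 S) : graph ι ≫ switch S = ι ≫ graph ι := by
  rw [squareLift_switch, comp_squareLift, hι, Category.comp_id]

theorem graph_squareMap : graph ι ≫ squareMap ι = ι ≫ graph ι := by
  rw [squareLift_squareMap, comp_squareLift, Category.id_comp, Category.comp_id]

theorem diag_squareMap {S' : CScheme} (f : S ⟶ S') : diag S ≫ squareMap f = f ≫ diag S' := by
  rw [squareLift_squareMap, comp_squareLift, Category.id_comp, Category.comp_id]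

theorem squareLift_twist {T : CScheme} (a b : T ⟶ S) :
    squareLift a b ≫ squareLift (squareFst S) (squareSnd S ≫ ι) = squareLift a (b ≫ ι) := by
  rw [comp_squareLift, squareLift_fst, ← Category.assoc, squareLift_snd]

theorem isClosedImmersion_of_comp_squareFst [IsSeparated S.str] (f : S ⟶ square S)
    (hf : f ≫ squareFst S = 𝟙 S) : IsClosedImmersion f.left := by
  have h1 : f.left ≫ (squareFst S).left = 𝟙 _ := congrArg CommaMorphism.left hf
  have : IsSeparated (squareFst S).left :=
    MorphismProperty.of_isPullback (isPullback_square S).flip inferInstance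
  have : IsClosedImmersion (f.left ≫ (squareFst S).left) := by rw [h1]; infer_instance
  exact IsClosedImmersion.of_comp f.left (squareFst S).left

theorem surjective_morphismRestrict_appTop {X Y : Scheme.{0}} (f : X ⟶ Y) {O : Y.Opens}
    (h : Function.Surjective (pb f (le_refl (f ⁻¹ᵁ O)))) :
    Function.Surjective (f ∣_ O).appTop := by
  have h1 : ∀ O', O' = O → Function.Surjective (f.app O') := by
    rintro _ rfl s
    obtain ⟨t, ht⟩ := h s
    exact ⟨t, by rw [app_eq_pb, ht]⟩
  rw [morphismRestrict_appTop]
  exact (presheaf_map_surjective _ (by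
    rw [show (f ∣_ O) ⁻¹ᵁ ⊤ = ⊤ from rfl, Scheme.Opens.ι_image_top,
      Scheme.Opens.ι_image_top])).comp (h1 _ (Scheme.Opens.ι_image_top O))

/-- The diagonal of the symmetric square is a closed immersion: a function `f` on the diagonal is
the restriction of the symmetric function `(f ⊗ 1 + 1 ⊗ f) / 2`. -/
theorem isClosedImmersion_diag_comp {S2 : CScheme} {π : square S ⟶ S2}
    (H : IsQuotient (switch S) π)
    (hc : ∀ x : (square S).left, ∃ U : S.left.Opens, IsAffineOpen U ∧ x ∈ box U) :
    IsClosedImmersion (diag S ≫ π).left := by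
  have H' := isQuotient_iff.1 H
  have hd1 : (diag S).left ≫ (squareFst S).left = 𝟙 _ :=
    congrArg CommaMorphism.left (squareLift_fst (𝟙 S) (𝟙 S))
  have hd2 : (diag S).left ≫ (squareSnd S).left = 𝟙 _ :=
    congrArg CommaMorphism.left (squareLift_snd (𝟙 S) (𝟙 S))
  have h : ∀ y : S2.left, ∃ O : S2.left.affineOpens, y ∈ O.1 ∧
      IsAffine ((diag S ≫ π).left ⁻¹ᵁ O.1).toScheme ∧
      Function.Surjective ((diag S ≫ π).left ∣_ O.1).appTop := by
    intro y
    obtain ⟨x, rfl⟩ := H.isQuotientMap.surjective y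
    obtain ⟨U, hU, hxU⟩ := hc x
    obtain ⟨O, hO, hOU⟩ := H'.exists_isAffineOpen (left_comp_eq_id (switch_switch S))
      (isAffineOpen_box hU) (switch_invariant_box U)
    have hOU' : (diag S ≫ π).left ⁻¹ᵁ O = U := by
      rw [Over.comp_left, Scheme.Hom.comp_preimage, hOU, box, Scheme.Hom.preimage_inf,
        ← Scheme.Hom.comp_preimage, ← Scheme.Hom.comp_preimage, hd1, hd2]
      simp
    refine ⟨⟨O, hO⟩, by rwa [← hOU] at hxU, by rw [hOU']; exact hU, ?_⟩
    apply surjective_morphismRestrict_appTop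
    intro f
    have hUd : U ≤ (diag S ≫ π).left ⁻¹ᵁ O := hOU'.ge
    have hdU : (diag S ≫ π).left ⁻¹ᵁ O ≤ U := hOU'.le
    have hδ : U ≤ (diag S).left ⁻¹ᵁ box U := by
      rw [← hOU]
      exact hUd
    have hσ := switch_invariant_box U
    have hπ : box U ≤ π.left ⁻¹ᵁ O := hOU.ge
    have hsw1 : (switch S).left ≫ (squareFst S).left = (squareSnd S).left :=
      congrArg CommaMorphism.left switch_fst
    have hsw2 : (switch S).left ≫ (squareSnd S).left = (squareFst S).left :=
      congrArg CommaMorphism.left switch_snd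
    obtain ⟨c, hc⟩ := isUnit_two (square S) (box U)
    -- `F` is the symmetric function `(f ⊗ 1 + 1 ⊗ f) / 2`
    let F : Γ((square S).left, box U) := ↑c⁻¹ * (pb (squareFst S).left (box_le_fst U)
      (res hUd f) + pb (squareSnd S).left (box_le_snd U) (res hUd f))
    have hF : pb (switch S).left hσ F = F := by
      have h2 : pb (switch S).left hσ (↑c⁻¹ : Γ((square S).left, box U)) = ↑c⁻¹ := by
        have h3 : pb (switch S).left hσ (c : Γ((square S).left, box U)) = c := by
          rw [hc, map_ofNat]
        rw [← mul_one (pb _ _ _), ← c.mul_inv, ← mul_assoc]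
        nth_rw 1 [← h3]
        rw [← map_mul, c.inv_mul, map_one, one_mul]
      simp only [F]
      rw [map_mul, map_add, h2, pb_pb, pb_pb, pb_congr hsw1, pb_congr hsw2, add_comm]
    obtain ⟨t, ht⟩ := (H'.hasInvariantSections O).exists_pb_eq (res hOU.le F) (by
      rw [pb_res, ← res_pb _ hOU.le hσ, hF])
    refine ⟨t, ?_⟩
    have h4 : pb (diag S ≫ π).left le_rfl t =
        res hdU (pb (diag S).left hδ (pb π.left hπ t)) := by
      rw [pb_pb, res_pb]
      rfl
    have h5 : pb π.left hπ t = F := by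
      have := congrArg (res hOU.ge) ht
      rwa [res_pb, res_res, res_self] at this
    have h6 : pb (diag S).left hδ (↑c⁻¹ : Γ((square S).left, box U)) * 2 = 1 := by
      rw [← map_ofNat (pb (diag S).left hδ) 2, ← hc, ← map_mul, c.inv_mul, map_one]
    have h7 : pb (diag S).left hδ F = res hUd f := by
      simp only [F]
      rw [map_mul, map_add, pb_pb, pb_pb, pb_congr hd1, pb_congr hd2, pb_id, res_self,
        ← two_mul, ← mul_assoc, h6, one_mul]
    rw [h4, h5, h7, res_res, res_self]
  choose O h1 h2 h3 using h
  refine (@HasAffineProperty.iff_of_iSup_eq_top _ _ IsClosedImmersion.hasAffineProperty _ _ _ _ O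
    ?_).2 fun y => ⟨h2 y, h3 y⟩
  · ext y
    simp only [Opens.coe_iSup, Set.mem_iUnion, Opens.coe_top, Set.mem_univ, iff_true]
    exact ⟨y, h1 y⟩

end

namespace SymmetricQuotients

variable {S : CScheme} {ι : S ⟶ S} (D : SymmetricQuotients S ι)

theorem exists_diag_desc : ∃ i : D.W ⟶ D.V, D.toW ≫ i = diag S ≫ D.toVq := by
  apply D.isQuotient_W.exists_desc
  rw [← Category.assoc, ← diag_squareMap, Category.assoc, D.squareMap_toVq]

theorem squareLift_toVq_swap {T : CScheme} (a b : T ⟶ S) :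
    squareLift a b ≫ D.toVq = squareLift b a ≫ D.toVq := by
  rw [← squareLift_switch b a, Category.assoc, D.switch_toVq]

theorem squareLift_toVq_map {T : CScheme} (a b : T ⟶ S) :
    squareLift (a ≫ ι) (b ≫ ι) ≫ D.toVq = squareLift a b ≫ D.toVq := by
  rw [← squareLift_squareMap a b, Category.assoc, D.squareMap_toVq]

theorem exists_graph_desc (hι : ι ≫ ι = 𝟙 S) :
    ∃ j : D.W ⟶ D.V, D.toW ≫ j = graph ι ≫ D.toVq := by
  apply D.isQuotient_W.exists_desc
  rw [← Category.assoc, ← graph_switch hι, Category.assoc, D.switch_toVq]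

/-- The involution of `V` induced by `(p, q) ↦ (p, ι q)`. -/
theorem exists_twist (hι : ι ≫ ι = 𝟙 S) : ∃ τ : D.V ⟶ D.V,
    D.toVq ≫ τ = squareLift (squareFst S) (squareSnd S ≫ ι) ≫ D.toVq ∧ τ ≫ τ = 𝟙 D.V := by
  have hιι : ∀ {T : CScheme} (a : T ⟶ S), (a ≫ ι) ≫ ι = a := fun a => by
    rw [Category.assoc, hι, Category.comp_id]
  obtain ⟨τ, hτ⟩ := D.exists_toVq_desc (squareLift (squareFst S) (squareSnd S ≫ ι) ≫ D.toVq) (by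
      rw [← Category.assoc, switch, squareLift_twist, ← D.squareLift_toVq_map, hιι,
        D.squareLift_toVq_swap]) (by
      rw [← Category.assoc, squareMap, squareLift_twist, D.squareLift_toVq_map])
  refine ⟨τ, hτ, D.toVq_hom_ext ?_⟩
  rw [← Category.assoc, hτ, Category.assoc, hτ, ← Category.assoc, Category.comp_id,
    squareLift_twist, hιι, squareLift_self_fst_snd, Category.id_comp]

/-- The twist interchanges the images of the diagonal and of the graph. -/
theorem comp_twist {i j : D.W ⟶ D.V} {τ : D.V ⟶ D.V} (hi : D.toW ≫ i = diag S ≫ D.toVq)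
    (hj : D.toW ≫ j = graph ι ≫ D.toVq)
    (hτ : D.toVq ≫ τ = squareLift (squareFst S) (squareSnd S ≫ ι) ≫ D.toVq) : i ≫ τ = j := by
  apply D.isQuotient_W.hom_ext
  rw [hj, ← Category.assoc, hi, Category.assoc, hτ, ← Category.assoc (diag S) (squareLift _ _),
    squareLift_twist, Category.id_comp]

end SymmetricQuotients

/-! ### Fixed points -/

section

variable {S : CScheme} {ι : S ⟶ S}

/-- The diagonal and the graph of `ι` are disjoint. A common point could be taken to be a complex
point, and then would be a fixed point of `ι`. -/
theorem IsEnriquesInvolution.disjoint [IsSeparated S.str] [LocallyOfFiniteType S.str]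
    (hι : IsEnriquesInvolution ι) :
    Disjoint (Set.range (diag S).left) (Set.range (graph ι).left) := by
  have h1 : IsClosedImmersion (diag S).left :=
    isClosedImmersion_of_comp_squareFst _ (squareLift_fst _ _)
  have h2 : IsClosedImmersion (graph ι).left :=
    isClosedImmersion_of_comp_squareFst _ (squareLift_fst _ _)
  have h3 : LocallyOfFiniteType (square S).str := by
    have : LocallyOfFiniteType (squareFst S).left :=
      MorphismProperty.of_isPullback (isPullback_square S).flip inferInstance
    rw [← CScheme.comp_str (squareFst S)]
    infer_instance
  rw [Set.disjoint_iff_inter_eq_empty]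
  by_contra h
  obtain ⟨p, ⟨s, hs⟩, ⟨t, ht⟩⟩ := exists_pointAt_mem (Set.nonempty_iff_ne_empty.2 h)
    (h1.isClosedEmbedding.isClosed_range.inter h2.isClosedEmbedding.isClosed_range).isLocallyClosed
  have key : ∀ (f : S ⟶ square S) [IsClosedImmersion f.left] (s : S.left),
      f.left s = pointAt p → ∃ a : pt ⟶ S, a ≫ f = p := by
    intro f _ s hs
    have : IsClosed {s} := by
      have h4 : f.left ⁻¹' {pointAt p} = {s} := by
        ext u
        rw [Set.mem_preimage, Set.mem_singleton_iff, ← hs,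
          f.left.isClosedEmbedding.injective.eq_iff, Set.mem_singleton_iff]
      rw [← h4]
      exact (isClosed_pointAt p).preimage f.left.continuous
    obtain ⟨a, rfl⟩ := exists_pointAt_eq this
    exact ⟨a, point_ext (by rw [pointAt_comp, hs])⟩
  obtain ⟨a, ha⟩ := key _ s hs
  obtain ⟨b, hb⟩ := key _ t ht
  rw [comp_squareLift, Category.comp_id] at ha hb
  have h5 := congrArg (· ≫ squareFst S) (ha.trans hb.symm)
  have h6 := congrArg (· ≫ squareSnd S) (ha.trans hb.symm)
  simp only [squareLift_fst, squareLift_snd] at h5 h6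
  exact hι.fixedPointFree b (h6.symm.trans h5)

end

attribute [local instance] sectionsAlgebra

section

variable {S : CScheme} {ι : S ⟶ S}

theorem locallyOfFiniteType_square [LocallyOfFiniteType S.str] :
    LocallyOfFiniteType (square S).str := by
  have : LocallyOfFiniteType (squareFst S).left :=
    MorphismProperty.of_isPullback (isPullback_square S).flip inferInstance
  rw [← CScheme.comp_str (squareFst S)]
  infer_instance

theorem smooth_square [Smooth S.str] : Smooth (square S).str := by
  have : Smooth (squareFst S).left :=
    MorphismProperty.of_isPullback (isPullback_square S).flip inferInstance
  rw [← CScheme.comp_str (squareFst S)]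
  infer_instance

theorem IsK3Surface.isIntegral_square (hS : IsK3Surface S) : IsIntegral (square S).left := by
  have := hS.integral
  have := hS.locallyOfFiniteType
  exact EnriquesQuotient.isIntegral_square hS.exists_isAffineOpen
    ⟨(diag S).left (Classical.arbitrary S.left)⟩

end

namespace SymmetricQuotients

variable {S : CScheme} {ι : S ⟶ S} (D : SymmetricQuotients S ι)

/-! ### Free loci of the quotient maps -/

theorem isGeomQuotient_W : IsGeomQuotient ι.left D.toW.left := isQuotient_iff.1 D.isQuotient_W

theorem isGeomQuotient_S2 : IsGeomQuotient (switch S).left D.toS2.left :=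
  isQuotient_iff.1 D.isQuotient_S2

theorem isGeomQuotient_V : IsGeomQuotient D.ι2.left D.toV.left := isQuotient_iff.1 D.isQuotient_V

theorem ι2_involutive (hι : ι ≫ ι = 𝟙 S) : D.ι2 ≫ D.ι2 = 𝟙 D.S2 :=
  D.isQuotient_S2.ι2_involutive hι D.toS2_ι2

theorem isAffineHom_toW (hS : IsK3Surface S) (hι : ι ≫ ι = 𝟙 S) : IsAffineHom D.toW.left :=
  D.isQuotient_W.isAffineHom hι (hS.cover hι)

theorem isAffineHom_toS2 (hS : IsK3Surface S) (hι : ι ≫ ι = 𝟙 S) : IsAffineHom D.toS2.left :=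
  D.isQuotient_S2.isAffineHom (switch_switch S) (hS.switch_cover hι)

theorem isAffineHom_toV (hS : IsK3Surface S) (hι : ι ≫ ι = 𝟙 S) : IsAffineHom D.toV.left :=
  D.isQuotient_V.isAffineHom (D.ι2_involutive hι) fun y => by
    obtain ⟨U, O, hy, -⟩ := hS.exists_invariantAffine_S2 hι D.isQuotient_S2 D.toS2_ι2 y
    exact ⟨O, hy⟩

theorem isClosedMap_toS2 (hS : IsK3Surface S) (hι : ι ≫ ι = 𝟙 S) : IsClosedMap D.toS2.left := by
  have := D.isAffineHom_toS2 hS hι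
  have := D.isGeomQuotient_S2.isIntegralHom (left_comp_eq_id (switch_switch S))
  exact D.toS2.left.isClosedMap

theorem isClosedMap_toVq (hS : IsK3Surface S) (hι : ι ≫ ι = 𝟙 S) : IsClosedMap D.toVq.left := by
  have := D.isAffineHom_toV hS hι
  have := D.isGeomQuotient_V.isIntegralHom (left_comp_eq_id (D.ι2_involutive hι))
  have h := D.toV.left.isClosedMap.comp (D.isClosedMap_toS2 hS hι)
  exact h

theorem freeLocus_W (hS : IsK3Surface S) (hι : IsEnriquesInvolution ι) :
    freeLocus D.isGeomQuotient_W.invariant = ⊤ := by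
  have := D.isAffineHom_toW hS hι.involutive
  have := hS.locallyOfFiniteType
  rw [eq_top_iff]
  intro w hw
  refine mem_freeLocus_of_forall_point D.isGeomQuotient_W (left_comp_eq_id hι.involutive) (𝟙 S)
    Function.surjective_id (Q₀ := ⊤) (fun p _ h => ?_) hw
  rw [Category.id_comp, Category.comp_id] at h
  exact hι.fixedPointFree p (point_ext h)

theorem mem_freeLocus_S2 (hS : IsK3Surface S) (hι : ι ≫ ι = 𝟙 S) {y : D.S2.left}
    (hy : y ∉ Set.range (diag S ≫ D.toS2).left) :
    y ∈ freeLocus D.isGeomQuotient_S2.invariant := by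
  have := D.isAffineHom_toS2 hS hι
  have := hS.locallyOfFiniteType
  have := hS.isSeparated
  have := locallyOfFiniteType_square (S := S)
  have hδ : IsClosedImmersion (diag S).left :=
    isClosedImmersion_of_comp_squareFst _ (squareLift_fst _ _)
  have hcl : IsClosed (Set.range (diag S ≫ D.toS2).left) := by
    have := (D.isClosedMap_toS2 hS hι) _ hδ.isClosedEmbedding.isClosed_range
    rw [← Set.range_comp] at this
    exact this
  refine mem_freeLocus_of_forall_point D.isGeomQuotient_S2 (left_comp_eq_id (switch_switch S)) (𝟙 _)
    Function.surjective_id (Q₀ := ⟨_, hcl.isOpen_compl⟩) (fun p hp h => hp ?_) hy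
  rw [Category.id_comp, Category.comp_id] at h
  have h1 := point_ext h
  refine ⟨pointAt (p ≫ squareFst S), ?_⟩
  rw [← pointAt_comp, ← Category.assoc, comp_squareLift, Category.comp_id]
  congr 3
  apply square_hom_ext_over
  · rw [squareLift_fst]
  · rw [squareLift_snd, ← switch_snd, ← Category.assoc, h1]

theorem range_eq_of_comp_eq {f : S ⟶ square S} {k : D.W ⟶ D.V} (h : D.toW ≫ k = f ≫ D.toVq) :
    Set.range k.left = D.toVq.left '' Set.range f.left := by
  rw [← Set.range_comp]
  have h1 : Set.range (D.toW ≫ k).left = Set.range (f ≫ D.toVq).left := by rw [h]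
  rw [← D.isGeomQuotient_W.isQuotientMap.surjective.range_comp k.left]
  exact h1

theorem isClosed_range_of_comp_eq (hS : IsK3Surface S) (hι : ι ≫ ι = 𝟙 S)
    {f : S ⟶ square S} (hf : f ≫ squareFst S = 𝟙 S) {k : D.W ⟶ D.V}
    (h : D.toW ≫ k = f ≫ D.toVq) : IsClosed (Set.range k.left) := by
  have := hS.isSeparated
  have := isClosedImmersion_of_comp_squareFst f hf
  rw [D.range_eq_of_comp_eq h]
  exact D.isClosedMap_toVq hS hι _ f.left.isClosedEmbedding.isClosed_range

/-- The involution `ι^{(2)}` of `S^{(2)}` acts freely over the complement of the image of the graph: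
`{ι p, ι q} = {p, q}` means `ι p = q`, since `ι` has no fixed points. -/
theorem mem_freeLocus_V (hS : IsK3Surface S) (hι : IsEnriquesInvolution ι) {j : D.W ⟶ D.V}
    (hj : D.toW ≫ j = graph ι ≫ D.toVq) {v : D.V.left} (hv : v ∉ Set.range j.left) :
    v ∈ freeLocus D.isGeomQuotient_V.invariant := by
  have := D.isAffineHom_toV hS hι.involutive
  have := hS.locallyOfFiniteType
  have := locallyOfFiniteType_square (S := S)
  have hcl := D.isClosed_range_of_comp_eq hS hι.involutive (squareLift_fst _ _) hj
  refine mem_freeLocus_of_forall_point D.isGeomQuotient_V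
    (left_comp_eq_id (D.ι2_involutive hι.involutive)) D.toS2
    D.isQuotient_S2.isQuotientMap.surjective (Q₀ := ⟨_, hcl.isOpen_compl⟩) (fun p hp h => ?_) hv
  rw [D.toS2_ι2, ← Category.assoc, pointAt_comp _ D.toS2, pointAt_comp _ D.toS2,
    D.isGeomQuotient_S2.orbits, ← pointAt_comp] at h
  rcases h with h | h
  · have h1 := congrArg (· ≫ squareFst S) (point_ext h)
    simp only [Category.assoc, squareMap_fst] at h1
    exact hι.fixedPointFree (p ≫ squareFst S) ((Category.assoc _ _ _).trans h1.symm)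
  · refine hp ?_
    have h1 := congrArg (· ≫ squareSnd S) (point_ext h)
    simp only [Category.assoc, switch_snd, squareMap_fst] at h1
    rw [D.range_eq_of_comp_eq hj]
    refine ⟨_, ⟨pointAt (p ≫ squareFst S), rfl⟩, ?_⟩
    rw [← pointAt_comp, ← pointAt_comp]
    congr 2
    rw [comp_squareLift, Category.comp_id]
    apply square_hom_ext_over
    · rw [squareLift_fst]
    · rw [squareLift_snd, h1, Category.assoc]

theorem disjoint_range (hS : IsK3Surface S) (hι : IsEnriquesInvolution ι) {i j : D.W ⟶ D.V}
    (hi : D.toW ≫ i = diag S ≫ D.toVq) (hj : D.toW ≫ j = graph ι ≫ D.toVq) :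
    Disjoint (Set.range i.left) (Set.range j.left) := by
  have := hS.isSeparated
  have := hS.locallyOfFiniteType
  rw [D.range_eq_of_comp_eq hi, D.range_eq_of_comp_eq hj, Set.disjoint_left]
  rintro _ ⟨_, ⟨s, rfl⟩, rfl⟩ ⟨_, ⟨t, rfl⟩, hst⟩
  rw [D.toVq_eq_iff] at hst
  refine Set.disjoint_left.1 hι.disjoint ⟨s, rfl⟩ ?_
  have h1 : (switch S).left ((graph ι).left t) = (graph ι).left (ι.left t) :=
    congrArg (fun f => f.left t) (graph_switch hι.involutive)
  have h2 : ∀ t, (squareMap ι).left ((graph ι).left t) = (graph ι).left (ι.left t) := fun t =>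
    congrArg (fun f => f.left t) (graph_squareMap (ι := ι))
  have h3 : (switch S).left ((graph ι).left (ι.left t)) = (graph ι).left (ι.left (ι.left t)) :=
    congrArg (fun f => f.left (ι.left t)) (graph_switch hι.involutive)
  rw [h2, h1, h3] at hst
  rcases hst with h | h | h | h
  · exact ⟨_, h.symm⟩
  · exact ⟨_, h.symm⟩
  · exact ⟨_, h.symm⟩
  · exact ⟨_, h.symm⟩

/-- Away from the images of the diagonal and of the graph, `V` is smooth. -/
theorem isSmoothAt_V (hS : IsK3Surface S) (hι : IsEnriquesInvolution ι) {i j : D.W ⟶ D.V}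
    (hi : D.toW ≫ i = diag S ≫ D.toVq) (hj : D.toW ≫ j = graph ι ≫ D.toVq) {v : D.V.left}
    (hvi : v ∉ Set.range i.left) (hvj : v ∉ Set.range j.left) : IsSmoothAt D.V.str v := by
  have := D.isAffineHom_toV hS hι.involutive
  have := D.isAffineHom_toS2 hS hι.involutive
  have := hS.smooth.smooth
  have := smooth_square (S := S)
  refine isSmoothAt_of_mem_freeLocus D.isGeomQuotient_V
    (left_comp_eq_id (D.ι2_involutive hι.involutive)) (isUnit_two _ _)
    (D.mem_freeLocus_V hS hι hj hvj) fun y hy => ?_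
  rw [CScheme.comp_str]
  refine isSmoothAt_of_mem_freeLocus D.isGeomQuotient_S2
    (left_comp_eq_id (switch_switch S)) (isUnit_two _ _)
    (D.mem_freeLocus_S2 hS hι.involutive ?_) fun x _ => ?_
  · rintro ⟨s, rfl⟩
    apply hvi
    rw [D.range_eq_of_comp_eq hi]
    exact ⟨_, ⟨s, rfl⟩, hy⟩
  · rw [CScheme.comp_str]
    exact isSmoothAt_of_smooth x

/-- If `S^{(2)}` is singular along the diagonal, then so is `V`: near the image of the diagonal
the map `S^{(2)} ⟶ V` is étale. -/
theorem not_isSmoothAt_V (hS : IsK3Surface S) (hι : IsEnriquesInvolution ι) {i j : D.W ⟶ D.V}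
    (hi : D.toW ≫ i = diag S ≫ D.toVq) (hj : D.toW ≫ j = graph ι ≫ D.toVq)
    (hsing : ∀ s, ¬ IsSmoothAt D.S2.str ((diag S ≫ D.toS2).left s)) (w : D.W.left) :
    ¬ IsSmoothAt D.V.str (i.left w) := by
  intro h
  have := D.isAffineHom_toV hS hι.involutive
  obtain ⟨s, rfl⟩ := D.isGeomQuotient_W.isQuotientMap.surjective w
  have h1 : i.left (D.toW.left s) = D.toV.left ((diag S ≫ D.toS2).left s) :=
    congrArg (fun f => f.left s) (hi.trans (Category.assoc _ _ _).symm)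
  have h2 := D.mem_freeLocus_V hS hι hj (v := i.left (D.toW.left s)) fun h' =>
    Set.disjoint_left.1 (D.disjoint_range hS hι hi hj) ⟨_, rfl⟩ h'
  rw [h1] at h h2
  obtain ⟨U, hU, hUe⟩ := exists_etale_of_mem_freeLocus D.isGeomQuotient_V
    (left_comp_eq_id (D.ι2_involutive hι.involutive)) (isUnit_two _ _) h2
  have h3 := IsSmoothAt.comp (U.ι ≫ D.toV.left) (t := (⟨_, hU⟩ : U)) h
  rw [Category.assoc, CScheme.comp_str] at h3
  exact hsing s h3.of_comp

theorem isSmoothAt_twist_iff {τ : D.V ⟶ D.V} (hτ : τ ≫ τ = 𝟙 D.V) (v : D.V.left) :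
    IsSmoothAt D.V.str (τ.left v) ↔ IsSmoothAt D.V.str v := by
  have : IsIso τ.left := ⟨τ.left, left_comp_eq_id hτ, left_comp_eq_id hτ⟩
  rw [← isSmoothAt_comp_iff τ.left, CScheme.comp_str]

/-- The singular locus of `V`, given that `S^{(2)}` is singular along the diagonal. The involution
of `V` induced by `1 × ι` exchanges the images of the diagonal and of the graph. -/
theorem singularLocus_V (hS : IsK3Surface S) (hι : IsEnriquesInvolution ι) {i j : D.W ⟶ D.V}
    (hi : D.toW ≫ i = diag S ≫ D.toVq) (hj : D.toW ≫ j = graph ι ≫ D.toVq)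
    (hsing : ∀ s, ¬ IsSmoothAt D.S2.str ((diag S ≫ D.toS2).left s)) :
    (singularLocus D.V : Set D.V.left) = Set.range i.left ∪ Set.range j.left := by
  obtain ⟨τ, hτ, hττ⟩ := D.exists_twist hι.involutive
  ext v
  have h1 : v ∈ (singularLocus D.V : Set D.V.left) ↔ ¬ IsSmoothAt D.V.str v := by
    rw [← mem_nonsingularLocus_iff]
    rfl
  rw [h1]
  constructor
  · intro h
    by_contra h'
    rw [Set.mem_union, not_or] at h'
    exact h (D.isSmoothAt_V hS hι hi hj h'.1 h'.2)
  · rintro (⟨w, rfl⟩ | ⟨w, rfl⟩)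
    · exact D.not_isSmoothAt_V hS hι hi hj hsing w
    · rw [← D.comp_twist hi hj hτ]
      have h2 := D.not_isSmoothAt_V hS hι hi hj hsing w
      rwa [← D.isSmoothAt_twist_iff hττ] at h2

end SymmetricQuotients

attribute [local instance] sectionsAlgebra

/-! ### The double cover -/

section

variable {S W : CScheme} {ι : S ⟶ S} {p : S ⟶ W}

/-- The product `S × S ⟶ W × W` of two quotient maps factors into two base changes of the quotient
map `S ⟶ W`. -/
theorem exists_factorization (H : IsQuotient ι p) (hι : ι ≫ ι = 𝟙 S) [IsAffineHom p.left] :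
    ∃ (M : Scheme.{0}) (a : (square S).left ⟶ M) (b : M ⟶ (square W).left) (γ : M ⟶ M),
      a ≫ b = (squareMap p).left ∧
      IsGeomQuotient (squareLift (squareFst S) (squareSnd S ≫ ι)).left a ∧
      IsGeomQuotient γ b ∧
      a ≫ γ = (squareLift (squareFst S ≫ ι) (squareSnd S)).left ≫ a := by
  have H' := isQuotient_iff.1 H
  have hp := CScheme.comp_str p
  have hι' := left_comp_eq_id hι
  have hpι : ι.left ≫ p.left = p.left := H'.invariant
  have hιs := CScheme.comp_str ι
  let a : (square S).left ⟶ pullback S.str W.str :=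
    pullback.lift (squareFst S).left ((squareSnd S).left ≫ p.left) (by
      rw [Category.assoc, hp, (isPullback_square S).w])
  have ha1 : a ≫ pullback.fst S.str W.str = (squareFst S).left := pullback.lift_fst _ _ _
  have ha2 : a ≫ pullback.snd S.str W.str = (squareSnd S).left ≫ p.left := pullback.lift_snd _ _ _
  let b : pullback S.str W.str ⟶ (square W).left :=
    (isPullback_square W).lift (pullback.fst S.str W.str ≫ p.left) (pullback.snd S.str W.str) (by
      rw [Category.assoc, hp, pullback.condition])
  have hb1 : b ≫ (squareFst W).left = pullback.fst S.str W.str ≫ p.left :=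
    (isPullback_square W).lift_fst _ _ _
  have hb2 : b ≫ (squareSnd W).left = pullback.snd S.str W.str :=
    (isPullback_square W).lift_snd _ _ _
  let γ : pullback S.str W.str ⟶ pullback S.str W.str :=
    pullback.lift (pullback.fst S.str W.str ≫ ι.left) (pullback.snd S.str W.str) (by
      rw [Category.assoc, hιs, pullback.condition])
  have hγ1 : γ ≫ pullback.fst S.str W.str = pullback.fst S.str W.str ≫ ι.left :=
    pullback.lift_fst _ _ _
  have hγ2 : γ ≫ pullback.snd S.str W.str = pullback.snd S.str W.str := pullback.lift_snd _ _ _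
  have hs1 : (squareLift (squareFst S) (squareSnd S ≫ ι)).left ≫ (squareFst S).left =
      (squareFst S).left := congrArg CommaMorphism.left (squareLift_fst _ _)
  have hs2 : (squareLift (squareFst S) (squareSnd S ≫ ι)).left ≫ (squareSnd S).left =
      (squareSnd S).left ≫ ι.left := congrArg CommaMorphism.left (squareLift_snd _ _)
  have ht1 : (squareLift (squareFst S ≫ ι) (squareSnd S)).left ≫ (squareFst S).left =
      (squareFst S).left ≫ ι.left := congrArg CommaMorphism.left (squareLift_fst _ _)
  have ht2 : (squareLift (squareFst S ≫ ι) (squareSnd S)).left ≫ (squareSnd S).left =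
      (squareSnd S).left := congrArg CommaMorphism.left (squareLift_snd _ _)
  have hm1 : (squareMap p).left ≫ (squareFst W).left = (squareFst S).left ≫ p.left :=
    congrArg CommaMorphism.left (squareMap_fst p)
  have hm2 : (squareMap p).left ≫ (squareSnd W).left = (squareSnd S).left ≫ p.left :=
    congrArg CommaMorphism.left (squareMap_snd p)
  have hPa : IsPullback (squareSnd S).left a p.left (pullback.snd S.str W.str) := by
    refine (IsPullback.of_right (h₁₂ := pullback.fst S.str W.str) (h₂₂ := W.str) (v₁₃ := S.str)
      ?_ ha2 (IsPullback.of_hasPullback S.str W.str)).flip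
    rw [ha1, hp]
    exact isPullback_square S
  have hPb : IsPullback (pullback.fst S.str W.str) b p.left (squareFst W).left := by
    refine (IsPullback.of_right (h₁₂ := (squareSnd W).left) (h₂₂ := W.str) (v₁₃ := W.str)
      ?_ hb1 (isPullback_square W).flip).flip
    rw [hb2, hp]
    exact (IsPullback.of_hasPullback S.str W.str).flip
  have h2 := isUnit_two W ⊤
  have hsa : (squareLift (squareFst S) (squareSnd S ≫ ι)).left ≫ a = a := by
    apply pullback.hom_ext
    · rw [Category.assoc, ha1, hs1]
    · rw [Category.assoc, ha2, ← Category.assoc, hs2, Category.assoc, hpι]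
  have hγb : γ ≫ b = b := by
    apply square_hom_ext
    · rw [Category.assoc, hb1, ← Category.assoc, hγ1, Category.assoc, hpι]
    · rw [Category.assoc, hb2, hγ2]
  refine ⟨_, a, b, γ, ?_, (H'.of_isPullback hι' h2 hPa _ hs2 hsa).1,
    (H'.of_isPullback hι' h2 hPb _ hγ1 hγb).1, ?_⟩
  · apply square_hom_ext
    · rw [Category.assoc, hb1, ← Category.assoc, ha1, hm1]
    · rw [Category.assoc, hb2, ha2, hm2]
  · apply pullback.hom_ext
    · rw [Category.assoc, Category.assoc, hγ1, ha1, ← Category.assoc, ha1, ht1]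
    · rw [Category.assoc, Category.assoc, hγ2, ha2, ← Category.assoc, ht2]

end

/-- A quotient by a group of order `8` computed in two ways: if `a`, `b`, `c` are successive
quotients by involutions and `ψ` is a quotient map for a subgroup of index `2`, then the induced
map `β` is the quotient by the remaining involution. -/
theorem isGeomQuotient_of_tower {X M N R V : Scheme.{0}} {a : X ⟶ M} {b : M ⟶ N} {c : N ⟶ R}
    {ψ : X ⟶ V} {β : V ⟶ R} {g₁ g₂ g₃ : X ⟶ X} {γ : M ⟶ M} {δ : N ⟶ N} {τ : V ⟶ V}
    (ha : IsGeomQuotient g₁ a) (hb : IsGeomQuotient γ b) (hc : IsGeomQuotient δ c)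
    (hγ : a ≫ γ = g₂ ≫ a) (hδ : (a ≫ b) ≫ δ = g₃ ≫ a ≫ b)
    (hψ : Function.Surjective ψ)
    (hψi : ∀ U : V.Opens, Function.Injective (pb ψ (le_refl (ψ ⁻¹ᵁ U))))
    (hβ : ψ ≫ β = a ≫ b ≫ c) (h1 : g₁ ≫ ψ = ψ ≫ τ) (h2 : g₂ ≫ ψ = ψ ≫ τ) (h3 : g₃ ≫ ψ = ψ)
    (hτ : τ ≫ τ = 𝟙 V) :
    IsGeomQuotient τ β := by
  have hepi : Epi ψ := epi_of_surjective_of_injective hψ fun U s t h => hψi U (by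
    rwa [← app_eq_pb, ← app_eq_pb])
  have hinv : τ ≫ β = β := by
    rw [← cancel_epi ψ, ← Category.assoc, ← h1, Category.assoc, hβ, ← Category.assoc, ha.invariant]
  have hψ1 : ∀ x, ψ (g₁ x) = τ (ψ x) := fun x => congrArg (fun f => f x) h1
  have hψ2 : ∀ x, ψ (g₂ x) = τ (ψ x) := fun x => congrArg (fun f => f x) h2
  have hψ3 : ∀ x, ψ (g₃ x) = ψ x := fun x => congrArg (fun f => f x) h3
  have hβ' : ∀ x, β (ψ x) = c (b (a x)) := fun x => congrArg (fun f => f x) hβ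
  refine ⟨hinv, ?_, fun v v' => ?_, fun U s t h => ?_, fun O t ht => ?_⟩
  · refine Topology.IsQuotientMap.of_comp ψ.continuous β.continuous ?_
    have h4 := hc.isQuotientMap.comp (hb.isQuotientMap.comp ha.isQuotientMap)
    convert h4 using 1
    ext x
    exact hβ' x
  · obtain ⟨x, rfl⟩ := hψ v
    obtain ⟨y, rfl⟩ := hψ v'
    have key : ∀ z, b (a z) = b (a y) → ψ y = ψ z ∨ ψ y = τ (ψ z) := by
      intro z hz
      have hγz : γ (a z) = a (g₂ z) := congrArg (fun f => f z) hγ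
      rcases (hb.orbits _ _).1 hz with h | h
      · rcases (ha.orbits _ _).1 h.symm with rfl | rfl
        · exact Or.inl rfl
        · exact Or.inr (hψ1 z)
      · rw [hγz] at h
        rcases (ha.orbits _ _).1 h.symm with rfl | rfl
        · exact Or.inr (hψ2 z)
        · left
          rw [hψ1, hψ2, apply_apply_of_involutive hτ]
    constructor
    · intro h
      rw [hβ', hβ'] at h
      rcases (hc.orbits _ _).1 h with h | h
      · exact key x h.symm
      · have hδx : δ (b (a x)) = b (a (g₃ x)) := congrArg (fun f => f x) hδ
        rw [hδx] at h
        have := key _ h.symm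
        rwa [hψ3] at this
    · rintro (h | h)
      · rw [h]
      · rw [h]
        exact (congrArg (fun f => f (ψ x)) hinv).symm
  · apply hc.injective U
    apply hb.injective
    apply ha.injective
    rw [app_eq_pb, app_eq_pb] at h
    simp only [app_eq_pb, pb_pb]
    have h5 := congrArg (pb ψ (V := a ⁻¹ᵁ b ⁻¹ᵁ c ⁻¹ᵁ U) (by
      rw [← Scheme.Hom.comp_preimage ψ, hβ]; exact le_rfl)) h
    rw [pb_pb, pb_pb, pb_congr hβ, pb_congr hβ] at h5
    simpa only [Category.assoc] using h5
  · rw [appLE_eq_pb] at ht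
    have e : a ⁻¹ᵁ b ⁻¹ᵁ c ⁻¹ᵁ O ≤ ψ ⁻¹ᵁ β ⁻¹ᵁ O := by
      rw [← Scheme.Hom.comp_preimage ψ, hβ]; exact le_rfl
    have e' : ψ ⁻¹ᵁ β ⁻¹ᵁ O ≤ a ⁻¹ᵁ b ⁻¹ᵁ c ⁻¹ᵁ O := by
      rw [← Scheme.Hom.comp_preimage ψ, hβ]; exact le_rfl
    have hs : ∀ (g : X ⟶ X) (e₁ : a ⁻¹ᵁ b ⁻¹ᵁ c ⁻¹ᵁ O ≤ g ⁻¹ᵁ a ⁻¹ᵁ b ⁻¹ᵁ c ⁻¹ᵁ O),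
        g ≫ ψ = ψ ≫ τ ∨ g ≫ ψ = ψ → pb g e₁ (pb ψ e t) = pb ψ e t := by
      rintro g e₁ (h | h)
      · rw [pb_pb, pb_congr h]
        conv_rhs => rw [← ht]
        rw [pb_pb]
      · rw [pb_pb, pb_congr h]
    have e₂ : a ⁻¹ᵁ b ⁻¹ᵁ c ⁻¹ᵁ O ≤ g₂ ⁻¹ᵁ a ⁻¹ᵁ b ⁻¹ᵁ c ⁻¹ᵁ O := by
      rw [← Scheme.Hom.comp_preimage g₂, ← hγ, Scheme.Hom.comp_preimage,
        ← Scheme.Hom.comp_preimage γ, hb.invariant]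
    have hδ' : (a ≫ b) ≫ δ = (g₃ ≫ a) ≫ b := by rw [hδ, Category.assoc]
    have e₃ : a ⁻¹ᵁ b ⁻¹ᵁ c ⁻¹ᵁ O ≤ g₃ ⁻¹ᵁ a ⁻¹ᵁ b ⁻¹ᵁ c ⁻¹ᵁ O := by
      rw [← Scheme.Hom.comp_preimage g₃, ← Scheme.Hom.comp_preimage (g₃ ≫ a), ← hδ',
        Scheme.Hom.comp_preimage, Scheme.Hom.comp_preimage a, ← Scheme.Hom.comp_preimage δ,
        hc.invariant]
    obtain ⟨m, hm⟩ := (ha.hasInvariantSections _).exists_pb_eq (pb ψ e t) (hs g₁ _ (Or.inl h1))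
    obtain ⟨n, hn⟩ := (hb.hasInvariantSections _).exists_pb_eq m (by
      apply (ha.hasInvariantSections _).injective
      rw [pb_pb, pb_congr hγ, ← pb_pb g₂ a le_rfl e₂, hm, hs g₂ e₂ (Or.inl h2)])
    obtain ⟨r, hr⟩ := (hc.hasInvariantSections _).exists_pb_eq n (by
      apply (hb.hasInvariantSections _).injective
      apply (ha.hasInvariantSections _).injective
      rw [pb_pb, pb_pb, pb_congr hδ', ← pb_pb (g₃ ≫ a) b le_rfl e₃, hn, ← pb_pb g₃ a le_rfl e₃, hm,
        hs g₃ e₃ (Or.inr h3)])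
    refine ⟨r, ?_⟩
    rw [app_eq_pb]
    apply hψi
    rw [pb_pb, pb_congr hβ]
    have h6 := congrArg (res e') hm
    rw [← hn, ← hr, pb_pb, pb_pb, res_pb, res_pb] at h6
    simpa only [Category.assoc] using h6

namespace SymmetricQuotients

variable {S : CScheme} {ι : S ⟶ S} (D : SymmetricQuotients S ι)

theorem pb_toVq_injective (U : D.V.left.Opens) :
    Function.Injective (pb D.toVq.left (le_refl (D.toVq.left ⁻¹ᵁ U))) := by
  intro s t h
  apply (D.isGeomQuotient_V.hasInvariantSections U).injective
  apply (D.isGeomQuotient_S2.hasInvariantSections _).injective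
  rw [pb_pb, pb_pb]
  exact h

/-- The map from `V` to the symmetric square of `W` is the quotient by the twist. -/
theorem isGeomQuotient_double_cover (hS : IsK3Surface S) (hι : ι ≫ ι = 𝟙 S) {W2 : CScheme}
    {c : square D.W ⟶ W2} (Hc : IsQuotient (switch D.W) c) {τ : D.V ⟶ D.V}
    (hτ : D.toVq ≫ τ = squareLift (squareFst S) (squareSnd S ≫ ι) ≫ D.toVq)
    (hττ : τ ≫ τ = 𝟙 D.V) {β : D.V ⟶ W2} (hβ : D.toVq ≫ β = squareMap D.toW ≫ c) :
    IsGeomQuotient τ.left β.left := by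
  have := D.isAffineHom_toW hS hι
  obtain ⟨M, a, b, γ, hab, ha, hb, hγ⟩ := exists_factorization D.isQuotient_W hι
  have hιι : ∀ {T : CScheme} (a : T ⟶ S), (a ≫ ι) ≫ ι = a := fun a => by
    rw [Category.assoc, hι, Category.comp_id]
  have h2 : squareLift (squareFst S ≫ ι) (squareSnd S) ≫ D.toVq = D.toVq ≫ τ := by
    rw [hτ, ← D.squareLift_toVq_map, hιι]
  refine isGeomQuotient_of_tower ha hb (isQuotient_iff.1 Hc) hγ (g₃ := (switch S).left) ?_
    D.toVq_surjective D.pb_toVq_injective ?_ (congrArg CommaMorphism.left hτ.symm)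
    (congrArg CommaMorphism.left h2) (congrArg CommaMorphism.left D.switch_toVq)
    (left_comp_eq_id hττ)
  · rw [hab]
    exact congrArg CommaMorphism.left (switch_squareMap D.toW).symm
  · rw [← Category.assoc, hab]
    exact congrArg CommaMorphism.left hβ

/-- The translates of the image of `U × U` under the twist are the image itself. -/
theorem exists_twist_invariantAffine (hS : IsK3Surface S) (hι : ι ≫ ι = 𝟙 S) {τ : D.V ⟶ D.V}
    (hτ : D.toVq ≫ τ = squareLift (squareFst S) (squareSnd S ≫ ι) ≫ D.toVq) (v : D.V.left) :
    ∃ O : InvariantAffine τ.left, v ∈ O.1 := by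
  obtain ⟨y, rfl⟩ := D.isQuotient_V.isQuotientMap.surjective v
  obtain ⟨U, O, hy, hO⟩ := hS.exists_invariantAffine_S2 hι D.isQuotient_S2 D.toS2_ι2 y
  obtain ⟨O', hO', hOO⟩ := D.isGeomQuotient_V.exists_isAffineOpen
    (left_comp_eq_id (D.ι2_involutive hι)) O.2.1 O.2.2
  have hbox : D.toVq.left ⁻¹ᵁ O' = box U.1 := by
    rw [← hO, ← hOO]
    rfl
  refine ⟨⟨O', hO', fun v hv => ?_⟩, by rwa [← hOO] at hy⟩
  obtain ⟨x, rfl⟩ := D.toVq_surjective v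
  have hx : x ∈ box U.1 := by rw [← hbox]; exact hv
  have h1 : τ.left (D.toVq.left x) =
      D.toVq.left ((squareLift (squareFst S) (squareSnd S ≫ ι)).left x) :=
    congrArg (fun f => f.left x) hτ
  have h2 : (squareLift (squareFst S) (squareSnd S ≫ ι)).left x ∈ box U.1 := by
    have h3 := congrArg (fun f => f.left x) (squareLift_fst (squareFst S) (squareSnd S ≫ ι))
    have h4 := congrArg (fun f => f.left x) (squareLift_snd (squareFst S) (squareSnd S ≫ ι))
    exact ⟨(congrArg (· ∈ U.1) h3).mpr hx.1, (congrArg (· ∈ U.1) h4).mpr (U.2.2 hx.2)⟩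
  rw [← hbox] at h2
  exact (congrArg (· ∈ O') h1).mpr h2

theorem exists_mem_box_W (hS : IsK3Surface S)
    (hι : ι ≫ ι = 𝟙 S) (x : (square D.W).left) :
    ∃ U : D.W.left.Opens, IsAffineOpen U ∧ x ∈ box U := by
  obtain ⟨s, hs⟩ := D.isQuotient_W.isQuotientMap.surjective ((squareFst D.W).left x)
  obtain ⟨t, ht⟩ := D.isQuotient_W.isQuotientMap.surjective ((squareSnd D.W).left x)
  obtain ⟨U, hsU, htU⟩ := hS.exists_invariantAffine (left_comp_eq_id hι) s t
  obtain ⟨O, hO, hOU⟩ := D.isGeomQuotient_W.exists_isAffineOpen (left_comp_eq_id hι) U.2.1 U.2.2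
  rw [← hOU] at hsU htU
  exact ⟨O, hO, (congrArg (· ∈ O) hs).mp hsU, (congrArg (· ∈ O) ht).mp htU⟩

/-- The map `V ⟶ W^{(2)}` is the quotient by the involution induced by `1 × ι`. That involution is
free: `{p, ι q}` is neither `{p, q}` nor `{ι p, ι q}`, since `ι` has no fixed points. -/
theorem exists_double_cover (hS : IsK3Surface S) (hι : IsEnriquesInvolution ι) {W2 : CScheme}
    {c : square D.W ⟶ W2} (Hc : IsQuotient (switch D.W) c) :
    ∃ β : D.V ⟶ W2, D.toVq ≫ β = squareMap D.toW ≫ c ∧ IsFinite β.left ∧ Etale β.left ∧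
      ∀ w, β.left.finrank w = 2 := by
  obtain ⟨τ, hτ, hττ⟩ := D.exists_twist hι.involutive
  obtain ⟨β, hβ⟩ := D.exists_toVq_desc (squareMap D.toW ≫ c)
    (by rw [← Category.assoc, switch_squareMap, Category.assoc, Hc.invariant])
    (by rw [← Category.assoc, squareMap_comp, D.isQuotient_W.invariant])
  have H := D.isGeomQuotient_double_cover hS hι.involutive Hc hτ hττ hβ
  have hττ' := left_comp_eq_id hττ
  have haff : IsAffineHom β.left := H.isAffineHom hττ'
    (D.exists_twist_invariantAffine hS hι.involutive hτ)
  have := hS.locallyOfFiniteType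
  have := locallyOfFiniteType_square (S := S)
  have hfree : freeLocus H.invariant = ⊤ := by
    rw [eq_top_iff]
    intro w hw
    refine mem_freeLocus_of_forall_point H hττ' D.toVq D.toVq_surjective (Q₀ := ⊤)
      (fun p _ h => ?_) hw
    have hno : ∀ q : pt ⟶ S, q ≫ ι ≠ q := hι.fixedPointFree
    have hp := squareLift_fst_snd p
    rw [hτ, ← Category.assoc, pointAt_comp _ D.toVq, pointAt_comp _ D.toVq, D.toVq_eq_iff,
      ← pointAt_comp, ← pointAt_comp, ← pointAt_comp] at h
    rw [← hp, squareLift_twist, squareLift_switch, squareLift_squareMap, squareLift_switch] at h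
    have h5 : ∀ {a b a' b' : pt ⟶ S}, pointAt (squareLift a b) = pointAt (squareLift a' b') →
        a = a' ∧ b = b' := fun {a b a' b'} h => by
      have h6 := point_ext h
      exact ⟨by rw [← squareLift_fst a b, h6, squareLift_fst],
        by rw [← squareLift_snd a b, h6, squareLift_snd]⟩
    rcases h with h | h | h | h
    · exact hno _ (h5 h).2.symm
    · obtain ⟨h6, h7⟩ := h5 h
      rw [h7] at h6
      exact hno _ h6.symm
    · exact hno _ (h5 h).1.symm
    · obtain ⟨h6, h7⟩ := h5 h
      rw [Category.assoc, hι.involutive, Category.comp_id] at h6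
      rw [← h6] at h7
      exact hno _ h7.symm
  have h2 := isUnit_two W2 ⊤
  exact ⟨β, hβ, isFinite_of_freeLocus_eq_top H hττ' h2 hfree,
    etale_of_freeLocus_eq_top H hττ' h2 hfree, finrank_eq_two_of_freeLocus_eq_top H hττ' h2 hfree⟩

/-- The images of the diagonal and of the graph are closed immersions: both are lifts to `V` of the
diagonal of the symmetric square of `W`. -/
theorem isClosedImmersion_of_comp_eq (hS : IsK3Surface S) (hι : IsEnriquesInvolution ι)
    {W2 : CScheme} {c : square D.W ⟶ W2} (Hc : IsQuotient (switch D.W) c) {k : S ⟶ S}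
    (hk : k ≫ D.toW = D.toW) {i : D.W ⟶ D.V} (hi : D.toW ≫ i = squareLift (𝟙 S) k ≫ D.toVq) :
    IsClosedImmersion i.left := by
  obtain ⟨β, hβ, h1, -⟩ := D.exists_double_cover hS hι Hc
  have h2 : i ≫ β = diag D.W ≫ c := by
    apply D.isQuotient_W.hom_ext
    rw [← Category.assoc, hi, Category.assoc, hβ, ← Category.assoc, squareLift_squareMap, hk,
      Category.id_comp, ← Category.assoc, comp_squareLift, Category.comp_id]
  have h3 : IsClosedImmersion (i.left ≫ β.left) := by
    rw [← Over.comp_left, h2]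
    exact isClosedImmersion_diag_comp Hc (D.exists_mem_box_W hS hι.involutive)
  exact IsClosedImmersion.of_comp i.left β.left

end SymmetricQuotients

/-! ### The obstruction to smoothness along the diagonal -/

section

variable {K : Type} [Field K]

theorem dualNumber_eq (z : DualNumber K) :
    z = algebraMap K (DualNumber K) z.fst + z.snd • DualNumber.eps := by
  ext <;> simp [TrivSqZeroExt.algebraMap_eq_inl]

theorem aeval_eps (p : Polynomial K) : Polynomial.aeval (DualNumber.eps : DualNumber K) p =
    algebraMap K _ (p.coeff 0) + p.coeff 1 • DualNumber.eps := by
  induction p using Polynomial.induction_on' with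
  | add p q hp hq => rw [map_add, hp, hq, Polynomial.coeff_add, Polynomial.coeff_add, map_add,
      add_smul, add_add_add_comm]
  | monomial n a =>
    rw [Polynomial.aeval_monomial]
    rcases n with _ | _ | n
    · simp
    · simp [Polynomial.coeff_monomial, Algebra.smul_def]
    · rw [pow_succ, pow_succ, mul_assoc, DualNumber.eps_mul_eps]
      simp [Polynomial.coeff_monomial]

/-- A cone `u v = w²` is not smooth at its vertex: the tangent vector `u = v = 0`, `w = ε` does not
lift modulo `ε³`. -/
theorem not_formallySmooth_of_mul_eq {B : Type} [CommRing B] [Algebra ℂ B]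
    [Algebra.FormallySmooth ℂ B] [Algebra ℂ K] (χ : B →ₐ[ℂ] DualNumber K) {u v w : B}
    (h : u * v = w * w) (hu : χ u = 0) (hv : χ v = 0) (hw : (χ w).fst = 0) :
    (χ w).snd = 0 := by
  let I : Ideal (Polynomial K) := Ideal.span {Polynomial.X ^ 3}
  let F := Polynomial K ⧸ I
  let q : F →ₐ[ℂ] DualNumber K := (Ideal.Quotient.liftₐ I (Polynomial.aeval DualNumber.eps) (by
    intro a ha
    obtain ⟨b, rfl⟩ := Ideal.mem_span_singleton.1 ha
    rw [map_mul, map_pow, Polynomial.aeval_X, pow_succ, pow_two, DualNumber.eps_mul_eps, zero_mul,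
      zero_mul])).restrictScalars ℂ
  have hq : ∀ p, q (Ideal.Quotient.mk I p) = Polynomial.aeval DualNumber.eps p := fun p => rfl
  have hsurj : Function.Surjective q := fun z => by
    refine ⟨Ideal.Quotient.mk I (Polynomial.C z.fst + Polynomial.C z.snd * Polynomial.X), ?_⟩
    rw [hq, aeval_eps]
    conv_rhs => rw [dualNumber_eq z]
    simp
  have hmem : ∀ p, q (Ideal.Quotient.mk I p) = 0 → p.coeff 0 = 0 ∧ p.coeff 1 = 0 := by
    intro p hp
    rw [hq, aeval_eps] at hp
    constructor
    · simpa [TrivSqZeroExt.algebraMap_eq_inl] using congrArg TrivSqZeroExt.fst hp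
    · simpa [TrivSqZeroExt.algebraMap_eq_inl] using congrArg TrivSqZeroExt.snd hp
  have hI : ∀ p : Polynomial K, Ideal.Quotient.mk I p = 0 ↔ p.coeff 0 = 0 ∧ p.coeff 1 = 0 ∧
      p.coeff 2 = 0 := by
    intro p
    rw [Ideal.Quotient.eq_zero_iff_mem, Ideal.mem_span_singleton, Polynomial.X_pow_dvd_iff]
    constructor
    · intro h
      exact ⟨h 0 (by norm_num), h 1 (by norm_num), h 2 (by norm_num)⟩
    · rintro ⟨h0, h1, h2⟩ d hd
      interval_cases d <;> assumption
  -- In a lift to `K[X] / (X³)`, the elements `u` and `v` become multiples of `X²` and `w` becomes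
  -- `c X + ⋯`. The coefficient of `X²` in `u v = w²` then gives `0 = c²`.
  have hcoeff : ∀ p r : Polynomial K, (p * r).coeff 2 =
      p.coeff 0 * r.coeff 2 + p.coeff 1 * r.coeff 1 + p.coeff 2 * r.coeff 0 := by
    intro p r
    rw [Polynomial.coeff_mul, Finset.Nat.sum_antidiagonal_eq_sum_range_succ_mk]
    simp [Finset.sum_range_succ]
  have hker : IsNilpotent (RingHom.ker (q : F →+* DualNumber K)) := by
    have key : RingHom.ker (q : F →+* DualNumber K) * RingHom.ker (q : F →+* DualNumber K) ≤ ⊥ :=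
      Ideal.mul_le.2 ?_
    · exact ⟨2, (pow_two (RingHom.ker (q : F →+* DualNumber K))).trans (eq_bot_iff.2 key)⟩
    intro a ha b hb
    obtain ⟨a, rfl⟩ := Ideal.Quotient.mk_surjective a
    obtain ⟨b, rfl⟩ := Ideal.Quotient.mk_surjective b
    obtain ⟨ha0, ha1⟩ := hmem a ha
    obtain ⟨hb0, hb1⟩ := hmem b hb
    rw [Ideal.mem_bot, ← map_mul, hI]
    refine ⟨by simp [Polynomial.mul_coeff_zero, ha0], ?_, by simp [hcoeff, ha0, ha1, hb0]⟩
    simp [Polynomial.mul_coeff_one, ha0, hb0]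
  let g := Algebra.FormallySmooth.liftOfSurjective χ q hsurj hker
  have hg : ∀ b, q (g b) = χ b := Algebra.FormallySmooth.liftOfSurjective_apply χ q hsurj hker
  obtain ⟨u', hu'⟩ := Ideal.Quotient.mk_surjective (g u)
  obtain ⟨v', hv'⟩ := Ideal.Quotient.mk_surjective (g v)
  obtain ⟨w', hw'⟩ := Ideal.Quotient.mk_surjective (g w)
  obtain ⟨hu0, hu1⟩ := hmem u' (by rw [hu', hg, hu])
  obtain ⟨hv0, hv1⟩ := hmem v' (by rw [hv', hg, hv])
  have hw1 : χ w = algebraMap K _ (w'.coeff 0) + w'.coeff 1 • DualNumber.eps := by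
    rw [← aeval_eps, ← hq, hw', hg]
  have hw0 : w'.coeff 0 = 0 := by
    rw [← hw, hw1]
    simp [TrivSqZeroExt.algebraMap_eq_inl]
  have h3 : Ideal.Quotient.mk I (u' * v' - w' * w') = 0 := by
    rw [map_sub, map_mul, map_mul, hu', hv', hw', ← map_mul, ← map_mul, h, sub_self]
  have h4 := ((hI _).1 h3).2.2
  rw [Polynomial.coeff_sub, hcoeff, hcoeff, hu0, hu1, hv0, hw0] at h4
  have h5 : w'.coeff 1 = 0 := by simpa using h4
  rw [hw1, h5]
  simp [TrivSqZeroExt.algebraMap_eq_inl]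

/-- The ring `K[x, y] / (x², y²)`. -/
abbrev BiDual (K : Type) [Field K] : Type := DualNumber (DualNumber K)

/-- The involution `x ↦ -x`, `y ↦ -y` of `K[x, y] / (x², y²)`. -/
def BiDual.neg : BiDual K →+* BiDual K where
  toFun z := .inl (.inl z.fst.fst + .inr (-z.fst.snd)) + .inr (.inl (-z.snd.fst) + .inr z.snd.snd)
  map_one' := by ext <;> simp
  map_zero' := by ext <;> simp
  map_mul' a b := by ext <;> simp <;> ring
  map_add' a b := by ext <;> simp <;> ring

theorem BiDual.neg_neg (z : BiDual K) : BiDual.neg (BiDual.neg z) = z := by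
  ext <;> simp [BiDual.neg]

/-- An element of `K[x, y] / (x², y²)` which is invariant under `x ↦ -x`, `y ↦ -y` has the form
`a + b x y`; this is `a + b ε`. -/
theorem BiDual.exists_eq_of_neg_eq [CharZero K] {B : Type} [CommRing B] (Φ : B →+* BiDual K)
    (hΦ : ∀ b, BiDual.neg (Φ b) = Φ b) :
    ∃ χ : B →+* DualNumber K, ∀ b, (χ b).fst = (Φ b).fst.fst ∧ (χ b).snd = (Φ b).snd.snd := by
  have h1 : ∀ b, (Φ b).fst.snd = 0 := fun b => by
    have := congrArg (fun z => z.fst.snd) (hΦ b)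
    simp only [BiDual.neg] at this
    simpa [neg_eq_iff_add_eq_zero, self_eq_neg, ← two_mul] using this
  have h2 : ∀ b, (Φ b).snd.fst = 0 := fun b => by
    have := congrArg (fun z => z.snd.fst) (hΦ b)
    simp only [BiDual.neg] at this
    simpa [neg_eq_iff_add_eq_zero, self_eq_neg, ← two_mul] using this
  refine ⟨{ toFun := fun b => .inl (Φ b).fst.fst + .inr (Φ b).snd.snd, map_one' := ?_,
            map_zero' := ?_, map_mul' := ?_, map_add' := ?_ }, fun b => ⟨?_, ?_⟩⟩
  · ext <;> simp
  · intro a b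
    ext <;> simp [h1, h2]

  · ext <;> simp
  · intro a b
    ext <;> simp
  · simp
  · simp

end

/-! ### Étale coordinates transverse to the diagonal -/

section

open TensorProduct

variable {R : Type} [CommRing R] [Algebra ℂ R] [Algebra (MvPolynomial (Fin 2) ℂ) R]

variable (R) in
/-- The function `s_i ⊗ 1 - 1 ⊗ s_i` on `U × U`, for coordinates `s_0`, `s_1` on `U = Spec R`. -/
def diagCoord (i : Fin 2) : R ⊗[ℂ] R :=
  algebraMap (MvPolynomial (Fin 2) ℂ) R (MvPolynomial.X i) ⊗ₜ 1 -
    1 ⊗ₜ algebraMap (MvPolynomial (Fin 2) ℂ) R (MvPolynomial.X i)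

theorem comm_diagCoord (i : Fin 2) :
    Algebra.TensorProduct.comm ℂ R R (diagCoord R i) = - diagCoord R i := by
  simp [diagCoord]

theorem lmul'_diagCoord (i : Fin 2) :
    Algebra.TensorProduct.lmul' ℂ (S := R) (diagCoord R i) = 0 := by
  simp [diagCoord]

/-- For an étale `ℂ[X_0, X_1]`-algebra `T`, the base change `R[X_0, X_1] → R ⊗ T` is étale. -/
theorem etale_aeval_right (R T : Type) [CommRing R] [Algebra ℂ R] [CommRing T] [Algebra ℂ T]
    [Algebra (MvPolynomial (Fin 2) ℂ) T] [IsScalarTower ℂ (MvPolynomial (Fin 2) ℂ) T]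
    [Algebra.Etale (MvPolynomial (Fin 2) ℂ) T] :
    (MvPolynomial.aeval (R := R) (S₁ := R ⊗[ℂ] T) fun i : Fin 2 =>
      (1 : R) ⊗ₜ[ℂ] algebraMap (MvPolynomial (Fin 2) ℂ) T (MvPolynomial.X i)).toRingHom.Etale := by
  let f := MvPolynomial.aeval (R := R) (S₁ := R ⊗[ℂ] T) fun i : Fin 2 =>
      (1 : R) ⊗ₜ[ℂ] algebraMap (MvPolynomial (Fin 2) ℂ) T (MvPolynomial.X i)
  let : Algebra (MvPolynomial (Fin 2) R) (R ⊗[ℂ] T) := f.toRingHom.toAlgebra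
  let : Algebra T (R ⊗[ℂ] T) := Algebra.TensorProduct.rightAlgebra
  let : Algebra (MvPolynomial (Fin 2) ℂ) (MvPolynomial (Fin 2) R) :=
    MvPolynomial.algebraMvPolynomial
  let : Algebra (MvPolynomial (Fin 2) ℂ) (R ⊗[ℂ] T) :=
    ((algebraMap T (R ⊗[ℂ] T)).comp (algebraMap (MvPolynomial (Fin 2) ℂ) T)).toAlgebra
  have : IsScalarTower (MvPolynomial (Fin 2) ℂ) T (R ⊗[ℂ] T) := .of_algebraMap_eq fun _ => rfl
  have : IsScalarTower R (MvPolynomial (Fin 2) R) (R ⊗[ℂ] T) :=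
    .of_algebraMap_eq fun r => (f.commutes r).symm
  have : IsScalarTower (MvPolynomial (Fin 2) ℂ) (MvPolynomial (Fin 2) R) (R ⊗[ℂ] T) := by
    refine .of_algebraMap_eq' (MvPolynomial.ringHom_ext (fun c => ?_) fun i => ?_)
    · have h1 : algebraMap (MvPolynomial (Fin 2) ℂ) (R ⊗[ℂ] T) (MvPolynomial.C c) =
        (1 : R) ⊗ₜ algebraMap ℂ T c := congrArg (fun t => (1 : R) ⊗ₜ[ℂ] t)
          (IsScalarTower.algebraMap_apply ℂ (MvPolynomial (Fin 2) ℂ) T c).symm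
      have h2 : algebraMap (MvPolynomial (Fin 2) R) (R ⊗[ℂ] T) (algebraMap _ _
        (MvPolynomial.C c : MvPolynomial (Fin 2) ℂ)) = algebraMap ℂ R c ⊗ₜ 1 := by
        refine (congrArg f (MvPolynomial.map_C (algebraMap ℂ R) c)).trans ?_
        exact f.commutes (algebraMap ℂ R c)
      refine h1.trans (Eq.trans ?_ h2.symm)
      rw [Algebra.algebraMap_eq_smul_one (A := T), Algebra.algebraMap_eq_smul_one (A := R),
        TensorProduct.smul_tmul]
    · refine .trans ?_ (congrArg f (MvPolynomial.map_X (algebraMap ℂ R) i)).symm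
      exact (MvPolynomial.aeval_X (R := R) (S₁ := R ⊗[ℂ] T) (fun i : Fin 2 =>
        (1 : R) ⊗ₜ[ℂ] algebraMap (MvPolynomial (Fin 2) ℂ) T (MvPolynomial.X i)) i).symm
  have : IsScalarTower ℂ (MvPolynomial (Fin 2) R) (R ⊗[ℂ] T) :=
    .of_algebraMap_eq fun c => (f.commutes (algebraMap ℂ R c)).symm
  have h : Algebra.IsPushout ℂ T R (R ⊗[ℂ] T) := inferInstance
  have : Algebra.IsPushout (MvPolynomial (Fin 2) ℂ) T (MvPolynomial (Fin 2) R) (R ⊗[ℂ] T) :=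
    (Algebra.IsPushout.comp_iff ℂ _ R _).1 h
  exact RingHom.Etale.isStableUnderBaseChange (MvPolynomial (Fin 2) ℂ) T (MvPolynomial (Fin 2) R)
    (R ⊗[ℂ] T) (RingHom.etale_algebraMap.2 inferInstance)

/-- The map `(p, q) ↦ (p, s_0(p) - s_0(q), s_1(p) - s_1(q))` from `U × U` to `U × 𝔸²` is étale. -/
theorem etale_aeval_diagCoord [IsScalarTower ℂ (MvPolynomial (Fin 2) ℂ) R]
    [Algebra.Etale (MvPolynomial (Fin 2) ℂ) R] :
    (MvPolynomial.aeval (R := R) (diagCoord R)).toRingHom.Etale := by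
  let s : Fin 2 → R := fun i => algebraMap (MvPolynomial (Fin 2) ℂ) R (MvPolynomial.X i)
  let e : MvPolynomial (Fin 2) R →ₐ[R] MvPolynomial (Fin 2) R :=
    MvPolynomial.aeval fun i => MvPolynomial.C (s i) - MvPolynomial.X i
  have he : e.comp e = AlgHom.id R _ := MvPolynomial.algHom_ext fun i => by simp [e]
  have heb : Function.Bijective e :=
    (Function.Involutive.bijective fun p => DFunLike.congr_fun he p)
  have h : MvPolynomial.aeval (diagCoord R) = (MvPolynomial.aeval (R := R) (S₁ := R ⊗[ℂ] R)
      fun i : Fin 2 => (1 : R) ⊗ₜ[ℂ] s i).comp e := MvPolynomial.algHom_ext fun i => by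
    simp [e, diagCoord, s]
  rw [h]
  exact RingHom.Etale.stableUnderComposition _ _ (.of_bijective heb) (etale_aeval_right R R)

/-- The functions `s_i ⊗ 1 - 1 ⊗ s_i` cut out the diagonal together with a closed set disjoint from
it. There is a symmetric function `h` which is `1` on the diagonal and which carries every function
vanishing on the diagonal into the ideal of these two functions. -/
theorem exists_separating_idempotent [IsScalarTower ℂ (MvPolynomial (Fin 2) ℂ) R]
    [Algebra.Etale (MvPolynomial (Fin 2) ℂ) R] :
    ∃ h : R ⊗[ℂ] R, Algebra.TensorProduct.comm ℂ R R h = h ∧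
      Algebra.TensorProduct.lmul' ℂ (S := R) h = 1 ∧
      ∀ a, Algebra.TensorProduct.lmul' ℂ (S := R) a = 0 →
        h * a ∈ Ideal.span {diagCoord R 0, diagCoord R 1} := by
  let J : Ideal (R ⊗[ℂ] R) := Ideal.span {diagCoord R 0, diagCoord R 1}
  let φ₁ : R →ₐ[ℂ] (R ⊗[ℂ] R) ⧸ J :=
    (Ideal.Quotient.mkₐ ℂ J).comp Algebra.TensorProduct.includeLeft
  let φ₂ : R →ₐ[ℂ] (R ⊗[ℂ] R) ⧸ J :=
    (Ideal.Quotient.mkₐ ℂ J).comp Algebra.TensorProduct.includeRight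
  have hφ : φ₁.comp (IsScalarTower.toAlgHom ℂ (MvPolynomial (Fin 2) ℂ) R) =
      φ₂.comp (IsScalarTower.toAlgHom ℂ (MvPolynomial (Fin 2) ℂ) R) := by
    refine MvPolynomial.algHom_ext fun i => ?_
    refine Ideal.Quotient.eq.2 ?_
    fin_cases i
    · exact Ideal.subset_span (Or.inl rfl)
    · exact Ideal.subset_span (Or.inr rfl)
  obtain ⟨t, ht, ht1⟩ := (Algebra.FormallyUnramified.iff_exists_tensorProduct
    (R := MvPolynomial (Fin 2) ℂ) (S := R)).1 inferInstance
  let : Algebra (MvPolynomial (Fin 2) ℂ) ((R ⊗[ℂ] R) ⧸ J) :=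
    (φ₁.comp (IsScalarTower.toAlgHom ℂ (MvPolynomial (Fin 2) ℂ) R)).toRingHom.toAlgebra
  let ψ₁ : R →ₐ[MvPolynomial (Fin 2) ℂ] (R ⊗[ℂ] R) ⧸ J :=
    { φ₁ with commutes' := fun p => rfl }
  let ψ₂ : R →ₐ[MvPolynomial (Fin 2) ℂ] (R ⊗[ℂ] R) ⧸ J :=
    { φ₂ with commutes' := fun p => (DFunLike.congr_fun hφ p).symm }
  let Ψ : R ⊗[MvPolynomial (Fin 2) ℂ] R →ₐ[MvPolynomial (Fin 2) ℂ] (R ⊗[ℂ] R) ⧸ J :=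
    Algebra.TensorProduct.productMap ψ₁ ψ₂
  have hJ : J ≤ RingHom.ker (Algebra.TensorProduct.lmul' ℂ (S := R)) := by
    rw [Ideal.span_le]
    rintro _ (rfl | rfl) <;> exact lmul'_diagCoord _
  let μ : (R ⊗[ℂ] R) ⧸ J →+* R :=
    Ideal.Quotient.lift J (Algebra.TensorProduct.lmul' ℂ (S := R)).toRingHom fun a ha => hJ ha
  have hμ : ∀ a, μ (Ideal.Quotient.mk J a) = Algebra.TensorProduct.lmul' ℂ (S := R) a :=
    fun a => rfl
  have hΨμ : ∀ z, μ (Ψ z) = Algebra.TensorProduct.lmul' (MvPolynomial (Fin 2) ℂ) (S := R) z := by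
    intro z
    induction z with
    | zero => rw [map_zero, map_zero, map_zero]
    | add a b ha hb => rw [map_add, map_add, map_add, ha, hb]
    | tmul a b =>
      rw [Algebra.TensorProduct.productMap_apply_tmul, Algebra.TensorProduct.lmul'_apply_tmul,
        map_mul]
      have h1 : μ (ψ₁ a) = a := by
        refine (hμ _).trans ?_
        simp
      have h2 : μ (ψ₂ b) = b := by
        refine (hμ _).trans ?_
        simp
      rw [h1, h2]
  obtain ⟨h₀, hh₀⟩ := Ideal.Quotient.mk_surjective (Ψ t)
  have h1 : Algebra.TensorProduct.lmul' ℂ (S := R) h₀ = 1 := by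
    rw [← hμ, hh₀, hΨμ, ht1]
  have hc : ∀ a, Algebra.TensorProduct.lmul' ℂ (S := R) (Algebra.TensorProduct.comm ℂ R R a) =
      Algebra.TensorProduct.lmul' ℂ (S := R) a := by
    intro a
    induction a with
    | zero => simp
    | add a b ha hb => rw [map_add, map_add, ha, hb, map_add]
    | tmul a b => simp [mul_comm]
  have hcc : ∀ a, Algebra.TensorProduct.comm ℂ R R (Algebra.TensorProduct.comm ℂ R R a) = a :=
    fun a => (Algebra.TensorProduct.comm ℂ R R).symm_apply_apply a
  refine ⟨h₀ * Algebra.TensorProduct.comm ℂ R R h₀, ?_, ?_, fun a ha => ?_⟩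
  · rw [map_mul, hcc, mul_comm]
  · rw [map_mul, hc, h1, mul_one]
  · have ha' : a ∈ KaehlerDifferential.ideal ℂ R := ha
    rw [← KaehlerDifferential.span_range_eq_ideal] at ha'
    suffices Ideal.span (Set.range fun s : R => (1 : R) ⊗ₜ[ℂ] s - s ⊗ₜ[ℂ] (1 : R)) ≤
        Submodule.comap (LinearMap.mulLeft (R ⊗[ℂ] R) h₀) J by
      rw [mul_right_comm]
      exact J.mul_mem_right _ (this ha')
    refine Ideal.span_le.2 ?_
    rintro _ ⟨s, rfl⟩
    change h₀ * ((1 : R) ⊗ₜ[ℂ] s - s ⊗ₜ[ℂ] (1 : R)) ∈ J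
    refine Ideal.Quotient.eq_zero_iff_mem.1 ?_
    have hs := congrArg Ψ (ht s)
    rw [map_mul, map_sub, map_zero, Algebra.TensorProduct.productMap_apply_tmul,
      Algebra.TensorProduct.productMap_apply_tmul, map_one, map_one, one_mul, mul_one] at hs
    refine ((map_mul (Ideal.Quotient.mk J) _ _).trans ?_).trans hs
    rw [hh₀, mul_comm]
    rfl

end

section

variable {K : Type} [Field K]

theorem BiDual.fst_fst_neg (z : BiDual K) : (BiDual.neg z).fst.fst = z.fst.fst := by
  simp [BiDual.neg]

theorem BiDual.neg_inl_inl (k : K) : BiDual.neg (.inl (.inl k) : BiDual K) = .inl (.inl k) := by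
  ext <;> simp [BiDual.neg]

theorem BiDual.neg_inl_inr (k : K) : BiDual.neg (.inl (.inr k) : BiDual K) = -.inl (.inr k) := by
  ext <;> simp [BiDual.neg]

theorem BiDual.neg_inr_inl (k : K) : BiDual.neg (.inr (.inl k) : BiDual K) = -.inr (.inl k) := by
  ext <;> simp [BiDual.neg]

/-- The involution `x ↦ -x`, `y ↦ -y` as a homomorphism of algebras. -/
def BiDual.negₐ [Algebra ℂ K] : BiDual K →ₐ[ℂ] BiDual K :=
  { BiDual.neg with
    commutes' := fun c => by
      change BiDual.neg _ = _
      rw [TrivSqZeroExt.algebraMap_eq_inl', TrivSqZeroExt.algebraMap_eq_inl']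
      exact BiDual.neg_inl_inl _ }

end

section

open TensorProduct

variable {R : Type} [CommRing R] [Algebra ℂ R] [Algebra (MvPolynomial (Fin 2) ℂ) R]
  [IsScalarTower ℂ (MvPolynomial (Fin 2) ℂ) R] [Algebra.Etale (MvPolynomial (Fin 2) ℂ) R]
  {K : Type} [Field K] [Algebra ℂ K]

/-- Homomorphisms from a formally smooth algebra lift along `q`, whose kernel is nilpotent because
it is an extension of two ideals of square zero. -/
theorem exists_lift_of_formallySmooth {P R E D K : Type} [CommRing P] [Algebra ℂ P] [CommRing R]
    [Algebra ℂ R] [Algebra P R] [IsScalarTower ℂ P R] [Algebra.FormallySmooth P R] [CommRing E]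
    [Algebra ℂ E] [CommRing D] [CommRing K] [Algebra ℂ K] (g : P →ₐ[ℂ] E) (q : E →ₐ[ℂ] K)
    (ev : R →ₐ[ℂ] K) (h : q.comp g = ev.comp (IsScalarTower.toAlgHom ℂ P R))
    (hsurj : Function.Surjective q)
    (d : E →+* D) (h1 : ∀ a b, q a = 0 → q b = 0 → d (a * b) = 0)
    (h2 : ∀ a b, d a = 0 → d b = 0 → a * b = 0) :
    ∃ f : R →ₐ[ℂ] E, (∀ r, q (f r) = ev r) ∧ ∀ p, f (algebraMap P R p) = g p := by
  let : Algebra P E := g.toRingHom.toAlgebra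
  let : Algebra P K := (q.comp g).toRingHom.toAlgebra
  have : IsScalarTower ℂ P E := .of_algebraMap_eq fun c => (g.commutes c).symm
  let q' : E →ₐ[P] K := { q with commutes' := fun p => rfl }
  let ev' : R →ₐ[P] K := { ev with commutes' := fun p => (DFunLike.congr_fun h p).symm }
  have hker : IsNilpotent (RingHom.ker (q' : E →+* K)) := by
    have h3 : RingHom.ker (q' : E →+* K) * RingHom.ker (q' : E →+* K) ≤ RingHom.ker d :=
      Ideal.mul_le.2 fun a ha b hb => h1 a b ha hb
    have h4 : RingHom.ker d * RingHom.ker d ≤ ⊥ := Ideal.mul_le.2 fun a ha b hb => h2 a b ha hb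
    refine ⟨2 + 2, ?_⟩
    rw [pow_add, pow_two]
    exact eq_bot_iff.2 ((Ideal.mul_mono h3 h3).trans h4)
  let f' := Algebra.FormallySmooth.liftOfSurjective ev' q' hsurj hker
  exact ⟨f'.restrictScalars ℂ,
    Algebra.FormallySmooth.liftOfSurjective_apply ev' q' hsurj hker, f'.commutes⟩

/-- A point `s` of a surface with étale coordinates `s_0`, `s_1` extends to a family of pairs of
points over a thickening `E` of the spectrum of a field, namely `s ± (v_0, v_1)`. -/
theorem exists_tangentFamily {E D : Type} [CommRing E] [Algebra ℂ E] [CommRing D] (q : E →ₐ[ℂ] K)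
    (d : E →+* D) (h1 : ∀ a b, q a = 0 → q b = 0 → d (a * b) = 0)
    (h2 : ∀ a b, d a = 0 → d b = 0 → a * b = 0) (c : K → E) (hqc : ∀ k, q (c k) = k)
    (n : E →ₐ[ℂ] E) (hn : ∀ z, n (n z) = z) (hqn : ∀ z, q (n z) = q z)
    (hnc : ∀ k, n (c k) = c k) (v : Fin 2 → E) (hv : ∀ i, q (v i) = 0) (hnv : ∀ i, n (v i) = -v i)
    (ev : R →ₐ[ℂ] K) : ∃ Ψ : R ⊗[ℂ] R →ₐ[ℂ] E,
    (∀ a, n (Ψ a) = Ψ (Algebra.TensorProduct.comm ℂ R R a)) ∧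
    (∀ a, q (Ψ a) = ev (Algebra.TensorProduct.lmul' ℂ (S := R) a)) ∧
    ∀ i, Ψ (diagCoord R i) = 2 * v i := by
  let s : Fin 2 → R := fun i => algebraMap (MvPolynomial (Fin 2) ℂ) R (MvPolynomial.X i)
  let g : MvPolynomial (Fin 2) ℂ →ₐ[ℂ] E := MvPolynomial.aeval fun i => c (ev (s i)) + v i
  have hgq : q.comp g = ev.comp (IsScalarTower.toAlgHom ℂ (MvPolynomial (Fin 2) ℂ) R) := by
    refine MvPolynomial.algHom_ext fun i => ?_
    simp [g, hqc, hv, s]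
  obtain ⟨f, hf, hfg⟩ := exists_lift_of_formallySmooth g q ev hgq (fun k => ⟨c k, hqc k⟩) d h1 h2
  have hfX : ∀ i, f (s i) = c (ev (s i)) + v i := fun i =>
    (hfg (MvPolynomial.X i)).trans (MvPolynomial.aeval_X _ i)
  let Ψ : R ⊗[ℂ] R →ₐ[ℂ] E := Algebra.TensorProduct.productMap f (n.comp f)
  have hΨ : ∀ r r', Ψ (r ⊗ₜ r') = f r * n (f r') := fun r r' =>
    Algebra.TensorProduct.productMap_apply_tmul _ _ _ _
  refine ⟨Ψ, fun a => ?_, fun a => ?_, fun i => ?_⟩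
  · induction a with
    | zero => rw [map_zero, map_zero, map_zero, map_zero]
    | add a b ha hb => rw [map_add, map_add, map_add, map_add, ha, hb]
    | tmul a b =>
      rw [Algebra.TensorProduct.comm_tmul, hΨ, hΨ, map_mul, hn, mul_comm]
  · induction a with
    | zero => rw [map_zero, map_zero, map_zero, map_zero]
    | add a b ha hb => rw [map_add, map_add, map_add, map_add, ← ha, ← hb]
    | tmul a b =>
      rw [hΨ, Algebra.TensorProduct.lmul'_apply_tmul, map_mul, map_mul, ← hf, ← hf, hqn]
  · rw [diagCoord, map_sub, hΨ, hΨ, map_one, map_one, mul_one, one_mul, hfX, map_add, hnc, hnv]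
    ring

/-- The symmetric square of a surface is not smooth along the diagonal: if `b` does not vanish at
the point `s` of the diagonal, the localization of the ring of symmetric functions at `b` is not
smooth. -/
theorem eq_zero_of_formallySmooth_away {B : Type} [CommRing B] [Algebra ℂ B]
    (j : B →ₐ[ℂ] R ⊗[ℂ] R) (hj : Function.Injective j)
    (hinv : ∀ a, Algebra.TensorProduct.comm ℂ R R a = a ↔ a ∈ Set.range j) (b : B) (C : Type)
    [CommRing C] [Algebra ℂ C] [Algebra B C] [IsScalarTower ℂ B C] [IsLocalization.Away b C]
    [Algebra.FormallySmooth ℂ C] (ev : R →ₐ[ℂ] K) :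
    ev (Algebra.TensorProduct.lmul' ℂ (S := R) (j b)) = 0 := by
  have : CharZero K := charZero_of_injective_algebraMap (algebraMap ℂ K).injective
  -- The pair of points `s ± (x, y)` over `K[x, y] / (x², y²)`: interchanging the points amounts to
  -- changing the signs of `x` and `y`, so symmetric functions take values `a + b x y`.
  obtain ⟨Ψ, h1, h2', h34⟩ := exists_tangentFamily (E := BiDual K) (D := DualNumber K)
    ((TrivSqZeroExt.fstHom ℂ K K).comp (TrivSqZeroExt.fstHom ℂ (DualNumber K) (DualNumber K)))
    (TrivSqZeroExt.fstHom ℂ (DualNumber K) (DualNumber K)).toRingHom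
    (fun a b ha hb => by
      have ha : a.fst.fst = 0 := ha
      have hb : b.fst.fst = 0 := hb
      change (a * b).fst = 0
      ext <;> simp [ha, hb])
    (fun a b ha hb => by
      have ha : a.fst = 0 := ha
      have hb : b.fst = 0 := hb
      refine TrivSqZeroExt.ext ?_ ?_ <;> simp [ha, hb])
    (fun k => .inl (.inl k)) (fun k => rfl) BiDual.negₐ BiDual.neg_neg
    (fun z => BiDual.fst_fst_neg z) (fun k => BiDual.neg_inl_inl k)
    ![.inl (.inr 1), .inr (.inl 1)] (fun i => by fin_cases i <;> rfl)
    (fun i => by fin_cases i <;> [exact BiDual.neg_inl_inr 1; exact BiDual.neg_inr_inl 1]) ev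
  have h3 : Ψ (diagCoord R 0) = .inl (.inr 1) + .inl (.inr 1) := (h34 0).trans (two_mul _)
  have h4 : Ψ (diagCoord R 1) = .inr (.inl 1) + .inr (.inl 1) := (h34 1).trans (two_mul _)
  have h2 : ∀ a, (Ψ a).fst.fst = ev (Algebra.TensorProduct.lmul' ℂ (S := R) a) := h2'
  obtain ⟨χ, hχ⟩ := BiDual.exists_eq_of_neg_eq ((Ψ.comp j).toRingHom) (fun b => by
    change BiDual.neg (Ψ (j b)) = Ψ (j b)
    exact (h1 _).trans (congrArg Ψ ((hinv _).2 ⟨b, rfl⟩)))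
  by_contra hb
  have hu : IsUnit (χ b) := by
    rw [TrivSqZeroExt.isUnit_iff_isUnit_fst, isUnit_iff_ne_zero, (hχ b).1]
    exact fun h => hb ((h2 _).symm.trans h)
  let χ' : C →+* DualNumber K := IsLocalization.Away.lift b hu
  have hχ' : ∀ b, χ' (algebraMap B C b) = χ b := fun b => IsLocalization.Away.lift_eq _ _ _
  let χ'' : C →ₐ[ℂ] DualNumber K :=
    { χ' with
      commutes' := fun c => by
        change χ' _ = _
        rw [IsScalarTower.algebraMap_apply ℂ B C, hχ']
        have h5 : Ψ (j (algebraMap ℂ B c)) = algebraMap ℂ _ c := by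
          rw [j.commutes, Ψ.commutes]
        ext
        · refine (hχ _).1.trans ((congrArg (fun z => z.fst.fst) h5).trans ?_)
          simp [TrivSqZeroExt.algebraMap_eq_inl']
        · refine (hχ _).2.trans ((congrArg (fun z => z.snd.snd) h5).trans ?_)
          simp [TrivSqZeroExt.algebraMap_eq_inl'] }
  have hχ'' : ∀ b, χ'' (algebraMap B C b) = χ b := hχ'
  have hmul : ∀ i k, ∃ b, j b = diagCoord R i * diagCoord R k := fun i k =>
    (hinv _).1 (by rw [map_mul, comm_diagCoord, comm_diagCoord, neg_mul_neg])
  -- with `x y` as `ε`, the products of the coordinates `2 x`, `2 y` of the family are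
  -- `u = v = 0` and `w = 4 ε`
  obtain ⟨u, hu⟩ := hmul 0 0
  obtain ⟨v, hv⟩ := hmul 1 1
  obtain ⟨w, hw⟩ := hmul 0 1
  have huv : u * v = w * w := hj (by rw [map_mul, map_mul, hu, hv, hw]; ring)
  have hval : ∀ {b z}, j b = z → (χ b).fst = (Ψ z).fst.fst ∧ (χ b).snd = (Ψ z).snd.snd := by
    rintro b _ rfl
    exact hχ b
  have h6 := not_formallySmooth_of_mul_eq χ'' (u := algebraMap B C u) (v := algebraMap B C v)
    (w := algebraMap B C w) (by rw [← map_mul, huv, map_mul])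
    (by
      rw [hχ'']
      ext
      · rw [(hval hu).1, map_mul, h3]
        simp
      · rw [(hval hu).2, map_mul, h3]
        simp)
    (by
      rw [hχ'']
      ext
      · rw [(hval hv).1, map_mul, h4]
        simp
      · rw [(hval hv).2, map_mul, h4]
        simp)
    (by
      rw [hχ'', (hval hw).1, map_mul, h3, h4]
      simp)
  rw [hχ'', (hval hw).2, map_mul, h3, h4] at h6
  simp at h6

end

attribute [local instance] sectionsAlgebra

open TensorProduct

theorem eq_top_of_le_preimage_str {X : CScheme} {O : (Spec (CommRingCat.of ℂ)).Opens}
    {U : X.left.Opens}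
    {x : X.left} (hx : x ∈ U) (e : U ≤ X.str ⁻¹ᵁ O) : O = ⊤ := by
  refine eq_top_iff.2 fun y _ => ?_
  have : y = X.str x := Subsingleton.elim (α := PrimeSpectrum ℂ) _ _
  rw [this]
  exact e hx

theorem exists_isStandardSmoothOfRelativeDimension {X : CScheme} {n : ℕ}
    [SmoothOfRelativeDimension n X.str] (x : X.left) :
    ∃ (U : X.left.Opens) (_ : IsAffineOpen U) (_ : x ∈ U),
      (algebraMap ℂ Γ(X.left, U)).IsStandardSmoothOfRelativeDimension n := by
  obtain ⟨O, hO, U, hU, hxU, e, h⟩ :=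
    SmoothOfRelativeDimension.exists_isStandardSmoothOfRelativeDimension (n := n) (f := X.str) x
  obtain rfl := eq_top_of_le_preimage_str hxU e
  exact ⟨U, hU, hxU, (RingHom.isStandardSmoothOfRelativeDimension_respectsIso (n := n)).2 _
      (Scheme.ΓSpecIso (CommRingCat.of ℂ)).symm.commRingCatIsoToRingEquiv h⟩

theorem exists_etale_coordinates {S : CScheme} [SmoothOfRelativeDimension 2 S.str] (s : S.left) :
    ∃ (U : S.left.Opens) (_ : IsAffineOpen U) (_ : s ∈ U)
      (g : MvPolynomial (Fin 2) ℂ →ₐ[ℂ] Γ(S.left, U)), g.toRingHom.Etale := by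
  obtain ⟨U, hU, hsU, h1⟩ := exists_isStandardSmoothOfRelativeDimension (n := 2) s
  obtain ⟨g, hg, hge⟩ := h1.exists_etale_mvPolynomial
  exact ⟨U, hU, hsU, { g with commutes' := fun c => congr($hg c) }, hge⟩

theorem fromSpec_comp_str (X : CScheme) {U : X.left.Opens} (hU : IsAffineOpen U) :
    hU.fromSpec ≫ X.str = Spec.map (CommRingCat.ofHom (algebraMap ℂ Γ(X.left, U))) := by
  have h := (isAffineOpen_top (Spec (CommRingCat.of ℂ))).SpecMap_appLE_fromSpec X.str hU le_top
  rw [← h, IsAffineOpen.fromSpec_top, Scheme.isoSpec_Spec_inv, ← Spec.map_comp]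
  rfl

theorem smooth_fromSpec_comp_str_iff (X : CScheme) {U : X.left.Opens} (hU : IsAffineOpen U) :
    Smooth (hU.fromSpec ≫ X.str) ↔ Algebra.Smooth ℂ Γ(X.left, U) := by
  rw [fromSpec_comp_str, HasRingHomProperty.Spec_iff (P := @Smooth)]
  exact RingHom.smooth_algebraMap

theorem smooth_sections (X : CScheme) {U V : X.left.Opens} (hU : IsAffineOpen U) (hUV : U ≤ V)
    (hV : Smooth (V.ι ≫ X.str)) : Algebra.Smooth ℂ Γ(X.left, U) := by
  rw [← smooth_fromSpec_comp_str_iff X hU]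
  have h1 : hU.fromSpec = IsOpenImmersion.lift V.ι hU.fromSpec (by
    rw [hU.range_fromSpec, Scheme.Opens.range_ι]; exact hUV) ≫ V.ι :=
    (IsOpenImmersion.lift_fac _ _ _).symm
  rw [h1, Category.assoc]
  infer_instance

/-- The ring of functions on `U × U`, with its structure maps. -/
theorem exists_boxEquiv (S : CScheme) {U : S.left.Opens} (hU : IsAffineOpen U) :
    ∃ e : Γ(S.left, U) ⊗[ℂ] Γ(S.left, U) ≃ₐ[ℂ] Γ((square S).left, box U),
      (∀ a, e (Algebra.TensorProduct.comm ℂ _ _ a) =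
        pb (switch S).left (switch_invariant_box U) (e a)) ∧
      (∀ (h : U ≤ (diag S).left ⁻¹ᵁ box U) a, pb (diag S).left h (e a) =
        Algebra.TensorProduct.lmul' ℂ (S := Γ(S.left, U)) a) := by
  obtain ⟨e, he⟩ := exists_tensorEquiv hU
  have h3 : (switch S).left ≫ (squareFst S).left = (squareSnd S).left :=
    congrArg CommaMorphism.left switch_fst
  have h4 : (switch S).left ≫ (squareSnd S).left = (squareFst S).left :=
    congrArg CommaMorphism.left switch_snd
  have h1 : (diag S).left ≫ (squareFst S).left = 𝟙 S.left :=
    congrArg CommaMorphism.left (squareLift_fst (𝟙 S) (𝟙 S))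
  have h2 : (diag S).left ≫ (squareSnd S).left = 𝟙 S.left :=
    congrArg CommaMorphism.left (squareLift_snd (𝟙 S) (𝟙 S))
  refine ⟨{ e with commutes' := fun c => ?_ }, fun a => ?_, fun h a => ?_⟩
  · change e _ = _
    rw [Algebra.TensorProduct.algebraMap_apply, he, map_one, mul_one]
    exact (pullbackFun (squareFst S) U (box U) (box_le_fst U)).commutes c
  · change e _ = pb _ _ (e a)
    induction a with
    | zero => simp only [map_zero]
    | add a b ha hb => simp only [map_add, ha, hb]
    | tmul a b =>
      rw [Algebra.TensorProduct.comm_tmul, he, he, map_mul, pb_pb, pb_pb,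
        pb_congr h3, pb_congr h4, mul_comm]
  · change pb _ _ (e a) = _
    induction a with
    | zero => simp only [map_zero]
    | add a b ha hb => simp only [map_add, ha, hb]
    | tmul a b =>
      rw [he, Algebra.TensorProduct.lmul'_apply_tmul, map_mul, pb_pb, pb_pb,
        pb_congr h1, pb_congr h2, pb_id, pb_id, res_self, res_self]

theorem diag_left_mem_box {S : CScheme} {U : S.left.Opens} {s : S.left} (hs : s ∈ U) :
    (diag S).left s ∈ box U := by
  have h1 := congrArg (fun f => f.left s) (squareLift_fst (𝟙 S) (𝟙 S))
  have h2 := congrArg (fun f => f.left s) (squareLift_snd (𝟙 S) (𝟙 S))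
  exact ⟨(congrArg (· ∈ U) h1).mpr hs, (congrArg (· ∈ U) h2).mpr hs⟩

theorem exists_eq_pb_of_invariant {X Q : Scheme.{0}} {g : X ⟶ X} {π : X ⟶ Q}
    (H : IsGeomQuotient g π) {O : Q.Opens} {U : X.Opens} (hOU : π ⁻¹ᵁ O = U) (hU : U ≤ g ⁻¹ᵁ U)
    (a : Γ(X, U)) : pb g hU a = a ↔ ∃ b, pb π (U := O) hOU.ge b = a := by
  subst hOU
  constructor
  · intro h
    exact (H.hasInvariantSections O).2 a h
  · rintro ⟨b, rfl⟩
    rw [pb_pb, pb_congr H.invariant]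

theorem pb_injective_of_eq {X Q : Scheme.{0}} {g : X ⟶ X} {π : X ⟶ Q} (H : IsGeomQuotient g π)
    {O : Q.Opens} {U : X.Opens} (hOU : π ⁻¹ᵁ O = U) :
    Function.Injective (pb π (U := O) hOU.ge) := by
  subst hOU
  exact (H.hasInvariantSections O).injective

/-- The symmetric square of a smooth surface is singular along the diagonal. -/
theorem not_isSmoothAt_diag {S Q : CScheme} [SmoothOfRelativeDimension 2 S.str]
    {π : square S ⟶ Q} (H : IsGeomQuotient (switch S).left π.left) (s : S.left) :
    ¬ IsSmoothAt Q.str ((diag S ≫ π).left s) := by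
  rintro ⟨N, hsN, hN⟩
  obtain ⟨U, hU, hsU, g, hg⟩ := exists_etale_coordinates s
  obtain ⟨O, hO, hOU⟩ := H.exists_isAffineOpen (congrArg CommaMorphism.left (switch_switch S))
    (isAffineOpen_box hU) (switch_invariant_box U)
  have hsO : (diag S ≫ π).left s ∈ O := by
    have h1 : (diag S).left s ∈ π.left ⁻¹ᵁ O := hOU.symm ▸ diag_left_mem_box hsU
    exact h1
  obtain ⟨b, hbN, hsb⟩ := hO.exists_basicOpen_le ⟨_, hsN⟩ hsO
  obtain ⟨e, he, he'⟩ := exists_boxEquiv S hU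
  have hsm : Algebra.Smooth ℂ Γ(Q.left, Q.left.basicOpen b) :=
    smooth_sections Q (hO.basicOpen b) hbN hN
  let : Algebra (MvPolynomial (Fin 2) ℂ) Γ(S.left, U) := g.toRingHom.toAlgebra
  have : IsScalarTower ℂ (MvPolynomial (Fin 2) ℂ) Γ(S.left, U) :=
    .of_algebraMap_eq fun c => (g.commutes c).symm
  have : Algebra.Etale (MvPolynomial (Fin 2) ℂ) Γ(S.left, U) := hg
  have : IsLocalization.Away b Γ(Q.left, Q.left.basicOpen b) := hO.isLocalization_basicOpen b
  have : IsScalarTower ℂ Γ(Q.left, O) Γ(Q.left, Q.left.basicOpen b) :=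
    .of_algebraMap_eq fun c => ((pullbackFun (𝟙 Q) O (Q.left.basicOpen b)
      (Q.left.basicOpen_le b)).commutes c).symm.trans (pb_id _ _)
  let j : Γ(Q.left, O) →ₐ[ℂ] Γ(S.left, U) ⊗[ℂ] Γ(S.left, U) :=
    e.symm.toAlgHom.comp (pullbackFun π O (box U) hOU.ge)
  have hj : ∀ a, e (j a) = pb π.left hOU.ge a := fun a => e.apply_symm_apply _
  let K := S.left.residueField s
  let : Algebra ℂ K := ((S.left.evaluation U s hsU).hom.comp (algebraMap ℂ Γ(S.left, U))).toAlgebra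
  let ev : Γ(S.left, U) →ₐ[ℂ] K :=
    { (S.left.evaluation U s hsU).hom with commutes' := fun _ => rfl }
  have h0 := eq_zero_of_formallySmooth_away (K := K) j (by
      exact e.symm.injective.comp (pb_injective_of_eq H hOU)) (fun a => by
      rw [← e.injective.eq_iff, he, exists_eq_pb_of_invariant H hOU]
      exact ⟨fun ⟨b, hb⟩ => ⟨b, e.injective ((hj b).trans hb)⟩,
        fun ⟨b, hb⟩ => ⟨b, (hj b).symm.trans (congrArg e hb)⟩⟩) b
    Γ(Q.left, Q.left.basicOpen b) ev
  have hUd : U ≤ (diag S).left ⁻¹ᵁ box U := fun t ht => diag_left_mem_box ht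
  rw [← he' hUd, hj, pb_pb] at h0
  have h1 : s ∈ S.left.basicOpen (pb ((diag S).left ≫ π.left)
      (le_comp_preimage hOU.ge hUd) b) := (mem_basicOpen_pb _ _ _ hsU).2 hsb
  exact (S.left.evaluation_ne_zero_iff_mem_basicOpen s hsU _).2 h1 h0

/-! ### The Hilbert square in étale coordinates -/

section

open TensorProduct

/-- The affine plane over `R`, as a chart of the blow-up of the plane in the origin. -/
def ChartRing (R : Type) [CommRing R] : Type := MvPolynomial (Fin 2) R

namespace ChartRing

variable (R : Type) [CommRing R]

instance : CommRing (ChartRing R) := inferInstanceAs (CommRing (MvPolynomial (Fin 2) R))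

instance : Algebra R (ChartRing R) := inferInstanceAs (Algebra R (MvPolynomial (Fin 2) R))

instance [IsDomain R] : IsDomain (ChartRing R) :=
  inferInstanceAs (IsDomain (MvPolynomial (Fin 2) R))

instance : Algebra.Smooth R (ChartRing R) :=
  let _ : Algebra.Smooth R (MvPolynomial (Fin 2) R) := ⟨inferInstance, inferInstance⟩
  inferInstanceAs (Algebra.Smooth R (MvPolynomial (Fin 2) R))

/-- The coordinates `X_0`, `T` on the chart. -/
def coord (i : Fin 2) : ChartRing R := (MvPolynomial.X i : MvPolynomial (Fin 2) R)

/-- The map `X_0 ↦ X_0`, `X_1 ↦ X_0 T` of the chart to the plane. -/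
def blowDown : MvPolynomial (Fin 2) R →ₐ[R] ChartRing R :=
  MvPolynomial.aeval ![coord R 0, coord R 0 * coord R 1]

instance : Algebra (MvPolynomial (Fin 2) R) (ChartRing R) := (blowDown R).toRingHom.toAlgebra

instance : IsScalarTower R (MvPolynomial (Fin 2) R) (ChartRing R) :=
  .of_algebraMap_eq fun r => ((blowDown R).commutes r).symm

theorem algebraMap_X_zero :
    algebraMap (MvPolynomial (Fin 2) R) (ChartRing R) (.X 0) = coord R 0 := by
  refine (MvPolynomial.aeval_X _ _).trans ?_
  simp

theorem algebraMap_X_one : algebraMap (MvPolynomial (Fin 2) R) (ChartRing R) (.X 1) =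
    coord R 0 * coord R 1 := by
  refine (MvPolynomial.aeval_X _ _).trans ?_
  simp

theorem coord_zero_ne [IsDomain R] : coord R 0 ≠ 0 := MvPolynomial.X_ne_zero _

theorem algebraMap_injective [IsDomain R] :
    Function.Injective (algebraMap (MvPolynomial (Fin 2) R) (ChartRing R)) := by
  let x : MvPolynomial (Fin 2) R := .X 0
  let L := Localization.Away x
  -- the inverse of the blow-up on the locus `X_0 ≠ 0`
  let γ : MvPolynomial (Fin 2) R →ₐ[R] L := MvPolynomial.aeval
    ![algebraMap _ L x,
      algebraMap (MvPolynomial (Fin 2) R) L (.X 1) * IsLocalization.Away.invSelf x]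
  let γ' : ChartRing R →+* L := γ.toRingHom
  have h : γ'.comp (algebraMap (MvPolynomial (Fin 2) R) (ChartRing R)) = algebraMap _ L := by
    refine MvPolynomial.ringHom_ext (fun r => ?_) fun i => ?_
    · refine (congrArg γ' (IsScalarTower.algebraMap_apply R (MvPolynomial (Fin 2) R)
        (ChartRing R) r).symm).trans ?_
      exact γ.commutes r
    · have h0 : γ' (coord R 0) = algebraMap _ L x := by
        refine (MvPolynomial.aeval_X _ _).trans ?_
        simp
      have h1 : γ' (coord R 1) =
          algebraMap (MvPolynomial (Fin 2) R) L (.X 1) * IsLocalization.Away.invSelf x := by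
        refine (MvPolynomial.aeval_X _ _).trans ?_
        simp
      fin_cases i
      · exact (congrArg γ' (algebraMap_X_zero R)).trans h0
      · refine (congrArg γ' (algebraMap_X_one R)).trans ?_
        rw [map_mul, h0, h1, mul_left_comm, IsLocalization.Away.mul_invSelf, mul_one]
        rfl
  have h2 : Function.Injective (algebraMap (MvPolynomial (Fin 2) R) L) :=
    IsLocalization.injective L (M := Submonoid.powers x)
      (powers_le_nonZeroDivisors_of_noZeroDivisors (MvPolynomial.X_ne_zero _))
  rw [← h] at h2
  exact Function.Injective.of_comp (f := γ') h2

/-- The chart is generated over the polynomial ring of the plane by the coordinate `y / x`. -/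
theorem exists_sum (z : ChartRing R) : ∃ p : Polynomial (MvPolynomial (Fin 2) R),
    z = Polynomial.aeval (coord R 1) p := by
  obtain ⟨z, rfl⟩ : ∃ z' : MvPolynomial (Fin 2) R, (z' : ChartRing R) = z := ⟨z, rfl⟩
  induction z using MvPolynomial.induction_on with
  | C r =>
    refine ⟨Polynomial.C (.C r), ?_⟩
    rw [Polynomial.aeval_C]
    exact IsScalarTower.algebraMap_apply R (MvPolynomial (Fin 2) R) (ChartRing R) r
  | add p q hp hq =>
    obtain ⟨p', hp⟩ := hp
    obtain ⟨q', hq⟩ := hq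
    refine ⟨p' + q', ?_⟩
    rw [map_add, ← hp, ← hq]
    rfl
  | mul_X p i hp =>
    obtain ⟨p', hp⟩ := hp
    fin_cases i
    · refine ⟨p' * Polynomial.C (.X 0), ?_⟩
      rw [map_mul, ← hp, Polynomial.aeval_C, algebraMap_X_zero]
      rfl
    · refine ⟨p' * Polynomial.X, ?_⟩
      rw [map_mul, ← hp, Polynomial.aeval_X]
      rfl

end ChartRing

/-- `A` is étale over the affine plane over `R`, with coordinates `x`, `y` that are changed in sign
by the involution `σ` of `A` with ring of invariants `B`; moreover `σ` is the identity on the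
closed subscheme `x = y = 0`. -/
structure IsTransverse (R : Type) {A : Type} (B : Type) [CommRing R] [CommRing A] [CommRing B]
    [Algebra ℂ R] [Algebra ℂ A] [Algebra ℂ B] [Algebra B A] (σ : A →+* A) (x y : A) : Prop where
  invariant : ∀ a, σ a = a ↔ a ∈ Set.range (algebraMap B A)
  injective : Function.Injective (algebraMap B A)
  involutive : ∀ a, σ (σ a) = a
  map_x : σ x = -x
  map_y : σ y = -y
  sub_mem : ∀ a, a - σ a ∈ Ideal.span {x, y}
  exists_etale : ∃ ψ : MvPolynomial (Fin 2) R →+* A, ψ.Etale ∧ ψ (.X 0) = x ∧ ψ (.X 1) = y ∧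
    ∀ c : ℂ, ψ (algebraMap ℂ _ c) = algebraMap ℂ A c

namespace IsTransverse

variable {R A B : Type} [CommRing R] [CommRing A] [CommRing B] [Algebra ℂ R] [Algebra ℂ A]
  [Algebra ℂ B] [Algebra B A] {σ : A →+* A} {x y : A}

theorem swap (H : IsTransverse R B σ x y) : IsTransverse R B σ y x where
  invariant := H.invariant
  injective := H.injective
  involutive := H.involutive
  map_x := H.map_y
  map_y := H.map_x
  sub_mem a := Ideal.span_pair_comm (x := x) (y := y) ▸ H.sub_mem a
  exists_etale := by
    obtain ⟨ψ, h, h0, h1, hc⟩ := H.exists_etale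
    let e := MvPolynomial.renameEquiv R (Equiv.swap (0 : Fin 2) 1)
    refine ⟨ψ.comp e.toRingEquiv.toRingHom,
      RingHom.Etale.stableUnderComposition _ _ (.of_bijective e.bijective) h, ?_, ?_, fun c => ?_⟩
    · rw [← h1]
      exact congrArg ψ (by simp [e])
    · rw [← h0]
      exact congrArg ψ (by simp [e])
    · rw [← hc]
      refine congrArg ψ ?_
      rw [IsScalarTower.algebraMap_apply ℂ R (MvPolynomial (Fin 2) R)]
      exact e.commutes _

theorem exists_half (a : A) : ∃ b : A, 2 * b = a := by
  refine ⟨algebraMap ℂ A (1 / 2) * a, ?_⟩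
  have : (2 : A) = algebraMap ℂ A 2 := (map_ofNat _ 2).symm
  rw [← mul_assoc, this, ← map_mul]
  norm_num

theorem eq_zero_of_two_mul {a : A} (h : 2 * a = 0) : a = 0 := by
  have h2 : (2 : A) = algebraMap ℂ A 2 := (map_ofNat _ 2).symm
  have h3 : algebraMap ℂ A (1 / 2) * (2 * a) = a := by
    rw [h2, ← mul_assoc, ← map_mul]
    norm_num
  rw [← h3, h, mul_zero]

/-- Anti-invariant functions are combinations of `x` and `y` with invariant coefficients. -/
theorem exists_of_map_eq_neg (H : IsTransverse R B σ x y) {a : A} (ha : σ a = -a) :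
    ∃ b b' : B, a = algebraMap B A b * x + algebraMap B A b' * y := by
  have h1 := H.sub_mem a
  obtain ⟨α, β, hαβ⟩ := Ideal.mem_span_pair.1 h1
  obtain ⟨α', hα'⟩ := exists_half (α + σ α)
  obtain ⟨β', hβ'⟩ := exists_half (β + σ β)
  have hinv : ∀ γ γ' : A, 2 * γ' = γ + σ γ → σ γ' = γ' := fun γ γ' h => by
    have h2 := congrArg σ h
    rw [map_mul, map_ofNat, map_add, H.involutive, add_comm, ← h] at h2
    rw [← sub_eq_zero]
    apply eq_zero_of_two_mul
    rw [mul_sub, h2, sub_self]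
  obtain ⟨α'', h1⟩ := exists_half α'
  obtain ⟨β'', h2⟩ := exists_half β'
  have hinv2 : ∀ γ γ' : A, 2 * γ' = γ → σ γ = γ → σ γ' = γ' := fun γ γ' h h' =>
    hinv γ' γ' (by
      apply sub_eq_zero.1
      apply eq_zero_of_two_mul
      rw [← h, map_mul, map_ofNat] at h'
      linear_combination -h')
  obtain ⟨b, hb⟩ := (H.invariant _).1 (hinv2 _ _ h1 (hinv _ _ hα'))
  obtain ⟨b', hb'⟩ := (H.invariant _).1 (hinv2 _ _ h2 (hinv _ _ hβ'))
  refine ⟨b, b', ?_⟩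
  rw [hb, hb']
  have h3 := congrArg σ hαβ
  rw [map_add, map_mul, map_mul, H.map_x, H.map_y, map_sub, H.involutive, ha] at h3
  rw [ha] at hαβ
  apply sub_eq_zero.1
  apply eq_zero_of_two_mul
  apply eq_zero_of_two_mul
  linear_combination (-2 * x) * h1 - 2 * y * h2 - x * hα' - y * hβ' - hαβ + h3

theorem exists_eq_add (H : IsTransverse R B σ x y) (a : A) :
    ∃ b b₀ b₁ : B, a = algebraMap B A b + algebraMap B A b₀ * x + algebraMap B A b₁ * y := by
  obtain ⟨a', ha'⟩ := exists_half a
  obtain ⟨b, hb⟩ := (H.invariant (a' + σ a')).1 (by rw [map_add, H.involutive, add_comm])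
  obtain ⟨b₀, b₁, h⟩ := H.exists_of_map_eq_neg (a := a' - σ a')
    (by rw [map_sub, H.involutive, neg_sub])
  refine ⟨b, b₀, b₁, ?_⟩
  rw [add_assoc, ← h, hb, ← ha']
  ring

/-- The invariant functions that vanish on `x = y = 0` are generated by `x²`, `xy`, `y²`. -/
theorem exists_of_mem_span (H : IsTransverse R B σ x y) {b : B}
    (hb : algebraMap B A b ∈ Ideal.span {x, y}) : ∃ b₀ b₁ b₂ : B, algebraMap B A b =
      algebraMap B A b₀ * (x * x) + algebraMap B A b₁ * (x * y) + algebraMap B A b₂ * (y * y) := by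
  obtain ⟨α, β, hαβ⟩ := Ideal.mem_span_pair.1 hb
  obtain ⟨a, a₀, a₁, rfl⟩ := H.exists_eq_add α
  obtain ⟨c, c₀, c₁, rfl⟩ := H.exists_eq_add β
  have hB : ∀ b : B, σ (algebraMap B A b) = algebraMap B A b := fun b => (H.invariant _).2 ⟨b, rfl⟩
  have h := congrArg σ hαβ
  simp only [map_add, map_mul, hB, H.map_x, H.map_y] at h
  refine ⟨a₀, a₁ + c₀, c₁, ?_⟩
  rw [map_add]
  apply sub_eq_zero.1
  apply eq_zero_of_two_mul
  linear_combination -hαβ - h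

end IsTransverse

end

section

open TensorProduct

namespace IsTransverse

variable {R A B : Type} [CommRing R] [CommRing A] [CommRing B] [Algebra ℂ R] [Algebra ℂ A]
  [Algebra ℂ B] [Algebra B A] {σ : A →+* A} {x y : A}

/-- The chart of the blow-up of `x = y = 0` with coordinate `t = y / x`: being the base change of
the chart of the blow-up of the plane along the étale map `(x, y)`, it is smooth. -/
theorem exists_chart_over [IsDomain R] [Algebra.Smooth ℂ R] (H : IsTransverse R B σ x y) :
    ∃ (D : Type) (_ : CommRing D) (_ : Algebra ℂ D) (_ : Algebra.Smooth ℂ D) (φ : A →ₐ[ℂ] D)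
      (t : D), Function.Injective φ ∧ φ x ∈ nonZeroDivisors D ∧ φ x * t = φ y ∧
      ∀ d : D, ∃ p : Polynomial A, d = p.eval₂ φ.toRingHom t := by
  obtain ⟨ψ, hψ, h0, h1, hc⟩ := H.exists_etale
  let : Algebra (MvPolynomial (Fin 2) R) A := ψ.toAlgebra
  have : Algebra.Etale (MvPolynomial (Fin 2) R) A := hψ
  let D := ChartRing R ⊗[MvPolynomial (Fin 2) R] A
  let : Algebra ℂ (ChartRing R) := ((algebraMap R (ChartRing R)).comp (algebraMap ℂ R)).toAlgebra
  have : IsScalarTower ℂ R (ChartRing R) := .of_algebraMap_eq fun c => rfl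
  have : Algebra.Smooth ℂ (ChartRing R) := .comp ℂ R (ChartRing R)
  have : IsScalarTower ℂ (ChartRing R) D := inferInstance
  have : Algebra.Smooth ℂ D := .comp ℂ (ChartRing R) D
  let φ : A →+* D := Algebra.TensorProduct.includeRight.toRingHom
  have hφ : ∀ p, φ (ψ p) = algebraMap (MvPolynomial (Fin 2) R) (ChartRing R) p ⊗ₜ 1 := fun p =>
    (Algebra.TensorProduct.includeRight : A →ₐ[MvPolynomial (Fin 2) R] D).commutes p
  refine ⟨D, inferInstance, inferInstance, inferInstance, { φ with commutes' := fun c => ?_ },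
    ChartRing.coord R 1 ⊗ₜ 1, ?_, ?_, ?_, ?_⟩
  · change φ (algebraMap ℂ A c) = _
    rw [← hc, hφ, IsScalarTower.algebraMap_apply ℂ R (MvPolynomial (Fin 2) R),
      ← IsScalarTower.algebraMap_apply R (MvPolynomial (Fin 2) R)]
    rfl
  · exact Algebra.TensorProduct.includeRight_injective (ChartRing.algebraMap_injective R)
  · have h : φ x = algebraMap (ChartRing R) D (ChartRing.coord R 0) := by
      rw [← h0, hφ, ChartRing.algebraMap_X_zero]
      rfl
    change φ x ∈ _
    have hreg := Module.Flat.isSMulRegular_of_nonZeroDivisors (M := D)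
      (mem_nonZeroDivisors_of_ne_zero (ChartRing.coord_zero_ne R))
    rw [h, mem_nonZeroDivisors_iff_right]
    intro d hd
    refine hreg (a₁ := d) (a₂ := 0) ?_
    change _ • d = _ • (0 : D)
    rwa [smul_zero, Algebra.smul_def, mul_comm]
  · change φ x * _ = φ y
    rw [← h0, ← h1, hφ, hφ, ChartRing.algebraMap_X_zero, ChartRing.algebraMap_X_one,
      Algebra.TensorProduct.tmul_mul_tmul, mul_one]
  · intro d
    induction d using TensorProduct.induction_on with
    | zero => exact ⟨0, by simp⟩
    | add d d' hd hd' =>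
      obtain ⟨p, rfl⟩ := hd
      obtain ⟨p', rfl⟩ := hd'
      exact ⟨p + p', (Polynomial.eval₂_add _ _).symm⟩
    | tmul z a =>
      obtain ⟨p, rfl⟩ := ChartRing.exists_sum R z
      refine ⟨Polynomial.C a * p.map ψ, ?_⟩
      change _ = Polynomial.eval₂ φ _ _
      rw [Polynomial.eval₂_mul, Polynomial.eval₂_C, Polynomial.eval₂_map]
      have h2 : (Polynomial.aeval (ChartRing.coord R 1) p ⊗ₜ a : D) =
          φ a * algebraMap (ChartRing R) D (Polynomial.aeval (ChartRing.coord R 1) p) := by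
        change _ = (1 ⊗ₜ a : D) * (_ ⊗ₜ 1)
        rw [Algebra.TensorProduct.tmul_mul_tmul, one_mul, mul_one]
        rfl
      rw [h2, Polynomial.aeval_def, Polynomial.hom_eval₂]
      congr 2
      exact RingHom.ext fun p => (hφ p).symm

/-- The chart `B[y²/x², xy/x²]` of the blow-up of the quotient by `σ` along the branch locus
is smooth: adjoining `x` to it gives a chart of the blow-up of `x = y = 0`. -/
theorem exists_smooth_isBlowUpAlgebra [IsScalarTower ℂ B A] [IsDomain R] [Algebra.Smooth ℂ R]
    (H : IsTransverse R B σ x y) {I : Ideal B}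
    (hI : ∀ b, b ∈ I ↔ algebraMap B A b ∈ Ideal.span {x, y}) {u : B}
    (hu : algebraMap B A u = x * x) :
    ∃ (C : Type) (_ : CommRing C) (_ : Algebra ℂ C) (φ : B →ₐ[ℂ] C),
      IsBlowUpAlgebra I {u} φ.toRingHom ∧ Algebra.Smooth ℂ C := by
  obtain ⟨D, _, _, _, φ, t, hinj, hreg, ht, hgen⟩ := H.exists_chart_over
  have hB : ∀ b : B, σ (algebraMap B A b) = algebraMap B A b := fun b => (H.invariant _).2 ⟨b, rfl⟩
  obtain ⟨w, hw⟩ := (H.invariant (x * y)).1 (by rw [map_mul, H.map_x, H.map_y, neg_mul_neg])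
  obtain ⟨v, hv⟩ := (H.invariant (y * y)).1 (by rw [map_mul, H.map_y, neg_mul_neg])
  let : Algebra B D := (φ.toRingHom.comp (algebraMap B A)).toAlgebra
  have hBD : ∀ b, algebraMap B D b = φ (algebraMap B A b) := fun _ => rfl
  have : IsScalarTower ℂ B D := .of_algebraMap_eq fun c => by
    rw [hBD, ← IsScalarTower.algebraMap_apply, φ.commutes]
  let C : Subalgebra B D := Algebra.adjoin B {t}
  have htC : t ∈ C := Algebra.subset_adjoin rfl
  have hBC : ∀ b, φ (algebraMap B A b) ∈ C := fun b => C.algebraMap_mem b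
  have huD : φ x * φ x = φ (algebraMap B A u) := by rw [hu, map_mul]
  have hspan : ∀ d : D, ∃ c ∈ C, ∃ c' ∈ C, d = c + c' * φ x := by
    intro d
    obtain ⟨p, rfl⟩ := hgen d
    induction p using Polynomial.induction_on' with
    | add p q hp hq =>
      obtain ⟨c, hc, c', hc', h⟩ := hp
      obtain ⟨e, he, e', he', h'⟩ := hq
      refine ⟨c + e, C.add_mem hc he, c' + e', C.add_mem hc' he', ?_⟩
      rw [Polynomial.eval₂_add, h, h']
      ring
    | monomial n a =>
      obtain ⟨b, b₀, b₁, rfl⟩ := H.exists_eq_add a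
      refine ⟨φ (algebraMap B A b) * t ^ n, C.mul_mem (hBC b) (C.pow_mem htC n),
        (φ (algebraMap B A b₀) + φ (algebraMap B A b₁) * t) * t ^ n,
        C.mul_mem (C.add_mem (hBC _) (C.mul_mem (hBC _) htC)) (C.pow_mem htC n), ?_⟩
      rw [Polynomial.eval₂_monomial]
      change φ _ * _ = _
      rw [map_add, map_add, map_mul, map_mul, ← ht]
      ring
  -- the denominators in `C` are powers of `u`
  have hpow : ∀ c ∈ C, ∃ (n : ℕ) (b : B), (φ x * φ x) ^ n * c = φ (algebraMap B A b) := by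
    intro c hc
    induction hc using Algebra.adjoin_induction with
    | mem c hc =>
      rw [Set.mem_singleton_iff.1 hc]
      refine ⟨1, w, ?_⟩
      rw [pow_one, mul_assoc, ht, hw, map_mul]
    | algebraMap b => exact ⟨0, b, by rw [pow_zero, one_mul]; rfl⟩
    | add c c' _ _ h h' =>
      obtain ⟨n, b, h⟩ := h
      obtain ⟨n', b', h'⟩ := h'
      refine ⟨n + n', u ^ n' * b + u ^ n * b', ?_⟩
      simp only [map_add, map_mul, map_pow, ← h, ← h', hu]
      ring
    | mul c c' _ _ h h' =>
      obtain ⟨n, b, h⟩ := h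
      obtain ⟨n', b', h'⟩ := h'
      refine ⟨n + n', b * b', ?_⟩
      simp only [map_mul, ← h, ← h']
      ring
  have hregn : ∀ n, (φ x * φ x) ^ n ∈ nonZeroDivisors D := fun n =>
    pow_mem (mul_mem hreg hreg) n
  have hsq : IsSqrtExtension (C := C) (D := D) ⟨φ x * φ x, huD ▸ hBC u⟩ (φ x) := by
    refine ⟨rfl, fun d => ?_, fun c c' h => ?_⟩
    · obtain ⟨c, hc, c', hc', h⟩ := hspan d
      exact ⟨⟨c, hc⟩, ⟨c', hc'⟩, h⟩
    · obtain ⟨c, hc⟩ := c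
      obtain ⟨c', hc'⟩ := c'
      have h : c + c' * φ x = 0 := h
      obtain ⟨n, b, hb⟩ := hpow c hc
      obtain ⟨n', b', hb'⟩ := hpow c' hc'
      have h2 : algebraMap B A (u ^ n' * b) + algebraMap B A (u ^ n * b') * x = 0 := by
        apply hinj
        simp only [map_add, map_mul, map_pow, ← hb, ← hb', hu, map_zero]
        linear_combination ((φ x * φ x) ^ n * (φ x * φ x) ^ n') * h
      have h3 := congrArg σ h2
      rw [map_add, map_mul σ _ x, hB, hB, H.map_x, map_zero] at h3
      have h4 : algebraMap B A (u ^ n' * b) = 0 := by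
        apply eq_zero_of_two_mul
        linear_combination h2 + h3
      have h5 : c = 0 := by
        apply (mul_right_mem_nonZeroDivisors_eq_zero_iff (hregn (n + n'))).1
        have := congrArg φ h4
        simp only [map_mul, map_pow, ← hb, hu, map_zero] at this
        rw [← this]
        ring
      refine ⟨Subtype.ext h5, Subtype.ext ?_⟩
      rw [h5, zero_add] at h
      exact (mul_right_mem_nonZeroDivisors_eq_zero_iff hreg).1 h
  let : Algebra ℂ C := inferInstance
  have hφC : ∀ b, ((algebraMap B C b : C) : D) = φ (algebraMap B A b) := fun b => rfl
  refine ⟨C, inferInstance, inferInstance, IsScalarTower.toAlgHom ℂ B C, ⟨?_, ?_, ?_, ?_⟩,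
    hsq.smooth (k := ℂ)⟩
  · rintro _ rfl
    rw [mem_nonZeroDivisors_iff_right]
    intro c hc
    have hc : (c : D) * φ (algebraMap B A _) = 0 := congrArg Subtype.val hc
    rw [← huD] at hc
    exact Subtype.ext ((mul_right_mem_nonZeroDivisors_eq_zero_iff (mul_mem hreg hreg)).1 hc)
  · rintro _ rfl a ha
    obtain ⟨b₀, b₁, b₂, h⟩ := H.exists_of_mem_span ((hI a).1 ha)
    refine ⟨⟨φ (algebraMap B A b₀) + φ (algebraMap B A b₁) * t +
      φ (algebraMap B A b₂) * (t * t), C.add_mem (C.add_mem (hBC _) (C.mul_mem (hBC _) htC))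
        (C.mul_mem (hBC _) (C.mul_mem htC htC))⟩, Subtype.ext ?_⟩
    change φ (algebraMap B A a) = φ (algebraMap B A _) * _
    rw [h, ← huD]
    simp only [map_add, map_mul, ← ht]
    ring
  · intro b hb
    have hb : φ (algebraMap B A b) = 0 := congrArg Subtype.val hb
    refine ⟨1, one_mem _, ?_⟩
    rw [one_mul]
    apply H.injective
    apply hinj
    rw [hb, map_zero, map_zero]
  · refine eq_top_iff.2 fun c _ => ?_
    obtain ⟨c, hc⟩ := c
    induction hc using Algebra.adjoin_induction with
    | mem c hc =>
      refine Subring.subset_closure (Or.inr ⟨u, rfl, w, (hI w).2 ?_, Subtype.ext ?_⟩)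
      · rw [hw]
        exact Ideal.mul_mem_right _ _ (Ideal.subset_span (Or.inl rfl))
      · change φ (algebraMap B A u) * c = φ (algebraMap B A w)
        rw [Set.mem_singleton_iff.1 hc, ← huD, mul_assoc, ht, hw, map_mul]
    | algebraMap b => exact Subring.subset_closure (Or.inl ⟨b, rfl⟩)
    | add c c' hc hc' h h' => exact Subring.add_mem _ (h trivial) (h' trivial)
    | mul c c' hc hc' h h' => exact Subring.mul_mem _ (h trivial) (h' trivial)

end IsTransverse

end

attribute [local instance] sectionsAlgebra

open TensorProduct

theorem mem_vanishingIdeal_ideal_iff {X : Scheme.{0}} {Z : Closeds X} {U : X.Opens}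
    (hU : IsAffineOpen U) (b : Γ(X, U)) :
    b ∈ (Scheme.IdealSheafData.vanishingIdeal Z).ideal ⟨U, hU⟩ ↔ ∀ z ∈ Z, z ∉ X.basicOpen b := by
  rw [Scheme.IdealSheafData.vanishingIdeal_ideal, PrimeSpectrum.mem_vanishingIdeal]
  have key : ∀ y : Spec Γ(X, U), hU.fromSpec y ∈ X.basicOpen b ↔ b ∉ y.asIdeal := fun y => by
    change y ∈ hU.fromSpec ⁻¹ᵁ X.basicOpen b ↔ _
    rw [hU.fromSpec_preimage_basicOpen]
    exact Iff.rfl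
  constructor
  · intro h z hz hzb
    have hzU := X.basicOpen_le b hzb
    rw [← fromSpec_specPt hU hzU] at hz hzb
    exact (key _).1 hzb (h _ hz)
  · intro h y hy
    by_contra hb
    exact h _ hy ((key _).2 hb)

theorem exists_boxEquiv_of_eq (S : CScheme) {U : S.left.Opens} (hU : IsAffineOpen U)
    {W : (square S).left.Opens} (hW : box U = W) (hg : W ≤ (switch S).left ⁻¹ᵁ W)
    (hd : U ≤ (diag S).left ⁻¹ᵁ W) :
    ∃ e : Γ(S.left, U) ⊗[ℂ] Γ(S.left, U) ≃ₐ[ℂ] Γ((square S).left, W),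
      (∀ a, e (Algebra.TensorProduct.comm ℂ _ _ a) = pb (switch S).left hg (e a)) ∧
      (∀ a, pb (diag S).left hd (e a) =
        Algebra.TensorProduct.lmul' ℂ (S := Γ(S.left, U)) a) := by
  subst hW
  obtain ⟨e, h1, h2⟩ := exists_boxEquiv S hU
  exact ⟨e, h1, h2 hd⟩

/-- Étale-locally at the diagonal, the symmetric square of a surface is the quotient of the plane
by `-1`, times the surface. -/
theorem exists_isTransverse {S Q : CScheme} [SmoothOfRelativeDimension 2 S.str]
    {π : square S ⟶ Q} (H : IsGeomQuotient (switch S).left π.left) (s : S.left) :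
    ∃ (U : S.left.Opens) (O : Q.left.Opens), IsAffineOpen U ∧ IsAffineOpen O ∧ s ∈ U ∧
      ∃ (hUO : (diag S).left ⁻¹ᵁ π.left ⁻¹ᵁ O = U)
        (x y : Γ((square S).left, π.left ⁻¹ᵁ O)),
      (∀ c, c ∈ Ideal.span {x, y} ↔ pb (diag S).left hUO.ge c = 0) ∧
      letI := (pb π.left (U := O) (V := π.left ⁻¹ᵁ O) le_rfl).toAlgebra
      IsTransverse Γ(S.left, U) Γ(Q.left, O)
        (pb (switch S).left (le_preimage_preimage H.invariant O)) x y := by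
  have hsw : (switch S).left ≫ (switch S).left = 𝟙 _ :=
    congrArg CommaMorphism.left (switch_switch S)
  obtain ⟨U, hU, hsU, g, hg⟩ := exists_etale_coordinates s
  obtain ⟨O, hO, hOU⟩ := H.exists_isAffineOpen hsw (isAffineOpen_box hU) (switch_invariant_box U)
  have hUd : U ≤ (diag S).left ⁻¹ᵁ π.left ⁻¹ᵁ O := fun t ht => by
    have h1 : (diag S).left t ∈ π.left ⁻¹ᵁ O := hOU.symm ▸ diag_left_mem_box ht
    exact h1
  have hU' : IsAffineOpen (π.left ⁻¹ᵁ O) := hOU.symm ▸ isAffineOpen_box hU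
  obtain ⟨e, he, he'⟩ := exists_boxEquiv_of_eq S hU hOU.symm
    (le_preimage_preimage H.invariant O) hUd
  let : Algebra (MvPolynomial (Fin 2) ℂ) Γ(S.left, U) := g.toRingHom.toAlgebra
  have : IsScalarTower ℂ (MvPolynomial (Fin 2) ℂ) Γ(S.left, U) :=
    .of_algebraMap_eq fun c => (g.commutes c).symm
  have : Algebra.Etale (MvPolynomial (Fin 2) ℂ) Γ(S.left, U) := hg
  obtain ⟨h, hh, hh1, hhJ⟩ := exists_separating_idempotent (R := Γ(S.left, U))
  -- `b` cuts out the open set on which `x` and `y` vanish only along the diagonal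
  obtain ⟨b, hb⟩ := (H.hasInvariantSections O).2 (e h) (by rw [← he, hh])
  let O' := Q.left.basicOpen b
  have hO' : IsAffineOpen O' := hO.basicOpen b
  have hO'O : π.left ⁻¹ᵁ O' ≤ π.left ⁻¹ᵁ O := π.left.preimage_mono (Q.left.basicOpen_le b)
  have hO'b : π.left ⁻¹ᵁ O' = (square S).left.basicOpen (e h) := by
    rw [Scheme.preimage_basicOpen, app_eq_pb, hb]
  have hUO : (diag S).left ⁻¹ᵁ π.left ⁻¹ᵁ O' = U := by
    apply le_antisymm
    · intro t ht
      have h1 : (diag S).left t ∈ box U := hOU ▸ hO'O ht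
      have h2 := congrArg (fun f => f.left t) (squareLift_fst (𝟙 S) (𝟙 S))
      exact (congrArg (· ∈ U) h2).mp h1.1
    · intro t ht
      have h1 : (diag S).left t ∈ (square S).left.basicOpen (e h) := by
        rw [← mem_basicOpen_pb _ hUd _ ht, he', hh1, Scheme.basicOpen_of_isUnit _ isUnit_one]
        exact ht
      exact hO'b.symm ▸ h1
  let ρ : Γ(S.left, U) ⊗[ℂ] Γ(S.left, U) →+* Γ((square S).left, π.left ⁻¹ᵁ O') :=
    (res hO'O).comp e.toRingEquiv.toRingHom
  have hρ : ∀ a, ρ a = res hO'O (e a) := fun _ => rfl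
  let : Algebra Γ((square S).left, π.left ⁻¹ᵁ O) Γ((square S).left, π.left ⁻¹ᵁ O') :=
    (res hO'O).toAlgebra
  have hloc : IsLocalization.Away (e h) Γ((square S).left, π.left ⁻¹ᵁ O') :=
    hU'.isLocalization_of_eq_basicOpen (e h) (homOfLE hO'O) hO'b
  have hρd : ∀ a, pb (diag S).left hUO.ge (ρ a) =
      Algebra.TensorProduct.lmul' ℂ (S := Γ(S.left, U)) a := fun a => by
    rw [hρ, pb_res, he']
  have hρg : ∀ a, pb (switch S).left (le_preimage_preimage H.invariant O') (ρ a) =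
      ρ (Algebra.TensorProduct.comm ℂ _ _ a) := fun a => by
    rw [hρ, hρ, he, pb_res, res_pb]
  have hunit : IsUnit (ρ h) := IsLocalization.Away.algebraMap_isUnit (e h)
  have hfrac : ∀ c, ∃ (n : ℕ) (a : _), ρ h ^ n * c = ρ a := fun c => by
    obtain ⟨⟨a, _, n, rfl⟩, h1⟩ := IsLocalization.surj (Submonoid.powers (e h)) c
    obtain ⟨a, rfl⟩ := e.surjective a
    refine ⟨n, a, ?_⟩
    rw [mul_comm, hρ, hρ, ← map_pow]
    exact h1
  have hJ : ∀ c, c ∈ Ideal.span {ρ (diagCoord _ 0), ρ (diagCoord _ 1)} ↔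
      pb (diag S).left hUO.ge c = 0 := by
    intro c
    constructor
    · intro hc
      obtain ⟨α, β, rfl⟩ := Ideal.mem_span_pair.1 hc
      rw [map_add, map_mul, map_mul, hρd, hρd, lmul'_diagCoord, lmul'_diagCoord, mul_zero,
        mul_zero, add_zero]
    · intro hc
      obtain ⟨n, a, ha⟩ := hfrac c
      have h1 := congrArg (pb (diag S).left hUO.ge) ha
      rw [map_mul, hc, mul_zero, hρd] at h1
      have h2 := Ideal.mem_map_of_mem ρ (hhJ a h1.symm)
      rw [Ideal.map_span, Set.image_pair, map_mul, ← ha, ← mul_assoc, ← pow_succ'] at h2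
      exact (Ideal.unit_mul_mem_iff_mem _ (hunit.pow _)).1 h2
  have hgd : (diag S).left ≫ (switch S).left = (diag S).left :=
    congrArg CommaMorphism.left (diag_switch S)
  refine ⟨U, O', hU, hO', hsU, hUO, ρ (diagCoord _ 0), ρ (diagCoord _ 1), hJ, ?_⟩
  refine @IsTransverse.mk _ _ _ _ _ _ _ _ _ (_) _ _ _ ?_ ?_ ?_ ?_ ?_ ?_ ?_
  · intro a
    exact exists_eq_pb_of_invariant H rfl _ a
  · exact (H.hasInvariantSections O').1
  · intro a
    rw [pb_pb, pb_congr hsw]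
    exact (pb_id _ _).trans (res_self _ _)
  · rw [hρg, comm_diagCoord, map_neg]
  · rw [hρg, comm_diagCoord, map_neg]
  · intro a
    rw [hJ, map_sub, pb_pb, pb_congr hgd, sub_self]
  · refine ⟨ρ.comp (MvPolynomial.aeval (R := Γ(S.left, U)) (diagCoord _)).toRingHom, ?_, ?_, ?_, ?_⟩
    · exact RingHom.Etale.stableUnderComposition _ _ etale_aeval_diagCoord
        (RingHom.Etale.stableUnderComposition _ _ (.of_bijective e.bijective)
          (RingHom.etale_algebraMap.2 (.of_isLocalizationAway (e h))))
    · exact congrArg ρ (MvPolynomial.aeval_X _ _)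
    · exact congrArg ρ (MvPolynomial.aeval_X _ _)
    · intro c
      have h1 : (MvPolynomial.aeval (R := Γ(S.left, U)) (diagCoord Γ(S.left, U)))
          (algebraMap ℂ _ c) = algebraMap ℂ _ c := by
        rw [IsScalarTower.algebraMap_apply ℂ Γ(S.left, U) (MvPolynomial (Fin 2) Γ(S.left, U)),
          AlgHom.commutes]
        rfl
      refine (congrArg ρ h1).trans ?_
      rw [hρ, e.commutes]
      exact (pb_id _ _).symm.trans
        ((pullbackFun (𝟙 (square S)) (π.left ⁻¹ᵁ O) (π.left ⁻¹ᵁ O') hO'O).commutes c)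

attribute [local instance] sectionsAlgebra

/-! ### The Hilbert square is smooth -/

section

variable {T X : Scheme.{0}} {I : X.IdealSheafData} {O : X.Opens} {hO : IsAffineOpen O}
  {f : T ⟶ X}

theorem IsChartOn.of_isUnit {W W' : T.Opens} {a u : Γ(X, O)} (ha : IsChartOn I hO {a} f W)
    (hW : W' ≤ W) {u' : Γ(T, W)} (hu' : IsUnit (res hW u'))
    (hu : pb f ha.le u = pb f ha.le a * u') :
    IsChartOn I hO {u} f W' := by
  have h1 : pb f (hW.trans ha.le) u = pb f (hW.trans ha.le) a * res hW u' := by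
    rw [← res_pb f hW ha.le, hu, map_mul, res_pb]
  have h2 := ha.of_le hW
  refine ⟨hW.trans ha.le, ?_, ?_⟩
  · rintro _ rfl
    rw [h1]
    exact (h2.regular a rfl).mul (IsUnit.isRegularSection hu')
  · rintro _ rfl c hc
    rw [h1]
    exact (hu'.mul_right_dvd).2 (h2.dvd a rfl c hc)

/-- If `I = (u, w, v)` with `u v = w²`, the blow-up of `I` is covered by the charts of `u`
and `v`. -/
theorem exists_isChartOn_of_mul_eq (H : IsEffectiveCartier (I.comap f)) {t : T} (ht : f t ∈ O)
    {u v w : Γ(X, O)} (huv : u * v = w * w) (hu : u ∈ I.ideal ⟨O, hO⟩) (hv : v ∈ I.ideal ⟨O, hO⟩)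
    (hw : w ∈ I.ideal ⟨O, hO⟩)
    (hI : ∀ a ∈ I.ideal ⟨O, hO⟩, ∃ p q r, a = p * u + q * w + r * v) :
    ∃ W, t ∈ W ∧ (IsChartOn I hO {u} f W ∨ IsChartOn I hO {v} f W) := by
  obtain ⟨a, ha, W, htW, hW⟩ := exists_isChartOn_of_isEffectiveCartier H hO ht
  obtain ⟨u', hu'⟩ := hW.dvd a rfl u hu
  obtain ⟨v', hv'⟩ := hW.dvd a rfl v hv
  obtain ⟨w', hw'⟩ := hW.dvd a rfl w hw
  obtain ⟨p, q, r, hpqr⟩ := hI a ha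
  have hreg := (hW.regular a rfl).mem_nonZeroDivisors
  set α := pb f hW.le a
  set p' := pb f hW.le p
  set q' := pb f hW.le q
  set r' := pb f hW.le r
  have h1 : p' * u' + q' * w' + r' * v' = 1 := by
    have h2 := congrArg (pb f hW.le) hpqr
    simp only [map_add, map_mul, hu', hv', hw'] at h2
    refine sub_eq_zero.1 ((mul_right_mem_nonZeroDivisors_eq_zero_iff hreg).1 ?_)
    linear_combination -h2
  have h3 : u' * v' = w' * w' := by
    have h2 := congrArg (pb f hW.le) huv
    simp only [map_mul, hu', hv', hw'] at h2
    refine sub_eq_zero.1 ((mul_right_mem_nonZeroDivisors_eq_zero_iff (mul_mem hreg hreg)).1 ?_)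
    linear_combination h2
  -- as `w'²` is a multiple of `u'`, the ideal `(u', v')` is trivial
  have h4 : (2 * p' - p' * (p' * u' + r' * v') + q' * q' * v') * u' +
      (2 * r' - r' * (p' * u' + r' * v')) * v' = 1 := by
    linear_combination (q' * w' - (p' * u' + r' * v') + 1) * h1 + q' * q' * h3
  have h5 := congrArg (T.presheaf.germ W t htW) h4
  rw [map_add, map_mul, map_mul, map_one] at h5
  have key : ∀ {c : Γ(X, O)} {c' : Γ(T, W)}, pb f hW.le c = α * c' →
      IsUnit (T.presheaf.germ W t htW c') → ∃ W', t ∈ W' ∧ IsChartOn I hO {c} f W' := by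
    intro c c' h h'
    exact ⟨T.basicOpen c', (T.mem_basicOpen c' t htW).2 h',
      hW.of_isUnit (T.basicOpen_le c') (isUnit_res_basicOpen c') h⟩
  rcases IsLocalRing.isUnit_or_isUnit_of_add_one h5 with h | h
  · obtain ⟨W', h6, h7⟩ := key hu' (isUnit_of_mul_isUnit_right h)
    exact ⟨W', h6, Or.inl h7⟩
  · obtain ⟨W', h6, h7⟩ := key hv' (isUnit_of_mul_isUnit_right h)
    exact ⟨W', h6, Or.inr h7⟩

end

theorem IsBlowUp.isSmoothAt_of_isChartOn {Q B : CScheme} {b : B ⟶ Q} {I : Q.left.IdealSheafData}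
    (H : IsBlowUp I b.left) {O : Q.left.Opens} {hO : IsAffineOpen O} {u : Γ(Q.left, O)}
    (hu : u ∈ I.ideal ⟨O, hO⟩) {C : Type} [CommRing C] [Algebra ℂ C] (φ : Γ(Q.left, O) →ₐ[ℂ] C)
    (hφ : IsBlowUpAlgebra (I.ideal ⟨O, hO⟩) {u} φ.toRingHom) [hC : Algebra.Smooth ℂ C]
    {W : B.left.Opens} (hW : IsChartOn I hO {u} b.left W) {z : B.left} (hz : z ∈ W) :
    IsSmoothAt B.str z := by
  obtain ⟨κ, hκ, _, hr⟩ := H.exists_chart (Set.finite_singleton u) (Set.singleton_nonempty u)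
    (Set.singleton_subset_iff.2 hu) (isChart_SpecMap hO {u} (CommRingCat.ofHom φ.toRingHom) hφ)
  obtain ⟨y, rfl⟩ := (hr z).2 ⟨W, hz, hW⟩
  apply isSmoothAt_of_isOpenImmersion
  rw [← CScheme.comp_str b, reassoc_of% hκ, fromSpec_comp_str, ← Spec.map_comp,
    HasRingHomProperty.Spec_iff (P := @Smooth)]
  have : (CommRingCat.ofHom (algebraMap ℂ Γ(Q.left, O)) ≫ CommRingCat.ofHom φ.toRingHom).hom =
      algebraMap ℂ C := φ.comp_algebraMap
  rw [this]
  exact RingHom.smooth_algebraMap.2 hC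

/-- The blow-up of the symmetric square of a smooth surface along the diagonal is smooth. -/
theorem IsBlowUp.smooth_of_symmetricSquare {S Q B : CScheme} [IsIntegral S.left]
    [SmoothOfRelativeDimension 2 S.str] {π : square S ⟶ Q}
    (H : IsGeomQuotient (switch S).left π.left) {b : B ⟶ Q}
    (hZ : (singularLocus Q : Set Q.left) = Set.range (diag S ≫ π).left)
    (hb : IsSingularBlowUp b) : Smooth B.str := by
  apply smooth_of_isSmoothAt
  intro z
  by_cases hz : b.left z ∈ singularLocus Q
  swap
  · obtain ⟨U, hU, hzU, h1⟩ := one_mem_vanishingIdeal hz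
    obtain ⟨κ, hκ, _, hr⟩ := hb.exists_of_one_mem hU h1
    obtain ⟨y, rfl⟩ : z ∈ Set.range κ := hr ▸ hzU
    apply IsSmoothAt.of_comp
    rw [← CScheme.comp_str b, reassoc_of% hκ]
    apply IsSmoothAt.comp
    rw [← hκ]
    by_contra h2
    exact hz fun h3 => h2 (mem_nonsingularLocus_iff.1 h3)
  · -- Over the diagonal, the ideal of the centre is generated by `u = x²`, `v = y²` and `w = x y`,
    -- and `u v = w²` shows that the charts of `u` and `v` cover the blow-up.
    obtain ⟨s, hs⟩ : b.left z ∈ Set.range (diag S ≫ π).left := hZ ▸ hz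
    obtain ⟨U, O, hU, hO, hsU, hUO, x, y, hJ, hT⟩ := exists_isTransverse H s
    let : Algebra Γ(Q.left, O) Γ((square S).left, π.left ⁻¹ᵁ O) :=
      (pb π.left (U := O) (V := π.left ⁻¹ᵁ O) le_rfl).toAlgebra
    have hpb : ∀ c, algebraMap Γ(Q.left, O) Γ((square S).left, π.left ⁻¹ᵁ O) c =
      pb π.left (U := O) (V := π.left ⁻¹ᵁ O) le_rfl c := fun _ => rfl
    have : IsScalarTower ℂ Γ(Q.left, O) Γ((square S).left, π.left ⁻¹ᵁ O) :=
      .of_algebraMap_eq fun c => ((pullbackFun π O (π.left ⁻¹ᵁ O) le_rfl).commutes c).symm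
    have : Nonempty U := ⟨⟨s, hsU⟩⟩
    have hsm : Algebra.Smooth ℂ Γ(S.left, U) := by
      have : Smooth S.str := SmoothOfRelativeDimension.smooth 2 S.str
      exact smooth_sections S hU le_rfl inferInstance
    have hzO : b.left z ∈ O := by
      rw [← hs]
      exact hUO.ge hsU
    have hI : ∀ c, c ∈ (Scheme.IdealSheafData.vanishingIdeal (singularLocus Q)).ideal ⟨O, hO⟩ ↔
        algebraMap Γ(Q.left, O) Γ((square S).left, π.left ⁻¹ᵁ O) c ∈ Ideal.span {x, y} := by
      intro c
      rw [hJ, hpb, pb_pb, mem_vanishingIdeal_ideal_iff, ← basicOpen_eq_bot_iff]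
      constructor
      · intro h
        refine eq_bot_iff.2 fun t ht => ?_
        have htU : t ∈ U := Scheme.basicOpen_le _ _ ht
        refine h ((diag S ≫ π).left t) ?_ ((mem_basicOpen_pb _ _ _ htU).1 ht)
        exact hZ.ge ⟨t, rfl⟩
      · intro h q hq hqc
        obtain ⟨t, rfl⟩ : q ∈ Set.range (diag S ≫ π).left := hZ ▸ hq
        have htU : t ∈ U := hUO.le (Q.left.basicOpen_le c hqc)
        have h1 := (mem_basicOpen_pb ((diag S).left ≫ π.left) (le_comp_preimage le_rfl hUO.ge) c
          htU).2 hqc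
        rw [h] at h1
        exact h1
    have hinv := hT.invariant
    obtain ⟨u, hu⟩ := (hT.invariant (x * x)).1 (by rw [map_mul, hT.map_x, neg_mul_neg])
    obtain ⟨v, hv⟩ := (hT.invariant (y * y)).1 (by rw [map_mul, hT.map_y, neg_mul_neg])
    obtain ⟨w, hw⟩ := (hT.invariant (x * y)).1 (by rw [map_mul, hT.map_x, hT.map_y, neg_mul_neg])
    have hx : x ∈ Ideal.span {x, y} := Ideal.subset_span (Or.inl rfl)
    have hy : y ∈ Ideal.span {x, y} := Ideal.subset_span (Or.inr rfl)
    have hu' := (hI u).2 (hu ▸ Ideal.mul_mem_left _ _ hx)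
    have hv' := (hI v).2 (hv ▸ Ideal.mul_mem_left _ _ hy)
    have hw' := (hI w).2 (hw ▸ Ideal.mul_mem_left _ _ hy)
    obtain ⟨W, hzW, hW | hW⟩ := exists_isChartOn_of_mul_eq hb.isEffectiveCartier hzO (u := u)
      (v := v) (w := w) (hT.injective (by rw [map_mul, map_mul, hu, hv, hw]; ring)) hu' hv' hw'
      (fun a ha => by
        obtain ⟨p, q, r, h⟩ := hT.exists_of_mem_span ((hI a).1 ha)
        refine ⟨p, q, r, hT.injective ?_⟩
        rw [h, map_add, map_add, map_mul, map_mul, map_mul, hu, hv, hw])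
    · obtain ⟨C, _, _, φ, hφ, _⟩ := hT.exists_smooth_isBlowUpAlgebra hI hu
      exact hb.isSmoothAt_of_isChartOn hu' φ hφ hW hzW
    · obtain ⟨C, _, _, φ, hφ, _⟩ := hT.swap.exists_smooth_isBlowUpAlgebra
        (by rwa [Ideal.span_pair_comm]) hv
      exact hb.isSmoothAt_of_isChartOn hv' φ hφ hW hzW

/-! ### Blow-ups and quotients -/

section

variable {X Q : Scheme.{0}} {g : X ⟶ X} {π : X ⟶ Q}

theorem mem_freeLocus_of_isPullback {P T : Scheme.{0}} {h : g ≫ π = π} {p : P ⟶ X} {k : P ⟶ T}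
    {b : T ⟶ Q} (hw : p ≫ π = k ≫ b) {γ : P ⟶ P} (hγp : γ ≫ p = p ≫ g) (hγk : γ ≫ k = k) {t : T}
    (ht : b t ∈ freeLocus h) : t ∈ freeLocus hγk := by
  obtain ⟨O, hO, htO, -, a, ha⟩ := exists_isFreeSection ht (U := ⊤) trivial
  obtain ⟨O', hO', htO', hle⟩ := exists_isAffineOpen_le (x := t) (U := b ⁻¹ᵁ O) htO
  have e : k ⁻¹ᵁ O' ≤ p ⁻¹ᵁ π ⁻¹ᵁ O := by
    rw [← Scheme.Hom.comp_preimage p π, hw]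
    exact k.preimage_mono hle
  refine Opens.mem_sSup.2 ⟨O', ⟨hO', pb p e a, ha.isUnit.map _, ?_⟩, htO'⟩
  rw [pb_pb, pb_congr hγp, ← map_neg, ← ha.pb_eq, pb_pb]

/-- Blowing up commutes with the quotient by an involution that acts freely near the centre. -/
theorem IsBlowUp.exists_isPullback (H : IsGeomQuotient g π) (hg : g ≫ g = 𝟙 X) [IsAffineHom π]
    (h2 : IsUnit (2 : Γ(Q, ⊤))) {Z : Closeds Q} (hZ : ∀ q ∈ Z, q ∈ freeLocus H.invariant)
    {B : Scheme.{0}} {b : B ⟶ Q} (hb : IsBlowUp (.vanishingIdeal Z) b) {P : Scheme.{0}} {p : P ⟶ X}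
    (hp : IsBlowUp (.vanishingIdeal (Z.preimage π.continuous)) p) {γ : P ⟶ P}
    (hγ : γ ≫ p = p ≫ g) :
    ∃ k : P ⟶ B, IsPullback p k π b ∧ γ ≫ k = k ∧ IsGeomQuotient γ k ∧ IsAffineHom k ∧
      γ ≫ γ = 𝟙 P := by
  have hI := comap_vanishingIdeal_of_le_freeLocus H hg h2 hZ
  let p' := pullback.fst π b
  let k' := pullback.snd π b
  have hP : IsPullback p' k' π b := IsPullback.of_hasPullback π b
  let γ' : pullback π b ⟶ pullback π b := pullback.lift (p' ≫ g) k' (by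
    rw [Category.assoc, H.invariant, hP.w])
  have hγ'p : γ' ≫ p' = p' ≫ g := pullback.lift_fst _ _ _
  have hγ'k : γ' ≫ k' = k' := pullback.lift_snd _ _ _
  obtain ⟨hk', _, hγγ⟩ := H.of_isPullback hg h2 hP γ' hγ'p hγ'k
  have h2B : IsUnit (2 : Γ(B, ⊤)) := by
    have := h2.map (pb b (U := ⊤) (V := ⊤) le_top)
    rwa [map_ofNat] at this
  -- the projection to `B` is étale over the centre
  have hC : IsEffectiveCartier ((Scheme.IdealSheafData.vanishingIdeal Z).comap (k' ≫ b)) := by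
    apply isEffectiveCartier_of_isCartierAt
    intro y
    by_cases hy : b (k' y) ∈ Z
    · have hfree : k' y ∈ freeLocus hk'.invariant :=
        mem_freeLocus_of_isPullback hP.w hγ'p hγ'k (hZ _ hy)
      obtain ⟨U, hyU, hU⟩ := exists_etale_of_mem_freeLocus hk' hγγ h2B hfree
      refine (isCartierAt_iff_comp U.ι (z := (⟨y, hyU⟩ : U))).1 ?_
      rw [← Category.assoc]
      exact (isCartierAt_of_isEffectiveCartier hb.isEffectiveCartier (k' y)).comp (U.ι ≫ k')
    · obtain ⟨U, hU, hyU, h1⟩ := one_mem_vanishingIdeal hy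
      exact isCartierAt_of_one_mem hU hyU h1
  have hbl := hb.of_isPullback hP.flip hC
  rw [hI] at hbl
  obtain ⟨e, he⟩ := hp.exists_iso hbl
  have hP' : IsPullback p (e.hom ≫ k') π b :=
    hP.of_iso e.symm (Iso.refl _) (Iso.refl _) (Iso.refl _) (by simp [← he, p'])
      (by simp) (by simp) (by simp)
  have hγk : γ ≫ e.hom ≫ k' = e.hom ≫ k' := by
    apply hb.hom_ext
    · rw [Category.assoc, ← hP'.w, reassoc_of% hγ, H.invariant]
    · have := hp.isEffectiveCartier
      rw [← hI, ← Scheme.IdealSheafData.comap_comp] at this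
      rw [Category.assoc, ← hP'.w, reassoc_of% hγ, H.invariant]
      exact this
  obtain ⟨h3, h4, h5⟩ := H.of_isPullback hg h2 hP' γ hγ hγk
  exact ⟨_, hP', hγk, h3, h4, h5⟩

end

section

variable {Q B : Scheme.{0}} {Z₁ Z₂ : Closeds Q} {b : B ⟶ Q}

/-- Away from the centre a blow-up is an isomorphism. -/
theorem IsBlowUp.comap_vanishingIdeal (hb : IsBlowUp (.vanishingIdeal Z₁) b)
    (hd : Disjoint (Z₁ : Set Q) Z₂) : (Scheme.IdealSheafData.vanishingIdeal Z₂).comap b =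
      .vanishingIdeal (Z₂.preimage b.continuous) := by
  have h1 : ((Scheme.IdealSheafData.vanishingIdeal Z₂).comap b).support =
      Z₂.preimage b.continuous := by
    rw [Scheme.IdealSheafData.support_comap, support_vanishingIdeal]
  rw [← h1]
  apply eq_vanishingIdeal_of_isRadical
  intro y
  by_cases hy : b y ∈ Z₂
  · obtain ⟨U, hU, hyU, h1⟩ := one_mem_vanishingIdeal fun h => Set.disjoint_left.1 hd h hy
    obtain ⟨κ, hκ, _, hr⟩ := hb.exists_of_one_mem hU h1
    have hr' : κ.opensRange = b ⁻¹ᵁ U := Opens.ext hr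
    have hV : IsAffineOpen (b ⁻¹ᵁ U) := by
      have : IsAffine U := hU
      rw [← hr']
      exact isAffineOpen_opensRange κ
    refine ⟨b ⁻¹ᵁ U, hV, hyU, ?_⟩
    rw [comap_ideal _ b ⟨U, hU⟩ ⟨b ⁻¹ᵁ U, hV⟩ le_rfl]
    have hκ' : κ ⁻¹ᵁ (b ⁻¹ᵁ U) = ⊤ := by
      rw [← Scheme.Hom.comp_preimage κ b, hκ, Scheme.Opens.ι_preimage_self]
    have h3 := bijective_pb_of_isOpenImmersion κ hr'.ge hκ'.symm
    have h4 := bijective_pb_of_isOpenImmersion U.ι (V := U) (by rw [Scheme.Opens.opensRange_ι])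
      (Scheme.Opens.ι_preimage_self U).symm
    have h5 : Function.Bijective (pb b (U := U) (V := b ⁻¹ᵁ U) le_rfl) := by
      rw [← Function.Bijective.of_comp_iff' h3]
      convert h4 using 1
      funext s
      refine (pb_pb κ b le_rfl hκ'.ge s).trans (pb_congr hκ _ s)
    let e := RingEquiv.ofBijective (pb b (U := U) (V := b ⁻¹ᵁ U) le_rfl) h5
    have h6 := isRadical_vanishingIdeal Z₂ ⟨U, hU⟩
    have h7 := h6.comap (e.symm : Γ(B, b ⁻¹ᵁ U) →+* Γ(Q, U))
    have h8 : Ideal.map (e : Γ(Q, U) →+* Γ(B, b ⁻¹ᵁ U)) _ = _ := Ideal.map_comap_of_equiv e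
      (I := (Scheme.IdealSheafData.vanishingIdeal Z₂).ideal ⟨U, hU⟩)
    have h9 := h8 ▸ h7
    exact h9
  · obtain ⟨U, hU, hyU, h1⟩ := one_mem_vanishingIdeal hy
    obtain ⟨V, hV, hyV, hVU⟩ := exists_isAffineOpen_le (x := y) (U := b ⁻¹ᵁ U) hyU
    refine ⟨V, hV, hyV, ?_⟩
    rw [(Ideal.eq_top_iff_one _).2 (comap_one_mem h1 hV hVU)]
    exact fun _ _ => trivial

/-- The union of two disjoint closed subsets can be blown up in two steps. -/
theorem IsBlowUp.comp_vanishingIdeal (hb : IsBlowUp (.vanishingIdeal Z₁) b)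
    (hd : Disjoint (Z₁ : Set Q) Z₂) {B' : Scheme.{0}} {b' : B' ⟶ B}
    (hb' : IsBlowUp (.vanishingIdeal (Z₂.preimage b.continuous)) b') :
    IsBlowUp (.vanishingIdeal (Z₁ ⊔ Z₂)) (b' ≫ b) := by
  rw [← hb.comap_vanishingIdeal hd] at hb'
  have h := hb.comp hb' (by
    rw [← Scheme.IdealSheafData.support_eq_bot_iff, Scheme.IdealSheafData.support_sup,
      support_vanishingIdeal, support_vanishingIdeal]
    ext x
    exact ⟨fun hx => Set.disjoint_left.1 hd hx.1 hx.2, fun hx => hx.elim⟩)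
  rwa [← Scheme.IdealSheafData.vanishingIdeal_sup] at h

end

attribute [local instance] sectionsAlgebra

/-! ### The quotient of the Hilbert square -/

theorem mem_singularLocus_iff {X : CScheme} {x : X.left} :
    x ∈ singularLocus X ↔ ¬ IsSmoothAt X.str x := by
  rw [← mem_nonsingularLocus_iff]
  rfl

/-- A quotient by an involution is determined up to isomorphism. -/
theorem IsQuotient.exists_iso {X Q Q' : CScheme} {g : X ⟶ X} {π : X ⟶ Q} {π' : X ⟶ Q'}
    (H : IsQuotient g π) (H' : IsQuotient g π') : ∃ e : Q ≅ Q', π ≫ e.hom = π' := by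
  obtain ⟨a, ha⟩ := H.exists_desc π' H'.invariant
  obtain ⟨b, hb⟩ := H'.exists_desc π H.invariant
  refine ⟨⟨a, b, H.hom_ext ?_, H'.hom_ext ?_⟩, ha⟩
  · rw [← Category.assoc, ha, hb, Category.comp_id]
  · rw [← Category.assoc, hb, ha, Category.comp_id]

namespace SymmetricQuotients

variable {S : CScheme} {ι : S ⟶ S} (D : SymmetricQuotients S ι)

theorem singularLocus_S2 (hS : IsK3Surface S) (hι : ι ≫ ι = 𝟙 S) :
    (singularLocus D.S2 : Set D.S2.left) = Set.range (diag S ≫ D.toS2).left := by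
  have := hS.smooth
  have := hS.smooth.smooth
  have := smooth_square (S := S)
  have := D.isAffineHom_toS2 hS hι
  ext y
  rw [SetLike.mem_coe, mem_singularLocus_iff]
  constructor
  · intro h
    by_contra h'
    refine h (isSmoothAt_of_mem_freeLocus D.isGeomQuotient_S2
      (left_comp_eq_id (switch_switch S)) (isUnit_two _ _) (D.mem_freeLocus_S2 hS hι h')
      fun x _ => ?_)
    rw [CScheme.comp_str]
    exact isSmoothAt_of_smooth x
  · rintro ⟨s, rfl⟩
    exact not_isSmoothAt_diag D.isGeomQuotient_S2 s

theorem preimage_range_diag (hS : IsK3Surface S) (hι : ι ≫ ι = 𝟙 S) {i : D.W ⟶ D.V}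
    (hi : D.toW ≫ i = diag S ≫ D.toVq) {Z₁ : Closeds D.V.left}
    (hZ₁ : (Z₁ : Set D.V.left) = Set.range i.left) :
    Z₁.preimage D.toV.left.continuous = singularLocus D.S2 := by
  apply Closeds.ext
  rw [D.singularLocus_S2 hS hι, Closeds.coe_preimage, hZ₁, D.range_eq_of_comp_eq hi]
  ext y
  constructor
  · rintro ⟨_, ⟨s, rfl⟩, hs⟩
    rcases (D.isGeomQuotient_V.orbits (D.toS2.left ((diag S).left s)) y).1 hs with rfl | rfl
    · exact ⟨s, rfl⟩
    · refine ⟨ι.left s, ?_⟩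
      have h : ι ≫ diag S ≫ D.toS2 = diag S ≫ D.toS2 ≫ D.ι2 := by
        rw [D.toS2_ι2, ← Category.assoc, ← Category.assoc, diag_squareMap]
      exact congrArg (fun f => f.left s) h
  · rintro ⟨s, rfl⟩
    exact ⟨_, ⟨s, rfl⟩, rfl⟩

theorem mem_freeLocus_V_diag (hS : IsK3Surface S) (hι : IsEnriquesInvolution ι) {i j : D.W ⟶ D.V}
    (hi : D.toW ≫ i = diag S ≫ D.toVq) (hj : D.toW ≫ j = graph ι ≫ D.toVq) {v : D.V.left}
    (hv : v ∈ Set.range i.left) : v ∈ freeLocus D.isGeomQuotient_V.invariant :=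
  D.mem_freeLocus_V hS hι hj fun h => Set.disjoint_left.1 (D.disjoint_range hS hι hi hj) hv h

variable {H : CScheme} {c : H ⟶ D.S2} {ιH : H ⟶ H}

/-- The quotient of the Hilbert square is the blow-up of `V` along the image of the diagonal. -/
theorem exists_isQuotient_blowUp (hS : IsK3Surface S) (hι : IsEnriquesInvolution ι)
    {i j : D.W ⟶ D.V} (hi : D.toW ≫ i = diag S ≫ D.toVq) (hj : D.toW ≫ j = graph ι ≫ D.toVq)
    (hc : IsSingularBlowUp c) (hιc : ιH ≫ c = c ≫ D.ι2) {Z₁ : Closeds D.V.left}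
    (hZ₁ : (Z₁ : Set D.V.left) = Set.range i.left) :
    ∃ (N : CScheme) (b : N ⟶ D.V) (k : H ⟶ N), IsBlowUp (.vanishingIdeal Z₁) b.left ∧
      IsQuotient ιH k ∧ k ≫ b = c ≫ D.toV ∧ IsAffineHom k.left ∧ ιH.left ≫ ιH.left = 𝟙 H.left := by
  have := D.isAffineHom_toV hS hι.involutive
  obtain ⟨N, b, hb⟩ := exists_isBlowUp (Scheme.IdealSheafData.vanishingIdeal Z₁)
  have hc' : IsBlowUp (.vanishingIdeal (Z₁.preimage D.toV.left.continuous)) c.left := by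
    rw [D.preimage_range_diag hS hι.involutive hi hZ₁]
    exact hc
  obtain ⟨k, hk, -, hkq, hka, hιι⟩ := hb.exists_isPullback D.isGeomQuotient_V
    (left_comp_eq_id (D.ι2_involutive hι.involutive)) (isUnit_two _ _)
    (fun v hv => D.mem_freeLocus_V_diag hS hι hi hj (by rw [← hZ₁]; exact hv)) hc'
    (γ := ιH.left) (congrArg CommaMorphism.left hιc)
  refine ⟨Over.mk (b ≫ D.V.str), Over.homMk b rfl, Over.homMk k ?_, hb, isQuotient_iff.2 hkq,
    Over.OverMorphism.ext hk.w.symm, hka, hιι⟩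
  change k ≫ b ≫ D.V.str = H.str
  rw [← Category.assoc, ← hk.w, Category.assoc, CScheme.comp_str, CScheme.comp_str]

/-- The quotient of the Hilbert square is the blow-up of `V` in the image of the diagonal, because
`ι^{(2)}` acts freely near the diagonal of `S^{(2)}`. -/
theorem exists_hilbQuot_hom (hS : IsK3Surface S) (hι : IsEnriquesInvolution ι)
    {i j : D.W ⟶ D.V} (hi : D.toW ≫ i = diag S ≫ D.toVq) (hj : D.toW ≫ j = graph ι ≫ D.toVq)
    (hc : IsSingularBlowUp c) (hιc : ιH ≫ c = c ≫ D.ι2) {Z₁ : Closeds D.V.left}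
    (hZ₁ : (Z₁ : Set D.V.left) = Set.range i.left) {N : CScheme} {k : H ⟶ N}
    (hk : IsQuotient ιH k) :
    ∃ h : N ⟶ D.V, k ≫ h = c ≫ D.toV ∧ IsBlowUp (.vanishingIdeal Z₁) h.left ∧
      IsAffineHom k.left ∧ ιH.left ≫ ιH.left = 𝟙 H.left := by
  obtain ⟨N', b, k', hb, hk', hw, ha, hιι⟩ := D.exists_isQuotient_blowUp hS hι hi hj hc hιc hZ₁
  obtain ⟨e, he⟩ := hk.exists_iso hk'
  have hb' := hb.of_iso (Iso.refl _) ((Over.forget _).mapIso e)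
  have he' : k.left = k'.left ≫ e.inv.left := by
    rw [← Over.comp_left, ← he, Category.assoc, e.hom_inv_id, Category.comp_id]
  refine ⟨e.hom ≫ b, by rw [← Category.assoc, he, hw], ?_, ?_, hιι⟩
  · simpa using hb'
  · have : IsIso e.inv.left := ((Over.forget _).mapIso e).isIso_inv
    rw [he']
    infer_instance

/-- The singular locus of the quotient of the Hilbert square is the preimage of the image of the
graph: elsewhere `ι^{[2]}` is free, and near the graph the quotient is isomorphic to `V`. -/
theorem singularLocus_hilbQuot (hS : IsK3Surface S) (hι : IsEnriquesInvolution ι)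
    {i j : D.W ⟶ D.V} (hi : D.toW ≫ i = diag S ≫ D.toVq) (hj : D.toW ≫ j = graph ι ≫ D.toVq)
    (hc : IsSingularBlowUp c) (hιc : ιH ≫ c = c ≫ D.ι2) {Z₁ Z₂ : Closeds D.V.left}
    (hZ₁ : (Z₁ : Set D.V.left) = Set.range i.left) (hZ₂ : (Z₂ : Set D.V.left) = Set.range j.left)
    {N : CScheme} {k : H ⟶ N} (hk : IsQuotient ιH k) [IsAffineHom k.left]
    (hιι : ιH.left ≫ ιH.left = 𝟙 H.left) {h : N ⟶ D.V}
    (hkh : k ≫ h = c ≫ D.toV) (hh : IsBlowUp (.vanishingIdeal Z₁) h.left) :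
    singularLocus N = Z₂.preimage h.left.continuous := by
  have hd := D.disjoint_range hS hι hi hj
  have := hS.smooth
  have := hS.integral
  ext n
  rw [SetLike.mem_coe, mem_singularLocus_iff, Closeds.coe_preimage, Set.mem_preimage, hZ₂]
  constructor
  · intro hn
    by_contra hv
    have hfree := mem_freeLocus_of_isPullback (t := n)
      (congrArg CommaMorphism.left hkh.symm : c.left ≫ D.toV.left = k.left ≫ h.left)
      (congrArg CommaMorphism.left hιc : ιH.left ≫ c.left = c.left ≫ D.ι2.left)
      (isQuotient_iff.1 hk).invariant (D.mem_freeLocus_V hS hι hj hv)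
    have hsm := IsBlowUp.smooth_of_symmetricSquare D.isGeomQuotient_S2
      (D.singularLocus_S2 hS hι.involutive) hc
    refine hn (isSmoothAt_of_mem_freeLocus (isQuotient_iff.1 hk) hιι (isUnit_two _ _) hfree
      fun x _ => ?_)
    rw [CScheme.comp_str]
    exact isSmoothAt_of_smooth x
  · intro hv hn
    have hv' : h.left n ∉ Z₁ := fun h' => Set.disjoint_left.1 hd (hZ₁ ▸ h') hv
    obtain ⟨U, hU, hvU, h1⟩ := one_mem_vanishingIdeal hv'
    obtain ⟨κ, hκ, _, hr⟩ := hh.exists_of_one_mem hU h1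
    obtain ⟨u, rfl⟩ : n ∈ Set.range κ := by
      rw [hr]
      exact hvU
    have h2 := hn.comp κ
    rw [← CScheme.comp_str h, reassoc_of% hκ, isSmoothAt_comp_iff] at h2
    have h3 : h.left (κ u) = U.ι u := congrArg (fun f => f u) hκ
    rw [h3] at hv
    have h4 : U.ι u ∈ (singularLocus D.V : Set D.V.left) := by
      rw [D.singularLocus_V hS hι hi hj fun s => not_isSmoothAt_diag D.isGeomQuotient_S2 s]
      exact Or.inr hv
    exact mem_singularLocus_iff.1 h4 h2

/-- `Y_S` arises from `V` by blowing up the image of the diagonal and then the preimage of the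
image of the graph. As these are disjoint, this is the blow-up of their union, the singular locus.
-/
theorem isSingularBlowUp_hilbQuot (hS : IsK3Surface S) (hι : IsEnriquesInvolution ι)
    {i j : D.W ⟶ D.V} (hi : D.toW ≫ i = diag S ≫ D.toVq) (hj : D.toW ≫ j = graph ι ≫ D.toVq)
    (hc : IsSingularBlowUp c) (hιc : ιH ≫ c = c ≫ D.ι2) {N : CScheme} {k : H ⟶ N}
    (hk : IsQuotient ιH k) {Y : CScheme} {b : Y ⟶ N} (hb : IsSingularBlowUp b) :
    ∃ h : N ⟶ D.V, k ≫ h = c ≫ D.toV ∧ IsSingularBlowUp (b ≫ h) := by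
  let Z₁ : Closeds D.V.left :=
    ⟨_, D.isClosed_range_of_comp_eq hS hι.involutive (squareLift_fst _ _) hi⟩
  let Z₂ : Closeds D.V.left :=
    ⟨_, D.isClosed_range_of_comp_eq hS hι.involutive (squareLift_fst _ _) hj⟩
  obtain ⟨h, hkh, hh, _, hιι⟩ := D.exists_hilbQuot_hom hS hι hi hj hc hιc (Z₁ := Z₁) rfl hk
  refine ⟨h, hkh, ?_⟩
  have hsV : singularLocus D.V = Z₁ ⊔ Z₂ := Closeds.ext
    (D.singularLocus_V hS hι hi hj fun s =>
      have := hS.smooth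
      not_isSmoothAt_diag D.isGeomQuotient_S2 s)
  rw [IsSingularBlowUp, D.singularLocus_hilbQuot hS hι hi hj hc hιc (Z₁ := Z₁) (Z₂ := Z₂) rfl rfl
    hk hιι hkh hh] at hb
  rw [IsSingularBlowUp, hsV]
  exact hh.comp_vanishingIdeal (D.disjoint_range hS hι hi hj) hb

end SymmetricQuotients

attribute [local instance] sectionsAlgebra

/-! ### Relative dimension -/

section

variable {X : CScheme} {n : ℕ}

theorem isStandardSmoothOfRelativeDimension_basicOpen {U : X.left.Opens} (hU : IsAffineOpen U)
    (h : (algebraMap ℂ Γ(X.left, U)).IsStandardSmoothOfRelativeDimension n) (f : Γ(X.left, U)) :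
    (algebraMap ℂ Γ(X.left, X.left.basicOpen f)).IsStandardSmoothOfRelativeDimension n := by
  have := hU.isLocalization_basicOpen f
  have h1 := (RingHom.isStandardSmoothOfRelativeDimension_stableUnderCompositionWithLocalizationAway
    n).right Γ(X.left, X.left.basicOpen f) f (algebraMap ℂ Γ(X.left, U)) h
  have h2 : (algebraMap Γ(X.left, U) Γ(X.left, X.left.basicOpen f)).comp
      (algebraMap ℂ Γ(X.left, U)) = algebraMap ℂ Γ(X.left, X.left.basicOpen f) := by
    have h3 := Scheme.Hom.appLE_map X.str (U := ⊤) (V := U) le_top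
      (homOfLE (X.left.basicOpen_le f)).op
    exact congrArg (fun φ => ((Scheme.ΓSpecIso (CommRingCat.of ℂ)).inv ≫ φ).hom) h3
  rwa [h2] at h1

/-- The relative dimension is unique on a nonempty scheme, being the rank of the module of
differentials. -/
theorem relativeDimension_unique {m : ℕ} [SmoothOfRelativeDimension m X.str]
    [SmoothOfRelativeDimension n X.str] (x : X.left) : m = n := by
  obtain ⟨U, hU, hxU, h⟩ := exists_isStandardSmoothOfRelativeDimension (n := m) x
  obtain ⟨V, hV, hxV, h'⟩ := exists_isStandardSmoothOfRelativeDimension (n := n) x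
  obtain ⟨f, g, hfg, hxf⟩ := exists_basicOpen_le_affine_inter hU hV x ⟨hxU, hxV⟩
  have h1 := isStandardSmoothOfRelativeDimension_basicOpen hU h f
  have h2 := isStandardSmoothOfRelativeDimension_basicOpen hV h' g
  rw [← hfg] at h2
  rw [RingHom.isStandardSmoothOfRelativeDimension_algebraMap] at h1 h2
  have : Nonempty (X.left.basicOpen f) := ⟨⟨x, hxf⟩⟩
  have h3 := h1.rank_kaehlerDifferential (n := m)
  rw [h2.rank_kaehlerDifferential (n := n)] at h3
  exact_mod_cast h3.symm

/-- The relative dimension can be computed on an étale covering. -/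
theorem smoothOfRelativeDimension_of_etale {Y : CScheme} [SmoothOfRelativeDimension n Y.str]
    [Smooth X.str] (f : Y ⟶ X) [Etale f.left] (hf : Function.Surjective f.left) :
    SmoothOfRelativeDimension n X.str where
  exists_isStandardSmoothOfRelativeDimension x := by
    obtain ⟨O, hO, U, hU, hxU, e, h⟩ := Smooth.exists_isStandardSmooth X.str x
    obtain rfl := eq_top_of_le_preimage_str hxU e
    have h1 : (algebraMap ℂ Γ(X.left, U)).IsStandardSmooth :=
      RingHom.isStandardSmooth_respectsIso.2 _
        (Scheme.ΓSpecIso (CommRingCat.of ℂ)).symm.commRingCatIsoToRingEquiv h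
    obtain ⟨_, _, _, _, ⟨P⟩⟩ := RingHom.isStandardSmooth_algebraMap.1 h1
    have h2 : Algebra.IsStandardSmoothOfRelativeDimension P.dimension ℂ Γ(X.left, U) :=
      ⟨_, _, _, ‹_›, ⟨P, rfl⟩⟩
    have h3 : SmoothOfRelativeDimension P.dimension (hU.fromSpec ≫ X.str) := by
      rw [fromSpec_comp_str, HasRingHomProperty.Spec_iff (P := @SmoothOfRelativeDimension _)]
      exact RingHom.locally_of
        RingHom.isStandardSmoothOfRelativeDimension_respectsIso _
        ((RingHom.isStandardSmoothOfRelativeDimension_algebraMap _).2 h2)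
    obtain ⟨y, rfl⟩ := hf x
    obtain ⟨z, hz1, hz2⟩ := Scheme.Pullback.exists_preimage_pullback (f := hU.fromSpec)
      (g := f.left) (specPt hU hxU) y (fromSpec_specPt hU hxU)
    let T : CScheme := Over.mk (pullback.fst hU.fromSpec f.left ≫ hU.fromSpec ≫ X.str)
    have : Etale (pullback.fst hU.fromSpec f.left) :=
      MorphismProperty.of_isPullback (IsPullback.of_hasPullback hU.fromSpec f.left).flip
        inferInstance
    have h4 : SmoothOfRelativeDimension (0 + P.dimension) T.str :=
      inferInstanceAs (SmoothOfRelativeDimension (0 + P.dimension)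
        (pullback.fst hU.fromSpec f.left ≫ hU.fromSpec ≫ X.str))
    have h5 : SmoothOfRelativeDimension (0 + n) T.str := by
      have : T.str = pullback.snd hU.fromSpec f.left ≫ Y.str := by
        rw [← CScheme.comp_str f, ← Category.assoc, ← pullback.condition, Category.assoc]
        rfl
      rw [this]
      infer_instance
    have h6 := relativeDimension_unique (X := T) (m := 0 + P.dimension) (n := 0 + n) z
    rw [zero_add, zero_add] at h6
    rw [h6] at h2
    have h7 := (RingHom.isStandardSmoothOfRelativeDimension_respectsIso (n := n)).2 _
      (Scheme.ΓSpecIso (CommRingCat.of ℂ)).commRingCatIsoToRingEquiv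
      ((RingHom.isStandardSmoothOfRelativeDimension_algebraMap n).2 h2)
    refine ⟨⊤, hO, U, hU, hxU, e, ?_⟩
    convert! h7
    exact congrArg CommRingCat.Hom.hom ((Scheme.ΓSpecIso (CommRingCat.of ℂ)).hom_inv_id_assoc
      (X.str.appLE ⊤ U e)).symm

end

theorem SymmetricQuotients.smoothOfRelativeDimension_W {S : CScheme} {ι : S ⟶ S}
    (D : SymmetricQuotients S ι) (hS : IsK3Surface S) (hι : IsEnriquesInvolution ι) :
    SmoothOfRelativeDimension 2 D.W.str := by
  have := D.isAffineHom_toW hS hι.involutive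
  have := hS.smooth
  have := hS.smooth.smooth
  have h2 := isUnit_two D.W ⊤
  have hι' := left_comp_eq_id hι.involutive
  have := etale_of_freeLocus_eq_top D.isGeomQuotient_W hι' h2 (D.freeLocus_W hS hι)
  have : Smooth D.W.str := smooth_of_isSmoothAt fun w =>
    isSmoothAt_of_mem_freeLocus D.isGeomQuotient_W hι' h2 (by rw [D.freeLocus_W hS hι]; trivial)
      fun x _ => by
        rw [CScheme.comp_str]
        exact isSmoothAt_of_smooth x
  exact smoothOfRelativeDimension_of_etale D.toW D.isGeomQuotient_W.isQuotientMap.surjective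

attribute [local instance] sectionsAlgebra

/-! ### Blow-ups of singular loci -/

section

variable {X X' B B' : CScheme}

theorem isIso_of_isIso_left (f : X ⟶ X') [h : IsIso f.left] : IsIso f :=
  @isIso_of_reflects_iso _ _ _ _ _ _ f (Over.forget _) h _

theorem comap_vanishingIdeal_singularLocus (e : X ⟶ X') [IsIso e.left] :
    (Scheme.IdealSheafData.vanishingIdeal (singularLocus X')).comap e.left =
      .vanishingIdeal (singularLocus X) := by
  -- an isomorphism is the blow-up of the empty set
  have h : IsBlowUp (.vanishingIdeal ⊥) e.left := by
    rw [Scheme.IdealSheafData.vanishingIdeal_bot]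
    simpa using (isBlowUp_top_id (X := X'.left)).of_iso (Iso.refl _) (asIso e.left)
  rw [h.comap_vanishingIdeal (by simp)]
  congr 1
  ext x
  rw [Closeds.coe_preimage, Set.mem_preimage, SetLike.mem_coe, SetLike.mem_coe,
    mem_singularLocus_iff, mem_singularLocus_iff, ← isSmoothAt_comp_iff e.left, CScheme.comp_str]

theorem IsSingularBlowUp.comp_isIso {b : B ⟶ X} (h : IsSingularBlowUp b) (e : X ⟶ X')
    [IsIso e.left] : IsSingularBlowUp (b ≫ e) := by
  have h1 := IsBlowUp.of_iso h (asIso e.left).symm (Iso.refl _)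
  rw [← comap_vanishingIdeal_singularLocus e, ← Scheme.IdealSheafData.comap_comp] at h1
  simpa [IsSingularBlowUp] using h1

theorem exists_isSingularBlowUp (X : CScheme) :
    ∃ (B : CScheme) (b : B ⟶ X), IsSingularBlowUp b := by
  obtain ⟨B, b, h⟩ := exists_isBlowUp (Scheme.IdealSheafData.vanishingIdeal (singularLocus X))
  exact ⟨Over.mk (b ≫ X.str), Over.homMk b rfl, h⟩

theorem IsSingularBlowUp.exists_iso {b : B ⟶ X} (h : IsSingularBlowUp b) {b' : B' ⟶ X}
    (h' : IsSingularBlowUp b') : ∃ e : B ≅ B', e.hom ≫ b' = b := by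
  obtain ⟨e, he⟩ := IsBlowUp.exists_iso h h'
  refine ⟨Over.isoMk e ?_, Over.OverMorphism.ext he⟩
  change e.hom ≫ B'.str = B.str
  rw [← CScheme.comp_str b', reassoc_of% he, CScheme.comp_str]

/-- An involution lifts to the blow-up of the singular locus, because it preserves that locus. -/
theorem IsSingularBlowUp.exists_lift {b : B ⟶ X} (h : IsSingularBlowUp b) {g : X ⟶ X}
    (hg : g ≫ g = 𝟙 X) : ∃ g' : B ⟶ B, g' ≫ b = b ≫ g := by
  have : IsIso g.left := ⟨g.left, left_comp_eq_id hg, left_comp_eq_id hg⟩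
  obtain ⟨g', hg', -⟩ := h.universal B.left (b.left ≫ g.left) (by
    rw [Scheme.IdealSheafData.comap_comp, comap_vanishingIdeal_singularLocus]
    exact h.isEffectiveCartier)
  refine ⟨Over.homMk g' ?_, Over.OverMorphism.ext hg'⟩
  change g' ≫ B.str = B.str
  rw [← CScheme.comp_str b, reassoc_of% hg', CScheme.comp_str]

/-- For a smooth variety, the blow-up of the (empty) singular locus changes nothing. -/
theorem IsSingularBlowUp.isIso [Smooth X.str] {b : B ⟶ X} (h : IsSingularBlowUp b) :
    IsIso b.left := by
  have h1 : singularLocus X = ⊥ := by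
    ext x
    rw [SetLike.mem_coe, mem_singularLocus_iff]
    simpa using isSmoothAt_of_smooth x
  exact IsBlowUp.isIso_of_eq_top h (by rw [h1, Scheme.IdealSheafData.vanishingIdeal_bot])

end

/-! ### The quotient by `ι × ι` -/

section

variable {S A : CScheme} {ι : S ⟶ S} {q : square S ⟶ A}

theorem IsQuotient.smooth_of_squareMap (hS : IsK3Surface S) (hι : IsEnriquesInvolution ι)
    (H : IsQuotient (squareMap ι) q) : Smooth A.str := by
  have hg := squareMap_involutive hι.involutive
  have := H.isAffineHom hg (hS.squareMap_cover hι.involutive)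
  have := hS.locallyOfFiniteType
  have := locallyOfFiniteType_square (S := S)
  have := hS.smooth.smooth
  have := smooth_square (S := S)
  have H' := isQuotient_iff.1 H
  refine smooth_of_isSmoothAt fun a => isSmoothAt_of_mem_freeLocus H' (left_comp_eq_id hg)
    (isUnit_two _ _) ?_ fun x _ => ?_
  · refine mem_freeLocus_of_forall_point H' (left_comp_eq_id hg) (𝟙 _)
      Function.surjective_id (Q₀ := ⊤) (fun p _ h => ?_) trivial
    rw [Category.id_comp, Category.comp_id] at h
    have h1 := congrArg (· ≫ squareFst S) (point_ext h)
    simp only [Category.assoc, squareMap_fst] at h1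
    exact hι.fixedPointFree (p ≫ squareFst S) ((Category.assoc _ _ _).trans h1)
  · rw [CScheme.comp_str]
    exact isSmoothAt_of_smooth x

theorem IsQuotient.comp_self_of_squareMap (H : IsQuotient (squareMap ι) q) {σ : A ⟶ A}
    (hσ : q ≫ σ = switch S ≫ q) : σ ≫ σ = 𝟙 A := by
  apply H.hom_ext
  rw [← Category.assoc, hσ, Category.assoc, hσ, ← Category.assoc, switch_switch, Category.id_comp,
    Category.comp_id]

variable {Z : CScheme} {b : Z ⟶ A} {σ : A ⟶ A} {σZ : Z ⟶ Z}

/-- The quotient of `Z_S` by the switch exists. -/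
theorem IsQuotient.exists_isQuotient_blowUp (hS : IsK3Surface S) (hι : ι ≫ ι = 𝟙 S)
    (H : IsQuotient (squareMap ι) q) (hσ : q ≫ σ = switch S ≫ q) [IsIso b.left]
    (hσZ : σZ ≫ b = b ≫ σ) : ∃ (N : CScheme) (k : Z ⟶ N), IsQuotient σZ k := by
  have : IsIso b := isIso_of_isIso_left b
  apply exists_isQuotient
  · rw [← cancel_mono b, Category.assoc, hσZ, ← Category.assoc, hσZ, Category.assoc,
      H.comp_self_of_squareMap hσ, Category.comp_id, Category.id_comp]
  · intro z
    obtain ⟨x, hx⟩ := H.isQuotientMap.surjective (b.left z)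
    obtain ⟨U, hU⟩ := hS.exists_mem_box hι x
    obtain ⟨O, hO⟩ := H.exists_invariantAffine (squareMap_involutive hι) hσ
      (isAffineOpen_box U.2.1) (squareMap_invariant_box U.2.2) (switch_invariant_box _)
    refine ⟨⟨b.left ⁻¹ᵁ O.1, O.2.1.preimage_of_isIso b.left, fun y hy => ?_⟩, ?_⟩
    · have h1 : b.left (σZ.left y) = σ.left (b.left y) := congrArg (fun f => f.left y) hσZ
      exact (congrArg (· ∈ O.1) h1).mpr (O.2.2 hy)
    · rw [← hO] at hU
      exact (congrArg (· ∈ O.1) hx).mp hU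

/-- The quotient of `Z_S` by the switch is `V`. -/
theorem SymmetricQuotients.exists_zQuot_hom (D : SymmetricQuotients S ι)
    (H : IsQuotient (squareMap ι) q) (hσ : q ≫ σ = switch S ≫ q) [IsIso b.left]
    (hσZ : σZ ≫ b = b ≫ σ) {N : CScheme} {k : Z ⟶ N} (hk : IsQuotient σZ k) :
    ∃ (β : A ⟶ D.V) (z : N ⟶ D.V), q ≫ β = D.toVq ∧ k ≫ z = b ≫ β ∧ IsIso z.left := by
  have : IsIso b := isIso_of_isIso_left b
  have hσZ' : σ ≫ inv b = inv b ≫ σZ := by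
    rw [IsIso.comp_inv_eq, Category.assoc, hσZ, IsIso.inv_hom_id_assoc]
  obtain ⟨β, hβ⟩ := H.exists_desc D.toVq D.squareMap_toVq
  have hσβ : σ ≫ β = β := H.hom_ext (by
    rw [← Category.assoc, hσ, Category.assoc, hβ, D.switch_toVq])
  obtain ⟨z, hz⟩ := hk.exists_desc (b ≫ β) (by
    rw [← Category.assoc, hσZ, Category.assoc, hσβ])
  obtain ⟨y, hy⟩ := D.exists_toVq_desc (q ≫ inv b ≫ k)
    (by rw [← Category.assoc, ← hσ, Category.assoc, ← Category.assoc σ, hσZ', Category.assoc,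
      hk.invariant])
    (by rw [← Category.assoc, H.invariant])
  have h1 : y ≫ z = 𝟙 D.V := D.toVq_hom_ext (by
    rw [← Category.assoc, hy, Category.assoc, Category.assoc, hz, IsIso.inv_hom_id_assoc, hβ,
      Category.comp_id])
  have h2 : β ≫ y = inv b ≫ k := H.hom_ext (by rw [← Category.assoc, hβ, hy])
  have h3 : z ≫ y = 𝟙 N := hk.hom_ext (by
    rw [← Category.assoc, hz, Category.assoc, h2, IsIso.hom_inv_id_assoc, Category.comp_id])
  exact ⟨β, z, hβ, hz, ⟨y.left, congrArg CommaMorphism.left h3, congrArg CommaMorphism.left h1⟩⟩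

end

/-! ### Existence and comparison of the varieties -/

section

variable {S : CScheme} {ι : S ⟶ S}

/-- All the quotients exist because any finite set of points of a projective scheme lies in an
affine open set, and blow-ups always exist. -/
theorem exists_varieties (hS : IsK3Surface S) (hι : IsEnriquesInvolution ι) :
    Nonempty (Varieties S ι) := by
  have hιι := hι.involutive
  obtain ⟨D⟩ := exists_symmetricQuotients hS hιι
  obtain ⟨W2, toW2, hW2⟩ := exists_isQuotient (switch_switch D.W) fun x => by
    obtain ⟨U, hU, hx⟩ := D.exists_mem_box_W hS hιι x
    exact ⟨⟨box U, isAffineOpen_box hU, switch_invariant_box _⟩, hx⟩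
  obtain ⟨Hilb, c, hc⟩ := exists_isSingularBlowUp D.S2
  obtain ⟨ιHilb, hιHilb⟩ := hc.exists_lift (D.ι2_involutive hιι)
  obtain ⟨i, hi⟩ := D.exists_diag_desc
  obtain ⟨j, hj⟩ := D.exists_graph_desc hιι
  obtain ⟨N, -, k, -, hk, -⟩ := D.exists_isQuotient_blowUp hS hι hi hj hc hιHilb
    (Z₁ := ⟨_, D.isClosed_range_of_comp_eq hS hιι (squareLift_fst _ _) hi⟩) rfl
  obtain ⟨Y, bY, hY⟩ := exists_isSingularBlowUp N
  obtain ⟨A, q, hq⟩ := exists_isQuotient (squareMap_involutive hιι) (hS.squareMap_cover hιι)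
  obtain ⟨σ, hσ⟩ := hq.exists_desc (switch S ≫ q) (by
    rw [← Category.assoc, ← switch_squareMap, Category.assoc, hq.invariant])
  obtain ⟨Z, bZ, hZ⟩ := exists_isSingularBlowUp A
  obtain ⟨σZ, hσZ⟩ := hZ.exists_lift (hq.comp_self_of_squareMap hσ)
  have := hq.smooth_of_squareMap hS hι
  have := hZ.isIso
  obtain ⟨M, m, hm⟩ := hq.exists_isQuotient_blowUp hS hιι hσ hσZ
  obtain ⟨T, bT, hT⟩ := exists_isSingularBlowUp M
  exact ⟨D.W, D.toW, D.isQuotient_W, W2, toW2, hW2, D.S2, D.toS2, D.isQuotient_S2, D.ι2, D.toS2_ι2,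
    D.V, D.toV, D.isQuotient_V, Hilb, c, hc, ιHilb, hιHilb, N, k, hk, Y, bY, hY, A, q, hq, σ, hσ,
    Z, bZ, hZ, σZ, hσZ, M, m, hm, T, bT, hT⟩

end

end EnriquesQuotient

end

open EnriquesQuotient in
theorem mainTheorem8 (S : CScheme) (hS : IsK3Surface S) (ι : S ⟶ S)
    (hι : IsEnriquesInvolution ι) :
    -- the quotients and blow-ups exist
    Nonempty (Varieties S ι) ∧
    ∀ D : Varieties S ι,
      -- `W` is a smooth irreducible surface
      IsIntegral D.W.left ∧ SmoothOfRelativeDimension 2 D.W.str ∧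
      -- `S^{(2)}/ι^{(2)}` is an irreducible unramified double cover of `W^{(2)}`
      IsIntegral D.V.left ∧
      (∃ β : D.V ⟶ D.W2,
        D.toS2 ≫ D.toV ≫ β = squareMap D.toW ≫ D.toW2 ∧
        IsFinite β.left ∧ Etale β.left ∧ ∀ w : D.W2.left, β.left.finrank w = 2) ∧
      -- its singular locus consists of two disjoint surfaces, both isomorphic to `W`: the images
      -- of the diagonal and of the graph of `ι`
      (∃ i j : D.W ⟶ D.V,
        D.toW ≫ i = squareLift (𝟙 S) (𝟙 S) ≫ D.toS2 ≫ D.toV ∧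
        D.toW ≫ j = squareLift (𝟙 S) ι ≫ D.toS2 ≫ D.toV ∧
        IsClosedImmersion i.left ∧ IsClosedImmersion j.left ∧
        Disjoint (Set.range i.left) (Set.range j.left) ∧
        (singularLocus D.V : Set D.V.left) = Set.range i.left ∪ Set.range j.left) ∧
      -- `Y_S` and the blow-up of `Z_S/σ_Z` map naturally to `S^{(2)}/ι^{(2)}`, both of these maps
      -- are the blow-up of the singular locus, and the two varieties are isomorphic over it
      ∃ (h : D.HilbQuot ⟶ D.V) (β₂ : D.A ⟶ D.V) (z : D.ZQuot ⟶ D.V),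
        D.toHilbQuot ≫ h = D.hilbertChow ≫ D.toV ∧
        D.toA ≫ β₂ = D.toS2 ≫ D.toV ∧
        D.toZQuot ≫ z = D.blowZ ≫ β₂ ∧
        IsSingularBlowUp (D.blowY ≫ h) ∧
        IsSingularBlowUp (D.blowT ≫ z) ∧
        ∃ e : D.Y ≅ D.T, e.hom ≫ D.blowT ≫ z = D.blowY ≫ h := by
  have hιι := hι.involutive
  refine ⟨exists_varieties hS hι, fun D => ?_⟩
  let D' : SymmetricQuotients S ι := ⟨D.W, D.toW, D.isQuotient_W, D.S2, D.toS2, D.isQuotient_S2,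
    D.ι2, D.toS2_ι2, D.V, D.toV, D.isQuotient_V⟩
  have := hS.integral
  have := hS.smooth
  have := hS.isIntegral_square
  have : IsIntegral D.S2.left := D'.isGeomQuotient_S2.isIntegral
  obtain ⟨i, hi⟩ := D'.exists_diag_desc
  obtain ⟨j, hj⟩ := D'.exists_graph_desc hιι
  obtain ⟨β, hβ, h1, h2, h3⟩ := D'.exists_double_cover hS hι D.isQuotient_W2
  refine ⟨D'.isGeomQuotient_W.isIntegral, D'.smoothOfRelativeDimension_W hS hι,
    D'.isGeomQuotient_V.isIntegral, ⟨β, (Category.assoc _ _ _).symm.trans hβ, h1, h2, h3⟩,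
    ⟨i, j, hi, hj,
      D'.isClosedImmersion_of_comp_eq hS hι D.isQuotient_W2 (Category.id_comp _) hi,
      D'.isClosedImmersion_of_comp_eq hS hι D.isQuotient_W2 D.isQuotient_W.invariant hj,
      D'.disjoint_range hS hι hi hj,
      D'.singularLocus_V hS hι hi hj fun s => not_isSmoothAt_diag D'.isGeomQuotient_S2 s⟩, ?_⟩
  obtain ⟨h, hh, hY⟩ := D'.isSingularBlowUp_hilbQuot hS hι hi hj D.isBlowUp_Hilb
    D.ιHilb_hilbertChow D.isQuotient_HilbQuot D.isBlowUp_Y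
  have := D.isQuotient_A.smooth_of_squareMap hS hι
  have := D.isBlowUp_Z.isIso
  obtain ⟨β₂, z, hβ₂, hz, _⟩ := D'.exists_zQuot_hom D.isQuotient_A D.toA_σA D.σZ_blowZ
    D.isQuotient_ZQuot
  have hT := D.isBlowUp_T.comp_isIso z
  exact ⟨h, β₂, z, hh, hβ₂, hz, hY, hT, hY.exists_iso hT⟩
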